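/- **Setting.** Let $K\ge 2$ and $W\ge 1$ be integers, let $\mathcal T$ be the rooted tree in which every vertex has $K$ forward neighbors, with root $0$, let $S_n$ be the sphere of radius $n$ about $0$ (so $|S_n|=K^n$), and for $x\neq 0$ let $x_-$ be the backward neighbor of $x$. Let $A$ be a fixed Hermitian $W\times W$ matrix, $\lambda>0$, and let $V(x)$, $x\in\mathcal T$, be independent $W\times W$ matrices drawn from the Gaussian Orthogonal Ensemble (real symmetric, with independent centered Gaussian entries on and above the diagonal, of variance $2$ on the diagonal and $1$ off it). Let $H$ be the random self-adjoint operator on $\ell^2(\mathcal T\to\mathbb C^W)$ with $W\times W$ blocks $H(x,y)=\mathbb 1$ if $x\sim y$, $H(x,x)=U(x)=A+\lambda V(x)$, and $H(x,y)=0$ otherwise. For $\operatorname{Im}z>0$ let $G(x,y;z)$ be the $(x,y)$ block of $(H-z)^{-1}$, and let $G^{\mathcal T_u}(x,y;z)$ be the corresponding block for the restriction of $H$ to $\mathcal T\setminus\{u\}$. Let $\|\cdot\|$ be the operator norm of matrices. The Lyapunov exponent $L(z)$, $\operatorname{Im}z>0$, is the almost sure, non-random limit $L(z)=-\lim_{n\to\infty}\frac1{n+1}\ln\|G(0,x_n;z)\|$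 along a branch $0=x_0,x_1,x_2,\dots$ of $\mathcal T$, and for real $E$ one sets $L(E)=\lim_{\eta\to+0}L(E+i\eta)$. The no-a.c. hypothesis holds at $E$ if, for each fixed vector $v\in\mathbb C^W$, almost surely $\operatorname{Im}\langle G(0,0;E+i\eta)v,v\rangle\to0$ as $\eta\to+0$. For $\delta>0$, $\eta>0$, $n\ge1$ and $x\in S_n$, put $\tau=e^{(L(E)+2\delta)n}$ and $$R_x=\Big\{\|G^{\mathcal T_x}(0,x_-;E+i\eta)\|\ge e^{-(L(E)+\delta)n}\Big\},\qquad E_x=\Big\{|\langle G(x,x;E+i\eta)\tilde v,\tilde v\rangle|\ge\tau\Big\},$$ where $\tilde v$ is the unit eigenvector of $G^{\mathcal T_x}(0,x_-;E+i\eta)^*\,G^{\mathcal T_x}(0,x_-;E+i\eta)$ associated with its largest eigenvalue (if that eigenvalue is multiple, which has probability zero, the inequality defining $E_x$ is required for every choice of $\tilde v$). Let $N=\sum_{x\in S_n}\mathbb 1_{R_x\cap E_x}$. **Proposition 3.2 (First moment bound).** Let $E\in\mathbb R$ be an energy at which the limit $L(E)$ exists and the no-a.c. hypothesis holds. Then there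 is a constant $C>0$, depending only on $K$, $W$, $A$, $\lambda$ and $E$, such that for every $\delta>0$ there is $n_0$ such that for every $n\ge n_0$ there is $\eta_0>0$ such that for all $\eta\in(0,\eta_0)$ $$\mathbb E N\ \ge\ \frac{K^n}{C\,\tau}.$$ -/

import Mathlib

namespace BetheStrip

open MeasureTheory ProbabilityTheory Filter Topology Matrix

/-- Sites of the rooted tree with branching number `K`: a site is the list of choices on the path
to it, the most recent choice first.  The root is `[]`, the forward neighbours of `x` are
`i :: x` for `i : Fin K`, and the backward neighbour of `x ≠ []` is `x.tail`. -/
abbrev Site (K : ℕ) : Type := List (Fin K)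

/-- Adjacency in the tree: one of the two sites is a forward neighbour of the other. -/
def Adjacent {K : ℕ} (x y : Site K) : Prop :=
  (∃ i, y = i :: x) ∨ (∃ i, x = i :: y)

/-- The (finite) set of neighbours of a site. -/
def neighbors {K : ℕ} : Site K → Finset (Site K)
  | [] => Finset.univ.image fun i => [i]
  | a :: t => insert t (Finset.univ.image fun i => i :: a :: t)

theorem mem_neighbors {K : ℕ} (x y : Site K) : y ∈ neighbors x ↔ Adjacent x y := by
  cases x with
  | nil => simp [neighbors, Adjacent, eq_comm]
  | cons a t =>
    simp only [neighbors, Adjacent, Finset.mem_insert, Finset.mem_image, Finset.mem_univ,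
      true_and, List.cons.injEq]
    constructor
    · rintro (rfl | ⟨i, rfl⟩)
      · exact Or.inr ⟨a, rfl, rfl⟩
      · exact Or.inl ⟨i, rfl⟩
    · rintro (⟨i, rfl⟩ | ⟨i, -, rfl⟩)
      · exact Or.inr ⟨i, rfl⟩
      · exact Or.inl rfl

/-- The sphere of radius `n` about the root. -/
def sphere (K n : ℕ) : Set (Site K) := {x | x.length = n}

/-- The action of the operator with matrix elements `H(x, y) = 1` for `x ∼ y`, `H(x, x) = U(x)`
and `H(x, y) = 0` otherwise. -/
noncomputable def schrodinger {K W : ℕ} (U : Site K → Matrix (Fin W) (Fin W) ℂ)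
    (ψ : Site K → Fin W → ℂ) (x : Site K) : Fin W → ℂ :=
  (∑ y ∈ neighbors x, ψ y) + U x *ᵥ ψ x

/-- `ψ = (H_S - z)⁻¹ φ`, where `H_S` is the restriction of `H` to the set `S` of sites, acting in
`ℓ²(S → ℂ^W)` on its maximal domain `{ψ ∈ ℓ² : H_S ψ ∈ ℓ²}`.  Functions on `S` are extended by
zero.  For square summable `φ` the equation itself puts `ψ` into the domain.  As adjacency is a
bounded operator and `U` is block diagonal, `H_S` is self-adjoint whenever all `U(x)` are
Hermitian, and then `ψ` exists and is unique for `Im z > 0`. -/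
def IsResolventOf {K W : ℕ} (S : Set (Site K)) (U : Site K → Matrix (Fin W) (Fin W) ℂ) (z : ℂ)
    (φ ψ : Site K → Fin W → ℂ) : Prop :=
  (Summable fun x => ∑ i, ‖ψ x i‖ ^ 2) ∧ (∀ x ∉ S, ψ x = 0) ∧
    ∀ x ∈ S, schrodinger U ψ x - z • ψ x = φ x

open Classical in
/-- The resolvent `(H_S - z)⁻¹ φ`. -/
noncomputable def resolventApply {K W : ℕ} (S : Set (Site K)) (U : Site K → Matrix (Fin W) (Fin W) ℂ)
    (z : ℂ) (φ : Site K → Fin W → ℂ) : Site K → Fin W → ℂ :=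
  if h : ∃ ψ, IsResolventOf S U z φ ψ then h.choose else 0

/-- The function `δ_y ⊗ e_j`. -/
noncomputable def delta {K W : ℕ} (y : Site K) (j : Fin W) : Site K → Fin W → ℂ :=
  Pi.single y (Pi.single j 1)

/-- The Green function: the `W × W` block at `(x, y)` of the resolvent `(H_S - z)⁻¹`. -/
noncomputable def green {K W : ℕ} (S : Set (Site K)) (U : Site K → Matrix (Fin W) (Fin W) ℂ)
    (z : ℂ) (x y : Site K) : Matrix (Fin W) (Fin W) ℂ :=
  Matrix.of fun i j => resolventApply S U z (delta y j) x i

/-- The operator norm of a matrix, with respect to the Euclidean norm. -/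
noncomputable def opNorm {W : ℕ} (M : Matrix (Fin W) (Fin W) ℂ) : ℝ :=
  ‖Matrix.toEuclideanCLM (n := Fin W) (𝕜 := ℂ) M‖

/-- The symmetrization `(X + Xᵀ) / √2`. -/
noncomputable def symmetrize {W : ℕ} (X : Fin W → Fin W → ℝ) : Fin W → Fin W → ℝ :=
  fun i j => (X i j + X j i) / Real.sqrt 2

theorem measurable_symmetrize (W : ℕ) : Measurable (symmetrize (W := W)) := by
  refine measurable_pi_lambda _ fun i => measurable_pi_lambda _ fun j => ?_
  simp only [symmetrize]
  fun_prop

/-- The Gaussian Orthogonal Ensemble: the law of `(X + Xᵀ) / √2`, where the entries of `X` are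
independent standard Gaussians.  The entries on and above the diagonal are then independent,
centered Gaussian, of variance `2` on the diagonal and `1` off it. -/
noncomputable def goe (W : ℕ) : Measure (Fin W → Fin W → ℝ) :=
  (Measure.pi fun _ : Fin W => Measure.pi fun _ : Fin W => gaussianReal 0 1).map symmetrize

instance instIsProbabilityMeasureGoe (W : ℕ) : IsProbabilityMeasure (goe W) :=
  Measure.isProbabilityMeasure_map (measurable_symmetrize W).aemeasurable

/-- The probability space: a configuration is a family `V(x)`, `x` a site, of real
`W × W` matrices. -/
abbrev Config (K W : ℕ) : Type := Site K → Fin W → Fin W → ℝ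

/-- Under this law the matrices `V(x)` are independent and each is drawn from GOE. -/
noncomputable def law (K W : ℕ) : Measure (Config K W) :=
  Measure.infinitePi fun _ : Site K => goe W

/-- The potential `U(x) = A + λ V(x)`. -/
noncomputable def potential {K W : ℕ} (A : Matrix (Fin W) (Fin W) ℂ) (lam : ℝ) (V : Config K W)
    (x : Site K) : Matrix (Fin W) (Fin W) ℂ :=
  A + (lam : ℂ) • Matrix.of fun i j => (V x i j : ℂ)

/-- `G(x, y; z)`, the Green function of `H` on the whole tree. -/
noncomputable def fullGreen {K W : ℕ} (A : Matrix (Fin W) (Fin W) ℂ) (lam : ℝ) (V : Config K W)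
    (z : ℂ) (x y : Site K) : Matrix (Fin W) (Fin W) ℂ :=
  green Set.univ (potential A lam V) z x y

/-- `G^{T_u}(x, y; z)`, the Green function of `H` restricted to the tree without the site `u`. -/
noncomputable def cutGreen {K W : ℕ} (A : Matrix (Fin W) (Fin W) ℂ) (lam : ℝ) (V : Config K W)
    (u : Site K) (z : ℂ) (x y : Site K) : Matrix (Fin W) (Fin W) ℂ :=
  green {u}ᶜ (potential A lam V) z x y

/-- `L` is the (almost sure, non-random) value of `- lim (n+1)⁻¹ log ‖G(0, x_n; z)‖` along each
branch `0 = x_0, x_1, x_2, …` of the tree. -/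
def IsLyapunovExponent (K : ℕ) {W : ℕ} (A : Matrix (Fin W) (Fin W) ℂ) (lam : ℝ) (z : ℂ)
    (L : ℝ) : Prop :=
  ∀ b : ℕ → Site K, b 0 = [] → (∀ n, ∃ i, b (n + 1) = i :: b n) →
    ∀ᵐ V ∂(law K W), Tendsto
      (fun n : ℕ => -(1 / ((n : ℝ) + 1) * Real.log (opNorm (fullGreen A lam V z [] (b n)))))
      atTop (𝓝 L)

open Classical in
/-- The (slowest) Lyapunov exponent `L(z)`, for `Im z > 0`. -/
noncomputable def lyapunov (K : ℕ) {W : ℕ} (A : Matrix (Fin W) (Fin W) ℂ) (lam : ℝ) (z : ℂ) : ℝ :=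
  if h : ∃ L, IsLyapunovExponent K A lam z L then h.choose else 0

/-- The no-a.c. hypothesis at the energy `E`: for each fixed vector `v` (at the root),
`Im ⟨(H - E - i0)⁻¹ v, v⟩ = 0` almost surely. -/
def NoAC (K : ℕ) {W : ℕ} (A : Matrix (Fin W) (Fin W) ℂ) (lam E : ℝ) : Prop :=
  ∀ v : Fin W → ℂ, ∀ᵐ V ∂(law K W), Tendsto
    (fun η : ℝ => (star v ⬝ᵥ (fullGreen A lam V (E + η * Complex.I) [] [] *ᵥ v)).im)
    (𝓝[>] 0) (𝓝 0)

/-- `v` is a unit eigenvector of the Hermitian matrix `M` for the largest eigenvalue of `M`. -/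
def IsUnitMaxEigenvector {W : ℕ} (M : Matrix (Fin W) (Fin W) ℂ) (v : Fin W → ℂ) : Prop :=
  star v ⬝ᵥ v = 1 ∧ ∃ μ : ℝ, M *ᵥ v = (μ : ℂ) • v ∧
    ∀ (ν : ℝ) (u : Fin W → ℂ), u ≠ 0 → M *ᵥ u = (ν : ℂ) • u → ν ≤ μ

/-- `τ = exp((L + 2δ) n)`. -/
noncomputable def tau (L δ : ℝ) (n : ℕ) : ℝ := Real.exp ((L + 2 * δ) * n)

/-- The event `R_x = {‖G^{T_x}(0, x₋; z)‖ ≥ exp(-(L + δ) n)}`. -/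
def eventR {K W : ℕ} (A : Matrix (Fin W) (Fin W) ℂ) (lam : ℝ) (z : ℂ) (L δ : ℝ) (n : ℕ)
    (x : Site K) : Set (Config K W) :=
  {V | Real.exp (-(L + δ) * n) ≤ opNorm (cutGreen A lam V x z [] x.tail)}

/-- The event `E_x = {|⟨G(x, x; z) v, v⟩| ≥ τ}`, where `v` is the unit eigenvector of
`G^{T_x}(0, x₋; z)* G^{T_x}(0, x₋; z)` for its largest eigenvalue.  The vector is determined up to
a phase, which is irrelevant, unless the eigenvalue is multiple, which has probability zero; in
that case the inequality is required for every choice. -/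
def eventE {K W : ℕ} (A : Matrix (Fin W) (Fin W) ℂ) (lam : ℝ) (z : ℂ) (L δ : ℝ) (n : ℕ)
    (x : Site K) : Set (Config K W) :=
  {V | ∀ v : Fin W → ℂ,
    IsUnitMaxEigenvector ((cutGreen A lam V x z [] x.tail)ᴴ * cutGreen A lam V x z [] x.tail) v →
      tau L δ n ≤ ‖star v ⬝ᵥ (fullGreen A lam V z x x *ᵥ v)‖}

/-- `N`: the number of sites `x` in the sphere of radius `n` on which `R_x ∩ E_x` occurs. -/
noncomputable def count {K W : ℕ} (A : Matrix (Fin W) (Fin W) ℂ) (lam : ℝ) (z : ℂ) (L δ : ℝ)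
    (n : ℕ) (V : Config K W) : ℕ :=
  {x ∈ sphere K n | V ∈ eventR A lam z L δ n x ∩ eventE A lam z L δ n x}.ncard

end BetheStrip

/-! By linearity the expectation of `N` is a sum of `K ^ n` probabilities, so it is enough that `R_x
∩ E_x` has probability at least `c / (2 τ)` for every `x` in the sphere, with `c` independent of
`δ`, `n` and `η`.

Fix `x` and freeze the potential at all other sites. The Schur complement formula gives `G(x, x) =
(λ V(x) + Q)⁻¹`, where the environment `Q` does not involve `V(x)` and has negative definite
imaginary part (`green_siteUpdate`, `environment_isDissipative`). The matrix `G^{T_x}(0, x₋)` does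
not involve `V(x)` either, so `R_x` and the top singular vector are frozen too. The core is a
one-site estimate, `resonance_probability`: if `‖Q‖ ≤ B` and `‖Q - Q*‖ ≤ ε / τ`, then for each unit
vector `v` the form `⟨(λ V(x) + Q)⁻¹ v, v⟩` has modulus at least `τ` with probability at least `c /
τ`. Indeed, as a function of one diagonal entry of `V(x)` the form is a Möbius function whose pole
is within `O(1 / τ)` of the real axis, so it exceeds `τ` on an interval of length of order `1 / τ`.

The pole and the residue are controlled with positive probability by logarithmic moments of the norm
of `(λ V + Q)⁻¹`, uniformly in dissipative `Q` (`lintegral_posLog_inv_le`), and of its matrix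
elements, up to the size of `log ‖Q‖` (`lintegral_logSqTop_form_le`). Both rest on
`lintegral_le_average`: a Gaussian law is at most a constant times the Gaussian law of twice the
variance averaged over shifts in a given direction. Along such lines everything is bounded through
rational functions of one real variable, whose squared logarithms are locally integrable.

It remains to see that the frozen data are good with probability at least `1 / 2`, which involves
four conditions. The event `R_x`: the logarithms of the norms along a ray are additive with
independent parts, up to errors bounded in mean square uniformly in `η` (`exists_almostAdditive`).
Hence their variance is `O(n)`, their mean is at least `-L(z) (n + 1) - κ`, and Chebyshev applies
(`measure_small_le`). Simplicity of the top singular value, so that the vector is unique up to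
phase: a norm is Lipschitz, hence almost everywhere differentiable along lines, while
differentiability at a multiple top singular value forces a purely imaginary eigenvalue, a null
event (`ae_isTopSimple`). The bound `‖Q‖ ≤ B`: logarithmic moments again. The bound on `Q - Q*`: the
no-a.c. hypothesis says that the Green function at the root becomes Hermitian in probability, and
this propagates along the path to every site (`vanishInProb_environment_univ`). -/

namespace BetheStrip

open MeasureTheory ProbabilityTheory Filter Topology Matrix

variable {K W : ℕ}

/-! ### Conservation of current and uniqueness of the resolvent. -/

section Energy

theorem sum_neighbors_nil {M : Type*} [AddCommMonoid M] (f : Site K → M) :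
    ∑ y ∈ neighbors ([] : Site K), f y = ∑ i, f [i] := by
  rw [neighbors, Finset.sum_image]
  intro i _ j _ h
  simpa using h

theorem sum_neighbors_cons {M : Type*} [AddCommMonoid M] (f : Site K → M) (a : Fin K)
    (t : Site K) :
    ∑ y ∈ neighbors (a :: t), f y = f t + ∑ i, f (i :: a :: t) := by
  rw [neighbors, Finset.sum_insert, Finset.sum_image]
  · intro i _ j _ h
    simpa using h
  · simp only [Finset.mem_image, Finset.mem_univ, true_and, not_exists]
    intro i h
    have := congrArg List.length h
    simp at this
    omega

/-- The squared norm of a vector. -/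
noncomputable def nsq (v : Fin W → ℂ) : ℝ := ∑ i, ‖v i‖ ^ 2

theorem nsq_nonneg (v : Fin W → ℂ) : 0 ≤ nsq v := Finset.sum_nonneg fun _ _ => by positivity

theorem nsq_eq_zero {v : Fin W → ℂ} (h : nsq v = 0) : v = 0 := by
  rw [nsq, Finset.sum_eq_zero_iff_of_nonneg (fun _ _ => by positivity)] at h
  ext i
  simpa using h i (Finset.mem_univ i)

theorem star_dotProduct_self (v : Fin W → ℂ) : star v ⬝ᵥ v = (nsq v : ℂ) := by
  simp only [dotProduct, nsq, Pi.star_apply, RCLike.star_def, Complex.ofReal_sum,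
    Complex.ofReal_pow]
  exact Finset.sum_congr rfl fun i _ => Complex.conj_mul' (v i)

theorem norm_dotProduct_le (a b : Fin W → ℂ) : ‖star a ⬝ᵥ b‖ ≤ nsq a + nsq b := by
  simp only [dotProduct, nsq, ← Finset.sum_add_distrib]
  refine (norm_sum_le _ _).trans (Finset.sum_le_sum fun i _ => ?_)
  rw [norm_mul, Pi.star_apply, norm_star]
  nlinarith [sq_nonneg (‖a i‖ - ‖b i‖), sq_nonneg (‖a i‖), sq_nonneg (‖b i‖)]

theorem im_dotProduct_swap (a b : Fin W → ℂ) : (star a ⬝ᵥ b).im = -(star b ⬝ᵥ a).im := by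
  have : star a ⬝ᵥ b = star (star b ⬝ᵥ a) := by
    rw [Matrix.star_dotProduct, dotProduct_comm]
  rw [this]; simp

theorem im_dotProduct_hermitian {M : Matrix (Fin W) (Fin W) ℂ} (hM : M.IsHermitian)
    (v : Fin W → ℂ) : (star v ⬝ᵥ (M *ᵥ v)).im = 0 := by
  have h := hM.im_star_dotProduct_mulVec_self v
  simpa using h

theorem cons_injective : Function.Injective fun p : Site K × Fin K => p.2 :: p.1 := by
  rintro ⟨x, i⟩ ⟨y, j⟩ h
  simp only [List.cons.injEq] at h
  simp [h.1, h.2]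

/-- The map `(x, i) ↦ i :: x` misses only the root, so a function vanishing there has the same sum
over sites as over pairs of a site and a child. -/
theorem cons_range {c : Site K → ℝ} (h0 : c [] = 0) :
    ∀ x ∉ Set.range (fun p : Site K × Fin K => p.2 :: p.1), c x = 0 := by
  intro x hx
  cases x with
  | nil => exact h0
  | cons i t => exact absurd ⟨(t, i), rfl⟩ hx

theorem tsum_cons {c : Site K → ℝ} (hc : Summable c) (h0 : c [] = 0) :
    HasSum (fun x => ∑ i, c (i :: x)) (∑' x, c x) := by
  have h1 : HasSum (fun p : Site K × Fin K => c (p.2 :: p.1)) (∑' x, c x) :=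
    (cons_injective.hasSum_iff (cons_range h0)).2 hc.hasSum
  exact h1.prod_fiberwise fun x => hasSum_fintype _

theorem summable_tail {f : Site K → ℝ} (hf : Summable f) (h0 : ∀ x, 0 ≤ f x) :
    Summable fun x : Site K => f x.tail := by
  classical
  have h1 : Summable fun x : Site K => if x = [] then 0 else f x.tail := by
    rw [← cons_injective.summable_iff (cons_range (by simp))]
    rw [summable_prod_of_nonneg]
    · refine ⟨fun x => Summable.of_finite, ?_⟩
      simpa using hf.mul_left (K : ℝ)
    · intro p
      simp [h0]
  have h2 : Summable fun x : Site K => if x = [] then f [] else 0 :=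
    (hasSum_ite_eq ([] : Site K) (f [])).summable
  refine (h1.add h2).congr fun x => ?_
  by_cases hx : x = []
  · subst hx; simp
  · simp [hx]

/-- The total current of a square summable function vanishes. -/
theorem hasSum_current {ψ : Site K → Fin W → ℂ} (hψ : Summable fun x => nsq (ψ x)) :
    HasSum (fun x => (star (ψ x) ⬝ᵥ ∑ y ∈ neighbors x, ψ y).im) 0 := by
  -- The current through the edge from `x` to its parent. Since `[].tail = []`, the value at the
  -- root is the imaginary part of a real number.
  set c : Site K → ℝ := fun x => (star (ψ x) ⬝ᵥ ψ x.tail).im with hc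
  have hc0 : c [] = 0 := by
    simp only [hc, List.tail_nil, star_dotProduct_self, Complex.ofReal_im]
  have hs : Summable c := by
    refine Summable.of_norm_bounded (hψ.add (summable_tail hψ fun x => nsq_nonneg _)) fun x => ?_
    exact (Complex.abs_im_le_norm _).trans (norm_dotProduct_le _ _)
  -- Each edge occurs twice with opposite signs, once from either end, so the total cancels by
  -- `tsum_cons`.
  have key : ∀ x, (star (ψ x) ⬝ᵥ ∑ y ∈ neighbors x, ψ y).im = c x - ∑ i, c (i :: x) := by
    intro x
    have h1 : ∀ i, (star (ψ x) ⬝ᵥ ψ (i :: x)).im = - c (i :: x) := fun i =>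
      im_dotProduct_swap _ _
    cases x with
    | nil =>
      rw [sum_neighbors_nil, dotProduct_sum, Complex.im_sum, hc0, zero_sub,
        ← Finset.sum_neg_distrib]
      exact Finset.sum_congr rfl fun i _ => h1 i
    | cons a t =>
      rw [sum_neighbors_cons, dotProduct_add, dotProduct_sum, Complex.add_im, Complex.im_sum,
        sub_eq_add_neg, ← Finset.sum_neg_distrib]
      congr 1
      exact Finset.sum_congr rfl fun i _ => h1 i
  simp only [key]
  simpa using hs.hasSum.sub (tsum_cons hs hc0)

/-- Pair the equation with `ψ` and take imaginary parts: the Hermitian potential drops out, the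
hopping has zero total current, and only the term with `Im z` survives. -/
theorem IsResolventOf.hasSum_im {S : Set (Site K)} {U : Site K → Matrix (Fin W) (Fin W) ℂ}
    (hU : ∀ x, (U x).IsHermitian) {z : ℂ} {φ ψ : Site K → Fin W → ℂ}
    (h : IsResolventOf S U z φ ψ) :
    HasSum (fun x => (star (ψ x) ⬝ᵥ φ x).im) (-(z.im * ∑' x, nsq (ψ x))) := by
  have h1 : Summable fun x => nsq (ψ x) := h.1
  have h2 := (hasSum_current h1).sub (h1.hasSum.mul_left z.im)
  rw [zero_sub] at h2
  refine h2.congr_fun ?_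
  intro x
  by_cases hx : x ∈ S
  · rw [← h.2.2 x hx, schrodinger, dotProduct_sub, dotProduct_add, Complex.sub_im, Complex.add_im,
      im_dotProduct_hermitian (hU x), dotProduct_smul, star_dotProduct_self]
    simp
  · rw [h.2.1 x hx]; simp [nsq]

theorem IsResolventOf.sub {S : Set (Site K)} {U : Site K → Matrix (Fin W) (Fin W) ℂ}
    {z : ℂ} {φ ψ φ' ψ' : Site K → Fin W → ℂ}
    (h : IsResolventOf S U z φ ψ) (h' : IsResolventOf S U z φ' ψ') :
    IsResolventOf S U z (φ - φ') (ψ - ψ') := by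
  refine ⟨?_, ?_, ?_⟩
  · refine Summable.of_nonneg_of_le (fun x => nsq_nonneg ((ψ - ψ') x)) (fun x => ?_)
      ((h.1.mul_left 2).add (h'.1.mul_left 2))
    rw [Finset.mul_sum, Finset.mul_sum, ← Finset.sum_add_distrib]
    refine Finset.sum_le_sum fun i _ => ?_
    have := norm_sub_le (ψ x i) (ψ' x i)
    simp only [Pi.sub_apply]
    nlinarith [sq_nonneg (‖ψ x i‖ - ‖ψ' x i‖), norm_nonneg (ψ x i - ψ' x i)]
  · intro x hx
    simp [h.2.1 x hx, h'.2.1 x hx]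
  · intro x hx
    rw [Pi.sub_apply φ, ← h.2.2 x hx, ← h'.2.2 x hx]
    simp only [schrodinger, Pi.sub_apply, Finset.sum_sub_distrib, mulVec_sub, smul_sub]
    abel

theorem IsResolventOf.smul {S : Set (Site K)} {U : Site K → Matrix (Fin W) (Fin W) ℂ}
    {z : ℂ} {φ ψ : Site K → Fin W → ℂ} (c : ℂ)
    (h : IsResolventOf S U z φ ψ) :
    IsResolventOf S U z (c • φ) (c • ψ) := by
  refine ⟨?_, ?_, ?_⟩
  · refine (h.1.mul_left (‖c‖ ^ 2)).congr fun x => ?_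
    rw [Finset.mul_sum]
    refine Finset.sum_congr rfl fun i _ => ?_
    simp [mul_pow]
  · intro x hx
    simp [h.2.1 x hx]
  · intro x hx
    rw [Pi.smul_apply c φ, ← h.2.2 x hx]
    simp only [schrodinger, Pi.smul_apply, ← Finset.smul_sum, mulVec_smul, smul_sub, smul_add]
    rw [smul_comm z c]

theorem IsResolventOf.zero {S : Set (Site K)} {U : Site K → Matrix (Fin W) (Fin W) ℂ}
    {z : ℂ} : IsResolventOf S U z (0 : Site K → Fin W → ℂ) 0 := by
  refine ⟨by simp, fun x _ => rfl, fun x _ => ?_⟩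
  simp [schrodinger]

theorem IsResolventOf.add {S : Set (Site K)} {U : Site K → Matrix (Fin W) (Fin W) ℂ}
    {z : ℂ} {φ ψ φ' ψ' : Site K → Fin W → ℂ}
    (h : IsResolventOf S U z φ ψ) (h' : IsResolventOf S U z φ' ψ') :
    IsResolventOf S U z (φ + φ') (ψ + ψ') := by
  have := h.sub (h'.smul (-1))
  simpa using this

theorem IsResolventOf.sum {ι : Type*} (s : Finset ι) {S : Set (Site K)}
    {U : Site K → Matrix (Fin W) (Fin W) ℂ} {z : ℂ} {φ ψ : ι → Site K → Fin W → ℂ}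
    (h : ∀ i ∈ s, IsResolventOf S U z (φ i) (ψ i)) :
    IsResolventOf S U z (∑ i ∈ s, φ i) (∑ i ∈ s, ψ i) := by
  classical
  induction s using Finset.induction_on with
  | empty => simpa using IsResolventOf.zero
  | insert a s ha ih =>
    rw [Finset.sum_insert ha, Finset.sum_insert ha]
    exact (h a (Finset.mem_insert_self a s)).add
      (ih fun i hi => h i (Finset.mem_insert_of_mem hi))

theorem IsResolventOf.congr {S : Set (Site K)} {U : Site K → Matrix (Fin W) (Fin W) ℂ}
    {z : ℂ} {φ φ' ψ : Site K → Fin W → ℂ} (h : IsResolventOf S U z φ ψ)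
    (hφ : ∀ x ∈ S, φ x = φ' x) : IsResolventOf S U z φ' ψ :=
  ⟨h.1, h.2.1, fun x hx => (h.2.2 x hx).trans (hφ x hx)⟩

/-- The difference of two solutions has zero source, so `Im z` times its squared norm vanishes. -/
theorem IsResolventOf.unique {S : Set (Site K)} {U : Site K → Matrix (Fin W) (Fin W) ℂ}
    (hU : ∀ x, (U x).IsHermitian) {z : ℂ} (hz : 0 < z.im) {φ ψ ψ' : Site K → Fin W → ℂ}
    (h : IsResolventOf S U z φ ψ) (h' : IsResolventOf S U z φ ψ') : ψ = ψ' := by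
  have h1 := (h.sub h').hasSum_im hU
  have hs : Summable fun x => nsq ((ψ - ψ') x) := (h.sub h').1
  simp only [sub_self, Pi.zero_apply, dotProduct_zero, Complex.zero_im] at h1
  have h2 := h1.unique hasSum_zero
  have h3 : ∑' x, nsq ((ψ - ψ') x) = 0 := by
    rcases mul_eq_zero.1 (neg_eq_zero.1 h2) with h | h
    · exact absurd h hz.ne'
    · exact h
  have h4 := (hasSum_zero_iff_of_nonneg fun x => nsq_nonneg ((ψ - ψ') x)).1 (h3 ▸ hs.hasSum)
  ext1 x
  exact sub_eq_zero.1 (nsq_eq_zero (congrFun h4 x))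

/-- The energy identity for a source at the site `y`. -/
theorem IsResolventOf.energy {S : Set (Site K)} {U : Site K → Matrix (Fin W) (Fin W) ℂ}
    (hU : ∀ x, (U x).IsHermitian) {z : ℂ} {y : Site K} {v : Fin W → ℂ} {ψ : Site K → Fin W → ℂ}
    (h : IsResolventOf S U z (Pi.single y v) ψ) :
    z.im * ∑' x, nsq (ψ x) = (star v ⬝ᵥ ψ y).im := by
  have h1 := h.hasSum_im hU
  have h2 : HasSum (fun x => (star (ψ x) ⬝ᵥ (Pi.single y v : Site K → Fin W → ℂ) x).im)
      ((star (ψ y) ⬝ᵥ v).im) := by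
    convert hasSum_single y ?_ using 1
    · simp
    · intro x hx
      simp [Pi.single_eq_of_ne hx]
  have h3 := h1.unique h2
  rw [im_dotProduct_swap]
  linarith

/-- With `T` the squared norm of `ψ`, the energy identity yields `Im z * T ≤ ‖ψ y j‖ ≤ √T`. The
bound does not depend on `S`, which makes finite volume approximations compact. -/
theorem IsResolventOf.nsq_le {S : Set (Site K)} {U : Site K → Matrix (Fin W) (Fin W) ℂ}
    (hU : ∀ x, (U x).IsHermitian) {z : ℂ} (hz : 0 < z.im) {y : Site K} {j : Fin W}
    {ψ : Site K → Fin W → ℂ}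
    (h : IsResolventOf S U z (delta y j) ψ) (s : Finset (Site K)) :
    ∑ x ∈ s, nsq (ψ x) ≤ 1 / z.im ^ 2 := by
  have h1 := IsResolventOf.energy hU h
  have hs : Summable fun x => nsq (ψ x) := h.1
  have h2 : (star (Pi.single j 1 : Fin W → ℂ) ⬝ᵥ ψ y).im ≤ ‖ψ y j‖ := by
    have : star (Pi.single j 1 : Fin W → ℂ) ⬝ᵥ ψ y = ψ y j := by
      rw [← Pi.single_star]; simp
    rw [this]
    exact (le_abs_self _).trans (Complex.abs_im_le_norm _)
  set T := ∑' x, nsq (ψ x) with hT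
  have h3 : ‖ψ y j‖ ^ 2 ≤ T := by
    refine le_trans ?_ (hs.le_tsum y fun x _ => nsq_nonneg _)
    exact Finset.single_le_sum (f := fun i => ‖ψ y i‖ ^ 2) (fun _ _ => by positivity)
      (Finset.mem_univ j)
  have hT0 : 0 ≤ T := tsum_nonneg fun x => nsq_nonneg _
  refine (hs.sum_le_tsum s fun x _ => nsq_nonneg _).trans ?_
  rw [← hT, le_div_iff₀ (by positivity)]
  have h4 : z.im * T ≤ ‖ψ y j‖ := h1.le.trans h2
  by_contra hcon
  push Not at hcon
  have h5 : (z.im * T) ^ 2 ≤ T := (pow_le_pow_left₀ (by positivity) h4 2).trans h3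
  have hTpos : 0 < T := by
    rcases hT0.eq_or_lt with h0 | h0
    · rw [← h0] at hcon; norm_num at hcon
    · exact h0
  nlinarith

end Energy


/-! ### Existence and measurability of the resolvent by finite volume approximation. -/

section Existence

theorem resolventApply_eq {S : Set (Site K)} {U : Site K → Matrix (Fin W) (Fin W) ℂ}
    (hU : ∀ x, (U x).IsHermitian) {z : ℂ} (hz : 0 < z.im) {φ ψ : Site K → Fin W → ℂ}
    (h : IsResolventOf S U z φ ψ) : resolventApply S U z φ = ψ := by
  have hex : ∃ ψ, IsResolventOf S U z φ ψ := ⟨ψ, h⟩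
  rw [resolventApply, dif_pos hex]
  exact hex.choose_spec.unique hU hz h

/-- The matrix of `H_F - z` for a finite set `F` of sites. -/
noncomputable def hamMatrix (F : Finset (Site K)) (U : Site K → Matrix (Fin W) (Fin W) ℂ) (z : ℂ) :
    Matrix (F × Fin W) (F × Fin W) ℂ :=
  Matrix.of fun p q => (if (q.1 : Site K) ∈ neighbors (p.1 : Site K) then
      (if p.2 = q.2 then 1 else 0) else 0) +
    if p.1 = q.1 then U p.1 p.2 q.2 - (if p.2 = q.2 then z else 0) else 0

/-- Extension by zero of a function on a finite set of sites. -/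
noncomputable def extendZero (F : Finset (Site K)) (f : F × Fin W → ℂ) : Site K → Fin W → ℂ :=
  fun x i => if h : x ∈ F then f (⟨x, h⟩, i) else 0

theorem hamMatrix_mulVec (F : Finset (Site K)) (U : Site K → Matrix (Fin W) (Fin W) ℂ) (z : ℂ)
    (f : F × Fin W → ℂ) (p : F × Fin W) :
    (hamMatrix F U z *ᵥ f) p =
      (schrodinger U (extendZero F f) p.1 - z • extendZero F f p.1) p.2 := by
  classical
  obtain ⟨x, i⟩ := p
  have hx : ∀ j, extendZero F f x j = f (x, j) := fun j => by simp [extendZero]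
  simp only [mulVec, dotProduct, hamMatrix, of_apply, add_mul, Finset.sum_add_distrib, schrodinger,
    Pi.sub_apply, Pi.add_apply, Pi.smul_apply, smul_eq_mul, Finset.sum_apply, hx,
    Fintype.sum_prod_type]
  rw [add_sub_assoc]
  congr 1
  · have h1 : ∀ y : F, ∑ j, (if (y : Site K) ∈ neighbors (x : Site K) then
        (if i = j then (1 : ℂ) else 0) else 0) * f (y, j) =
        if (y : Site K) ∈ neighbors (x : Site K) then extendZero F f y i else 0 := by
      intro y
      by_cases hy : (y : Site K) ∈ neighbors (x : Site K)
      · simp [hy, extendZero]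
      · simp [hy]
    rw [Finset.sum_congr rfl fun y _ => h1 y,
      Finset.sum_coe_sort F fun y => if y ∈ neighbors (x : Site K) then extendZero F f y i else 0,
      ← Finset.sum_filter]
    refine Finset.sum_subset (fun y hy => (Finset.mem_filter.1 hy).2) fun y hy hy' => ?_
    have : y ∉ F := fun h => hy' (Finset.mem_filter.2 ⟨h, hy⟩)
    simp [extendZero, this]
  · rw [Finset.sum_eq_single x]
    · simp [sub_mul, Finset.sum_sub_distrib]
    · intro y _ hy
      simp [Ne.symm hy]
    · simp

theorem extendZero_isResolventOf {F : Finset (Site K)} {U : Site K → Matrix (Fin W) (Fin W) ℂ}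
    {z : ℂ} {φ : Site K → Fin W → ℂ} {f : F × Fin W → ℂ}
    (h : hamMatrix F U z *ᵥ f = fun p => φ p.1 p.2) :
    IsResolventOf (F : Set (Site K)) U z φ (extendZero F f) := by
  refine ⟨?_, ?_, ?_⟩
  · refine summable_of_ne_finset_zero (s := F) fun x hx => ?_
    simp [extendZero, hx]
  · intro x hx
    ext i
    have : x ∉ F := by simpa using hx
    simp [extendZero, this]
  · intro x hx
    ext i
    have := hamMatrix_mulVec F U z f (⟨x, by simpa using hx⟩, i)
    rw [← this, h]

/-- A kernel vector, extended by zero, would solve the homogeneous equation, against uniqueness. -/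
theorem hamMatrix_det_ne_zero (F : Finset (Site K)) {U : Site K → Matrix (Fin W) (Fin W) ℂ}
    (hU : ∀ x, (U x).IsHermitian) {z : ℂ} (hz : 0 < z.im) : (hamMatrix F U z).det ≠ 0 := by
  intro h0
  obtain ⟨f, hf, h1⟩ := Matrix.exists_mulVec_eq_zero_iff.2 h0
  apply hf
  have h2 : IsResolventOf (F : Set (Site K)) U z 0 (extendZero F f) :=
    extendZero_isResolventOf (by rw [h1]; rfl)
  have h3 := h2.unique hU hz IsResolventOf.zero
  ext ⟨x, i⟩
  have := congrFun (congrFun h3 x) i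
  simpa [extendZero] using this

/-- The resolvent of a finite set of sites. -/
noncomputable def finiteSolution (F : Finset (Site K)) (U : Site K → Matrix (Fin W) (Fin W) ℂ)
    (z : ℂ) (φ : Site K → Fin W → ℂ) : Site K → Fin W → ℂ :=
  extendZero F ((hamMatrix F U z)⁻¹ *ᵥ fun p => φ p.1 p.2)

theorem finiteSolution_isResolventOf (F : Finset (Site K))
    {U : Site K → Matrix (Fin W) (Fin W) ℂ} (hU : ∀ x, (U x).IsHermitian) {z : ℂ} (hz : 0 < z.im)
    (φ : Site K → Fin W → ℂ) :
    IsResolventOf (F : Set (Site K)) U z φ (finiteSolution F U z φ) := by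
  apply extendZero_isResolventOf
  rw [mulVec_mulVec, mul_nonsing_inv _ (isUnit_iff_ne_zero.2 (hamMatrix_det_ne_zero F hU hz)),
    one_mulVec]

/-- The finite set of the sites of `S` within distance `n` of the root. -/
noncomputable def truncation (S : Set (Site K)) (n : ℕ) : Finset (Site K) :=
  ((List.finite_length_le (Fin K) n).inter_of_left S).toFinset

theorem mem_truncation {S : Set (Site K)} {n : ℕ} {x : Site K} :
    x ∈ truncation S n ↔ x.length ≤ n ∧ x ∈ S := by
  simp [truncation]

theorem norm_le_of_nsq_le {v : Fin W → ℂ} {c : ℝ} (hc : 0 ≤ c) (h : nsq v ≤ c ^ 2) (i : Fin W) :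
    ‖v i‖ ≤ c := by
  refine (sq_le_sq₀ (norm_nonneg _) hc).1 (le_trans ?_ h)
  exact Finset.single_le_sum (f := fun i => ‖v i‖ ^ 2) (fun _ _ => by positivity)
    (Finset.mem_univ i)

theorem continuous_eval_site (x : Site K) :
    Continuous fun ψ : Site K → Fin W → ℂ => ψ x := continuous_apply x

theorem continuous_schrodinger (U : Site K → Matrix (Fin W) (Fin W) ℂ) (x : Site K) :
    Continuous fun ψ : Site K → Fin W → ℂ => schrodinger U ψ x := by
  unfold schrodinger
  refine Continuous.add (continuous_finsetSum _ fun y _ => continuous_eval_site y) ?_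
  exact Continuous.matrix_mulVec continuous_const (continuous_eval_site x)

/-- The resolvent is the limit of the resolvents of finite sets. -/
theorem exists_tendsto_finiteSolution (S : Set (Site K))
    {U : Site K → Matrix (Fin W) (Fin W) ℂ} (hU : ∀ x, (U x).IsHermitian) {z : ℂ} (hz : 0 < z.im)
    (y : Site K) (j : Fin W) :
    ∃ ψ, IsResolventOf S U z (delta y j) ψ ∧
      Tendsto (fun n => finiteSolution (truncation S n) U z (delta y j)) atTop (𝓝 ψ) := by
  set Ψ := fun n => finiteSolution (truncation S n) U z (delta y j) with hΨ
  have hΨr : ∀ n, IsResolventOf (truncation S n : Set (Site K)) U z (delta y j) (Ψ n) := fun n =>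
    finiteSolution_isResolventOf _ hU hz _
  set B : Set (Site K → Fin W → ℂ) :=
    Set.univ.pi fun _ => Set.univ.pi fun _ => Metric.closedBall 0 (1 / z.im)
  have hB : IsCompact B :=
    isCompact_univ_pi fun _ => isCompact_univ_pi fun _ => isCompact_closedBall _ _
  have hmem : ∀ n, Ψ n ∈ B := by
    intro n x _ i _
    rw [mem_closedBall_zero_iff]
    refine norm_le_of_nsq_le (v := Ψ n x) (by positivity) ?_ i
    have := (hΨr n).nsq_le hU hz {x}
    simpa [div_pow] using this
  -- Every clause of the resolvent equation is a closed condition in finitely many coordinates (for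
  -- summability, the partial sums) and holds for all large `n`, so it passes to cluster points.
  -- Uniqueness of the cluster point in the compact box then gives convergence.
  have hclus : ∀ ψ, MapClusterPt ψ atTop Ψ → IsResolventOf S U z (delta y j) ψ := by
    intro ψ hψ
    have hcl : ∀ C : Set (Site K → Fin W → ℂ), IsClosed C → (∀ᶠ n in atTop, Ψ n ∈ C) → ψ ∈ C := by
      intro C hC h
      rw [← hC.closure_eq]
      exact mem_closure_iff_clusterPt.2 (ClusterPt.mono hψ (le_principal_iff.2 h))
    refine ⟨?_, ?_, ?_⟩
    · refine summable_of_sum_le (c := 1 / z.im ^ 2) (fun x => nsq_nonneg (ψ x)) fun s => ?_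
      refine hcl {ψ | ∑ x ∈ s, ∑ i, ‖ψ x i‖ ^ 2 ≤ 1 / z.im ^ 2} ?_ ?_
      · refine isClosed_le ?_ continuous_const
        fun_prop
      · exact Eventually.of_forall fun n => (hΨr n).nsq_le hU hz s
    · intro x hx
      refine hcl {ψ | ψ x = 0} (isClosed_eq (continuous_eval_site x) continuous_const) ?_
      refine Eventually.of_forall fun n => (hΨr n).2.1 x ?_
      simp [mem_truncation, hx]
    · intro x hx
      refine hcl {ψ | schrodinger U ψ x - z • ψ x = delta y j x} ?_ ?_
      · exact isClosed_eq ((continuous_schrodinger U x).sub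
          ((continuous_eval_site x).const_smul z)) continuous_const
      · filter_upwards [eventually_ge_atTop x.length] with n hn
        exact (hΨr n).2.2 x (by simp [mem_truncation, hx, hn])
  obtain ⟨ψ, -, hψ⟩ := hB.exists_mapClusterPt
    (f := atTop) (u := Ψ) (tendsto_principal.2 (Eventually.of_forall hmem))
  refine ⟨ψ, hclus ψ hψ, hB.tendsto_nhds_of_unique_mapClusterPt (Eventually.of_forall hmem) ?_⟩
  intro ψ' _ h'
  exact (hclus ψ' h').unique hU hz (hclus ψ hψ)

theorem resolventApply_isResolventOf (S : Set (Site K))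
    {U : Site K → Matrix (Fin W) (Fin W) ℂ} (hU : ∀ x, (U x).IsHermitian) {z : ℂ} (hz : 0 < z.im)
    (y : Site K) (j : Fin W) :
    IsResolventOf S U z (delta y j) (resolventApply S U z (delta y j)) := by
  obtain ⟨ψ, h, -⟩ := exists_tendsto_finiteSolution S hU hz y j
  rwa [resolventApply_eq hU hz h]

theorem tendsto_finiteSolution (S : Set (Site K))
    {U : Site K → Matrix (Fin W) (Fin W) ℂ} (hU : ∀ x, (U x).IsHermitian) {z : ℂ} (hz : 0 < z.im)
    (x y : Site K) (i j : Fin W) :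
    Tendsto (fun n => finiteSolution (truncation S n) U z (delta y j) x i) atTop
      (𝓝 (green S U z x y i j)) := by
  obtain ⟨ψ, h, h'⟩ := exists_tendsto_finiteSolution S hU hz y j
  rw [green, of_apply, resolventApply_eq hU hz h]
  exact ((continuous_apply i).tendsto _).comp (((continuous_apply x).tendsto _).comp h')

theorem norm_green_apply_le (S : Set (Site K))
    {U : Site K → Matrix (Fin W) (Fin W) ℂ} (hU : ∀ x, (U x).IsHermitian) {z : ℂ} (hz : 0 < z.im)
    (x y : Site K) (i j : Fin W) : ‖green S U z x y i j‖ ≤ 1 / z.im := by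
  have := (resolventApply_isResolventOf S hU hz y j).nsq_le hU hz {x}
  refine norm_le_of_nsq_le (v := resolventApply S U z (delta y j) x) (by positivity) ?_ i
  simpa [div_pow] using this

theorem measurable_finiteSolution {Ω : Type*} [MeasurableSpace Ω] (F : Finset (Site K))
    {U : Ω → Site K → Matrix (Fin W) (Fin W) ℂ} (hU : ∀ x i j, Measurable fun ω => U ω x i j)
    (z : ℂ) (φ : Site K → Fin W → ℂ) (x : Site K) (i : Fin W) :
    Measurable fun ω => finiteSolution F (U ω) z φ x i := by
  classical
  have hM : Measurable fun ω => (fun p q => hamMatrix F (U ω) z p q : F × Fin W → F × Fin W → ℂ) := by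
    refine measurable_pi_lambda _ fun p => measurable_pi_lambda _ fun q => ?_
    simp only [hamMatrix, of_apply]
    refine Measurable.add measurable_const ?_
    by_cases h : p.1 = q.1
    · simp only [h, if_true]
      exact (hU _ _ _).sub measurable_const
    · simp only [h, if_false]
      exact measurable_const
  by_cases hx : x ∈ F
  · simp only [finiteSolution, extendZero, hx, dif_pos, mulVec, dotProduct]
    refine Finset.measurable_sum _ fun q _ => Measurable.mul ?_ measurable_const
    simp only [inv_def, Ring.inverse_eq_inv', Matrix.smul_apply, smul_eq_mul]
    refine Measurable.mul ?_ ?_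
    · have h1 : Continuous fun M : F × Fin W → F × Fin W → ℂ => (Matrix.of M).det :=
        Continuous.matrix_det continuous_id
      exact (h1.measurable.comp hM).inv
    · have h1 : Continuous fun M : F × Fin W → F × Fin W → ℂ =>
          (Matrix.of M).adjugate (⟨x, hx⟩, i) q := by
        have : Continuous fun M : F × Fin W → F × Fin W → ℂ => (Matrix.of M).adjugate :=
          Continuous.matrix_adjugate continuous_id
        exact this.matrix_elem _ _
      exact h1.measurable.comp hM
  · simp only [finiteSolution, extendZero, hx, dif_neg, not_false_eq_true]
    exact measurable_const

/-- The resolvent is selected by choice, so measurability is not visible from its definition; it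
comes from the pointwise limit of finite volume solutions, which are given by Cramer's rule. -/
theorem measurable_green {Ω : Type*} [MeasurableSpace Ω] (S : Set (Site K))
    {U : Ω → Site K → Matrix (Fin W) (Fin W) ℂ} (hU : ∀ x i j, Measurable fun ω => U ω x i j)
    (hU' : ∀ ω x, (U ω x).IsHermitian) {z : ℂ} (hz : 0 < z.im) (x y : Site K) (i j : Fin W) :
    Measurable fun ω => green S (U ω) z x y i j := by
  refine measurable_of_tendsto_metrizable
    (fun n => measurable_finiteSolution (truncation S n) hU z (delta y j) x i) ?_
  rw [tendsto_pi_nhds]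
  exact fun ω => tendsto_finiteSolution S (hU' ω) hz x y i j

end Existence


/-! ### Matrix-valued resolvent equations: decoupling, embeddings, removal of a site. -/

section MatrixResolvent

/-- The columns of `X` solve the resolvent equation with the columns of `Φ` as sources. -/
def IsMatrixResolvent (S : Set (Site K)) (U : Site K → Matrix (Fin W) (Fin W) ℂ) (z : ℂ)
    (Φ X : Site K → Matrix (Fin W) (Fin W) ℂ) : Prop :=
  ∀ j, IsResolventOf S U z (fun x i => Φ x i j) fun x i => X x i j

theorem IsMatrixResolvent.congr {S : Set (Site K)} {U : Site K → Matrix (Fin W) (Fin W) ℂ}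
    {z : ℂ} {Φ Φ' X : Site K → Matrix (Fin W) (Fin W) ℂ} (h : IsMatrixResolvent S U z Φ X)
    (hΦ : ∀ x ∈ S, Φ x = Φ' x) : IsMatrixResolvent S U z Φ' X :=
  fun j => (h j).congr fun x hx => by simp [hΦ x hx]

theorem IsMatrixResolvent.unique {S : Set (Site K)} {U : Site K → Matrix (Fin W) (Fin W) ℂ}
    (hU : ∀ x, (U x).IsHermitian) {z : ℂ} (hz : 0 < z.im)
    {Φ X X' : Site K → Matrix (Fin W) (Fin W) ℂ} (h : IsMatrixResolvent S U z Φ X)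
    (h' : IsMatrixResolvent S U z Φ X') : X = X' := by
  ext x i j
  exact congrFun (congrFun ((h j).unique hU hz (h' j)) x) i

theorem IsMatrixResolvent.sub {S : Set (Site K)} {U : Site K → Matrix (Fin W) (Fin W) ℂ}
    {z : ℂ} {Φ Φ' X X' : Site K → Matrix (Fin W) (Fin W) ℂ} (h : IsMatrixResolvent S U z Φ X)
    (h' : IsMatrixResolvent S U z Φ' X') :
    IsMatrixResolvent S U z (fun x => Φ x - Φ' x) fun x => X x - X' x :=
  fun j => (h j).sub (h' j)

theorem IsMatrixResolvent.sum {ι : Type*} (s : Finset ι) {S : Set (Site K)}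
    {U : Site K → Matrix (Fin W) (Fin W) ℂ} {z : ℂ}
    {Φ X : ι → Site K → Matrix (Fin W) (Fin W) ℂ}
    (h : ∀ i ∈ s, IsMatrixResolvent S U z (Φ i) (X i)) :
    IsMatrixResolvent S U z (fun x => ∑ i ∈ s, Φ i x) fun x => ∑ i ∈ s, X i x := by
  intro j
  convert IsResolventOf.sum s fun i hi => h i hi j using 1 <;>
  · ext x k
    simp [Matrix.sum_apply]

theorem IsMatrixResolvent.mul_right {S : Set (Site K)} {U : Site K → Matrix (Fin W) (Fin W) ℂ}
    {z : ℂ} {Φ X : Site K → Matrix (Fin W) (Fin W) ℂ} (h : IsMatrixResolvent S U z Φ X)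
    (c : Matrix (Fin W) (Fin W) ℂ) :
    IsMatrixResolvent S U z (fun x => Φ x * c) fun x => X x * c := by
  intro j
  convert IsResolventOf.sum Finset.univ fun k _ => (h k).smul (c k j) using 1 <;>
  · ext x i
    simp [Matrix.mul_apply, mul_comm]

theorem IsMatrixResolvent.equation {S : Set (Site K)} {U : Site K → Matrix (Fin W) (Fin W) ℂ}
    {z : ℂ} {Φ X : Site K → Matrix (Fin W) (Fin W) ℂ} (h : IsMatrixResolvent S U z Φ X)
    {x : Site K} (hx : x ∈ S) :
    (∑ w ∈ neighbors x, X w) + (U x - z • (1 : Matrix (Fin W) (Fin W) ℂ)) * X x = Φ x := by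
  ext i j
  have h1 := congrFun ((h j).2.2 x hx) i
  simp only [schrodinger, Pi.sub_apply, Pi.add_apply, Finset.sum_apply, Pi.smul_apply,
    smul_eq_mul, mulVec, dotProduct] at h1
  rw [← h1]
  simp only [Matrix.add_apply, Matrix.sum_apply, sub_mul, Matrix.sub_apply, Matrix.smul_mul,
    Matrix.smul_apply, Matrix.one_mul, smul_eq_mul, Matrix.mul_apply]
  ring

theorem IsMatrixResolvent.eq_zero {S : Set (Site K)} {U : Site K → Matrix (Fin W) (Fin W) ℂ}
    {z : ℂ} {Φ X : Site K → Matrix (Fin W) (Fin W) ℂ} (h : IsMatrixResolvent S U z Φ X)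
    {x : Site K} (hx : x ∉ S) : X x = 0 := by
  ext i j
  exact congrFun ((h j).2.1 x hx) i

theorem isMatrixResolvent_green (S : Set (Site K)) {U : Site K → Matrix (Fin W) (Fin W) ℂ}
    (hU : ∀ x, (U x).IsHermitian) {z : ℂ} (hz : 0 < z.im) (y : Site K) :
    IsMatrixResolvent S U z (Pi.single y 1) fun x => green S U z x y := by
  intro j
  refine (resolventApply_isResolventOf S hU hz y j).congr fun x _ => ?_
  ext i
  rcases eq_or_ne x y with rfl | hxy
  · simp [delta, Matrix.one_apply, Pi.single_apply]
  · simp [delta, hxy]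

/-- Truncation to `C` moves the hopping from outside `C` into the source. -/
theorem IsMatrixResolvent.indicator {S : Set (Site K)} {U : Site K → Matrix (Fin W) (Fin W) ℂ}
    {z : ℂ} {Φ X : Site K → Matrix (Fin W) (Fin W) ℂ} (h : IsMatrixResolvent S U z Φ X)
    (C : Set (Site K)) :
    IsMatrixResolvent (S ∩ C) U z (fun x => Φ x - ∑ w ∈ neighbors x, Cᶜ.indicator X w)
      (C.indicator X) := by
  classical
  intro j
  refine ⟨?_, ?_, ?_⟩
  · refine Summable.of_nonneg_of_le (fun x => nsq_nonneg (fun i => C.indicator X x i j))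
      (fun x => ?_) (h j).1
    by_cases hx : x ∈ C
    · simp [hx]
    · simpa [hx, nsq] using nsq_nonneg fun i => X x i j
  · intro x hx
    by_cases hC : x ∈ C
    · have : x ∉ S := fun h => hx ⟨h, hC⟩
      simp [hC, h.eq_zero this]
      rfl
    · simp [hC]
      rfl
  · rintro x ⟨hxS, hxC⟩
    have h1 := (h j).2.2 x hxS
    ext i
    have h2 := congrFun h1 i
    simp only [schrodinger, Pi.sub_apply, Pi.add_apply, Finset.sum_apply, Pi.smul_apply,
      smul_eq_mul, Set.indicator_of_mem hxC, Matrix.sub_apply, Matrix.sum_apply] at h2 ⊢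
    rw [← h2]
    have h3 : ∑ w ∈ neighbors x, X w i j = ∑ w ∈ neighbors x, C.indicator X w i j +
        ∑ w ∈ neighbors x, Cᶜ.indicator X w i j := by
      rw [← Finset.sum_add_distrib]
      refine Finset.sum_congr rfl fun w _ => ?_
      rw [← Matrix.add_apply, Set.indicator_self_add_compl_apply]
    rw [h3]
    ring

theorem green_off {S : Set (Site K)} {U : Site K → Matrix (Fin W) (Fin W) ℂ}
    (hU : ∀ x, (U x).IsHermitian) {z : ℂ} (hz : 0 < z.im) {x : Site K} (hx : x ∉ S) (y : Site K) :
    green S U z x y = 0 :=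
  (isMatrixResolvent_green S hU hz y).eq_zero hx

theorem isMatrixResolvent_zero (S : Set (Site K)) (U : Site K → Matrix (Fin W) (Fin W) ℂ)
    (z : ℂ) : IsMatrixResolvent S U z (fun _ => 0) fun _ => 0 :=
  fun _ => IsResolventOf.zero

theorem green_off_right {S : Set (Site K)} {U : Site K → Matrix (Fin W) (Fin W) ℂ}
    (hU : ∀ x, (U x).IsHermitian) {z : ℂ} (hz : 0 < z.im) (x : Site K) {y : Site K} (hy : y ∉ S) :
    green S U z x y = 0 := by
  have h := (isMatrixResolvent_green S hU hz y).congr (Φ' := fun _ => 0) fun x hx => by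
    rw [Pi.single_eq_of_ne]; rintro rfl; exact hy hx
  exact congrFun (h.unique hU hz (isMatrixResolvent_zero S U z)) x

/-- `C` is a union of components of `S`. -/
def IsClosedIn (S C : Set (Site K)) : Prop :=
  ∀ x ∈ S ∩ C, ∀ w ∈ neighbors x, w ∈ S → w ∈ C

/-- No edge inside `S` leaves `C`, so the correction to the source is zero. -/
theorem IsMatrixResolvent.indicator_of_isClosedIn {S : Set (Site K)}
    {U : Site K → Matrix (Fin W) (Fin W) ℂ}
    {z : ℂ} {Φ X : Site K → Matrix (Fin W) (Fin W) ℂ} (h : IsMatrixResolvent S U z Φ X)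
    {C : Set (Site K)} (hC : IsClosedIn S C) :
    IsMatrixResolvent (S ∩ C) U z Φ (C.indicator X) := by
  refine (h.indicator C).congr fun x hx => ?_
  rw [Finset.sum_eq_zero, sub_zero]
  intro w hw
  by_cases hwS : w ∈ S
  · simp [hC x hx w hw hwS]
  · by_cases hwC : w ∈ C
    · simp [hwC]
    · simp [hwC, h.eq_zero hwS]

theorem green_restrict {S : Set (Site K)} {U : Site K → Matrix (Fin W) (Fin W) ℂ}
    (hU : ∀ x, (U x).IsHermitian) {z : ℂ} (hz : 0 < z.im) {C : Set (Site K)}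
    (hC : IsClosedIn S C) {x : Site K} (hx : x ∈ C) (y : Site K) :
    green S U z x y = green (S ∩ C) U z x y := by
  have h := ((isMatrixResolvent_green S hU hz y).indicator_of_isClosedIn hC).unique hU hz
    (isMatrixResolvent_green (S ∩ C) hU hz y)
  have := congrFun h x
  rwa [Set.indicator_of_mem hx] at this

theorem green_separated {S : Set (Site K)} {U : Site K → Matrix (Fin W) (Fin W) ℂ}
    (hU : ∀ x, (U x).IsHermitian) {z : ℂ} (hz : 0 < z.im) {C : Set (Site K)}
    (hC : IsClosedIn S C) {x y : Site K} (hx : x ∈ C) (hy : y ∉ C) : green S U z x y = 0 := by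
  rw [green_restrict hU hz hC hx, green_off_right hU hz x fun h => hy h.2]

/-- Hermiticity plays no role here: the two defining predicates coincide, hence so do the chosen
solutions. -/
theorem green_congr_potential {S : Set (Site K)} {U U' : Site K → Matrix (Fin W) (Fin W) ℂ}
    (h : ∀ x ∈ S, U x = U' x) (z : ℂ) : green S U z = green S U' z := by
  have h1 : ∀ φ, IsResolventOf S U z φ = IsResolventOf S U' z φ := by
    intro φ
    ext ψ
    have h2 : ∀ x ∈ S, schrodinger U ψ x = schrodinger U' ψ x := fun x hx => by
      simp [schrodinger, h x hx]
    constructor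
    · rintro ⟨a, b, c⟩
      exact ⟨a, b, fun x hx => by rw [← h2 x hx]; exact c x hx⟩
    · rintro ⟨a, b, c⟩
      exact ⟨a, b, fun x hx => by rw [h2 x hx]; exact c x hx⟩
  have h2 : ∀ φ, resolventApply S U z φ = resolventApply S U' z φ := by
    intro φ
    unfold resolventApply
    congr! 2
    all_goals simp only [h1]
  ext x y i j
  simp only [green, of_apply, h2]

theorem green_congr {S S' : Set (Site K)} {U U' : Site K → Matrix (Fin W) (Fin W) ℂ}
    (hU : ∀ x, (U x).IsHermitian) (hU' : ∀ x, (U' x).IsHermitian) {z : ℂ} (hz : 0 < z.im)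
    {C : Set (Site K)} (hC : IsClosedIn S C) (hC' : IsClosedIn S' C) (hS : S ∩ C = S' ∩ C)
    (h : ∀ x ∈ S ∩ C, U x = U' x) {x : Site K} (hx : x ∈ C) (y : Site K) :
    green S U z x y = green S' U' z x y := by
  rw [green_restrict hU hz hC hx, green_restrict hU' hz hC' hx, ← hS, green_congr_potential h]

/-- By `hcl` the neighbours of `f x` outside the range of `f` are outside `S`, where the solution
vanishes, so pulling back along `f` preserves the equation. This serves both shifts to subtrees and
automorphisms of the tree. -/
theorem green_comp_embedding {S : Set (Site K)} {U : Site K → Matrix (Fin W) (Fin W) ℂ}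
    (hU : ∀ x, (U x).IsHermitian) {z : ℂ} (hz : 0 < z.im) {f : Site K → Site K}
    (hf : Function.Injective f) (hadj : ∀ a b, Adjacent (f a) (f b) ↔ Adjacent a b)
    (hcl : ∀ a, f a ∈ S → ∀ w ∈ neighbors (f a), w ∈ S → w ∈ Set.range f) (a b : Site K) :
    green S U z (f a) (f b) = green (f ⁻¹' S) (U ∘ f) z a b := by
  classical
  have h := isMatrixResolvent_green S hU hz (f b)
  have h' : IsMatrixResolvent (f ⁻¹' S) (U ∘ f) z (Pi.single b 1)
      fun a => green S U z (f a) (f b) := by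
    intro j
    refine ⟨(h j).1.comp_injective hf, fun x hx => (h j).2.1 (f x) hx, fun x hx => ?_⟩
    have h1 := (h j).2.2 (f x) hx
    have h2 : (Pi.single (f b) (1 : Matrix (Fin W) (Fin W) ℂ) : Site K → _) (f x) =
        (Pi.single b (1 : Matrix (Fin W) (Fin W) ℂ) : Site K → _) x := by
      rcases eq_or_ne x b with rfl | hxb
      · simp
      · rw [Pi.single_eq_of_ne hxb, Pi.single_eq_of_ne (hf.ne hxb)]
    simp only [h2] at h1
    refine Eq.trans ?_ h1
    simp only [schrodinger]
    congr 2
    have h3 : (neighbors x).image f ⊆ neighbors (f x) := by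
      intro w hw
      obtain ⟨c, hc, rfl⟩ := Finset.mem_image.1 hw
      exact (mem_neighbors _ _).2 ((hadj _ _).2 ((mem_neighbors _ _).1 hc))
    rw [← Finset.sum_subset h3, Finset.sum_image fun c _ d _ hcd => hf hcd]
    intro w hw hw'
    refine (h j).2.1 w fun hwS => hw' ?_
    obtain ⟨c, rfl⟩ := hcl x hx w hw hwS
    exact Finset.mem_image_of_mem f
      ((mem_neighbors _ _).2 ((hadj _ _).1 ((mem_neighbors _ _).1 hw)))
  exact congrFun (h'.unique (fun x => hU (f x)) hz
    (isMatrixResolvent_green (f ⁻¹' S) (fun x => hU (f x)) hz b)).symm a |>.symm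

theorem adjacent_symm {x y : Site K} : Adjacent x y ↔ Adjacent y x := or_comm

theorem not_mem_neighbors_self (x : Site K) : x ∉ neighbors x := by
  rw [mem_neighbors]
  rintro (⟨i, h⟩ | ⟨i, h⟩) <;>
  · have := congrArg List.length h
    simp at this

/-- The Green function in terms of the Green function with the site `u` removed. -/
theorem green_remove (S : Set (Site K)) {U : Site K → Matrix (Fin W) (Fin W) ℂ}
    (hU : ∀ x, (U x).IsHermitian) {z : ℂ} (hz : 0 < z.im) {u x : Site K} (hx : x ≠ u)
    (y : Site K) :
    green S U z x y = green (S \ {u}) U z x y -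
      (∑ w ∈ neighbors u, green (S \ {u}) U z x w) * green S U z u y := by
  classical
  -- Away from `u` the Green function solves the equation on `S \ {u}` with an additional source
  -- `-G(u, y)` at the neighbours of `u`; superposition and uniqueness identify it.
  have h := (isMatrixResolvent_green S hU hz y).indicator {u}ᶜ
  have h1 := (isMatrixResolvent_green (S \ {u}) hU hz y).sub
    ((IsMatrixResolvent.sum (neighbors u) fun w _ =>
      isMatrixResolvent_green (S \ {u}) hU hz w).mul_right (green S U z u y))
  have h2 := h.unique hU hz (h1.congr fun v hv => ?_)
  · have := congrFun h2 x
    simpa [hx] using this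
  · congr 1
    rw [compl_compl, Finset.sum_mul]
    have h3 : ∀ w, Set.indicator {u} (fun x => green S U z x y) w =
        if w = u then green S U z u y else 0 := by
      intro w
      by_cases hw : w = u <;> simp [hw]
    simp only [h3, Finset.sum_ite_eq']
    by_cases hvu : u ∈ neighbors v
    · rw [if_pos hvu, Finset.sum_eq_single v]
      · simp
      · intro w _ hw
        simp [Pi.single_eq_of_ne hw.symm]
      · intro h
        exact absurd ((mem_neighbors _ _).2 (adjacent_symm.1 ((mem_neighbors _ _).1 hvu))) h
    · rw [if_neg hvu, Finset.sum_eq_zero]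
      intro w hw
      rw [Pi.single_eq_of_ne, zero_mul]
      rintro rfl
      exact hvu ((mem_neighbors _ _).2 (adjacent_symm.1 ((mem_neighbors _ _).1 hw)))

/-- The equation at `u`, with the values at the neighbours eliminated by `green_remove`. -/
theorem green_equation {S : Set (Site K)} {U : Site K → Matrix (Fin W) (Fin W) ℂ}
    (hU : ∀ x, (U x).IsHermitian) {z : ℂ} (hz : 0 < z.im) {u : Site K} (hu : u ∈ S) (y : Site K) :
    (U u - z • (1 : Matrix (Fin W) (Fin W) ℂ) -
      ∑ x ∈ neighbors u, ∑ w ∈ neighbors u, green (S \ {u}) U z x w) * green S U z u y =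
    (Pi.single y 1 : Site K → Matrix (Fin W) (Fin W) ℂ) u -
      ∑ x ∈ neighbors u, green (S \ {u}) U z x y := by
  have h := (isMatrixResolvent_green S hU hz y).equation hu
  rw [Finset.sum_congr rfl fun x hx => green_remove S hU hz
    (u := u) (x := x) (fun h => not_mem_neighbors_self u (h.subst (motive := fun a => a ∈ neighbors u) hx)) y, Finset.sum_sub_distrib,
    ← Finset.sum_mul] at h
  rw [sub_mul, ← h]
  abel

/-- By the energy identity with source `v` at `y`, this imaginary part is `Im z` times a squared
norm. -/
theorem im_green_nonneg (S : Set (Site K)) {U : Site K → Matrix (Fin W) (Fin W) ℂ}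
    (hU : ∀ x, (U x).IsHermitian) {z : ℂ} (hz : 0 < z.im) (y : Site K) (v : Fin W → ℂ) :
    0 ≤ (star v ⬝ᵥ (green S U z y y *ᵥ v)).im := by
  have h := isMatrixResolvent_green S hU hz y
  have h1 := IsResolventOf.sum Finset.univ fun j _ => (h j).smul (v j)
  have h2 := IsResolventOf.energy (y := y) (v := v) hU (h1.congr fun x _ => ?_)
  · have h3 : (∑ j, v j • fun x i => green S U z x y i j) y = green S U z y y *ᵥ v := by
      ext i
      simp [mulVec, dotProduct, mul_comm]
    rw [h3] at h2
    rw [← h2]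
    exact mul_nonneg hz.le (tsum_nonneg fun x => nsq_nonneg _)
  · ext i
    rcases eq_or_ne x y with rfl | hxy
    · simp [Matrix.one_apply]
    · simp [hxy]

end MatrixResolvent


/-! ### Factorizations of Green functions on the tree, and tree automorphisms. -/

section Tree

/-- The subtree of the sites whose path to the root passes through `p`. -/
def desc (p : Site K) : Set (Site K) := {x | p <:+ x}

theorem mem_desc {p x : Site K} : x ∈ desc p ↔ p <:+ x := Iff.rfl

/-- The subtree at `i :: u` is attached to the rest of the tree by a single edge; all decouplings
below come from this. -/
theorem desc_edge {i : Fin K} {u x w : Site K} (h : w ∈ neighbors x) (hx : x ∈ desc (i :: u))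
    (hw : w ∉ desc (i :: u)) : w = u ∧ x = i :: u := by
  rw [mem_neighbors] at h
  rw [mem_desc] at hx hw
  rcases h with ⟨j, rfl⟩ | ⟨j, rfl⟩
  · exact absurd (hx.trans (List.suffix_cons j x)) hw
  · rcases List.suffix_cons_iff.1 hx with h | h
    · simp only [List.cons.injEq] at h
      exact ⟨h.2.symm, by simp [h.1, h.2]⟩
    · exact absurd h hw

theorem isClosedIn_desc {S : Set (Site K)} {i : Fin K} {u : Site K} (hu : u ∉ S) :
    IsClosedIn S (desc (i :: u)) := by
  intro x hx w hw hwS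
  by_contra hcon
  exact hu ((desc_edge hw hx.2 hcon).1 ▸ hwS)

theorem isClosedIn_compl_desc {S : Set (Site K)} {i : Fin K} {u : Site K}
    (hu : u ∉ S ∨ (i :: u) ∉ S) : IsClosedIn S (desc (i :: u))ᶜ := by
  intro x hx w hw hwS hcon
  have hw' : x ∈ neighbors w := (mem_neighbors _ _).2 (adjacent_symm.1 ((mem_neighbors _ _).1 hw))
  obtain ⟨h1, h2⟩ := desc_edge hw' hcon hx.2
  rcases hu with hu | hu
  · exact hu (h1 ▸ hx.1)
  · exact hu (h2 ▸ hwS)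

theorem mem_neighbors_cases {u w : Site K} (h : w ∈ neighbors u) :
    (∃ i, w = i :: u) ∨ (u ≠ [] ∧ w = u.tail) := by
  rcases (mem_neighbors _ _).1 h with h | ⟨i, rfl⟩
  · exact Or.inl h
  · exact Or.inr ⟨by simp, by simp⟩

theorem child_mem_neighbors (i : Fin K) (u : Site K) : i :: u ∈ neighbors u :=
  (mem_neighbors _ _).2 (Or.inl ⟨i, rfl⟩)

theorem tail_mem_neighbors {u : Site K} (h : u ≠ []) : u.tail ∈ neighbors u := by
  cases u with
  | nil => exact absurd rfl h
  | cons i t => exact (mem_neighbors _ _).2 (Or.inr ⟨i, by simp⟩)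

theorem self_mem_desc (p : Site K) : p ∈ desc p := List.suffix_refl p

theorem not_mem_desc_of_length_lt {p x : Site K} (h : x.length < p.length) : x ∉ desc p :=
  fun hx => absurd (List.IsSuffix.length_le hx) (not_le.2 h)

theorem not_mem_desc_of_mem_neighbors {u w : Site K} {i : Fin K} (h : w ∈ neighbors u)
    (hw : w ≠ i :: u) : w ∉ desc (i :: u) := by
  rcases mem_neighbors_cases h with ⟨j, rfl⟩ | ⟨_, rfl⟩
  · intro hcon
    exact hw (List.IsSuffix.eq_of_length hcon (by simp)).symm
  · exact not_mem_desc_of_length_lt (by simp)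

/-- Removing `u` puts its neighbours into different components. Hence the Schur complement on a tree
has no cross terms. -/
theorem green_neighbors_separated (S : Set (Site K)) {U : Site K → Matrix (Fin W) (Fin W) ℂ}
    (hU : ∀ x, (U x).IsHermitian) {z : ℂ} (hz : 0 < z.im) {u x w : Site K}
    (hx : x ∈ neighbors u) (hw : w ∈ neighbors u) (hxw : x ≠ w) :
    green (S \ {u}) U z x w = 0 := by
  rcases mem_neighbors_cases hx with ⟨i, rfl⟩ | ⟨h1, rfl⟩
  · exact green_separated hU hz (isClosedIn_desc (by simp)) (self_mem_desc _)
      (not_mem_desc_of_mem_neighbors hw hxw.symm)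
  · rcases mem_neighbors_cases hw with ⟨i, rfl⟩ | ⟨h1, rfl⟩
    · exact green_separated hU hz (C := (desc (i :: u))ᶜ) (isClosedIn_compl_desc (Or.inl (by simp)))
        (not_mem_desc_of_mem_neighbors hx hxw) (by simpa using self_mem_desc _)
    · exact absurd rfl hxw

/-- The sum of the self-energies at `u` of the neighbours of `u`. -/
noncomputable def selfEnergy (S : Set (Site K)) (U : Site K → Matrix (Fin W) (Fin W) ℂ) (z : ℂ)
    (u : Site K) : Matrix (Fin W) (Fin W) ℂ :=
  ∑ w ∈ neighbors u, green (S \ {u}) U z w w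

theorem sum_green_neighbors (S : Set (Site K)) {U : Site K → Matrix (Fin W) (Fin W) ℂ}
    (hU : ∀ x, (U x).IsHermitian) {z : ℂ} (hz : 0 < z.im) (u : Site K) :
    ∑ x ∈ neighbors u, ∑ w ∈ neighbors u, green (S \ {u}) U z x w = selfEnergy S U z u := by
  refine Finset.sum_congr rfl fun x hx => ?_
  rw [Finset.sum_eq_single x]
  · intro w hw hwx
    exact green_neighbors_separated S hU hz hx hw hwx.symm
  · intro h; exact absurd hx h

theorem mul_green_self {S : Set (Site K)} {U : Site K → Matrix (Fin W) (Fin W) ℂ}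
    (hU : ∀ x, (U x).IsHermitian) {z : ℂ} (hz : 0 < z.im) {u : Site K} (hu : u ∈ S) :
    (U u - z • (1 : Matrix (Fin W) (Fin W) ℂ) - selfEnergy S U z u) * green S U z u u = 1 := by
  have h := green_equation hU hz hu u
  rw [sum_green_neighbors S hU hz] at h
  rw [h, Finset.sum_eq_zero fun x _ => green_off_right hU hz x (by simp), sub_zero]
  simp

theorem green_self_mul {S : Set (Site K)} {U : Site K → Matrix (Fin W) (Fin W) ℂ}
    (hU : ∀ x, (U x).IsHermitian) {z : ℂ} (hz : 0 < z.im) {u : Site K} (hu : u ∈ S) :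
    green S U z u u * (U u - z • (1 : Matrix (Fin W) (Fin W) ℂ) - selfEnergy S U z u) = 1 :=
  mul_eq_one_comm.1 (mul_green_self hU hz hu)

theorem green_self_eq_inv {S : Set (Site K)} {U : Site K → Matrix (Fin W) (Fin W) ℂ}
    (hU : ∀ x, (U x).IsHermitian) {z : ℂ} (hz : 0 < z.im) {u : Site K} (hu : u ∈ S) :
    green S U z u u = (U u - z • (1 : Matrix (Fin W) (Fin W) ℂ) - selfEnergy S U z u)⁻¹ :=
  (Matrix.inv_eq_right_inv (mul_green_self hU hz hu)).symm

theorem green_row {S : Set (Site K)} {U : Site K → Matrix (Fin W) (Fin W) ℂ}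
    (hU : ∀ x, (U x).IsHermitian) {z : ℂ} (hz : 0 < z.im) {u y : Site K} (hu : u ∈ S)
    (hy : y ≠ u) :
    green S U z u y = -(green S U z u u * ∑ x ∈ neighbors u, green (S \ {u}) U z x y) := by
  have h := green_equation hU hz hu y
  rw [sum_green_neighbors S hU hz, Pi.single_eq_of_ne hy.symm, zero_sub] at h
  have h2 := congrArg (fun M => green S U z u u * M) h
  simpa only [← mul_assoc, green_self_mul hU hz hu, one_mul, mul_neg] using h2

/-- Once `u` is removed, its only neighbour in the component of the root is the backward one. -/
theorem sum_green_left {S : Set (Site K)} {U : Site K → Matrix (Fin W) (Fin W) ℂ}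
    (hU : ∀ x, (U x).IsHermitian) {z : ℂ} (hz : 0 < z.im) {u : Site K} (hu : u ≠ []) :
    ∑ w ∈ neighbors u, green (S \ {u}) U z [] w = green (S \ {u}) U z [] u.tail := by
  rw [Finset.sum_eq_single u.tail]
  · intro w hw hwt
    rcases mem_neighbors_cases hw with ⟨i, rfl⟩ | ⟨h1, rfl⟩
    · exact green_separated hU hz (C := (desc (i :: u))ᶜ)
        (isClosedIn_compl_desc (Or.inl (by simp)))
        (not_mem_desc_of_length_lt (by simp)) (by simpa using self_mem_desc _)
    · exact absurd rfl hwt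
  · intro h
    exact absurd (tail_mem_neighbors hu) h

theorem nil_not_mem_desc {u : Site K} (hu : u ≠ []) : ([] : Site K) ∉ desc u :=
  not_mem_desc_of_length_lt (by simpa using List.length_pos_iff.2 hu)

theorem isClosedIn_compl_desc_self {S : Set (Site K)} {u : Site K} (hu : u ∉ S) (hne : u ≠ []) :
    IsClosedIn S (desc u)ᶜ := by
  cases u with
  | nil => exact absurd rfl hne
  | cons i t => exact isClosedIn_compl_desc (Or.inr hu)

/-- The Green function between the root and the backward neighbour of the removed site `u` does
not depend on what happens beyond `u`. -/
theorem green_root_congr {S S' : Set (Site K)} {U U' : Site K → Matrix (Fin W) (Fin W) ℂ}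
    (hU : ∀ x, (U x).IsHermitian) (hU' : ∀ x, (U' x).IsHermitian) {z : ℂ} (hz : 0 < z.im)
    {u : Site K} (hu : u ≠ []) (huS : u ∉ S) (huS' : u ∉ S')
    (hS : S ∩ (desc u)ᶜ = S' ∩ (desc u)ᶜ) (h : ∀ x ∉ desc u, U x = U' x)
    (x : Site K) (hx : x ∉ desc u) (y : Site K) : green S U z x y = green S' U' z x y :=
  green_congr hU hU' hz (isClosedIn_compl_desc_self huS hu)
    (isClosedIn_compl_desc_self huS' hu) hS (fun x hx => h x hx.2) hx y

theorem fullGreen_factor {U : Site K → Matrix (Fin W) (Fin W) ℂ}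
    (hU : ∀ x, (U x).IsHermitian) {z : ℂ} (hz : 0 < z.im) {x : Site K} (hx : x ≠ []) :
    green Set.univ U z [] x = -(green {x}ᶜ U z [] x.tail * green Set.univ U z x x) := by
  rw [green_remove Set.univ hU hz hx.symm, green_off_right hU hz _ (by simp), zero_sub,
    sum_green_left hU hz hx, Set.compl_eq_univ_sdiff]

theorem cutGreen_extend {U : Site K → Matrix (Fin W) (Fin W) ℂ}
    (hU : ∀ x, (U x).IsHermitian) {z : ℂ} (hz : 0 < z.im) {u : Site K} (hu : u ≠ []) (i : Fin K) :
    green {i :: u}ᶜ U z [] u = -(green {u}ᶜ U z [] u.tail * green {i :: u}ᶜ U z u u) := by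
  rw [green_remove {i :: u}ᶜ hU hz hu.symm, green_off_right hU hz _ (by simp), zero_sub,
    sum_green_left hU hz hu]
  congr 2
  refine green_root_congr hU hU hz hu (by simp) (by simp) ?_ (fun _ _ => rfl) _
    (nil_not_mem_desc hu) _
  ext w
  simp only [Set.mem_inter_iff, Set.mem_sdiff, Set.mem_compl_iff, Set.mem_singleton_iff]
  constructor
  · rintro ⟨⟨_, h⟩, h'⟩; exact ⟨h, h'⟩
  · rintro ⟨h, h'⟩
    refine ⟨⟨?_, h⟩, h'⟩
    rintro rfl
    exact h' (List.suffix_cons i u)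

theorem adjacent_append (p a b : Site K) : Adjacent (a ++ p) (b ++ p) ↔ Adjacent a b := by
  simp only [Adjacent, ← List.cons_append, List.append_left_inj]

theorem range_append (p : Site K) : Set.range (fun w : Site K => w ++ p) = desc p := by
  ext x
  simp [desc, List.IsSuffix]

/-- The Green function of the subtree beyond a removed site is that of a shifted tree. -/
theorem green_append {S : Set (Site K)} {U : Site K → Matrix (Fin W) (Fin W) ℂ}
    (hU : ∀ x, (U x).IsHermitian) {z : ℂ} (hz : 0 < z.im) {u : Site K} (hu : u ∉ S) (i : Fin K)
    (a b : Site K) :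
    green S U z (a ++ i :: u) (b ++ i :: u) =
      green ((fun w => w ++ i :: u) ⁻¹' S) (fun w => U (w ++ i :: u)) z a b := by
  refine green_comp_embedding (f := fun w => w ++ i :: u) hU hz
    (fun a b h => by simpa using h) (adjacent_append _) ?_ a b
  intro a ha w hw hwS
  rw [range_append]
  exact isClosedIn_desc hu _ ⟨ha, List.suffix_append _ _⟩ w hw hwS

theorem green_child {S : Set (Site K)} {U : Site K → Matrix (Fin W) (Fin W) ℂ}
    (hU : ∀ x, (U x).IsHermitian) {z : ℂ} (hz : 0 < z.im) {u : Site K} (hu : u ∉ S) (i : Fin K)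
    (hS : desc (i :: u) ⊆ S) :
    green S U z (i :: u) (i :: u) = green Set.univ (fun w => U (w ++ i :: u)) z [] [] := by
  have h := green_append hU hz hu i [] []
  have h1 : (fun w => w ++ i :: u) ⁻¹' S = Set.univ := by
    ext w
    simpa using hS (List.suffix_append w (i :: u))
  rwa [h1] at h

/-- Every path from the root to the end passes through `u`. The outer factors depend on disjoint
sets of sites, neither containing `u`; only the middle one sees the potential at `u`. This is the
source of almost additivity of the logarithms. -/
theorem cutGreen_split {U : Site K → Matrix (Fin W) (Fin W) ℂ}
    (hU : ∀ x, (U x).IsHermitian) {z : ℂ} (hz : 0 < z.im) {u w : Site K} (hu : u ≠ [])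
    (hw : w ≠ []) (i : Fin K) :
    green {w ++ i :: u}ᶜ U z [] (w ++ i :: u).tail =
      green {u}ᶜ U z [] u.tail * green {w ++ i :: u}ᶜ U z u u *
        green {w}ᶜ (fun v => U (v ++ i :: u)) z [] w.tail := by
  set x := w ++ i :: u with hx
  have hux : u ≠ x := by
    intro h
    have := congrArg List.length h
    simp [hx] at this
    omega
  have hxd : x ∈ desc u := (List.suffix_cons i u).trans (List.suffix_append w _)
  have htail : x.tail = w.tail ++ i :: u := by
    rw [hx, List.tail_append_of_ne_nil hw]
  have htd : x.tail ∈ desc (i :: u) := by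
    rw [htail]; exact List.suffix_append _ _
  have htu : x.tail ≠ u := by
    rw [htail]
    intro h
    have := congrArg List.length h
    simp at this
    omega
  have hn : ([] : Site K) ∉ desc (i :: u) := nil_not_mem_desc (by simp)
  have hCc : IsClosedIn ({x}ᶜ \ {u}) (desc (i :: u))ᶜ := isClosedIn_compl_desc (Or.inl (by simp))
  rw [green_remove {x}ᶜ hU hz hu.symm, green_separated hU hz hCc hn (by simpa using htd), zero_sub,
    sum_green_left hU hz hu, green_row hU hz (S := {x}ᶜ) (by simpa using hux) htu,
    Finset.sum_eq_single (i :: u)]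
  · have h1 : green ({x}ᶜ \ {u}) U z [] u.tail = green {u}ᶜ U z [] u.tail := by
      refine green_root_congr hU hU hz hu (by simp) (by simp) ?_ (fun _ _ => rfl) _
        (nil_not_mem_desc hu) _
      ext v
      simp only [Set.mem_inter_iff, Set.mem_sdiff, Set.mem_compl_iff, Set.mem_singleton_iff]
      constructor
      · rintro ⟨⟨_, h⟩, h'⟩; exact ⟨h, h'⟩
      · rintro ⟨h, h'⟩
        exact ⟨⟨fun h2 => h' (h2 ▸ hxd), h⟩, h'⟩
    have h2 : green ({x}ᶜ \ {u}) U z (i :: u) x.tail =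
        green {w}ᶜ (fun v => U (v ++ i :: u)) z [] w.tail := by
      have h := green_append hU hz (S := {x}ᶜ \ {u}) (u := u) (by simp) i [] w.tail
      have h3 : (fun w => w ++ i :: u) ⁻¹' ({x}ᶜ \ {u}) = {w}ᶜ := by
        ext v
        have h4 : v ++ i :: u ≠ u := by
          intro h
          have := congrArg List.length h
          simp at this
          omega
        simp [hx, h4]
      rw [htail]
      rwa [h3] at h
    rw [h1, h2]
    simp [mul_assoc]
  · intro v hv hvi
    exact green_separated hU hz hCc (not_mem_desc_of_mem_neighbors hv hvi) (by simpa using htd)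
  · intro h
    exact absurd (child_mem_neighbors i u) h

/-- The automorphism of the tree that permutes the forward neighbours of all sites of the sphere
of radius `n` by `π n`. -/
def levelMap (π : ℕ → Equiv.Perm (Fin K)) : Site K → Site K
  | [] => []
  | i :: w => π w.length i :: levelMap π w

theorem levelMap_injective (π : ℕ → Equiv.Perm (Fin K)) : Function.Injective (levelMap π) := by
  intro a
  induction a with
  | nil =>
    intro b h
    cases b with
    | nil => rfl
    | cons j b => simp [levelMap] at h
  | cons i a ih =>
    intro b h
    cases b with
    | nil => simp [levelMap] at h
    | cons j b =>
      simp only [levelMap, List.cons.injEq] at h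
      obtain rfl := ih h.2
      simpa using h.1

theorem levelMap_surjective (π : ℕ → Equiv.Perm (Fin K)) : Function.Surjective (levelMap π) := by
  intro b
  induction b with
  | nil => exact ⟨[], rfl⟩
  | cons j b ih =>
    obtain ⟨a, rfl⟩ := ih
    exact ⟨(π a.length).symm j :: a, by simp [levelMap]⟩

theorem adjacent_levelMap (π : ℕ → Equiv.Perm (Fin K)) (a b : Site K) :
    Adjacent (levelMap π a) (levelMap π b) ↔ Adjacent a b := by
  have key : ∀ a b : Site K, (∃ i, levelMap π b = i :: levelMap π a) ↔ ∃ i, b = i :: a := by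
    intro a b
    constructor
    · rintro ⟨i, h⟩
      refine ⟨(π a.length).symm i, levelMap_injective π ?_⟩
      rw [h]; simp [levelMap]
    · rintro ⟨i, rfl⟩
      exact ⟨_, rfl⟩
  simp only [Adjacent, key]

theorem tail_levelMap (π : ℕ → Equiv.Perm (Fin K)) (w : Site K) :
    (levelMap π w).tail = levelMap π w.tail := by
  cases w <;> rfl

theorem green_levelMap (S : Set (Site K)) {U : Site K → Matrix (Fin W) (Fin W) ℂ}
    (hU : ∀ x, (U x).IsHermitian) {z : ℂ} (hz : 0 < z.im) (π : ℕ → Equiv.Perm (Fin K))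
    (a b : Site K) :
    green S U z (levelMap π a) (levelMap π b) =
      green (levelMap π ⁻¹' S) (fun w => U (levelMap π w)) z a b :=
  green_comp_embedding hU hz (levelMap_injective π) (adjacent_levelMap π)
    (fun _ _ w _ _ => levelMap_surjective π w) a b

theorem levelMap_replicate (π : ℕ → Equiv.Perm (Fin K)) (b : ℕ → Site K) (o : Fin K)
    (h0 : b 0 = []) (hb : ∀ n, b (n + 1) = π n o :: b n) (n : ℕ) :
    levelMap π (List.replicate n o) = b n := by
  induction n with
  | zero => simp [levelMap, h0]
  | succ n ih => simp [List.replicate_succ, levelMap, ih, hb]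

/-- Some automorphism of the tree takes a given branch to another one. -/
theorem exists_levelMap_branch (b : ℕ → Site K) (o : Fin K) (h0 : b 0 = [])
    (hb : ∀ n, ∃ i, b (n + 1) = i :: b n) :
    ∃ π : ℕ → Equiv.Perm (Fin K), ∀ n, levelMap π (List.replicate n o) = b n := by
  choose i hi using hb
  refine ⟨fun n => Equiv.swap o (i n), levelMap_replicate _ b o h0 fun n => ?_⟩
  simp [hi]

theorem exists_levelMap_site (x : Site K) (o : Fin K) :
    ∃ π : ℕ → Equiv.Perm (Fin K), levelMap π (List.replicate x.length o) = x := by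
  induction x with
  | nil => exact ⟨fun _ => 1, rfl⟩
  | cons i x ih =>
    obtain ⟨π, hπ⟩ := ih
    refine ⟨fun n => if n = x.length then Equiv.swap o i else π n, ?_⟩
    have h : ∀ m ≤ x.length, levelMap (fun n => if n = x.length then Equiv.swap o i else π n)
        (List.replicate m o) = levelMap π (List.replicate m o) := by
      intro m hm
      induction m with
      | zero => rfl
      | succ m ihm =>
        simp only [List.replicate_succ, levelMap, List.length_replicate]
        rw [ihm (by omega), if_neg (by omega)]
    simp [List.replicate_succ, levelMap, h _ le_rfl, hπ]

end Tree


/-! ### The law of the potential: relabelling, resampling, independence. -/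

section Law

instance instIsProbabilityMeasureLaw (K W : ℕ) : IsProbabilityMeasure (law K W) := by
  unfold law; infer_instance

theorem measurePreserving_comp {f : Site K → Site K} (hf : Function.Injective f) :
    MeasurePreserving (fun V : Config K W => fun x => V (f x)) (law K W) (law K W) := by
  classical
  have hm : Measurable (fun V : Config K W => fun x => V (f x)) :=
    measurable_pi_lambda _ fun x => measurable_pi_apply _
  refine ⟨hm, ?_⟩
  refine Measure.eq_infinitePi _ fun s t ht => ?_
  rw [Measure.map_apply hm (MeasurableSet.pi s.countable_toSet fun i _ => ht i)]
  have h1 : (fun V : Config K W => fun x => V (f x)) ⁻¹' (Set.pi (s : Set (Site K)) t) =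
      Set.pi ((s.image f : Finset (Site K)) : Set (Site K))
        (Function.extend f t fun _ => Set.univ) := by
    ext V
    simp [hf.extend_apply]
  rw [h1, law, Measure.infinitePi_pi]
  · rw [Finset.prod_image fun a _ b _ h => hf h]
    simp [hf.extend_apply]
  · intro i hi
    obtain ⟨x, _, rfl⟩ := Finset.mem_image.1 hi
    rw [hf.extend_apply]
    exact ht x

open Classical in
/-- Resampling the potential on the set `T`. -/
noncomputable def resample (T : Set (Site K)) (p : Config K W × Config K W) : Config K W :=
  fun x => if x ∈ T then p.2 x else p.1 x

theorem measurable_resample (T : Set (Site K)) : Measurable (resample (W := W) T) := by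
  classical
  refine measurable_pi_lambda _ fun x => ?_
  unfold resample
  by_cases hx : x ∈ T
  · simp only [hx, if_true]; fun_prop
  · simp only [hx, if_false]; fun_prop

/-- On a cylinder set the constraints at sites of `T` fall on the second copy and the others on the
first, and the product of the masses is unchanged. -/
theorem measurePreserving_resample (T : Set (Site K)) :
    MeasurePreserving (resample (W := W) T) ((law K W).prod (law K W)) (law K W) := by
  classical
  refine ⟨measurable_resample T, ?_⟩
  refine Measure.eq_infinitePi _ fun s t ht => ?_
  rw [Measure.map_apply (measurable_resample T)
    (MeasurableSet.pi s.countable_toSet fun i _ => ht i)]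
  have h1 : resample T ⁻¹' (Set.pi (s : Set (Site K)) t) =
      (Set.pi ((s.filter fun x => x ∉ T : Finset (Site K)) : Set (Site K)) t) ×ˢ
        (Set.pi ((s.filter fun x => x ∈ T : Finset (Site K)) : Set (Site K)) t) := by
    ext p
    simp only [Set.mem_preimage, Set.mem_pi, Set.mem_prod, resample, Finset.mem_coe,
      Finset.mem_filter]
    constructor
    · intro h
      refine ⟨fun x hx => ?_, fun x hx => ?_⟩
      · have := h x hx.1
        rwa [if_neg hx.2] at this
      · have := h x hx.1
        rwa [if_pos hx.2] at this
    · rintro ⟨h1, h2⟩ x hx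
      by_cases hT : x ∈ T
      · rw [if_pos hT]; exact h2 x ⟨hx, hT⟩
      · rw [if_neg hT]; exact h1 x ⟨hx, hT⟩
  rw [h1, Measure.prod_prod, law, Measure.infinitePi_pi _ fun i _ => ht i,
    Measure.infinitePi_pi _ fun i _ => ht i, mul_comm,
    Finset.prod_filter_mul_prod_filter_not]

theorem lintegral_resample (T : Set (Site K)) {F : Config K W → ENNReal} (hF : Measurable F) :
    ∫⁻ V, F V ∂(law K W) = ∫⁻ V, ∫⁻ V', F (resample T (V, V')) ∂(law K W) ∂(law K W) := by
  rw [← (measurePreserving_resample T).lintegral_comp hF, lintegral_prod]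
  exact (hF.comp (measurable_resample T)).aemeasurable

theorem lintegral_resample_site (u : Site K) {F : Config K W → ENNReal} (hF : Measurable F) :
    ∫⁻ V, F V ∂(law K W) =
      ∫⁻ V, ∫⁻ v, F (Function.update V u v) ∂(goe W) ∂(law K W) := by
  classical
  rw [lintegral_resample {u} hF]
  refine lintegral_congr fun V => ?_
  have h1 : ∀ V' : Config K W, resample {u} (V, V') = Function.update V u (V' u) := by
    intro V'
    ext1 x
    by_cases hx : x = u
    · subst hx; simp [resample]
    · simp [resample, hx]
  simp only [h1]
  exact (measurePreserving_eval_infinitePi (fun _ : Site K => goe W) u).lintegral_comp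
    (hF.comp (measurable_update V))

/-- Functions of the potential on disjoint sets of sites are independent. -/
theorem indepFun_of_disjoint (T : Set (Site K)) {f g : Config K W → ℝ} (hf : Measurable f)
    (hg : Measurable g) (hfT : ∀ V V' : Config K W, (∀ x ∉ T, V x = V' x) → f V = f V')
    (hgT : ∀ V V' : Config K W, (∀ x ∈ T, V x = V' x) → g V = g V') :
    IndepFun f g (law K W) := by
  rw [indepFun_iff_measure_inter_preimage_eq_mul]
  intro s t hs ht
  have h1 := (measurePreserving_resample (W := W) T).measure_preimage
    ((hf hs).inter (hg ht)).nullMeasurableSet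
  rw [← h1]
  have h2 : resample T ⁻¹' (f ⁻¹' s ∩ g ⁻¹' t) = (f ⁻¹' s) ×ˢ (g ⁻¹' t) := by
    ext p
    have e1 : f (resample T p) = f p.1 := hfT _ _ fun x hx => by simp [resample, hx]
    have e2 : g (resample T p) = g p.2 := hgT _ _ fun x hx => by simp [resample, hx]
    simp [e1, e2]
  rw [h2, Measure.prod_prod]

/-- A configuration is an arbitrary family of real matrices, so the potential is Hermitian only off
a null set. -/
theorem ae_symm_goe (W : ℕ) : ∀ᵐ v ∂(goe W), ∀ i j, v i j = v j i := by
  have hm : MeasurableSet {v : Fin W → Fin W → ℝ | ∀ i j, v i j = v j i} := by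
    simp only [Set.ofPred_forall]
    refine MeasurableSet.iInter fun i => MeasurableSet.iInter fun j =>
      measurableSet_eq_fun ?_ ?_ <;> fun_prop
  rw [goe, ae_map_iff (measurable_symmetrize W).aemeasurable hm]
  refine ae_of_all _ fun X i j => ?_
  simp [symmetrize, add_comm]

theorem ae_symm_law (K W : ℕ) : ∀ᵐ V ∂(law K W), ∀ x i j, V x i j = V x j i := by
  rw [ae_all_iff]
  intro x
  exact (measurePreserving_eval_infinitePi (fun _ : Site K => goe W) x).quasiMeasurePreserving.ae
    (ae_symm_goe W)

end Law


/-! ### Domination of shifted Gaussian matrices by Gaussians of larger variance. -/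

section Domination

open scoped NNReal ENNReal

/-- Doubling the variance absorbs a bounded shift: the difference of the exponents is `((x - 2 t) ^
2 + 2 (T ^ 2 - t ^ 2)) / (4 v)`. -/
theorem gaussianPDFReal_le {t T : ℝ} (ht : |t| ≤ T) {v : ℝ≥0} (hv : v ≠ 0) (x : ℝ) :
    gaussianPDFReal t v x ≤
      (Real.sqrt 2 * Real.exp (T ^ 2 / (2 * v))) * gaussianPDFReal 0 (2 * v) x := by
  have hv' : (0 : ℝ) < v := by positivity
  have h1 : -(x - t) ^ 2 / (2 * v) ≤ T ^ 2 / (2 * v) + -(x - 0) ^ 2 / (2 * (2 * v)) := by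
    have : T ^ 2 / (2 * v) + -(x - 0) ^ 2 / (2 * (2 * v)) - -(x - t) ^ 2 / (2 * v) =
      (2 * T ^ 2 - x ^ 2 + 2 * (x - t) ^ 2) / (4 * (v : ℝ)) := by
      field_simp; ring
    rw [← sub_nonneg, this]
    have h2 : t ^ 2 ≤ T ^ 2 := sq_le_sq' (by linarith [abs_le.1 ht]) (abs_le.1 ht).2
    apply div_nonneg _ (by positivity)
    nlinarith [sq_nonneg (x - 2 * t)]
  have h2 : (Real.sqrt (2 * Real.pi * v))⁻¹ =
      Real.sqrt 2 * (Real.sqrt (2 * Real.pi * ((2 * v : ℝ≥0) : ℝ)))⁻¹ := by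
    have : 2 * Real.pi * ((2 * v : ℝ≥0) : ℝ) = 2 * (2 * Real.pi * v) := by push_cast; ring
    rw [this, Real.sqrt_mul (by norm_num) (2 * Real.pi * (v : ℝ)), mul_inv, ← mul_assoc,
      mul_inv_cancel₀ (by positivity), one_mul]
  simp only [gaussianPDFReal]
  calc (Real.sqrt (2 * Real.pi * v))⁻¹ * Real.exp (-(x - t) ^ 2 / (2 * v))
      ≤ (Real.sqrt (2 * Real.pi * v))⁻¹ *
        Real.exp (T ^ 2 / (2 * v) + -(x - 0) ^ 2 / (2 * (2 * v))) := by gcongr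
    _ = _ := by
      rw [Real.exp_add, h2]
      push_cast
      ring

theorem gaussianReal_le_smul (T : ℝ) {v : ℝ≥0} (hv : v ≠ 0) :
    ∃ C : ℝ≥0∞, C ≠ 0 ∧ C ≠ ∞ ∧ ∀ t : ℝ, |t| ≤ T →
      gaussianReal t v ≤ C • gaussianReal 0 (2 * v) := by
  refine ⟨ENNReal.ofReal (Real.sqrt 2 * Real.exp (T ^ 2 / (2 * v))), ?_, ENNReal.ofReal_ne_top,
    fun t ht => ?_⟩
  · simp only [ne_eq, ENNReal.ofReal_eq_zero, not_le]; positivity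
  · rw [gaussianReal_of_var_ne_zero _ hv, gaussianReal_of_var_ne_zero _ (by simpa using hv),
      ← withDensity_smul _ (measurable_gaussianPDF _ _)]
    refine withDensity_mono (ae_of_all _ fun x => ?_)
    simp only [gaussianPDF, Pi.smul_apply, smul_eq_mul]
    rw [← ENNReal.ofReal_mul (by positivity)]
    exact ENNReal.ofReal_le_ofReal (gaussianPDFReal_le ht hv x)

/-- The product outer measure is the largest one below the product values on boxes, so a bound on
boxes is a bound on all measurable sets. Division by the constant is why it must be nonzero and
finite. -/
theorem measure_pi_le_smul {ι : Type*} [Fintype ι] {α : Type*} [MeasurableSpace α]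
    (μ ν : ι → Measure α) [∀ i, SigmaFinite (μ i)] {C : ℝ≥0∞} (h0 : C ≠ 0) (hC : C ≠ ∞)
    (h : ∀ i, μ i ≤ C • ν i) :
    Measure.pi μ ≤ C ^ Fintype.card ι • Measure.pi ν := by
  have hn0 : C ^ Fintype.card ι ≠ 0 := pow_ne_zero _ h0
  have hnt : C ^ Fintype.card ι ≠ ∞ := ENNReal.pow_ne_top hC
  have h1 : ((C ^ Fintype.card ι)⁻¹ • Measure.pi μ).toOuterMeasure ≤
      OuterMeasure.pi fun i => (ν i).toOuterMeasure := by
    rw [OuterMeasure.le_pi]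
    intro s _
    simp only [Measure.coe_toOuterMeasure, Measure.smul_apply, Measure.pi_pi, smul_eq_mul]
    rw [mul_comm, ← div_eq_mul_inv]
    refine ENNReal.div_le_of_le_mul ?_
    calc ∏ i, μ i (s i) ≤ ∏ i, C * ν i (s i) := by
          refine Finset.prod_le_prod' fun i _ => ?_
          simpa using h i (s i)
      _ = _ := by rw [Finset.prod_mul_distrib, Finset.prod_const, mul_comm, Finset.card_univ]
  rw [Measure.le_iff]
  intro s hs
  have h2 := h1 s
  rw [Measure.coe_toOuterMeasure, Measure.smul_apply, smul_eq_mul] at h2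
  rw [Measure.smul_apply, smul_eq_mul, Measure.pi_def ν, toMeasure_apply _ _ hs, mul_comm]
  rw [mul_comm, ← div_eq_mul_inv] at h2
  exact (ENNReal.div_le_iff hn0 hnt).1 h2

/-- The law of a `W × W` matrix with independent centered Gaussian entries of variance `v`. -/
noncomputable def gaussMat (W : ℕ) (v : ℝ≥0) : Measure (Fin W → Fin W → ℝ) :=
  Measure.pi fun _ : Fin W => Measure.pi fun _ : Fin W => gaussianReal 0 v

instance (v : ℝ≥0) : IsProbabilityMeasure (gaussMat W v) := by unfold gaussMat; infer_instance

theorem gaussMat_map_add_le (T : ℝ) {v : ℝ≥0} (hv : v ≠ 0) :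
    ∃ C : ℝ≥0∞, C ≠ 0 ∧ C ≠ ∞ ∧ ∀ θ : Fin W → Fin W → ℝ, (∀ i j, |θ i j| ≤ T) →
      (gaussMat W v).map (fun X => X + θ) ≤ C • gaussMat W (2 * v) := by
  obtain ⟨C, h0, hC, h⟩ := gaussianReal_le_smul T hv
  refine ⟨(C ^ W) ^ W, pow_ne_zero _ (pow_ne_zero _ h0),
    ENNReal.pow_ne_top (ENNReal.pow_ne_top hC), fun θ hθ => ?_⟩
  have h1 : ∀ i j, (gaussianReal 0 v).map (fun x => x + θ i j) ≤ C • gaussianReal 0 (2 * v) := by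
    intro i j
    rw [gaussianReal_map_add_const]
    exact h _ (by simpa using hθ i j)
  have h2 : ∀ i, (Measure.pi fun _ : Fin W => gaussianReal 0 v).map (fun x => x + θ i) ≤
      C ^ W • Measure.pi fun _ : Fin W => gaussianReal 0 (2 * v) := by
    intro i
    have hsig : ∀ j, SigmaFinite ((gaussianReal 0 v).map (fun x => x + θ i j)) := fun j => by
      rw [gaussianReal_map_add_const]; infer_instance
    have := measure_pi_le_smul (fun j => (gaussianReal 0 v).map (fun x => x + θ i j))
      (fun _ => gaussianReal 0 (2 * v)) h0 hC (h1 i)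
    rw [← Measure.pi_map_pi fun j => by fun_prop, Fintype.card_fin] at this
    exact this
  have hprob : ∀ i, IsProbabilityMeasure
      ((Measure.pi fun _ : Fin W => gaussianReal 0 v).map (fun x => x + θ i)) := fun i =>
    Measure.isProbabilityMeasure_map (by fun_prop)
  have := measure_pi_le_smul
    (fun i => (Measure.pi fun _ : Fin W => gaussianReal 0 v).map (fun x => x + θ i))
    (fun _ => Measure.pi fun _ : Fin W => gaussianReal 0 (2 * v)) (pow_ne_zero _ h0)
    (ENNReal.pow_ne_top hC) h2
  rw [← Measure.pi_map_pi fun i => by fun_prop, Fintype.card_fin] at this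
  exact this

/-- The symmetrized Gaussian matrix as a complex matrix. -/
noncomputable def symMat (X : Fin W → Fin W → ℝ) : Matrix (Fin W) (Fin W) ℂ :=
  Matrix.of fun i j => ((symmetrize X i j : ℝ) : ℂ)

/-- The shift of `X` that shifts the symmetrized matrix by `s S`. -/
noncomputable def shiftMat (S : Fin W → Fin W → ℝ) (s : ℝ) (X : Fin W → Fin W → ℝ) :
    Fin W → Fin W → ℝ :=
  X + fun i j => s * (S i j / Real.sqrt 2)

/-- Symmetrization sends `S / √2` to `S` for symmetric `S`, whence the factor in `shiftMat`. -/
theorem symMat_shiftMat {S : Fin W → Fin W → ℝ} (hS : ∀ i j, S i j = S j i) (s : ℝ)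
    (X : Fin W → Fin W → ℝ) :
    symMat (shiftMat S s X) =
      symMat X + (s : ℂ) • (Matrix.of fun i j => (S i j : ℂ) : Matrix (Fin W) (Fin W) ℂ) := by
  ext i j
  have h2 : Real.sqrt 2 * Real.sqrt 2 = 2 := Real.mul_self_sqrt (by norm_num)
  have h3 : Real.sqrt 2 ≠ 0 := by positivity
  have : symmetrize (shiftMat S s X) i j = symmetrize X i j + s * S i j := by
    simp only [symmetrize, shiftMat, Pi.add_apply]
    rw [hS j i]
    field_simp
    linear_combination (-(s * S i j)) * h2
  simp [symMat, this]

theorem measurable_shiftMat (S : Fin W → Fin W → ℝ) :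
    Measurable fun p : ℝ × (Fin W → Fin W → ℝ) => shiftMat S p.1 p.2 := by
  unfold shiftMat
  refine measurable_pi_lambda _ fun i => measurable_pi_lambda _ fun j => ?_
  simp only [Pi.add_apply]
  fun_prop

/-- Comparison of the law of a shifted Gaussian matrix with a Gaussian matrix of larger
variance. -/
theorem lintegral_shift_le (T : ℝ) {v : ℝ≥0} (hv : v ≠ 0) :
    ∃ C : ℝ≥0∞, C ≠ 0 ∧ C ≠ ∞ ∧ ∀ S : Fin W → Fin W → ℝ, (∀ i j, |S i j| ≤ 1) →
      ∀ s : ℝ, |s| ≤ T → ∀ h : (Fin W → Fin W → ℝ) → ℝ≥0∞, Measurable h →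
        ∫⁻ X, h (shiftMat S s X) ∂(gaussMat W v) ≤ C * ∫⁻ X, h X ∂(gaussMat W (2 * v)) := by
  obtain ⟨C, h0, hC, hle⟩ := gaussMat_map_add_le (W := W) T hv
  refine ⟨C, h0, hC, fun S hS s hs h hm => ?_⟩
  have h2 : (1 : ℝ) ≤ Real.sqrt 2 := Real.one_le_sqrt.2 (by norm_num)
  have := hle (fun i j => s * (S i j / Real.sqrt 2)) fun i j => by
    rw [abs_mul, abs_div, abs_of_nonneg (Real.sqrt_nonneg 2)]
    have : |S i j| / Real.sqrt 2 ≤ 1 := by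
      rw [div_le_one (by positivity)]; exact (hS i j).trans h2
    calc |s| * (|S i j| / Real.sqrt 2) ≤ |s| * 1 := by gcongr
      _ ≤ T := by simpa using hs
  calc ∫⁻ X, h (shiftMat S s X) ∂(gaussMat W v)
      = ∫⁻ X, h X ∂((gaussMat W v).map fun X => X + fun i j => s * (S i j / Real.sqrt 2)) := by
        rw [lintegral_map hm (by fun_prop)]; rfl
    _ ≤ ∫⁻ X, h X ∂(C • gaussMat W (2 * v)) := lintegral_mono' this le_rfl
    _ = _ := by rw [lintegral_smul_measure, smul_eq_mul]

theorem shiftMat_neg (S : Fin W → Fin W → ℝ) (s : ℝ) (X : Fin W → Fin W → ℝ) :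
    shiftMat S s (shiftMat S (-s) X) = X := by
  ext i j
  simp [shiftMat]

/-- A Gaussian average is dominated by averages over shifts in a given direction. -/
theorem lintegral_le_average {v : ℝ≥0} (hv : v ≠ 0) :
    ∃ C : ℝ≥0∞, C ≠ ∞ ∧ ∀ S : Fin W → Fin W → ℝ, (∀ i j, |S i j| ≤ 1) →
      ∀ h : (Fin W → Fin W → ℝ) → ℝ≥0∞, Measurable h →
        ∫⁻ X, h X ∂(gaussMat W v) ≤
          C * ∫⁻ X, (∫⁻ s in Set.Icc (0 : ℝ) 1, h (shiftMat S s X)) ∂(gaussMat W (2 * v)) := by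
  obtain ⟨C, h0, hC, hle⟩ := lintegral_shift_le (W := W) 1 hv
  refine ⟨C, hC, fun S hS h hm => ?_⟩
  have hm2 : Measurable fun p : ℝ × (Fin W → Fin W → ℝ) => h (shiftMat S p.1 p.2) :=
    hm.comp (measurable_shiftMat S)
  -- Apply the comparison with shift `-s` to the function already shifted by `s`, then average over
  -- `s`.
  have h1 : ∀ s ∈ Set.Icc (0 : ℝ) 1, ∫⁻ X, h X ∂(gaussMat W v) ≤
      C * ∫⁻ X, h (shiftMat S s X) ∂(gaussMat W (2 * v)) := by
    intro s hs
    have := hle S hS (-s) (by rw [abs_neg, abs_of_nonneg hs.1]; exact hs.2)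
      (fun X => h (shiftMat S s X)) (hm2.comp (by fun_prop : Measurable fun X => (s, X)))
    simpa only [shiftMat_neg] using this
  calc ∫⁻ X, h X ∂(gaussMat W v)
      = ∫⁻ s in Set.Icc (0 : ℝ) 1, ∫⁻ X, h X ∂(gaussMat W v) := by simp
    _ ≤ ∫⁻ s in Set.Icc (0 : ℝ) 1, C * ∫⁻ X, h (shiftMat S s X) ∂(gaussMat W (2 * v)) :=
        setLIntegral_mono' measurableSet_Icc h1
    _ = C * ∫⁻ s in Set.Icc (0 : ℝ) 1, ∫⁻ X, h (shiftMat S s X) ∂(gaussMat W (2 * v)) := by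
        rw [lintegral_const_mul' _ _ hC]
    _ = _ := by
        rw [lintegral_lintegral_swap hm2.aemeasurable]

theorem lintegral_sq_gaussMat_lt_top (v : ℝ≥0) (i j : Fin W) :
    ∫⁻ X, ENNReal.ofReal (X i j ^ 2) ∂(gaussMat W v) < ∞ := by
  have h1 : MeasurePreserving (fun X : Fin W → Fin W → ℝ => X i j) (gaussMat W v)
      (gaussianReal 0 v) :=
    (measurePreserving_eval (fun _ : Fin W => gaussianReal 0 v) j).comp
      (measurePreserving_eval (fun _ : Fin W => Measure.pi fun _ : Fin W => gaussianReal 0 v) i)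
  rw [h1.lintegral_comp (f := fun x => ENNReal.ofReal (x ^ 2)) (by fun_prop)]
  have h2 : MemLp (id : ℝ → ℝ) 2 (gaussianReal 0 v) := memLp_id_gaussianReal 2
  have h3 := h2.integrable_sq
  have h4 := h3.lintegral_lt_top
  simpa using h4

theorem goe_eq_map (W : ℕ) : goe W = (gaussMat W 1).map symmetrize := rfl

end Domination

/-! ### Integrability of the squared logarithm. -/

section LogIntegral

open scoped NNReal ENNReal
open Real (posLog)

/-- The square of the negative part of the logarithm. -/
noncomputable def logSq (x : ℝ) : ℝ := (posLog x⁻¹) ^ 2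

theorem measurable_logSq : Measurable logSq := by
  unfold logSq
  exact (Real.continuous_posLog.measurable.comp measurable_inv).pow_const 2

/-- The logarithm is compared with the power `1 / 4`, whose square is still integrable at zero. -/
theorem logSq_le_rpow {x : ℝ} (hx : 0 < x) : logSq x ≤ 16 * x ^ (-(1 / 2) : ℝ) := by
  have h1 : posLog x⁻¹ ≤ 4 * (x⁻¹) ^ (1 / 4 : ℝ) := by
    rw [Real.posLog_apply]
    refine max_le (by positivity) ?_
    have := Real.log_le_rpow_div (x := x⁻¹) (by positivity) (ε := 1 / 4) (by norm_num)
    linarith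
  have h2 : (x⁻¹ ^ (1 / 4 : ℝ)) ^ 2 = x ^ (-(1 / 2) : ℝ) := by
    rw [← Real.rpow_natCast, ← Real.rpow_mul (by positivity), Real.inv_rpow hx.le,
      ← Real.rpow_neg hx.le]
    norm_num
  calc logSq x ≤ (4 * (x⁻¹) ^ (1 / 4 : ℝ)) ^ 2 :=
        pow_le_pow_left₀ Real.posLog_nonneg h1 2
    _ = _ := by rw [mul_pow, h2]; norm_num

theorem lintegral_logSq_lt_top : ∫⁻ u : ℝ, ENNReal.ofReal (logSq |u|) < ∞ := by
  have h0 : ∀ u : ℝ, 1 < |u| → logSq |u| = 0 := by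
    intro u hu
    have : posLog |u|⁻¹ = 0 := by
      rw [Real.posLog_eq_zero_iff, abs_inv, abs_abs]
      exact inv_le_one_of_one_le₀ hu.le
    simp [logSq, this]
  have h1 : ∫⁻ u in Set.Ioi (0 : ℝ), ENNReal.ofReal (logSq |u|) < ∞ := by
    have hint : IntegrableOn (fun x : ℝ => 16 * x ^ (-(1 / 2) : ℝ)) (Set.Ioc 0 1) :=
      ((intervalIntegral.intervalIntegrable_rpow' (a := 0) (b := 1)
        (by norm_num : (-1 : ℝ) < -(1 / 2))).1).const_mul 16
    calc ∫⁻ u in Set.Ioi (0 : ℝ), ENNReal.ofReal (logSq |u|)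
        = ∫⁻ u in Set.Ioc (0 : ℝ) 1, ENNReal.ofReal (logSq |u|) := by
          rw [← Set.Ioc_union_Ioi_eq_Ioi zero_le_one,
            lintegral_union measurableSet_Ioi (Set.Ioc_disjoint_Ioi le_rfl)]
          rw [setLIntegral_congr_fun (g := fun _ => 0) measurableSet_Ioi]
          · simp
          · intro u hu
            have hu' : (1 : ℝ) < u := hu
            simp [h0 u (by rw [abs_of_pos (by linarith)]; exact hu')]
      _ ≤ ∫⁻ u in Set.Ioc (0 : ℝ) 1, ENNReal.ofReal (16 * u ^ (-(1 / 2) : ℝ)) := by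
          refine setLIntegral_mono' measurableSet_Ioc fun u hu => ENNReal.ofReal_le_ofReal ?_
          rw [abs_of_pos hu.1]
          exact logSq_le_rpow hu.1
      _ < ∞ := hint.lintegral_lt_top
  have h2 : ∫⁻ u in Set.Iic (0 : ℝ), ENNReal.ofReal (logSq |u|) < ∞ := by
    have h3 : ∫⁻ u in Set.Iio (0 : ℝ), ENNReal.ofReal (logSq |u|) =
        ∫⁻ u in Set.Ioi (0 : ℝ), ENNReal.ofReal (logSq |u|) := by
      have := (Measure.measurePreserving_neg (volume : Measure ℝ)).setLIntegral_comp_preimage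
        (s := Set.Ioi (0 : ℝ)) (f := fun u => ENNReal.ofReal (logSq |u|)) measurableSet_Ioi
        ((measurable_logSq.comp measurable_abs).ennreal_ofReal)
      simpa using this
    rw [setLIntegral_congr Iio_ae_eq_Iic.symm, h3]
    exact h1
  rw [← setLIntegral_univ, ← Set.Iic_union_Ioi (a := (0 : ℝ)),
    lintegral_union measurableSet_Ioi (Set.Iic_disjoint_Ioi le_rfl)]
  exact ENNReal.add_lt_top.2 ⟨h2, h1⟩

theorem logSq_anti {x y : ℝ} (hx : 0 < x) (hxy : x ≤ y) : logSq y ≤ logSq x := by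
  refine pow_le_pow_left₀ Real.posLog_nonneg ?_ 2
  exact Real.posLog_le_posLog (inv_nonneg.2 (hx.le.trans hxy)) (inv_anti₀ hx hxy)

/-- A uniform bound for the integral of the squared negative logarithm of a linear function. -/
noncomputable def logConst : ℝ≥0∞ := ∫⁻ u : ℝ, ENNReal.ofReal (logSq |u|)

theorem logConst_ne_top : logConst ≠ ∞ := lintegral_logSq_lt_top.ne

/-- Projecting `r` to the real axis can only bring it closer to `s`, and the resulting integral over
the line is translation invariant. The bound is therefore independent of `r`. -/
theorem lintegral_logSq_sub_le (r : ℂ) :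
    ∫⁻ s in Set.Icc (0 : ℝ) 1, ENNReal.ofReal (logSq ‖(s : ℂ) - r‖) ≤ logConst := by
  refine (setLIntegral_le_lintegral _ _).trans ?_
  have h1 : ∫⁻ s : ℝ, ENNReal.ofReal (logSq |s - r.re|) = logConst :=
    lintegral_sub_right_eq_self (fun s => ENNReal.ofReal (logSq |s|)) r.re
  rw [← h1]
  refine lintegral_mono_ae ?_
  have h2 : ∀ᵐ s : ℝ, s ≠ r.re := by simp [ae_iff, measure_singleton]
  filter_upwards [h2] with s hs
  refine ENNReal.ofReal_le_ofReal (logSq_anti (abs_pos.2 (sub_ne_zero.2 hs)) ?_)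
  have := Complex.abs_re_le_norm ((s : ℂ) - r)
  simpa using this

end LogIntegral


/-! ### The operator norm: bounds by forms and entries, attainment. -/

section MatrixNorm

open scoped Matrix.Norms.L2Operator

theorem opNorm_eq_norm (M : Matrix (Fin W) (Fin W) ℂ) : opNorm M = ‖M‖ := rfl

theorem norm_toLp_sq (v : Fin W → ℂ) : ‖(WithLp.toLp 2 v : EuclideanSpace ℂ (Fin W))‖ ^ 2 = nsq v := by
  rw [EuclideanSpace.norm_sq_eq]; rfl

theorem norm_toLp (v : Fin W → ℂ) :
    ‖(WithLp.toLp 2 v : EuclideanSpace ℂ (Fin W))‖ = Real.sqrt (nsq v) := by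
  rw [← norm_toLp_sq, Real.sqrt_sq (norm_nonneg _)]

theorem sqrt_nsq_mulVec_le (M : Matrix (Fin W) (Fin W) ℂ) (v : Fin W → ℂ) :
    Real.sqrt (nsq (M *ᵥ v)) ≤ ‖M‖ * Real.sqrt (nsq v) := by
  have h : ‖(WithLp.toLp 2 (M *ᵥ v) : EuclideanSpace ℂ (Fin W))‖ ≤
      ‖M‖ * ‖(WithLp.toLp 2 v : EuclideanSpace ℂ (Fin W))‖ :=
    l2_opNorm_mulVec M (WithLp.toLp 2 v)
  rwa [norm_toLp, norm_toLp] at h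

theorem norm_dotProduct_le_sqrt (a b : Fin W → ℂ) :
    ‖star a ⬝ᵥ b‖ ≤ Real.sqrt (nsq a) * Real.sqrt (nsq b) := by
  have h := norm_inner_le_norm (𝕜 := ℂ) (WithLp.toLp 2 a : EuclideanSpace ℂ (Fin W))
    (WithLp.toLp 2 b)
  rw [norm_toLp, norm_toLp] at h
  rw [EuclideanSpace.inner_toLp_toLp, dotProduct_comm] at h
  exact h

theorem norm_form_le (M : Matrix (Fin W) (Fin W) ℂ) {a b : Fin W → ℂ} (ha : nsq a = 1)
    (hb : nsq b = 1) : ‖star a ⬝ᵥ (M *ᵥ b)‖ ≤ ‖M‖ := by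
  refine (norm_dotProduct_le_sqrt _ _).trans ?_
  have := sqrt_nsq_mulVec_le M b
  rw [ha, Real.sqrt_one, one_mul]
  rwa [hb, Real.sqrt_one, mul_one] at this

theorem nsq_single (i : Fin W) : nsq (Pi.single i 1 : Fin W → ℂ) = 1 := by
  rw [nsq, Finset.sum_eq_single i]
  · simp
  · intro j _ hj
    simp [hj]
  · simp

theorem form_single (M : Matrix (Fin W) (Fin W) ℂ) (i j : Fin W) :
    star (Pi.single i 1 : Fin W → ℂ) ⬝ᵥ (M *ᵥ Pi.single j 1) = M i j := by
  rw [← Pi.single_star]; simp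

theorem norm_entry_le (M : Matrix (Fin W) (Fin W) ℂ) (i j : Fin W) : ‖M i j‖ ≤ ‖M‖ := by
  rw [← form_single M i j]
  exact norm_form_le M (nsq_single i) (nsq_single j)

theorem norm_le_of_form {M : Matrix (Fin W) (Fin W) ℂ} {c : ℝ} (hc : 0 ≤ c)
    (h : ∀ v, Real.sqrt (nsq (M *ᵥ v)) ≤ c * Real.sqrt (nsq v)) : ‖M‖ ≤ c := by
  rw [cstar_norm_def]
  refine ContinuousLinearMap.opNorm_le_bound _ hc fun x => ?_
  have := h (WithLp.ofLp x)
  rw [← norm_toLp, ← norm_toLp] at this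
  exact this

theorem norm_single_le (i j : Fin W) (c : ℂ) : ‖Matrix.single i j c‖ ≤ ‖c‖ := by
  refine norm_le_of_form (norm_nonneg c) fun v => ?_
  rw [← Real.sqrt_sq (norm_nonneg c), ← Real.sqrt_mul (by positivity)]
  refine Real.sqrt_le_sqrt ?_
  have h1 : (Matrix.single i j c) *ᵥ v = Pi.single i (c * v j) := by
    rw [Matrix.single_mulVec]
    rfl
  rw [h1, nsq, Finset.sum_eq_single i]
  · simp only [Pi.single_eq_same, norm_mul, mul_pow]
    refine mul_le_mul_of_nonneg_left ?_ (by positivity)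
    exact Finset.single_le_sum (f := fun i => ‖v i‖ ^ 2) (fun _ _ => by positivity)
      (Finset.mem_univ j)
  · intro k _ hk
    simp [hk]
  · simp

theorem norm_le_sum_entries (M : Matrix (Fin W) (Fin W) ℂ) : ‖M‖ ≤ ∑ i, ∑ j, ‖M i j‖ := by
  conv_lhs => rw [Matrix.matrix_eq_sum_single M]
  refine (norm_sum_le _ _).trans (Finset.sum_le_sum fun i _ => ?_)
  exact (norm_sum_le _ _).trans (Finset.sum_le_sum fun j _ => norm_single_le i j _)

/-- The norm of a matrix is attained at a unit vector. -/
theorem exists_norm_attained (hW : 0 < W) (M : Matrix (Fin W) (Fin W) ℂ) :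
    ∃ v, nsq v = 1 ∧ Real.sqrt (nsq (M *ᵥ v)) = ‖M‖ := by
  have : Nonempty (Fin W) := ⟨⟨0, hW⟩⟩
  have hc : IsCompact (Metric.sphere (0 : EuclideanSpace ℂ (Fin W)) 1) := isCompact_sphere _ _
  have hne : (Metric.sphere (0 : EuclideanSpace ℂ (Fin W)) 1).Nonempty :=
    NormedSpace.sphere_nonempty.2 zero_le_one
  set T := toEuclideanCLM (n := Fin W) (𝕜 := ℂ) M
  obtain ⟨x, hx, hmax⟩ := hc.exists_isMaxOn hne (f := fun x => ‖T x‖) (by fun_prop)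
  have hx1 : ‖x‖ = 1 := by simpa using hx
  refine ⟨WithLp.ofLp x, ?_, ?_⟩
  · rw [← norm_toLp_sq]
    simp [hx1]
  · have h0 : Real.sqrt (nsq (M *ᵥ WithLp.ofLp x)) = ‖T x‖ := by
      rw [← norm_toLp]; rfl
    rw [h0]
    refine le_antisymm ?_ ?_
    · have := T.le_opNorm x
      rw [hx1, mul_one] at this
      exact this
    · rw [cstar_norm_def]
      refine ContinuousLinearMap.opNorm_le_bound _ (norm_nonneg _) fun y => ?_
      rcases eq_or_ne y 0 with rfl | hy
      · simp
      · have hy' : ‖y‖ ≠ 0 := norm_ne_zero_iff.2 hy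
        have h1 : ((‖y‖ : ℂ)⁻¹) • y ∈ Metric.sphere (0 : EuclideanSpace ℂ (Fin W)) 1 := by
          simp [norm_smul, hy']
        have h2 : ‖T (((‖y‖ : ℂ)⁻¹) • y)‖ ≤ ‖T x‖ := hmax h1
        rw [map_smul, norm_smul, norm_inv, Complex.norm_real, norm_norm,
          inv_mul_le_iff₀ (by positivity)] at h2
        linarith

end MatrixNorm

/-! ### Measurability of matrix-valued maps. -/

section MeasurableMatrix

open scoped Matrix.Norms.L2Operator

variable {Ω : Type*} [MeasurableSpace Ω]

/-- A matrix valued map with measurable entries. -/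
def MeasurableEntries (M : Ω → Matrix (Fin W) (Fin W) ℂ) : Prop :=
  ∀ i j, Measurable fun ω => M ω i j

theorem MeasurableEntries.comp_continuous {Y : Type*} [TopologicalSpace Y] [MeasurableSpace Y]
    [BorelSpace Y] {M : Ω → Matrix (Fin W) (Fin W) ℂ} (hM : MeasurableEntries M)
    {f : Matrix (Fin W) (Fin W) ℂ → Y} (hf : Continuous f) : Measurable fun ω => f (M ω) := by
  have h1 : Continuous fun A : Fin W → Fin W → ℂ => f (Matrix.of A) := hf
  have h2 : Measurable fun ω => (fun i j => M ω i j : Fin W → Fin W → ℂ) :=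
    measurable_pi_lambda _ fun i => measurable_pi_lambda _ fun j => hM i j
  exact h1.measurable.comp h2

theorem MeasurableEntries.norm {M : Ω → Matrix (Fin W) (Fin W) ℂ} (hM : MeasurableEntries M) :
    Measurable fun ω => ‖M ω‖ := hM.comp_continuous continuous_norm

theorem MeasurableEntries.inv {M : Ω → Matrix (Fin W) (Fin W) ℂ} (hM : MeasurableEntries M) :
    MeasurableEntries fun ω => (M ω)⁻¹ := by
  intro i j
  simp only [inv_def, Ring.inverse_eq_inv', Matrix.smul_apply, smul_eq_mul]
  refine Measurable.mul ?_ ?_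
  · exact (hM.comp_continuous (f := fun A => A.det) continuous_id.matrix_det).inv
  · exact hM.comp_continuous (f := fun A => A.adjugate i j)
      (continuous_id.matrix_adjugate.matrix_elem _ _)

theorem MeasurableEntries.mul {M N : Ω → Matrix (Fin W) (Fin W) ℂ} (hM : MeasurableEntries M)
    (hN : MeasurableEntries N) : MeasurableEntries fun ω => M ω * N ω := by
  intro i j
  simp only [Matrix.mul_apply]
  exact Finset.measurable_sum _ fun k _ => (hM i k).mul (hN k j)

theorem MeasurableEntries.add {M N : Ω → Matrix (Fin W) (Fin W) ℂ} (hM : MeasurableEntries M)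
    (hN : MeasurableEntries N) : MeasurableEntries fun ω => M ω + N ω :=
  fun i j => (hM i j).add (hN i j)

theorem MeasurableEntries.sub {M N : Ω → Matrix (Fin W) (Fin W) ℂ} (hM : MeasurableEntries M)
    (hN : MeasurableEntries N) : MeasurableEntries fun ω => M ω - N ω :=
  fun i j => (hM i j).sub (hN i j)

theorem MeasurableEntries.smul {M : Ω → Matrix (Fin W) (Fin W) ℂ} (hM : MeasurableEntries M)
    (c : ℂ) : MeasurableEntries fun ω => c • M ω :=
  fun i j => (hM i j).const_mul c

theorem measurableEntries_const (A : Matrix (Fin W) (Fin W) ℂ) :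
    MeasurableEntries fun _ : Ω => A := fun _ _ => measurable_const

theorem MeasurableEntries.sum {ι : Type*} (s : Finset ι) {M : ι → Ω → Matrix (Fin W) (Fin W) ℂ}
    (hM : ∀ k ∈ s, MeasurableEntries (M k)) : MeasurableEntries fun ω => ∑ k ∈ s, M k ω := by
  intro i j
  simp only [Matrix.sum_apply]
  exact Finset.measurable_sum _ fun k hk => hM k hk i j

theorem MeasurableEntries.comp {Ω' : Type*} [MeasurableSpace Ω']
    {M : Ω → Matrix (Fin W) (Fin W) ℂ} (hM : MeasurableEntries M) {f : Ω' → Ω}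
    (hf : Measurable f) : MeasurableEntries fun ω => M (f ω) :=
  fun i j => (hM i j).comp hf

theorem measurableEntries_symMat : MeasurableEntries (symMat (W := W)) := by
  intro i j
  simp only [symMat, of_apply]
  have := measurable_symmetrize W
  fun_prop

end MeasurableMatrix

/-! ### Matrices with negative definite imaginary part, and rank one shifts. -/

section Dissipative

open scoped Matrix.Norms.L2Operator

/-- The imaginary part of the matrix is negative definite. -/
def IsDissipative (N : Matrix (Fin W) (Fin W) ℂ) : Prop :=
  ∀ w, w ≠ 0 → (star w ⬝ᵥ (N *ᵥ w)).im < 0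

theorem IsDissipative.add_hermitian {N H : Matrix (Fin W) (Fin W) ℂ} (hN : IsDissipative N)
    (hH : H.IsHermitian) : IsDissipative (H + N) := by
  intro w hw
  rw [add_mulVec, dotProduct_add, Complex.add_im, im_dotProduct_hermitian hH, zero_add]
  exact hN w hw

theorem IsDissipative.isUnit_det {N : Matrix (Fin W) (Fin W) ℂ} (hN : IsDissipative N) :
    IsUnit N.det := by
  rw [isUnit_iff_ne_zero]
  intro h0
  obtain ⟨w, hw, h1⟩ := Matrix.exists_mulVec_eq_zero_iff.2 h0
  have := hN w hw
  rw [h1] at this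
  simp at this

theorem IsDissipative.inv_im_pos {N : Matrix (Fin W) (Fin W) ℂ} (hN : IsDissipative N)
    {w : Fin W → ℂ} (hw : w ≠ 0) : 0 < (star w ⬝ᵥ (N⁻¹ *ᵥ w)).im := by
  set u := N⁻¹ *ᵥ w with hu
  have h1 : N *ᵥ u = w := by
    rw [hu, mulVec_mulVec, mul_nonsing_inv _ hN.isUnit_det, one_mulVec]
  have h2 : u ≠ 0 := by
    intro h; rw [h] at h1; simp at h1; exact hw h1.symm
  have h3 := hN u h2
  rw [h1] at h3
  rw [im_dotProduct_swap]
  linarith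

theorem IsDissipative.inv_diag_im_pos {N : Matrix (Fin W) (Fin W) ℂ} (hN : IsDissipative N)
    (k : Fin W) : 0 < (N⁻¹ k k).im := by
  have := hN.inv_im_pos (w := Pi.single k 1) (by simp)
  rwa [form_single] at this

/-- A matrix with nonnegative imaginary part: its off-diagonal anti-Hermitian part is controlled by
the diagonal. -/
theorem norm_sub_conj_le {G : Matrix (Fin W) (Fin W) ℂ}
    (hG : ∀ w, 0 ≤ (star w ⬝ᵥ (G *ᵥ w)).im) (j k : Fin W) :
    ‖G j k - star (G k j)‖ ≤ (G j j).im + (G k k).im := by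
  set h := G j k - star (G k j) with hh
  rcases eq_or_ne h 0 with h0 | h0
  · rw [h0, norm_zero]
    have h1 := hG (Pi.single j 1)
    have h2 := hG (Pi.single k 1)
    rw [form_single] at h1 h2
    linarith
  -- A phase with `t * h = -i ‖h‖`: testing positivity on `e_j + t e_k` makes the off-diagonal
  -- contribution exactly `-‖h‖`.
  · set t : ℂ := -Complex.I * (star h / ‖h‖) with ht
    have hn : (‖h‖ : ℂ) ≠ 0 := by simpa using h0
    have h1 := hG (Pi.single j 1 + t • Pi.single k 1)
    have h2 : star (Pi.single j 1 + t • Pi.single k 1 : Fin W → ℂ) ⬝ᵥ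
        (G *ᵥ (Pi.single j 1 + t • Pi.single k 1)) =
        G j j + t * G j k + star t * G k j + star t * t * G k k := by
      rw [star_add, star_smul, mulVec_add, mulVec_smul, add_dotProduct, dotProduct_add,
        dotProduct_add, smul_dotProduct, smul_dotProduct, dotProduct_smul, dotProduct_smul,
        form_single, form_single, form_single, form_single]
      simp only [smul_eq_mul]
      ring
    rw [h2] at h1
    have h3 : star h * h = (‖h‖ : ℂ) ^ 2 := Complex.conj_mul' h
    have h4 : t * h = -Complex.I * ‖h‖ := by
      rw [ht]
      field_simp
      linear_combination (-1 : ℂ) * h3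
    have h5 : star t * t = 1 := by
      have h6 : star h * star (star h) = (‖h‖ : ℂ) ^ 2 := by rw [star_star]; exact h3
      have : star t * t = (star h * star (star h)) / (‖h‖ : ℂ) ^ 2 := by
        rw [ht]
        simp only [star_mul', star_neg, star_div₀, Complex.star_def, Complex.conj_I,
          Complex.conj_ofReal]
        field_simp
        linear_combination (-(starRingEnd ℂ h * (starRingEnd ℂ) ((starRingEnd ℂ) h))) *
          Complex.I_sq
      rw [this, h6, div_self (pow_ne_zero 2 hn)]
    have h7 : (t * G j k + star t * G k j).im = (t * h).im := by
      have : ∀ t a b : ℂ, (t * a + star t * b).im = (t * (a - star b)).im := by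
        intro t a b
        simp only [Complex.add_im, Complex.mul_im, Complex.sub_im, Complex.sub_re, Complex.star_def,
          Complex.conj_re, Complex.conj_im]
        ring
      exact this t _ _
    rw [h5, one_mul, Complex.add_im, add_assoc, Complex.add_im, h7, h4] at h1
    have h8 : (-Complex.I * (‖h‖ : ℂ)).im = -‖h‖ := by simp
    rw [h8] at h1
    linarith

/-- The Sherman-Morrison formula for a shift of a diagonal entry. -/
theorem inv_add_single {N : Matrix (Fin W) (Fin W) ℂ} (hN : IsUnit N.det) (k : Fin W) (s : ℂ)
    (h : 1 + s * N⁻¹ k k ≠ 0) (a b : Fin W) :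
    (N + Matrix.single k k s)⁻¹ a b =
      N⁻¹ a b - s / (1 + s * N⁻¹ k k) * (N⁻¹ a k * N⁻¹ k b) := by
  set G := N⁻¹ with hG
  have hNG : N * G = 1 := mul_nonsing_inv _ hN
  have hE : Matrix.single k k s = s • Matrix.single k k (1 : ℂ) := by simp
  set E := Matrix.single k k (1 : ℂ) with hEdef
  have hEGE : E * G * E = G k k • E := by
    rw [hEdef, Matrix.single_mul_mul_single]
    simp
  have key : (N + s • E) * (G - (s / (1 + s * G k k)) • (G * E * G)) = 1 := by
    have : (N + s • E) * (G - (s / (1 + s * G k k)) • (G * E * G)) =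
        N * G + s • (E * G) - (s / (1 + s * G k k)) • (N * G * E * G) -
          ((s / (1 + s * G k k)) * s) • (E * G * E * G) := by
      simp only [add_mul, mul_sub, Matrix.smul_mul, Matrix.mul_smul, smul_smul, mul_assoc]
      abel
    rw [this, hNG, hEGE, one_mul, Matrix.smul_mul, smul_smul]
    have h2 : s - s / (1 + s * G k k) - (s / (1 + s * G k k)) * s * G k k = 0 := by
      field_simp
      ring
    have h3 : (1 : Matrix (Fin W) (Fin W) ℂ) + s • (E * G) - (s / (1 + s * G k k)) • (E * G) -
        ((s / (1 + s * G k k)) * s * G k k) • (E * G) =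
        1 + (s - s / (1 + s * G k k) - (s / (1 + s * G k k)) * s * G k k) • (E * G) := by
      module
    rw [h3, h2]
    simp
  have h4 : (N + Matrix.single k k s)⁻¹ = G - (s / (1 + s * G k k)) • (G * E * G) := by
    rw [hE]
    exact Matrix.inv_eq_right_inv key
  have h5 : (G * E * G) a b = G a k * G k b := by
    rw [hEdef, Matrix.mul_apply, Finset.sum_eq_single k]
    · rw [Matrix.mul_single_apply_same]; simp
    · intro c _ hc
      rw [Matrix.mul_single_apply_of_ne _ _ _ _ _ hc, zero_mul]
    · simp
  rw [h4]
  simp [h5]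

end Dissipative


/-! ### Upper logarithmic moments of the inverse of a perturbed Gaussian matrix. -/

section UpperBound

open scoped Matrix.Norms.L2Operator NNReal ENNReal
open Real (posLog)

/-- Cauchy–Schwarz with `c` counted as one more summand. -/
theorem ofReal_sq_le_sum {ι : Type*} (s : Finset ι) {a c : ℝ} {b : ι → ℝ} (ha : 0 ≤ a)
    (h : a ≤ c + ∑ i ∈ s, b i) :
    ENNReal.ofReal (a ^ 2) ≤
      (s.card + 1 : ℕ) * (ENNReal.ofReal (c ^ 2) + ∑ i ∈ s, ENNReal.ofReal (b i ^ 2)) := by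
  have h1 : (c + ∑ i ∈ s, b i) ^ 2 ≤ (s.card + 1 : ℕ) * (c ^ 2 + ∑ i ∈ s, b i ^ 2) := by
    have h2 := sq_sum_le_card_mul_sum_sq (s := s.insertNone) (f := fun o => o.elim c b)
    simpa using h2
  rw [← ENNReal.ofReal_sum_of_nonneg fun i _ => sq_nonneg _,
    ← ENNReal.ofReal_add (sq_nonneg _) (Finset.sum_nonneg fun i _ => sq_nonneg _),
    ← ENNReal.ofReal_natCast, ← ENNReal.ofReal_mul (by positivity)]
  exact ENNReal.ofReal_le_ofReal ((pow_le_pow_left₀ ha h 2).trans h1)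

/-- The Schur complement of the `j`-th diagonal entry in the `{j, k}` block of `N⁻¹`. -/
noncomputable def schurEntry (j k : Fin W) (N : Matrix (Fin W) (Fin W) ℂ) : ℂ :=
  (N⁻¹ j j * N⁻¹ k k - N⁻¹ j k * N⁻¹ k j) / N⁻¹ j j

theorem ne_zero_of_im_pos {c : ℂ} (h : 0 < c.im) : c ≠ 0 := by
  rintro rfl; simp at h

theorem one_add_real_mul_ne_zero {c : ℂ} (h : 0 < c.im) (s : ℝ) : 1 + (s : ℂ) * c ≠ 0 := by
  intro h0
  have h1 := congrArg Complex.im h0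
  simp at h1
  rcases h1 with h1 | h1
  · subst h1; simp at h0
  · exact h.ne' h1

/-- With `g` the entry before the shift, the shifted entry is `g / (1 + s g) = 1 / (s + 1 / g)`. -/
theorem diag_shift_le {N : Matrix (Fin W) (Fin W) ℂ} (hN : IsDissipative N) (k : Fin W) :
    ∃ r : ℂ, ∀ s : ℝ, ‖(N + Matrix.single k k (s : ℂ))⁻¹ k k‖ ≤ ‖(s : ℂ) - r‖⁻¹ := by
  have him := hN.inv_diag_im_pos k
  have h0 := ne_zero_of_im_pos him
  refine ⟨-(N⁻¹ k k)⁻¹, fun s => ?_⟩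
  have h1 := one_add_real_mul_ne_zero him s
  rw [inv_add_single hN.isUnit_det k s h1, ← norm_inv]
  refine le_of_eq (congrArg norm ?_)
  generalize N⁻¹ k k = g at *
  have h2 : (s : ℂ) - -g⁻¹ = (1 + s * g) / g := by field_simp; ring
  rw [h2, inv_div, eq_div_iff h1]
  linear_combination (-(g * g)) * div_mul_cancel₀ (s : ℂ) h1

/-- With `Δ` the `{j, k}` minor and `a` the `j`-th diagonal entry of `N⁻¹`, the shifted Schur
complement is `Δ / (a + s Δ)`, again the reciprocal of a monic linear function of `s`. For `Δ = 0`
it vanishes and any `r` serves. -/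
theorem schurEntry_shift_le {N : Matrix (Fin W) (Fin W) ℂ} (hN : IsDissipative N) (j k : Fin W) :
    ∃ r : ℂ, ∀ s : ℝ, ‖schurEntry j k (N + Matrix.single k k (s : ℂ))‖ ≤ ‖(s : ℂ) - r‖⁻¹ := by
  have him := hN.inv_diag_im_pos k
  have hj := ne_zero_of_im_pos (hN.inv_diag_im_pos j)
  set Δ := N⁻¹ j j * N⁻¹ k k - N⁻¹ j k * N⁻¹ k j with hΔ
  refine ⟨-(N⁻¹ j j / Δ), fun s => ?_⟩
  have h1 := one_add_real_mul_ne_zero him s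
  simp only [schurEntry, inv_add_single hN.isUnit_det k s h1]
  generalize N⁻¹ k k = g at *
  generalize N⁻¹ j j = a at *
  generalize N⁻¹ j k = b at *
  generalize N⁻¹ k j = c at *
  have e1 : a - s / (1 + s * g) * (b * c) = (a + s * Δ) / (1 + s * g) := by
    rw [hΔ]; field_simp; ring
  have e2 : (a - s / (1 + s * g) * (b * c)) * (g - s / (1 + s * g) * (g * g)) -
      (b - s / (1 + s * g) * (b * g)) * (c - s / (1 + s * g) * (g * c)) = Δ / (1 + s * g) := by
    rw [hΔ]; field_simp; ring
  rw [e2, e1, div_div_div_cancel_right₀ h1]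
  by_cases hD : Δ = 0
  · rw [hD]; simp
  · rw [← norm_inv]
    refine le_of_eq (congrArg norm ?_)
    have h2 : (s : ℂ) - -(a / Δ) = (a + s * Δ) / Δ := by field_simp; ring
    rw [h2, inv_div]

/-- The product of the two off-diagonal entries is determined by the diagonal and the Schur
complement. Positivity of the imaginary part of `N⁻¹` bounds the difference between one entry and
the conjugate of the other. So neither can be large alone, and both cannot be large together. -/
theorem norm_offdiag_le {N : Matrix (Fin W) (Fin W) ℂ} (hN : IsDissipative N) (j k : Fin W) :
    ‖N⁻¹ j k‖ ≤ 4 * (max 1 ‖N⁻¹ j j‖ * max 1 ‖N⁻¹ k k‖ * max 1 ‖schurEntry j k N‖) := by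
  have hG : ∀ w, 0 ≤ (star w ⬝ᵥ (N⁻¹ *ᵥ w)).im := by
    intro w
    by_cases hw : w = 0
    · simp [hw]
    · exact (hN.inv_im_pos hw).le
  have h1 := norm_sub_conj_le hG j k
  have hj := ne_zero_of_im_pos (hN.inv_diag_im_pos j)
  have h2 : N⁻¹ j k * N⁻¹ k j = N⁻¹ j j * (N⁻¹ k k - schurEntry j k N) := by
    rw [schurEntry]; field_simp; ring
  have h3 := congrArg norm h2
  rw [norm_mul, norm_mul] at h3
  have h4 : ‖N⁻¹ k k - schurEntry j k N‖ ≤ ‖N⁻¹ k k‖ + ‖schurEntry j k N‖ := norm_sub_le _ _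
  have h5 : ‖N⁻¹ j k‖ ≤ ‖N⁻¹ j k - star (N⁻¹ k j)‖ + ‖N⁻¹ k j‖ := by
    have := norm_add_le (N⁻¹ j k - star (N⁻¹ k j)) (star (N⁻¹ k j))
    rwa [sub_add_cancel, norm_star] at this
  have h6 : (N⁻¹ j j).im ≤ ‖N⁻¹ j j‖ := (le_abs_self _).trans (Complex.abs_im_le_norm _)
  have h7 : (N⁻¹ k k).im ≤ ‖N⁻¹ k k‖ := (le_abs_self _).trans (Complex.abs_im_le_norm _)
  have ha1 := le_max_left 1 ‖N⁻¹ j j‖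
  have ha2 := le_max_right 1 ‖N⁻¹ j j‖
  have hb1 := le_max_left 1 ‖N⁻¹ k k‖
  have hb2 := le_max_right 1 ‖N⁻¹ k k‖
  have hc1 := le_max_left 1 ‖schurEntry j k N‖
  have hc2 := le_max_right 1 ‖schurEntry j k N‖
  have n1 := norm_nonneg (N⁻¹ k j)
  have n2 := norm_nonneg (N⁻¹ j j)
  have n3 := norm_nonneg (N⁻¹ k k)
  have n4 := norm_nonneg (schurEntry j k N)
  generalize ‖N⁻¹ j k - star (N⁻¹ k j)‖ = β at *
  generalize ‖N⁻¹ k k - schurEntry j k N‖ = α at *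
  generalize ‖N⁻¹ j k‖ = x at *
  generalize ‖N⁻¹ k j‖ = y at *
  generalize max 1 ‖N⁻¹ j j‖ = a at *
  generalize max 1 ‖N⁻¹ k k‖ = b at *
  generalize max 1 ‖schurEntry j k N‖ = c at *
  -- With `m = a b c`, an entry above `4 m` forces the other above `2 m`, while their product is at
  -- most `2 m ^ 2`.
  by_contra hcon
  push Not at hcon
  have hab : 1 ≤ a * b := by nlinarith
  have habc : a * b ≤ a * b * c := by nlinarith
  have hac : a ≤ a * b * c := by nlinarith
  have hbc : b ≤ a * b * c := by nlinarith
  have hcc : c ≤ a * b * c := by nlinarith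
  set m := a * b * c with hm
  have hβ : β ≤ 2 * m := by linarith
  have hy : 2 * m < y := by linarith
  have hα : α ≤ 2 * m := by linarith
  have hm1 : 1 ≤ m := by linarith
  have e1 : ‖N⁻¹ j j‖ * α ≤ m * (2 * m) := by
    refine mul_le_mul (ha2.trans hac) hα ?_ (by linarith)
    by_contra hneg
    push Not at hneg
    rcases n2.eq_or_lt with h0 | h0
    · rw [← h0] at h3; nlinarith
    · nlinarith
  nlinarith

theorem posLog_norm_inv_le {N : Matrix (Fin W) (Fin W) ℂ} (hN : IsDissipative N) :
    posLog ‖N⁻¹‖ ≤ (Real.log (W * W : ℕ) + W * W * Real.log 4) +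
      ∑ p : Fin W × Fin W, (posLog ‖N⁻¹ p.1 p.1‖ + posLog ‖N⁻¹ p.2 p.2‖ +
        posLog ‖schurEntry p.1 p.2 N‖) := by
  have h1 : ‖N⁻¹‖ ≤ ∑ p : Fin W × Fin W, ‖N⁻¹ p.1 p.2‖ := by
    rw [Fintype.sum_prod_type]
    exact norm_le_sum_entries _
  have h2 : ∀ p : Fin W × Fin W, posLog ‖N⁻¹ p.1 p.2‖ ≤ Real.log 4 +
      (posLog ‖N⁻¹ p.1 p.1‖ + posLog ‖N⁻¹ p.2 p.2‖ + posLog ‖schurEntry p.1 p.2 N‖) := by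
    intro p
    have h3 := Real.posLog_le_posLog (norm_nonneg _) (norm_offdiag_le hN p.1 p.2)
    refine h3.trans ?_
    have hl : ∀ x : ℝ, posLog (max 1 ‖x‖) = posLog ‖x‖ := by
      intro x
      rw [Real.posLog_eq_log_max_one (norm_nonneg x),
        Real.posLog_eq_log_max_one (by positivity), max_eq_right (le_max_left _ _)]
    have hl' : ∀ x : ℂ, posLog (max 1 ‖x‖) = posLog ‖x‖ := fun x => by
      have := hl ‖x‖; rwa [norm_norm] at this
    refine Real.posLog_mul.trans ?_
    have h4 : posLog 4 = Real.log 4 := Real.posLog_eq_log (by norm_num)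
    rw [h4]
    gcongr
    refine Real.posLog_mul.trans ?_
    rw [hl']
    gcongr
    refine Real.posLog_mul.trans ?_
    rw [hl', hl']
  calc posLog ‖N⁻¹‖ ≤ posLog (∑ p : Fin W × Fin W, ‖N⁻¹ p.1 p.2‖) :=
        Real.posLog_le_posLog (norm_nonneg _) h1
    _ ≤ Real.log (Finset.univ : Finset (Fin W × Fin W)).card +
        ∑ p : Fin W × Fin W, posLog ‖N⁻¹ p.1 p.2‖ := Real.posLog_sum _ _
    _ ≤ Real.log (Finset.univ : Finset (Fin W × Fin W)).card +
        ∑ p : Fin W × Fin W, (Real.log 4 + (posLog ‖N⁻¹ p.1 p.1‖ + posLog ‖N⁻¹ p.2 p.2‖ +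
          posLog ‖schurEntry p.1 p.2 N‖)) := by gcongr with p _; exact h2 p
    _ = _ := by
        rw [Finset.sum_add_distrib, Finset.sum_const]
        simp [Finset.card_univ, Fintype.card_prod]
        ring

theorem isHermitian_symMat (X : Fin W → Fin W → ℝ) : (symMat X).IsHermitian := by
  ext i j
  simp [symMat, symmetrize, add_comm]

theorem isHermitian_smul_symMat (lam : ℝ) (X : Fin W → Fin W → ℝ) :
    ((lam : ℂ) • symMat X).IsHermitian := by
  have := isHermitian_symMat X
  unfold Matrix.IsHermitian at *
  rw [conjTranspose_smul, this]
  simp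

theorem posLog_sq_shift_le {lam : ℝ} (hlam : 0 < lam) {f : ℝ → ℝ} (hf0 : ∀ s, 0 ≤ f s) {r : ℂ}
    (hf : ∀ s, f s ≤ ‖(s : ℂ) - r‖⁻¹) (s : ℝ) :
    ENNReal.ofReal (posLog (f (lam * s)) ^ 2) ≤
      2 * (ENNReal.ofReal (posLog lam⁻¹ ^ 2) + ENNReal.ofReal (logSq ‖(s : ℂ) - r / lam‖)) := by
  have hl : (lam : ℂ) ≠ 0 := by exact_mod_cast hlam.ne'
  have h1 : ‖((lam * s : ℝ) : ℂ) - r‖⁻¹ = lam⁻¹ * ‖(s : ℂ) - r / lam‖⁻¹ := by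
    have : ((lam * s : ℝ) : ℂ) - r = lam * ((s : ℂ) - r / lam) := by
      push_cast; field_simp
    rw [this, norm_mul, mul_inv, Complex.norm_real, Real.norm_of_nonneg hlam.le]
  have h2 : posLog (f (lam * s)) ≤ posLog lam⁻¹ + posLog ‖(s : ℂ) - r / lam‖⁻¹ := by
    refine (Real.posLog_le_posLog (hf0 _) ((hf _).trans_eq h1)).trans Real.posLog_mul
  have h3 := ofReal_sq_le_sum {()} (b := fun _ => posLog ‖(s : ℂ) - r / lam‖⁻¹)
    Real.posLog_nonneg (by simpa using h2)
  simpa [logSq] using h3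

/-- Averaging over shifts of the `k`-th diagonal entry reduces the moment to a one-dimensional
integral of a squared logarithm, bounded independently of the pole `r`. Hence `C` depends neither on
`Q` nor on `f`. -/
theorem lintegral_posLog_shift_le {lam : ℝ} (hlam : 0 < lam) {v : ℝ≥0} (hv : v ≠ 0) :
    ∃ C : ℝ≥0∞, C ≠ ∞ ∧ ∀ (k : Fin W) (f : Matrix (Fin W) (Fin W) ℂ → ℝ),
      (∀ M : (Fin W → Fin W → ℝ) → Matrix (Fin W) (Fin W) ℂ, MeasurableEntries M →
        Measurable fun X => f (M X)) →
      (∀ N, 0 ≤ f N) →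
      (∀ N, IsDissipative N → ∃ r : ℂ, ∀ s : ℝ,
        f (N + Matrix.single k k (s : ℂ)) ≤ ‖(s : ℂ) - r‖⁻¹) →
      ∀ Q, IsDissipative Q →
        ∫⁻ X, ENNReal.ofReal (posLog (f ((lam : ℂ) • symMat X + Q)) ^ 2) ∂(gaussMat W v) ≤ C := by
  obtain ⟨C, hC, h⟩ := lintegral_le_average (W := W) hv
  refine ⟨C * (2 * (ENNReal.ofReal (posLog lam⁻¹ ^ 2) + logConst)), ?_, ?_⟩
  · exact ENNReal.mul_ne_top hC (ENNReal.mul_ne_top (by simp)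
      (ENNReal.add_ne_top.2 ⟨ENNReal.ofReal_ne_top, logConst_ne_top⟩))
  intro k f hfm hf0 hf Q hQ
  set S : Fin W → Fin W → ℝ := Pi.single k (Pi.single k 1) with hS
  have hSs : ∀ i j, S i j = if i = k ∧ j = k then 1 else 0 := by
    intro i j
    by_cases hi : i = k
    · subst hi; by_cases hj : j = i
      · subst hj; simp [hS]
      · simp [hS, hj]
    · simp [hS, hi]
  have hsymm : ∀ i j, S i j = S j i := by
    intro i j; simp only [hSs, and_comm]
  have hSm : (Matrix.of fun i j => (S i j : ℂ) : Matrix (Fin W) (Fin W) ℂ) =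
      Matrix.single k k 1 := by
    ext i j
    simp only [of_apply, hSs, Matrix.single_apply, eq_comm (a := k)]
    split_ifs <;> simp
  have hm : Measurable fun X => ENNReal.ofReal (posLog (f ((lam : ℂ) • symMat X + Q)) ^ 2) := by
    have := hfm (fun X => (lam : ℂ) • symMat X + Q)
      ((measurableEntries_symMat.smul _).add (measurableEntries_const Q))
    exact ((Real.continuous_posLog.measurable.comp this).pow_const 2).ennreal_ofReal
  refine (h S (fun i j => ?_) _ hm).trans ?_
  · rw [hSs]; split_ifs <;> simp
  · gcongr
    have h2 : ∀ X : Fin W → Fin W → ℝ, ∫⁻ s in Set.Icc (0 : ℝ) 1,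
        ENNReal.ofReal (posLog (f ((lam : ℂ) • symMat (shiftMat S s X) + Q)) ^ 2) ≤
        2 * (ENNReal.ofReal (posLog lam⁻¹ ^ 2) + logConst) := by
      intro X
      obtain ⟨r, hr⟩ := hf ((lam : ℂ) • symMat X + Q)
        (hQ.add_hermitian (isHermitian_smul_symMat lam X))
      have h3 : ∀ s : ℝ, (lam : ℂ) • symMat (shiftMat S s X) + Q =
          ((lam : ℂ) • symMat X + Q) + Matrix.single k k ((lam * s : ℝ) : ℂ) := by
        intro s
        rw [symMat_shiftMat hsymm, hSm]
        ext i j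
        simp only [Matrix.add_apply, Matrix.smul_apply, Matrix.single_apply, smul_eq_mul]
        split_ifs <;> push_cast <;> ring
      simp only [h3]
      calc _ ≤ ∫⁻ s in Set.Icc (0 : ℝ) 1, 2 * (ENNReal.ofReal (posLog lam⁻¹ ^ 2) +
            ENNReal.ofReal (logSq ‖(s : ℂ) - r / lam‖)) :=
            lintegral_mono fun s => posLog_sq_shift_le hlam
              (f := fun s => f (((lam : ℂ) • symMat X + Q) + Matrix.single k k (s : ℂ)))
              (fun s => hf0 _) hr s
        _ ≤ _ := by
          rw [lintegral_const_mul' _ _ (by simp), lintegral_add_left measurable_const]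
          gcongr
          · simp
          · exact lintegral_logSq_sub_le _
    calc _ ≤ ∫⁻ X, 2 * (ENNReal.ofReal (posLog lam⁻¹ ^ 2) + logConst) ∂(gaussMat W (2 * v)) :=
          lintegral_mono h2
      _ = _ := by simp

/-- The logarithmic moments of the inverse of a Gaussian matrix with an arbitrary dissipative
perturbation are bounded. -/
theorem lintegral_posLog_inv_le (W : ℕ) {lam : ℝ} (hlam : 0 < lam) {v : ℝ≥0} (hv : v ≠ 0) :
    ∃ C : ℝ≥0∞, C ≠ ∞ ∧ ∀ Q : Matrix (Fin W) (Fin W) ℂ, IsDissipative Q →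
      ∫⁻ X, ENNReal.ofReal (posLog ‖((lam : ℂ) • symMat X + Q)⁻¹‖ ^ 2) ∂(gaussMat W v) ≤ C := by
  obtain ⟨C, hC, h⟩ := lintegral_posLog_shift_le (W := W) hlam hv
  set c := Real.log (W * W : ℕ) + W * W * Real.log 4 with hc
  set n := ((Finset.univ : Finset (Fin W × Fin W)).card + 1 : ℕ) with hn
  refine ⟨n * (ENNReal.ofReal (c ^ 2) + ∑ p : Fin W × Fin W, 4 * (0 + 3 * C)), ?_, ?_⟩
  · refine ENNReal.mul_ne_top (by simp) (ENNReal.add_ne_top.2 ⟨ENNReal.ofReal_ne_top, ?_⟩)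
    refine ENNReal.sum_ne_top.2 fun p _ => ENNReal.mul_ne_top (by simp) ?_
    simpa using ENNReal.mul_ne_top (by simp) hC
  intro Q hQ
  set N : (Fin W → Fin W → ℝ) → Matrix (Fin W) (Fin W) ℂ := fun X => (lam : ℂ) • symMat X + Q
    with hN
  have hNd : ∀ X, IsDissipative (N X) := fun X =>
    hQ.add_hermitian (isHermitian_smul_symMat lam X)
  have hNm : MeasurableEntries N :=
    (measurableEntries_symMat.smul _).add (measurableEntries_const Q)
  have hdm : ∀ (M : (Fin W → Fin W → ℝ) → Matrix (Fin W) (Fin W) ℂ), MeasurableEntries M →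
      ∀ k, Measurable fun X => ‖(M X)⁻¹ k k‖ := fun M hM k => (hM.inv k k).norm
  have hsm : ∀ (M : (Fin W → Fin W → ℝ) → Matrix (Fin W) (Fin W) ℂ), MeasurableEntries M →
      ∀ j k, Measurable fun X => ‖schurEntry j k (M X)‖ := fun M hM j k =>
    ((((hM.inv j j).mul (hM.inv k k)).sub ((hM.inv j k).mul (hM.inv k j))).div
      (hM.inv j j)).norm
  have hd : ∀ k, ∫⁻ X, ENNReal.ofReal (posLog ‖(N X)⁻¹ k k‖ ^ 2) ∂(gaussMat W v) ≤ C := fun k =>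
    h k (fun N => ‖N⁻¹ k k‖) (fun M hM => hdm M hM k) (fun _ => norm_nonneg _)
      (fun N hN => diag_shift_le hN k) Q hQ
  have hs : ∀ j k, ∫⁻ X, ENNReal.ofReal (posLog ‖schurEntry j k (N X)‖ ^ 2) ∂(gaussMat W v) ≤ C :=
    fun j k => h k (fun N => ‖schurEntry j k N‖) (fun M hM => hsm M hM j k)
      (fun _ => norm_nonneg _) (fun N hN => schurEntry_shift_le hN j k) Q hQ
  have hpm : ∀ {g : (Fin W → Fin W → ℝ) → ℝ}, Measurable g →
      Measurable fun X => ENNReal.ofReal (posLog (g X) ^ 2) := fun hg =>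
    ((Real.continuous_posLog.measurable.comp hg).pow_const 2).ennreal_ofReal
  have key : ∀ X, ENNReal.ofReal (posLog ‖(N X)⁻¹‖ ^ 2) ≤ n * (ENNReal.ofReal (c ^ 2) +
      ∑ p : Fin W × Fin W, 4 * (ENNReal.ofReal (0 ^ 2) +
        (ENNReal.ofReal (posLog ‖(N X)⁻¹ p.1 p.1‖ ^ 2) +
          ENNReal.ofReal (posLog ‖(N X)⁻¹ p.2 p.2‖ ^ 2) +
          ENNReal.ofReal (posLog ‖schurEntry p.1 p.2 (N X)‖ ^ 2)))) := by
    intro X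
    refine (ofReal_sq_le_sum Finset.univ Real.posLog_nonneg (posLog_norm_inv_le (hNd X))).trans ?_
    gcongr with p _
    have := ofReal_sq_le_sum (Finset.univ : Finset (Fin 3)) (c := 0)
      (b := ![posLog ‖(N X)⁻¹ p.1 p.1‖, posLog ‖(N X)⁻¹ p.2 p.2‖,
        posLog ‖schurEntry p.1 p.2 (N X)‖])
      (a := posLog ‖(N X)⁻¹ p.1 p.1‖ + posLog ‖(N X)⁻¹ p.2 p.2‖ +
        posLog ‖schurEntry p.1 p.2 (N X)‖)
      (add_nonneg (add_nonneg Real.posLog_nonneg Real.posLog_nonneg) Real.posLog_nonneg)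
      (by simp [Fin.sum_univ_three])
    simpa [Fin.sum_univ_three] using this
  refine (lintegral_mono key).trans ?_
  rw [lintegral_const_mul' _ _ (by simp), lintegral_add_left measurable_const,
    lintegral_finsetSum _ fun p _ => ?_]
  · gcongr with p _
    · simp
    · rw [lintegral_const_mul' _ _ (by simp), lintegral_add_left measurable_const,
        lintegral_add_right _ (hpm (hsm N hNm p.1 p.2)),
        lintegral_add_right _ (hpm (hdm N hNm p.2))]
      gcongr
      · simp
      · calc _ ≤ C + C + C := add_le_add (add_le_add (hd _) (hd _)) (hs _ _)
          _ = 3 * C := by ring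
  · exact (measurable_const.add (((hpm (hdm N hNm p.1)).add (hpm (hdm N hNm p.2))).add
      (hpm (hsm N hNm p.1 p.2)))).const_mul _

end UpperBound


/-! ### Matrix elements of the inverse along an involution. -/

section LowerBound

open scoped Matrix.Norms.L2Operator NNReal ENNReal
open Real (posLog)

/-- The complex matrix with the given real entries. -/
noncomputable def complexify (S : Fin W → Fin W → ℝ) : Matrix (Fin W) (Fin W) ℂ :=
  Matrix.of fun i j => (S i j : ℂ)

theorem complexify_one : complexify (1 : Matrix (Fin W) (Fin W) ℝ) = 1 := by
  ext i j
  simp only [complexify, of_apply, Matrix.one_apply]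
  split_ifs <;> simp

theorem complexify_reflection (i : Fin W) (b : Fin W → ℂ) :
    complexify (Matrix.diagonal fun k => if k = i then (-1 : ℝ) else 1) *ᵥ b =
      fun k => if k = i then -b k else b k := by
  ext k
  rw [mulVec, dotProduct, Finset.sum_eq_single k]
  · simp only [complexify, of_apply, diagonal_apply_eq]; split_ifs <;> simp
  · intro j _ hj
    simp [complexify, Matrix.diagonal_apply_ne _ (Ne.symm hj)]
  · simp

/-- The matrix of a transposition. -/
def swapMat (i j : Fin W) : Fin W → Fin W → ℝ := fun k l => if Equiv.swap i j k = l then 1 else 0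

theorem complexify_swapMat (i j : Fin W) (b : Fin W → ℂ) :
    complexify (swapMat i j) *ᵥ b = fun k => b (Equiv.swap i j k) := by
  ext k
  rw [mulVec, dotProduct, Finset.sum_eq_single (Equiv.swap i j k)]
  · simp [complexify, swapMat]
  · intro l _ hl
    simp [complexify, swapMat, Ne.symm hl]
  · simp

theorem mul_self_eq_one_of_mulVec {S : Matrix (Fin W) (Fin W) ℂ} (h : ∀ b, S *ᵥ (S *ᵥ b) = b) :
    S * S = 1 := by
  refine Matrix.ext_of_mulVec_single fun i => ?_
  rw [← mulVec_mulVec, h, one_mulVec]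

theorem exists_large_coordinate (hW : 0 < W) {a : Fin W → ℂ} (ha : nsq a = 1) :
    ∃ i, 1 / (W : ℝ) ≤ ‖a i‖ ^ 2 := by
  by_contra h
  push Not at h
  have : nsq a < ∑ _i : Fin W, 1 / (W : ℝ) :=
    Finset.sum_lt_sum_of_nonempty ⟨⟨0, hW⟩, Finset.mem_univ _⟩ fun i _ => h i
  have hW' : (W : ℝ) ≠ 0 := by positivity
  rw [ha] at this
  simp [hW'] at this

theorem norm_coordinate_le {a : Fin W → ℂ} (ha : nsq a = 1) (i : Fin W) : ‖a i‖ ≤ 1 := by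
  have : ‖a i‖ ^ 2 ≤ 1 := by
    rw [← ha]
    exact Finset.single_le_sum (f := fun i => ‖a i‖ ^ 2) (fun _ _ => by positivity)
      (Finset.mem_univ i)
  nlinarith [norm_nonneg (a i)]

/-- Any two unit vectors are related, up to a uniformly nonzero overlap, by a real symmetric
involution. -/
theorem exists_involution (hW : 0 < W) {a b : Fin W → ℂ} (ha : nsq a = 1) (hb : nsq b = 1) :
    ∃ S : Fin W → Fin W → ℝ, (∀ i j, |S i j| ≤ 1) ∧ (∀ i j, S i j = S j i) ∧
      complexify S * complexify S = 1 ∧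
      1 / (5 * (W : ℝ) ^ 2 + 1) ≤ ‖star a ⬝ᵥ (complexify S *ᵥ b)‖ := by
  -- Suppose the identity, all coordinate reflections and all transpositions have overlap below `ε`.
  -- Identity against reflection makes each `conj (a i) * b i` small; transpositions then make `conj
  -- (a i) * b j + conj (a j) * b i` small. At a large coordinate of `a` this makes every coordinate
  -- of `b` small, although `b` is a unit vector.
  by_contra hcon
  push Not at hcon
  set ε : ℝ := 1 / (5 * (W : ℝ) ^ 2 + 1) with hε
  have hε0 : 0 < ε := by positivity
  have h1 : ‖star a ⬝ᵥ b‖ < ε := by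
    have := hcon (1 : Matrix (Fin W) (Fin W) ℝ)
      (fun i j => by rw [Matrix.one_apply]; split_ifs <;> simp)
      (fun i j => by simp only [Matrix.one_apply, eq_comm])
      (by rw [complexify_one, one_mul])
    rwa [complexify_one, one_mulVec] at this
  have h2 : ∀ i, ‖star (a i) * b i‖ < ε := by
    intro i
    have hS := complexify_reflection (W := W) i
    have := hcon (Matrix.diagonal fun k => if k = i then (-1 : ℝ) else 1)
      (fun k l => by rw [Matrix.diagonal_apply]; split_ifs <;> simp)
      (fun k l => by
        by_cases h : k = l
        · subst h; rfl
        · rw [Matrix.diagonal_apply_ne _ h, Matrix.diagonal_apply_ne _ (Ne.symm h)])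
      (mul_self_eq_one_of_mulVec fun b => by
        rw [hS, hS]; ext k; by_cases h : k = i <;> simp [h])
    rw [hS] at this
    have e : star a ⬝ᵥ b - star a ⬝ᵥ (fun k => if k = i then -b k else b k) =
        2 * (star (a i) * b i) := by
      rw [← dotProduct_sub, dotProduct, Finset.sum_eq_single i]
      · simp; ring
      · intro j _ hj; simp [hj]
      · simp
    have h3 := norm_sub_le (star a ⬝ᵥ b) (star a ⬝ᵥ (fun k => if k = i then -b k else b k))
    rw [e, norm_mul] at h3
    norm_num at h3 ⊢
    linarith
  have h3 : ∀ i j, i ≠ j → ‖star (a i) * b j + star (a j) * b i‖ < 4 * ε := by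
    intro i j hij
    have hS := complexify_swapMat (W := W) i j
    have := hcon (swapMat i j)
      (fun k l => by rw [swapMat]; split_ifs <;> simp)
      (fun k l => by
        simp only [swapMat]
        congr 1
        rw [eq_iff_iff]
        constructor <;> (rintro rfl; simp))
      (mul_self_eq_one_of_mulVec fun b => by rw [hS, hS]; ext k; simp)
    rw [hS] at this
    have e : star a ⬝ᵥ (fun k => b (Equiv.swap i j k)) - star a ⬝ᵥ b =
        (star (a i) * b j + star (a j) * b i) - (star (a i) * b i + star (a j) * b j) := by
      rw [← dotProduct_sub, dotProduct, Fintype.sum_eq_add i j hij]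
      · simp; ring
      · rintro k ⟨hk, hk'⟩
        simp [Equiv.swap_apply_of_ne_of_ne hk hk']
    have e' : star (a i) * b j + star (a j) * b i =
        (star a ⬝ᵥ (fun k => b (Equiv.swap i j k)) - star a ⬝ᵥ b) +
          (star (a i) * b i + star (a j) * b j) := by rw [e]; ring
    rw [e']
    have n1 := norm_add_le (star a ⬝ᵥ (fun k => b (Equiv.swap i j k)) - star a ⬝ᵥ b)
      (star (a i) * b i + star (a j) * b j)
    have n2 := norm_sub_le (star a ⬝ᵥ (fun k => b (Equiv.swap i j k))) (star a ⬝ᵥ b)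
    have n3 := norm_add_le (star (a i) * b i) (star (a j) * b j)
    linarith [h2 i, h2 j]
  obtain ⟨i, hi⟩ := exists_large_coordinate hW ha
  have hai := norm_coordinate_le ha i
  have hW' : (0 : ℝ) < W := by exact_mod_cast hW
  have h4 : ∀ j, ‖b j‖ ≤ 5 * W * ε := by
    intro j
    have hn : ∀ k l, ‖star (a k) * b l‖ = ‖a k‖ * ‖b l‖ := fun k l => by
      rw [norm_mul, norm_star]
    have h5 : ‖a i‖ ^ 2 * ‖b j‖ ≤ 5 * ε := by
      have hij : ‖a i‖ * ‖b j‖ ≤ 4 * ε + ‖a j‖ * ‖b i‖ := by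
        by_cases h : i = j
        · subst h
          linarith
        · have n1 := norm_sub_le (star (a i) * b j + star (a j) * b i) (star (a j) * b i)
          rw [add_sub_cancel_right, hn, hn] at n1
          linarith [h3 i j h]
      have h6 := h2 i
      rw [hn] at h6
      have haj := norm_coordinate_le ha j
      have hbi := norm_nonneg (b i)
      have hai0 := norm_nonneg (a i)
      calc ‖a i‖ ^ 2 * ‖b j‖ = ‖a i‖ * (‖a i‖ * ‖b j‖) := by ring
        _ ≤ ‖a i‖ * (4 * ε + ‖a j‖ * ‖b i‖) := by gcongr
        _ = ‖a i‖ * (4 * ε) + ‖a j‖ * (‖a i‖ * ‖b i‖) := by ring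
        _ ≤ 1 * (4 * ε) + 1 * ε := by gcongr
        _ = 5 * ε := by ring
    have h7 : 1 / (W : ℝ) * ‖b j‖ ≤ 5 * ε := le_trans (by gcongr) h5
    calc ‖b j‖ = W * (1 / (W : ℝ) * ‖b j‖) := by field_simp
      _ ≤ W * (5 * ε) := by gcongr
      _ = _ := by ring
  obtain ⟨j, hj⟩ := exists_large_coordinate hW hb
  -- With the chosen `ε` this would read `(5 W ^ 2 + 1) ^ 2 ≤ 25 W ^ 3`, which fails for `W ≥ 1`.
  have h5 : 1 / (W : ℝ) ≤ (5 * W * ε) ^ 2 := hj.trans (by gcongr; exact h4 j)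
  rw [hε] at h5
  have h6 : (5 * (W : ℝ) * (1 / (5 * (W : ℝ) ^ 2 + 1))) ^ 2 = 25 * W ^ 2 / (5 * (W : ℝ) ^ 2 + 1) ^ 2 := by
    field_simp; ring
  rw [h6, div_le_div_iff₀ hW' (by positivity)] at h5
  have hW1 : (1 : ℝ) ≤ W := by exact_mod_cast hW
  nlinarith [pow_pos hW' 2, pow_pos hW' 3, mul_le_mul_of_nonneg_left hW1 (pow_pos hW' 3).le]

open Polynomial in
theorem exists_roots (p : ℂ[X]) : ∃ r : Fin p.natDegree → ℂ,
    ∀ s, p.eval s = p.leadingCoeff * ∏ i, (s - r i) := by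
  have hs : p.Splits := IsAlgClosed.splits p
  have hc : p.roots.toList.length = p.natDegree := by
    rw [Multiset.length_toList, hs.natDegree_eq_card_roots]
  refine ⟨fun i => p.roots.toList.get (i.cast hc.symm), fun s => ?_⟩
  rw [hs.eval_eq_prod_roots]
  congr 1
  conv_lhs => rw [← Multiset.coe_toList p.roots, Multiset.map_coe, Multiset.prod_coe]
  rw [← List.prod_ofFn]
  congr 1
  apply List.ext_get
  · simp [hc]
  · intro n h1 h2
    simp

open Polynomial in
/-- The numerator of the resolvent along a direction given by an involution is a polynomial with
a known leading coefficient. -/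
theorem exists_numerator (hW : 0 < W) {S M : Matrix (Fin W) (Fin W) ℂ} (hS : S * S = 1)
    (a b : Fin W → ℂ) (hab : star a ⬝ᵥ (S *ᵥ b) ≠ 0) :
    ∃ r : Fin (W - 1) → ℂ, ∀ s : ℂ, IsUnit (M + s • S).det →
      ‖star a ⬝ᵥ ((M + s • S)⁻¹ *ᵥ b)‖ * ‖(M + s • S).det‖ =
        ‖star a ⬝ᵥ (S *ᵥ b)‖ * ∏ i, ‖s - r i‖ := by
  have hne : Nonempty (Fin W) := ⟨⟨0, hW⟩⟩
  -- Since `S` is an involution, `M + s S = S (s + T)`. By the determinant lemma for the rank one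
  -- matrix `R`, the numerator is `det (s + T + R) - det (s + T)`, a difference of two monic
  -- polynomials of degree `W`; its coefficient of degree `W - 1` is `trace R = ⟨a, S b⟩`.
  set T := S * M with hT
  set R := vecMulVec (S *ᵥ b) (star a) with hR
  set p : ℂ[X] := (-(T + R)).charpoly - (-T).charpoly with hp
  have hcoeff : p.coeff (W - 1) = star a ⬝ᵥ (S *ᵥ b) := by
    have h1 := trace_eq_neg_charpoly_coeff (-(T + R))
    have h2 := trace_eq_neg_charpoly_coeff (-T)
    rw [Fintype.card_fin] at h1 h2
    rw [hp, coeff_sub]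
    have h3 : trace R = star a ⬝ᵥ (S *ᵥ b) := by
      rw [hR, trace_vecMulVec, dotProduct_comm]
    rw [← h3]
    have h4 : trace (-(T + R)) = trace (-T) - trace R := by
      rw [trace_neg, trace_add, trace_neg]; ring
    rw [h4] at h1
    linear_combination h1 - h2
  have hp0 : p ≠ 0 := by
    intro h; rw [h, coeff_zero] at hcoeff; exact hab hcoeff.symm
  have hdeg : p.natDegree = W - 1 := by
    refine le_antisymm ?_ (le_natDegree_of_ne_zero (by rw [hcoeff]; exact hab))
    have h1 : p.degree < W := by
      have := degree_sub_lt_left (p := (-(T + R)).charpoly) (q := (-T).charpoly)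
        (by rw [charpoly_degree_eq_dim, charpoly_degree_eq_dim])
        (charpoly_monic _).ne_zero
        (by rw [(charpoly_monic _).leadingCoeff, (charpoly_monic _).leadingCoeff])
      rwa [charpoly_degree_eq_dim, Fintype.card_fin] at this
    have := (natDegree_lt_iff_degree_lt hp0).2 h1
    omega
  obtain ⟨r, hr⟩ := exists_roots p
  refine ⟨fun i => r (i.cast hdeg.symm), fun s hs => ?_⟩
  have hfac : M + s • S = S * (s • (1 : Matrix (Fin W) (Fin W) ℂ) + T) := by
    rw [mul_add, hT, ← Matrix.mul_assoc, hS, one_mul, Matrix.mul_smul, mul_one, add_comm]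
  set D := s • (1 : Matrix (Fin W) (Fin W) ℂ) + T with hD
  have hdetS : S.det * S.det = 1 := by rw [← det_mul, hS, det_one]
  have hnS : ‖S.det‖ = 1 := by
    have := congrArg norm hdetS
    rw [norm_mul, norm_one] at this
    nlinarith [norm_nonneg S.det]
  have hSinv : S⁻¹ = S := inv_eq_left_inv hS
  have hDu : IsUnit D.det := by
    rw [hfac, det_mul] at hs
    exact isUnit_of_mul_isUnit_right hs
  have e1 : star a ⬝ᵥ ((M + s • S)⁻¹ *ᵥ b) = star a ⬝ᵥ (D⁻¹ *ᵥ (S *ᵥ b)) := by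
    rw [hfac, Matrix.mul_inv_rev, hSinv, mulVec_mulVec]
  have e2 : ‖(M + s • S).det‖ = ‖D.det‖ := by
    rw [hfac, det_mul, norm_mul, hnS, one_mul]
  have ev : ∀ N : Matrix (Fin W) (Fin W) ℂ, (-N).charpoly.eval s =
      (s • (1 : Matrix (Fin W) (Fin W) ℂ) + N).det := by
    intro N
    rw [Matrix.eval_charpoly]
    congr 1
    ext i j
    simp [Matrix.one_apply, Matrix.diagonal_apply, Matrix.scalar_apply]
  have e3 : p.eval s = (star a ⬝ᵥ (D⁻¹ *ᵥ (S *ᵥ b))) * D.det := by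
    rw [hp, eval_sub, ev, ev, ← add_assoc, ← hD, hR]
    have h1 : (D + vecMulVec (S *ᵥ b) (star a)).det =
        D.det * (1 + star a ⬝ᵥ (D⁻¹ *ᵥ (S *ᵥ b))) := by
      have h2 : D + vecMulVec (S *ᵥ b) (star a) =
          D * (1 + vecMulVec (D⁻¹ *ᵥ (S *ᵥ b)) (star a)) := by
        rw [mul_add, mul_one, Matrix.mul_vecMulVec, mulVec_mulVec, mul_nonsing_inv _ hDu,
          one_mulVec]
      rw [h2, det_mul]
      congr 1
      rw [vecMulVec_eq Unit, det_one_add_replicateCol_mul_replicateRow]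
    rw [h1]; ring
  have hl : p.leadingCoeff = star a ⬝ᵥ (S *ᵥ b) := by
    rw [leadingCoeff, hdeg, hcoeff]
  rw [e1, e2, ← norm_mul, ← e3, hr, norm_mul, hl, norm_prod]
  congr 1
  exact (Fintype.prod_equiv (finCongr hdeg.symm) _ _ fun i => rfl).symm

end LowerBound


/-! ### Lower logarithmic moments of matrix elements of the inverse. -/

section LowerBoundIntegral

open scoped Matrix.Norms.L2Operator NNReal ENNReal
open Real (posLog)

theorem posLog_norm_det_le (N : Matrix (Fin W) (Fin W) ℂ) :
    posLog ‖N.det‖ ≤ Real.log (W.factorial) + W * posLog ‖N‖ := by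
  have h := Matrix.det_le (A := N) (abv := ⟨⟨fun x : ℂ => ‖x‖, norm_mul⟩, norm_nonneg,
    fun _ => norm_eq_zero, norm_add_le⟩) (x := ‖N‖) fun i j => norm_entry_le N i j
  change ‖N.det‖ ≤ _ at h
  rw [Fintype.card_fin, nsmul_eq_mul] at h
  refine (Real.posLog_le_posLog (norm_nonneg _) h).trans ?_
  rw [← Real.posLog_pow]
  exact Real.posLog_nat_mul

theorem posLog_le_self {x : ℝ} (hx : 0 ≤ x) : posLog x ≤ x := by
  rw [Real.posLog_apply]
  exact max_le hx (Real.log_le_self hx)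

/-- Along the involution the matrix element is a polynomial with `W - 1` roots and leading
coefficient of modulus at least `κ`, divided by a determinant. Its reciprocal is thus controlled by
the determinant and the distances to the roots. -/
theorem norm_form_inv_le {S M : Matrix (Fin W) (Fin W) ℂ} (hM : IsDissipative M)
    (hW : 0 < W) (hS : S * S = 1) (hSh : S.IsHermitian) {a b : Fin W → ℂ} {κ : ℝ} (hκ : 0 < κ)
    (hab : κ ≤ ‖star a ⬝ᵥ (S *ᵥ b)‖) {lam : ℝ} (hlam : 0 < lam) :
    ∃ r : Fin (W - 1) → ℂ, ∀ s : ℝ, (∀ i, (s : ℂ) - r i ≠ 0) →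
      star a ⬝ᵥ ((M + ((lam * s : ℝ) : ℂ) • S)⁻¹ *ᵥ b) ≠ 0 ∧
      posLog ‖star a ⬝ᵥ ((M + ((lam * s : ℝ) : ℂ) • S)⁻¹ *ᵥ b)‖⁻¹ ≤
        posLog ‖(M + ((lam * s : ℝ) : ℂ) • S).det‖ + (posLog κ⁻¹ + W * posLog lam⁻¹) +
          ∑ i, posLog ‖(s : ℂ) - r i‖⁻¹ := by
  have hl : (lam : ℂ) ≠ 0 := by exact_mod_cast hlam.ne'
  have h0 : 0 < ‖star a ⬝ᵥ (S *ᵥ b)‖ := hκ.trans_le hab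
  obtain ⟨r, hr⟩ := exists_numerator hW (M := M) hS a b (norm_pos_iff.1 h0)
  refine ⟨fun i => r i / lam, fun s hs => ?_⟩
  have hH : (((lam * s : ℝ) : ℂ) • S).IsHermitian := by
    unfold Matrix.IsHermitian at *
    rw [conjTranspose_smul, hSh]; simp
  have hd : IsUnit (M + ((lam * s : ℝ) : ℂ) • S).det := by
    rw [add_comm]; exact (hM.add_hermitian hH).isUnit_det
  have h1 := hr _ hd
  set D := ‖(M + ((lam * s : ℝ) : ℂ) • S).det‖ with hD
  have hDpos : 0 < D := norm_pos_iff.2 hd.ne_zero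
  have h2 : ∀ i, ‖((lam * s : ℝ) : ℂ) - r i‖ = lam * ‖(s : ℂ) - r i / lam‖ := by
    intro i
    have : ((lam * s : ℝ) : ℂ) - r i = lam * ((s : ℂ) - r i / lam) := by
      push_cast; field_simp
    rw [this, norm_mul, Complex.norm_real, Real.norm_of_nonneg hlam.le]
  simp only [h2] at h1
  have hP : 0 < ∏ i, lam * ‖(s : ℂ) - r i / lam‖ :=
    Finset.prod_pos fun i _ => mul_pos hlam (norm_pos_iff.2 (hs i))
  set F := ‖star a ⬝ᵥ ((M + ((lam * s : ℝ) : ℂ) • S)⁻¹ *ᵥ b)‖ with hF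
  have hFpos : F ≠ 0 := by
    intro h
    rw [h, zero_mul] at h1
    exact (mul_pos h0 hP).ne h1
  refine ⟨norm_ne_zero_iff.1 hFpos, ?_⟩
  have h3 : F⁻¹ = D * (‖star a ⬝ᵥ (S *ᵥ b)‖⁻¹ * ∏ i, (lam⁻¹ * ‖(s : ℂ) - r i / lam‖⁻¹)) := by
    have : ∏ i, (lam⁻¹ * ‖(s : ℂ) - r i / lam‖⁻¹) = (∏ i, lam * ‖(s : ℂ) - r i / lam‖)⁻¹ := by
      rw [← Finset.prod_inv_distrib]
      simp only [mul_inv]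
    rw [this, ← mul_inv, ← h1, mul_inv]
    field_simp
  rw [h3]
  refine Real.posLog_mul.trans ?_
  rw [add_assoc]
  gcongr
  refine Real.posLog_mul.trans ?_
  have h4 : posLog ‖star a ⬝ᵥ (S *ᵥ b)‖⁻¹ ≤ posLog κ⁻¹ :=
    Real.posLog_le_posLog (by positivity) (inv_anti₀ hκ hab)
  have h5 : posLog (∏ i, (lam⁻¹ * ‖(s : ℂ) - r i / lam‖⁻¹)) ≤
      W * posLog lam⁻¹ + ∑ i, posLog ‖(s : ℂ) - r i / lam‖⁻¹ := by
    refine (Real.posLog_prod _ _).trans ?_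
    refine (Finset.sum_le_sum fun i _ => Real.posLog_mul).trans ?_
    rw [Finset.sum_add_distrib]
    gcongr
    rw [Finset.sum_const, Finset.card_univ, Fintype.card_fin, nsmul_eq_mul]
    gcongr
    · exact Real.posLog_nonneg
    · omega
  linarith

/-- The square of the negative part of the logarithm, equal to `∞` at zero. -/
noncomputable def logSqTop (x : ℝ) : ℝ≥0∞ := if x = 0 then ∞ else ENNReal.ofReal (logSq x)

theorem measurable_logSqTop : Measurable logSqTop :=
  Measurable.ite (measurableSet_singleton 0) measurable_const measurable_logSq.ennreal_ofReal

/-- A bound for the norm of a symmetrized matrix. -/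
noncomputable def entrySum (X : Fin W → Fin W → ℝ) : ℝ := ∑ p : Fin W × Fin W, (|X p.1 p.2| + |X p.2 p.1|)

theorem norm_symMat_le (X : Fin W → Fin W → ℝ) : ‖symMat X‖ ≤ entrySum X := by
  refine (norm_le_sum_entries _).trans ?_
  rw [entrySum, Fintype.sum_prod_type]
  gcongr with i _ j _
  simp only [symMat, of_apply, Complex.norm_real, symmetrize, norm_div, Real.norm_eq_abs]
  have h2 : (1 : ℝ) ≤ Real.sqrt 2 := Real.one_le_sqrt.2 (by norm_num)
  rw [abs_of_nonneg (Real.sqrt_nonneg 2)]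
  exact (div_le_self (abs_nonneg _) h2).trans (abs_add_le _ _)

theorem lintegral_entrySum_sq_lt_top (W : ℕ) (v : ℝ≥0) :
    ∫⁻ X, ENNReal.ofReal (entrySum X ^ 2) ∂(gaussMat W v) < ∞ := by
  have h1 : ∀ X : Fin W → Fin W → ℝ, ENNReal.ofReal (entrySum X ^ 2) ≤
      ((Finset.univ : Finset (Fin W × Fin W)).card + 1 : ℕ) * (0 + ∑ p : Fin W × Fin W,
        (2 * (ENNReal.ofReal (X p.1 p.2 ^ 2) + ENNReal.ofReal (X p.2 p.1 ^ 2)))) := by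
    intro X
    refine (ofReal_sq_le_sum Finset.univ (c := 0)
      (b := fun p : Fin W × Fin W => |X p.1 p.2| + |X p.2 p.1|)
      (Finset.sum_nonneg fun _ _ => by positivity) (zero_add _).ge).trans ?_
    gcongr with p _
    · simp
    · have := ofReal_sq_le_sum {()} (c := |X p.1 p.2|) (b := fun _ => |X p.2 p.1|)
        (a := |X p.1 p.2| + |X p.2 p.1|) (by positivity) (by simp)
      simpa [one_add_one_eq_two] using this
  refine (lintegral_mono h1).trans_lt ?_
  simp only [zero_add]
  have hm : ∀ i j : Fin W, Measurable fun X : Fin W → Fin W → ℝ =>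
      ENNReal.ofReal (X i j ^ 2) := fun i j => by fun_prop
  rw [lintegral_const_mul' _ _ (ENNReal.natCast_ne_top _), lintegral_finsetSum _ fun p _ =>
    ((hm p.1 p.2).add (hm p.2 p.1)).const_mul 2]
  refine ENNReal.mul_lt_top (ENNReal.natCast_lt_top _) (ENNReal.sum_lt_top.2 fun p _ => ?_)
  rw [lintegral_const_mul' _ _ (by simp), lintegral_add_left (hm _ _)]
  exact ENNReal.mul_lt_top (by simp) (ENNReal.add_lt_top.2
    ⟨lintegral_sq_gaussMat_lt_top v _ _, lintegral_sq_gaussMat_lt_top v _ _⟩)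

theorem logSqTop_of_ne_zero {x : ℝ} (hx : x ≠ 0) : logSqTop x = ENNReal.ofReal (logSq x) :=
  if_neg hx

theorem complexify_isHermitian {S : Fin W → Fin W → ℝ} (hS : ∀ i j, S i j = S j i) :
    (complexify S).IsHermitian := by
  ext i j
  simp [complexify, hS j i]

theorem norm_complexify_le {S : Fin W → Fin W → ℝ} (hS : ∀ i j, |S i j| ≤ 1) :
    ‖complexify S‖ ≤ W * W := by
  refine (norm_le_sum_entries _).trans ?_
  calc ∑ i, ∑ j, ‖complexify S i j‖ ≤ ∑ _i : Fin W, ∑ _j : Fin W, (1 : ℝ) := by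
        gcongr with i _ j _
        simp only [complexify, of_apply, Complex.norm_real, Real.norm_eq_abs]
        exact hS i j
    _ = W * W := by simp

/-- The logarithmic moments of the inverse matrix elements of a Gaussian matrix with an arbitrary
dissipative perturbation do not exceed those of the perturbation. -/
theorem lintegral_logSqTop_form_le {W : ℕ} (hW : 0 < W) {lam : ℝ} (hlam : 0 < lam) {v : ℝ≥0}
    (hv : v ≠ 0) :
    ∃ C : ℝ≥0∞, C ≠ ∞ ∧ ∀ Q : Matrix (Fin W) (Fin W) ℂ, IsDissipative Q →
      ∀ a b : Fin W → ℂ, nsq a = 1 → nsq b = 1 →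
      ∫⁻ X, logSqTop ‖star a ⬝ᵥ (((lam : ℂ) • symMat X + Q)⁻¹ *ᵥ b)‖ ∂(gaussMat W v) ≤
        C * (1 + ENNReal.ofReal (posLog ‖Q‖ ^ 2)) := by
  obtain ⟨C, hC, h⟩ := lintegral_le_average (W := W) hv
  set κ : ℝ := 1 / (5 * (W : ℝ) ^ 2 + 1) with hκdef
  have hκ : 0 < κ := by positivity
  set c₀ : ℝ := Real.log W.factorial + W * (Real.log 2 + posLog lam + (Real.log 2 + (W * W : ℝ)) +
    Real.log 2) + (posLog κ⁻¹ + W * posLog lam⁻¹) with hc₀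
  set I := ∫⁻ X, ENNReal.ofReal (entrySum X ^ 2) ∂(gaussMat W (2 * v)) with hI
  have hIt : I ≠ ∞ := (lintegral_entrySum_sq_lt_top W _).ne
  set D : ℝ≥0∞ := ENNReal.ofReal (c₀ ^ 2) + ENNReal.ofReal ((W : ℝ) ^ 2) * I +
    ENNReal.ofReal ((W : ℝ) ^ 2) + (W - 1 : ℕ) * logConst with hD
  have hDt : D ≠ ∞ := by
    refine ENNReal.add_ne_top.2 ⟨ENNReal.add_ne_top.2 ⟨ENNReal.add_ne_top.2
      ⟨ENNReal.ofReal_ne_top, ENNReal.mul_ne_top ENNReal.ofReal_ne_top hIt⟩,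
      ENNReal.ofReal_ne_top⟩, ENNReal.mul_ne_top (by simp) logConst_ne_top⟩
  set n : ℝ≥0∞ := ((W - 1 + 2 + 1 : ℕ) : ℝ≥0∞) with hn
  refine ⟨C * (n * D), ENNReal.mul_ne_top hC (ENNReal.mul_ne_top (by simp [hn]) hDt), ?_⟩
  intro Q hQ a b ha hb
  obtain ⟨S, hS1, hSs, hSS, hSab⟩ := exists_involution hW ha hb
  have hSh := complexify_isHermitian hSs
  have hm : Measurable fun X : Fin W → Fin W → ℝ =>
      logSqTop ‖star a ⬝ᵥ (((lam : ℂ) • symMat X + Q)⁻¹ *ᵥ b)‖ := by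
    have h1 : MeasurableEntries fun X : Fin W → Fin W → ℝ => ((lam : ℂ) • symMat X + Q)⁻¹ :=
      ((measurableEntries_symMat.smul _).add (measurableEntries_const Q)).inv
    have h2 : Continuous fun A : Matrix (Fin W) (Fin W) ℂ => ‖star a ⬝ᵥ (A *ᵥ b)‖ := by
      fun_prop
    exact measurable_logSqTop.comp (h1.comp_continuous h2)
  refine (h S hS1 _ hm).trans ?_
  rw [mul_assoc]
  gcongr
  have key : ∀ X : Fin W → Fin W → ℝ, (∫⁻ s in Set.Icc (0 : ℝ) 1,
      logSqTop ‖star a ⬝ᵥ (((lam : ℂ) • symMat (shiftMat S s X) + Q)⁻¹ *ᵥ b)‖) ≤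
      n * ((ENNReal.ofReal (c₀ ^ 2) + (W - 1 : ℕ) * logConst +
        ENNReal.ofReal ((W : ℝ) ^ 2) * ENNReal.ofReal (posLog ‖Q‖ ^ 2)) +
        ENNReal.ofReal ((W : ℝ) ^ 2) * ENNReal.ofReal (entrySum X ^ 2)) := by
    intro X
    set M := (lam : ℂ) • symMat X + Q with hM
    have hMd : IsDissipative M := hQ.add_hermitian (isHermitian_smul_symMat lam X)
    have hsh : ∀ s : ℝ, (lam : ℂ) • symMat (shiftMat S s X) + Q =
        M + ((lam * s : ℝ) : ℂ) • complexify S := by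
      intro s
      rw [symMat_shiftMat hSs, hM, smul_add, smul_smul, Complex.ofReal_mul, add_right_comm]
      rfl
    simp only [hsh]
    obtain ⟨r, hr⟩ := norm_form_inv_le hMd hW hSS hSh hκ hSab hlam
    -- Roots may be hit only at finitely many shifts, so the value `∞` of `logSqTop` does no harm.
    have hae : ∀ᵐ s : ℝ, ∀ i, (s : ℂ) - r i ≠ 0 := by
      rw [ae_all_iff]
      intro i
      have : ∀ᵐ s : ℝ, s ≠ (r i).re := by simp [ae_iff, measure_singleton]
      filter_upwards [this] with s hs h0
      apply hs
      have := congrArg Complex.re h0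
      simp at this
      linarith
    have hdet : ∀ s ∈ Set.Icc (0 : ℝ) 1,
        posLog ‖(M + ((lam * s : ℝ) : ℂ) • complexify S).det‖ + (posLog κ⁻¹ + W * posLog lam⁻¹) ≤
          c₀ + (W * entrySum X + W * posLog ‖Q‖) := by
      intro s hs
      have h1 := posLog_norm_det_le (M + ((lam * s : ℝ) : ℂ) • complexify S)
      have e : M + ((lam * s : ℝ) : ℂ) • complexify S =
          (lam : ℂ) • (symMat X + (s : ℂ) • complexify S) + Q := by
        rw [hM, smul_add, smul_smul, Complex.ofReal_mul, add_right_comm]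
      have h2 : posLog ‖M + ((lam * s : ℝ) : ℂ) • complexify S‖ ≤
          (posLog lam + (entrySum X + (W * W : ℝ) + Real.log 2)) + posLog ‖Q‖ + Real.log 2 := by
        rw [e]
        refine (Real.posLog_norm_add_le _ _).trans ?_
        refine add_le_add (add_le_add ?_ le_rfl) le_rfl
        rw [norm_smul, Complex.norm_real, Real.norm_of_nonneg hlam.le]
        refine Real.posLog_mul.trans ?_
        refine add_le_add le_rfl ?_
        refine (Real.posLog_norm_add_le _ _).trans ?_
        refine add_le_add (add_le_add ?_ ?_) le_rfl
        · exact (posLog_le_self (norm_nonneg _)).trans (norm_symMat_le X)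
        · refine (posLog_le_self (norm_nonneg _)).trans ?_
          rw [norm_smul, Complex.norm_real, Real.norm_of_nonneg hs.1]
          calc s * ‖complexify S‖ ≤ 1 * (W * W : ℝ) := by
                gcongr
                · exact hs.2
                · exact norm_complexify_le hS1
            _ = _ := one_mul _
      have h3 : (W : ℝ) * posLog ‖M + ((lam * s : ℝ) : ℂ) • complexify S‖ ≤ W *
          ((posLog lam + (entrySum X + (W * W : ℝ) + Real.log 2)) + posLog ‖Q‖ + Real.log 2) := by
        gcongr
      have hl2 : 0 ≤ (W : ℝ) * Real.log 2 := by positivity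
      rw [hc₀]
      linarith
    -- The summands for Cauchy–Schwarz: one per root, and two for the sizes of `X` and `Q`; the
    -- constant `c₀` makes `W - 1 + 2 + 1` terms.
    set b' : Fin (W - 1) ⊕ Fin 2 → ℝ → ℝ := fun i s =>
      Sum.elim (fun i => posLog ‖(s : ℂ) - r i‖⁻¹) ![W * entrySum X, W * posLog ‖Q‖] i with hb'
    calc (∫⁻ s in Set.Icc (0 : ℝ) 1,
          logSqTop ‖star a ⬝ᵥ ((M + ((lam * s : ℝ) : ℂ) • complexify S)⁻¹ *ᵥ b)‖)
        ≤ ∫⁻ s in Set.Icc (0 : ℝ) 1, n * ((ENNReal.ofReal (c₀ ^ 2) +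
            (ENNReal.ofReal ((W : ℝ) ^ 2) * ENNReal.ofReal (entrySum X ^ 2) +
            ENNReal.ofReal ((W : ℝ) ^ 2) * ENNReal.ofReal (posLog ‖Q‖ ^ 2))) +
              ∑ i, ENNReal.ofReal (logSq ‖(s : ℂ) - r i‖)) := by
          refine lintegral_mono_ae ?_
          filter_upwards [ae_restrict_of_ae hae, ae_restrict_mem measurableSet_Icc] with s hs hs'
          obtain ⟨h1, h2⟩ := hr s hs
          rw [logSqTop_of_ne_zero (norm_ne_zero_iff.2 h1), logSq]
          have h3 := ofReal_sq_le_sum (Finset.univ : Finset (Fin (W - 1) ⊕ Fin 2))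
            (c := c₀) (b := fun i => b' i s)
            (a := posLog ‖star a ⬝ᵥ ((M + ((lam * s : ℝ) : ℂ) • complexify S)⁻¹ *ᵥ b)‖⁻¹)
            Real.posLog_nonneg (by
              refine h2.trans ?_
              simp only [hb', Fintype.sum_sum_type, Sum.elim_inl, Sum.elim_inr, Fin.sum_univ_two,
                Matrix.cons_val_zero, Matrix.cons_val_one]
              linarith [hdet s hs'])
          refine h3.trans (le_of_eq ?_)
          rw [Finset.card_univ, Fintype.card_sum, Fintype.card_fin, Fintype.card_fin, hn]
          simp only [hb', Fintype.sum_sum_type, Sum.elim_inl, Sum.elim_inr, Fin.sum_univ_two,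
            Matrix.cons_val_zero, Matrix.cons_val_one, mul_pow,
            ENNReal.ofReal_mul (sq_nonneg (W : ℝ)), logSq]
          ring
      _ ≤ _ := by
          have hmr : ∀ i, Measurable fun s : ℝ => ENNReal.ofReal (logSq ‖(s : ℂ) - r i‖) :=
            fun i => (measurable_logSq.comp (by fun_prop)).ennreal_ofReal
          rw [lintegral_const_mul' _ _ (by simp [hn]), lintegral_add_left measurable_const,
            lintegral_finsetSum _ fun i _ => hmr i]
          refine mul_le_mul' le_rfl ?_
          have h1 : ∑ i, ∫⁻ s in Set.Icc (0 : ℝ) 1, ENNReal.ofReal (logSq ‖(s : ℂ) - r i‖) ≤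
              (W - 1 : ℕ) * logConst := by
            refine (Finset.sum_le_sum fun i _ => lintegral_logSq_sub_le (r i)).trans ?_
            simp
          refine (add_le_add le_rfl h1).trans ?_
          simp only [lintegral_const, Measure.restrict_apply_univ, Real.volume_Icc, sub_zero,
            ENNReal.ofReal_one, mul_one]
          apply le_of_eq
          ring
  refine (lintegral_mono key).trans ?_
  rw [lintegral_const_mul' _ _ (by simp [hn]), lintegral_add_left measurable_const,
    lintegral_const_mul' _ _ ENNReal.ofReal_ne_top, ← hI, lintegral_const, measure_univ, mul_one,
    mul_assoc]
  gcongr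
  rw [hD, mul_add, mul_one]
  generalize ENNReal.ofReal (posLog ‖Q‖ ^ 2) = q
  generalize ENNReal.ofReal ((W : ℝ) ^ 2) = w
  generalize ENNReal.ofReal (c₀ ^ 2) = c
  generalize ((W - 1 : ℕ) : ℝ≥0∞) * logConst = l
  calc c + l + w * q + w * I ≤ (c + w * I + w + l) + w * q := by
        have : c + w * I + w + l + w * q = (c + l + w * q + w * I) + w := by ring
        rw [this]
        exact le_self_add
    _ ≤ _ := by
        gcongr
        calc w ≤ w + (c + w * I + l) := le_self_add
          _ = _ := by ring

end LowerBoundIntegral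


/-! ### Tightness from logarithmic moments, and the deterministic resonance. -/

section Resonance

open scoped Matrix.Norms.L2Operator NNReal ENNReal
open Real (posLog)

theorem measure_le_of_lintegral_le {Ω : Type*} [MeasurableSpace Ω] (μ : Measure Ω) {F : Ω → ℝ≥0∞}
    (hF : Measurable F) {D p : ℝ≥0∞} (hD : D ≠ ∞) (hp : p ≠ 0) (hp' : p ≠ ∞) (h : ∫⁻ ω, F ω ∂μ ≤ D)
    {t : ℝ} (ht : (D / p).toReal + 1 ≤ t) : μ {ω | ENNReal.ofReal t ≤ F ω} ≤ p := by
  have ht0 : 0 < t := lt_of_lt_of_le (by positivity) ht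
  have h1 : ENNReal.ofReal t ≠ 0 := by simpa using ht0
  refine (meas_ge_le_lintegral_div hF.aemeasurable h1 ENNReal.ofReal_ne_top).trans ?_
  refine ENNReal.div_le_of_le_mul (h.trans ?_)
  have h2 : D / p ≤ ENNReal.ofReal t := by
    rw [← ENNReal.ofReal_toReal (ENNReal.div_ne_top hD hp)]
    exact ENNReal.ofReal_le_ofReal (by linarith)
  calc D = p * (D / p) := (ENNReal.mul_div_cancel hp hp').symm
    _ ≤ p * ENNReal.ofReal t := by gcongr

/-- A tightness bound from a logarithmic moment. -/
theorem exists_upper_threshold {D p : ℝ≥0∞} (hD : D ≠ ∞) (hp : p ≠ 0) (hp' : p ≠ ∞) :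
    ∃ Λ : ℝ, 1 ≤ Λ ∧ ∀ {Ω : Type} [MeasurableSpace Ω] (μ : Measure Ω) {f : Ω → ℝ}, Measurable f →
      ∫⁻ ω, ENNReal.ofReal (posLog (f ω) ^ 2) ∂μ ≤ D → μ {ω | Λ < f ω} ≤ p := by
  set t := (D / p).toReal + 1 with ht
  have ht0 : 0 < t := by positivity
  refine ⟨Real.exp (Real.sqrt t), Real.one_le_exp (Real.sqrt_nonneg _), fun μ f hf h => ?_⟩
  refine (measure_mono fun ω hω => ?_).trans (measure_le_of_lintegral_le μ
    ((Real.continuous_posLog.measurable.comp hf).pow_const 2).ennreal_ofReal hD hp hp' h ht.ge)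
  refine ENNReal.ofReal_le_ofReal ?_
  have h1 : Real.exp (Real.sqrt t) < f ω := hω
  have h2 : Real.sqrt t ≤ posLog (f ω) := by
    rw [Real.posLog_apply]
    exact le_max_of_le_right ((Real.le_log_iff_exp_le ((Real.exp_pos _).trans h1)).2 h1.le)
  calc t = Real.sqrt t ^ 2 := (Real.sq_sqrt ht0.le).symm
    _ ≤ posLog (f ω) ^ 2 := by gcongr

/-- A lower tightness bound from a negative logarithmic moment. -/
theorem exists_lower_threshold {D p : ℝ≥0∞} (hD : D ≠ ∞) (hp : p ≠ 0) (hp' : p ≠ ∞) :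
    ∃ κ : ℝ, 0 < κ ∧ ∀ {Ω : Type} [MeasurableSpace Ω] (μ : Measure Ω) {f : Ω → ℝ}, Measurable f →
      (∀ ω, 0 ≤ f ω) → ∫⁻ ω, logSqTop (f ω) ∂μ ≤ D → μ {ω | f ω < κ} ≤ p := by
  set t := (D / p).toReal + 1 with ht
  have ht0 : 0 < t := by positivity
  refine ⟨Real.exp (-Real.sqrt t), Real.exp_pos _, fun μ f hf hf0 h => ?_⟩
  refine (measure_mono fun ω hω => ?_).trans (measure_le_of_lintegral_le μ
    (measurable_logSqTop.comp hf) hD hp hp' h ht.ge)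
  change ENNReal.ofReal t ≤ logSqTop (f ω)
  -- At a zero the convention `0⁻¹ = 0` would make `logSq` vanish and miss the event; `logSqTop` is
  -- `∞` there.
  by_cases h0 : f ω = 0
  · simp [logSqTop, h0]
  rw [logSqTop_of_ne_zero h0]
  have hpos : 0 < f ω := lt_of_le_of_ne (hf0 ω) (Ne.symm h0)
  refine ENNReal.ofReal_le_ofReal ?_
  have h1 : f ω < Real.exp (-Real.sqrt t) := hω
  have h2 : Real.sqrt t ≤ posLog (f ω)⁻¹ := by
    rw [Real.posLog_apply, Real.log_inv]
    have := (Real.log_lt_iff_lt_exp hpos).2 h1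
    exact le_max_of_le_right (by linarith)
  calc t = Real.sqrt t ^ 2 := (Real.sq_sqrt ht0.le).symm
    _ ≤ posLog (f ω)⁻¹ ^ 2 := by gcongr

theorem form_inv_add_single {N : Matrix (Fin W) (Fin W) ℂ} (hN : IsUnit N.det) (k : Fin W) (s : ℂ)
    (h : 1 + s * N⁻¹ k k ≠ 0) (a b : Fin W → ℂ) :
    star a ⬝ᵥ ((N + Matrix.single k k s)⁻¹ *ᵥ b) = star a ⬝ᵥ (N⁻¹ *ᵥ b) -
      s / (1 + s * N⁻¹ k k) * ((star a ⬝ᵥ (N⁻¹ *ᵥ Pi.single k 1)) *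
        (star (Pi.single k 1) ⬝ᵥ (N⁻¹ *ᵥ b))) := by
  have h1 : (N + Matrix.single k k s)⁻¹ = N⁻¹ - (s / (1 + s * N⁻¹ k k)) •
      vecMulVec (N⁻¹ *ᵥ Pi.single k 1) (N⁻¹ k) := by
    ext i j
    rw [inv_add_single hN k s h]
    simp [vecMulVec_apply]
  rw [h1, sub_mulVec, smul_mulVec, dotProduct_sub, dotProduct_smul, vecMulVec_mulVec,
    dotProduct_smul]
  simp only [smul_eq_mul, MulOpposite.smul_eq_mul_unop, MulOpposite.unop_op]
  congr 3
  rw [← Pi.single_star]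
  simp [mulVec]

theorem inv_sub_conjTranspose {N : Matrix (Fin W) (Fin W) ℂ} (hN : IsUnit N.det) :
    N⁻¹ - (N⁻¹)ᴴ = (N⁻¹)ᴴ * (Nᴴ - N) * N⁻¹ := by
  have h1 : N * N⁻¹ = 1 := mul_nonsing_inv _ hN
  have h2 : (N⁻¹)ᴴ * Nᴴ = 1 := by rw [← conjTranspose_mul, h1, conjTranspose_one]
  rw [mul_sub, sub_mul, h2, one_mul, Matrix.mul_assoc, h1, mul_one]

theorem norm_inv_sub_conjTranspose_le {N : Matrix (Fin W) (Fin W) ℂ} (hN : IsUnit N.det) :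
    ‖N⁻¹ - (N⁻¹)ᴴ‖ ≤ ‖N⁻¹‖ ^ 2 * ‖N - Nᴴ‖ := by
  rw [inv_sub_conjTranspose hN]
  refine (norm_mul_le _ _).trans ?_
  have h1 : ‖(N⁻¹)ᴴ * (Nᴴ - N)‖ ≤ ‖N⁻¹‖ * ‖N - Nᴴ‖ := by
    refine (norm_mul_le _ _).trans ?_
    rw [l2_opNorm_conjTranspose, norm_sub_rev]
  calc _ ≤ ‖N⁻¹‖ * ‖N - Nᴴ‖ * ‖N⁻¹‖ := by gcongr
    _ = _ := by ring

/-- Moving one diagonal entry produces a resonance at a controlled position. -/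
theorem exists_resonance {N : Matrix (Fin W) (Fin W) ℂ} (hN : IsDissipative N) (k : Fin W)
    {v : Fin W → ℂ} (hv : nsq v = 1) {lam κ Λ τ : ℝ} (hlam : 0 < lam) (hκ : 0 < κ)
    (hΛ : ‖N⁻¹‖ ≤ Λ) (hτ : 1 ≤ τ) (hγ : κ ≤ ‖N⁻¹ k k‖)
    (hα : κ ≤ ‖star v ⬝ᵥ (N⁻¹ *ᵥ Pi.single k 1)‖)
    (hβ : κ ≤ ‖star (Pi.single k 1) ⬝ᵥ (N⁻¹ *ᵥ v)‖) {ρ : ℝ}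
    (hρ : ρ = κ ^ 2 / (lam * Λ ^ 2 * (1 + (Λ + Λ ^ 2 / κ))))
    (him : ‖N - Nᴴ‖ ≤ lam * κ ^ 2 * ρ / (2 * Λ ^ 2) / τ) :
    ∃ s₀ : ℝ, |s₀| ≤ 1 / (lam * κ) ∧ ∀ s : ℝ, |s - s₀| ≤ ρ / (2 * τ) →
      τ ≤ ‖star v ⬝ᵥ ((N + Matrix.single k k ((lam * s : ℝ) : ℂ))⁻¹ *ᵥ v)‖ := by
  have hΛ0 : 0 < Λ := (hκ.trans_le hγ).trans_le ((norm_entry_le _ k k).trans hΛ)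
  have hτ0 : 0 < τ := by linarith
  have him0 := hN.inv_diag_im_pos k
  have hf : ‖star v ⬝ᵥ (N⁻¹ *ᵥ v)‖ ≤ Λ := (norm_form_le _ hv hv).trans hΛ
  have hαΛ : ‖star v ⬝ᵥ (N⁻¹ *ᵥ Pi.single k 1)‖ ≤ Λ := (norm_form_le _ hv (nsq_single k)).trans hΛ
  have hβΛ : ‖star (Pi.single k 1) ⬝ᵥ (N⁻¹ *ᵥ v)‖ ≤ Λ :=
    (norm_form_le _ (nsq_single k) hv).trans hΛ
  have hγΛ : ‖N⁻¹ k k‖ ≤ Λ := (norm_entry_le _ k k).trans hΛ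
  have hform := form_inv_add_single hN.isUnit_det k (a := v) (b := v)
  -- The skew part of `N⁻¹` is at most `‖N⁻¹‖ ^ 2 ‖N - N*‖`, so near-Hermiticity of `N` puts the
  -- pole close to the real axis.
  have himγ : (N⁻¹ k k).im ≤ Λ ^ 2 * (lam * κ ^ 2 * ρ / (2 * Λ ^ 2) / τ) := by
    have h1 := norm_inv_sub_conjTranspose_le hN.isUnit_det
    have h2 := (norm_entry_le (N⁻¹ - (N⁻¹)ᴴ) k k).trans h1
    rw [Matrix.sub_apply, conjTranspose_apply] at h2
    have h3 : (N⁻¹ k k - star (N⁻¹ k k)).im = 2 * (N⁻¹ k k).im := by simp; ring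
    have h4 := (le_abs_self _).trans (Complex.abs_im_le_norm (N⁻¹ k k - star (N⁻¹ k k)))
    rw [h3] at h4
    have h5 : ‖N⁻¹‖ ^ 2 * ‖N - Nᴴ‖ ≤ Λ ^ 2 * (lam * κ ^ 2 * ρ / (2 * Λ ^ 2) / τ) := by
      gcongr
    linarith
  generalize N⁻¹ k k = γ at *
  generalize star v ⬝ᵥ (N⁻¹ *ᵥ v) = f₀ at *
  generalize star v ⬝ᵥ (N⁻¹ *ᵥ Pi.single k 1) = α at *
  generalize star (Pi.single k 1) ⬝ᵥ (N⁻¹ *ᵥ v) = β at *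
  have hγ0 : γ ≠ 0 := norm_pos_iff.1 (hκ.trans_le hγ)
  have hlam' : (lam : ℂ) ≠ 0 := by exact_mod_cast hlam.ne'
  have hρ0 : 0 < ρ := by rw [hρ]; positivity
  -- The real part of the pole `-1 / (lam γ)` of the Möbius function of `s`.
  refine ⟨-((lam * γ)⁻¹).re, ?_, fun s hs => ?_⟩
  · rw [abs_neg]
    refine (Complex.abs_re_le_norm _).trans ?_
    rw [norm_inv, norm_mul, Complex.norm_real, Real.norm_of_nonneg hlam.le, one_div]
    gcongr
  · have hne : 1 + ((lam * s : ℝ) : ℂ) * γ ≠ 0 := one_add_real_mul_ne_zero him0 _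
    rw [hform _ hne]
    have hδ : |((lam * γ)⁻¹).im| ≤ ρ / (2 * τ) := by
      have e : ((lam * γ)⁻¹).im = -(γ.im / (lam * ‖γ‖ ^ 2)) := by
        rw [mul_inv, ← Complex.ofReal_inv, Complex.im_ofReal_mul, Complex.inv_im,
          Complex.normSq_eq_norm_sq]
        field_simp
      rw [e, abs_neg, abs_of_nonneg (by positivity), div_le_iff₀ (by positivity)]
      calc γ.im ≤ Λ ^ 2 * (lam * κ ^ 2 * ρ / (2 * Λ ^ 2) / τ) := himγ
        _ = ρ / (2 * τ) * (lam * κ ^ 2) := by field_simp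
        _ ≤ ρ / (2 * τ) * (lam * ‖γ‖ ^ 2) := by gcongr
    have hden : ‖1 + ((lam * s : ℝ) : ℂ) * γ‖ ≤ lam * Λ * (ρ / τ) := by
      have e : 1 + ((lam * s : ℝ) : ℂ) * γ = lam * γ * (s + (lam * γ)⁻¹) := by
        push_cast; field_simp; ring
      have h1 : ‖(s : ℂ) + (lam * γ)⁻¹‖ ≤ ρ / τ := by
        refine (Complex.norm_le_abs_re_add_abs_im _).trans ?_
        simp only [Complex.add_re, Complex.ofReal_re, Complex.add_im, Complex.ofReal_im, zero_add]
        rw [sub_neg_eq_add] at hs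
        calc _ ≤ ρ / (2 * τ) + ρ / (2 * τ) := add_le_add hs hδ
          _ = ρ / τ := by field_simp; ring
      rw [e, norm_mul, norm_mul, Complex.norm_real, Real.norm_of_nonneg hlam.le]
      gcongr
    -- Partial fractions: a singular term minus a constant bounded by `Λ ^ 2 / κ + Λ`. The value of
    -- `ρ` makes the singular term at least `(1 + Λ + Λ ^ 2 / κ) τ`, which beats `τ` plus that
    -- constant because `τ ≥ 1`.
    have e2 : f₀ - ((lam * s : ℝ) : ℂ) / (1 + ((lam * s : ℝ) : ℂ) * γ) * (α * β) =
        α * β / γ / (1 + ((lam * s : ℝ) : ℂ) * γ) - (α * β / γ - f₀) := by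
      generalize ((lam * s : ℝ) : ℂ) = t at *
      field_simp
      ring
    have h2 : ‖α * β / γ - f₀‖ ≤ Λ ^ 2 / κ + Λ := by
      refine (norm_sub_le _ _).trans (add_le_add ?_ hf)
      rw [norm_div, norm_mul, sq]
      gcongr
    have h3 : (1 + (Λ + Λ ^ 2 / κ)) * τ ≤ ‖α * β / γ / (1 + ((lam * s : ℝ) : ℂ) * γ)‖ := by
      rw [norm_div, norm_div, norm_mul]
      calc (1 + (Λ + Λ ^ 2 / κ)) * τ = κ * κ / Λ / (lam * Λ * (ρ / τ)) := by
            rw [hρ]; field_simp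
        _ ≤ _ := by
            gcongr
    rw [e2]
    have h4 := norm_sub_norm_le (α * β / γ / (1 + ((lam * s : ℝ) : ℂ) * γ)) (α * β / γ - f₀)
    have h5 : 0 ≤ (Λ + Λ ^ 2 / κ) * (τ - 1) := mul_nonneg (by positivity) (by linarith)
    nlinarith

end Resonance


/-! ### Probability of a resonance at a single site. -/

section ResonanceProbability

open scoped Matrix.Norms.L2Operator NNReal ENNReal
open Real (posLog)

theorem complexify_single (k : Fin W) :
    complexify (Pi.single k (Pi.single k 1)) = Matrix.single k k 1 := by
  ext i j
  by_cases h1 : i = k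
  · subst h1
    by_cases h2 : j = i
    · subst h2; simp [complexify]
    · simp [complexify, h2, Ne.symm h2]
  · simp [complexify, h1, Ne.symm h1]

theorem single_symm (k i j : Fin W) :
    (Pi.single k (Pi.single k 1) : Fin W → Fin W → ℝ) i j =
      (Pi.single k (Pi.single k 1) : Fin W → Fin W → ℝ) j i := by
  by_cases h1 : i = k <;> by_cases h2 : j = k <;> simp [h1, h2]

theorem abs_single_le (k i j : Fin W) :
    |(Pi.single k (Pi.single k 1) : Fin W → Fin W → ℝ) i j| ≤ 1 := by
  by_cases h1 : i = k <;> by_cases h2 : j = k <;> simp [h1, h2]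

theorem smul_symMat_shiftMat_single (lam s : ℝ) (k : Fin W) (Q : Matrix (Fin W) (Fin W) ℂ)
    (X : Fin W → Fin W → ℝ) :
    (lam : ℂ) • symMat (shiftMat (Pi.single k (Pi.single k 1)) s X) + Q =
      ((lam : ℂ) • symMat X + Q) + Matrix.single k k ((lam * s : ℝ) : ℂ) := by
  have h := complexify_single k
  rw [complexify] at h
  rw [symMat_shiftMat (single_symm k), h, smul_add, smul_smul, add_right_comm]
  simp

theorem measurable_form {Ω : Type*} [MeasurableSpace Ω] {M : Ω → Matrix (Fin W) (Fin W) ℂ}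
    (hM : MeasurableEntries M) (a b : Fin W → ℂ) :
    Measurable fun ω => star a ⬝ᵥ (M ω *ᵥ b) := by
  refine hM.comp_continuous (f := fun A => star a ⬝ᵥ (A *ᵥ b)) ?_
  fun_prop

theorem measurableEntries_inv_gauss (lam : ℝ) (Q : Matrix (Fin W) (Fin W) ℂ) :
    MeasurableEntries fun X : Fin W → Fin W → ℝ => ((lam : ℂ) • symMat X + Q)⁻¹ :=
  ((measurableEntries_symMat.smul _).add (measurableEntries_const Q)).inv

/-- The probability of a shifted event, averaged over the shift, bounds the probability of the
event from below. -/
theorem average_shift_le (T : ℝ) (W : ℕ) : ∃ C : ℝ≥0∞, C ≠ 0 ∧ C ≠ ∞ ∧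
    ∀ S : Fin W → Fin W → ℝ, (∀ i j, |S i j| ≤ 1) → ∀ A : Set (Fin W → Fin W → ℝ),
      MeasurableSet A → ∫⁻ X, volume {s ∈ Set.Icc (-T) T | shiftMat S s X ∈ A} ∂(gaussMat W (1 / 2))
        ≤ C * ENNReal.ofReal (T - -T) * gaussMat W 1 A := by
  obtain ⟨C, h0, hC, h⟩ := lintegral_shift_le (W := W) T (v := 1 / 2) (by norm_num)
  refine ⟨C, h0, hC, fun S hS A hA => ?_⟩
  -- The auxiliary variance is `1 / 2` so that doubling it returns the law of the model.
  have h2 : (2 : ℝ≥0) * (1 / 2) = 1 := by norm_num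
  rw [h2] at h
  set g : (Fin W → Fin W → ℝ) → ℝ≥0∞ := A.indicator 1 with hg
  have hgm : Measurable g := measurable_one.indicator hA
  have hm2 : Measurable fun p : ℝ × (Fin W → Fin W → ℝ) => g (shiftMat S p.1 p.2) :=
    hgm.comp (measurable_shiftMat S)
  have hvol : ∀ X, volume {s ∈ Set.Icc (-T) T | shiftMat S s X ∈ A} =
      ∫⁻ s in Set.Icc (-T) T, g (shiftMat S s X) := by
    intro X
    have hms : MeasurableSet {s : ℝ | shiftMat S s X ∈ A} :=
      ((measurable_shiftMat S).comp (measurable_id.prodMk measurable_const)) hA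
    have : (fun s => g (shiftMat S s X)) = Set.indicator {s : ℝ | shiftMat S s X ∈ A} 1 := by
      ext s
      rfl
    rw [this, lintegral_indicator_one hms, Measure.restrict_apply hms, Set.inter_comm]
    rfl
  simp only [hvol]
  rw [lintegral_lintegral_swap (by
    exact (hm2.comp measurable_swap).aemeasurable)]
  calc ∫⁻ s in Set.Icc (-T) T, (∫⁻ X, g (shiftMat S s X) ∂(gaussMat W (1 / 2)))
      ≤ ∫⁻ _s in Set.Icc (-T) T, C * ∫⁻ X, g X ∂(gaussMat W 1) := by
        refine setLIntegral_mono measurable_const fun s hs => ?_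
        exact h S hS s (abs_le.2 hs) g hgm
    _ = _ := by
        rw [hg, lintegral_indicator_one hA]
        simp only [lintegral_const, Measure.restrict_apply_univ, Real.volume_Icc]
        ring

/-- Under the law of variance `1 / 2`, four quantities entering `exists_resonance` (the norm of the
inverse and three matrix elements) are controlled except on events of probability `1 / 8` each. On
the remaining half of the space the event occurs for an interval of shifts of length `ρ / τ`, and
`average_shift_le` converts this into a lower bound under the law of variance `1`. -/
theorem resonance_probability (hW : 0 < W) {lam : ℝ} (hlam : 0 < lam) (B : ℝ) :
    ∃ c : ℝ, 0 < c ∧ ∃ ε : ℝ, 0 < ε ∧ ∀ Q : Matrix (Fin W) (Fin W) ℂ, IsDissipative Q → ‖Q‖ ≤ B →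
      ∀ τ : ℝ, 1 ≤ τ → ‖Q - Qᴴ‖ ≤ ε / τ → ∀ v : Fin W → ℂ, nsq v = 1 →
        ENNReal.ofReal (c / τ) ≤
          gaussMat W 1 {X | τ ≤ ‖star v ⬝ᵥ (((lam : ℂ) • symMat X + Q)⁻¹ *ᵥ v)‖} := by
  have hv2 : (1 / 2 : ℝ≥0) ≠ 0 := by norm_num
  obtain ⟨C₁, hC₁, hUB⟩ := lintegral_posLog_inv_le W hlam hv2
  obtain ⟨C₂, hC₂, hLB⟩ := lintegral_logSqTop_form_le hW hlam hv2
  have h8 : (8⁻¹ : ℝ≥0∞) ≠ 0 := by simp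
  have h8' : (8⁻¹ : ℝ≥0∞) ≠ ∞ := by simp
  set D := C₂ * (1 + ENNReal.ofReal (posLog B ^ 2)) with hD
  have hDt : D ≠ ∞ := ENNReal.mul_ne_top hC₂ (ENNReal.add_ne_top.2 ⟨by simp, ENNReal.ofReal_ne_top⟩)
  obtain ⟨Λ, hΛ1, hΛ⟩ := exists_upper_threshold hC₁ h8 h8'
  obtain ⟨κ, hκ0, hκ⟩ := exists_lower_threshold hDt h8 h8'
  have hΛ0 : 0 < Λ := by linarith
  set ρ := κ ^ 2 / (lam * Λ ^ 2 * (1 + (Λ + Λ ^ 2 / κ))) with hρ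
  have hρ0 : 0 < ρ := by positivity
  -- A window that contains every resonance interval: its centre is at most `1 / (lam κ)` in modulus
  -- and its half-length at most `ρ`.
  set T := 1 / (lam * κ) + ρ with hT
  have hT0 : 0 < T := by positivity
  obtain ⟨C, hC0, hCt, hav⟩ := average_shift_le T W
  set c := (2⁻¹ * ρ) / (C.toReal * (T - -T)) with hc
  have hCr : 0 < C.toReal := ENNReal.toReal_pos hC0 hCt
  have hTT : 0 < T - -T := by linarith
  refine ⟨c, by positivity, lam * κ ^ 2 * ρ / (2 * Λ ^ 2), by positivity, ?_⟩
  intro Q hQ hQB τ hτ hQτ v hv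
  have hτ0 : 0 < τ := by linarith
  set k : Fin W := ⟨0, hW⟩ with hk
  set A := {X : Fin W → Fin W → ℝ | τ ≤ ‖star v ⬝ᵥ (((lam : ℂ) • symMat X + Q)⁻¹ *ᵥ v)‖} with hA
  have hGm := measurableEntries_inv_gauss (W := W) lam Q
  have hAm : MeasurableSet A := measurableSet_le measurable_const (measurable_form hGm v v).norm
  set G : (Fin W → Fin W → ℝ) → Matrix (Fin W) (Fin W) ℂ := fun X => ((lam : ℂ) • symMat X + Q)⁻¹
    with hG
  set e : Fin W → ℂ := Pi.single k 1 with he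
  have hDle : ∀ a b : Fin W → ℂ, nsq a = 1 → nsq b = 1 →
      gaussMat W (1 / 2) {X | ‖star a ⬝ᵥ (G X *ᵥ b)‖ < κ} ≤ 8⁻¹ := by
    intro a b ha hb
    refine hκ _ (measurable_form hGm a b).norm (fun _ => norm_nonneg _)
      ((hLB Q hQ a b ha hb).trans ?_)
    rw [hD]
    gcongr
    exact Real.posLog_nonneg
  set b₀ := {X : Fin W → Fin W → ℝ | Λ < ‖G X‖} with hb₀
  set b₁ := {X : Fin W → Fin W → ℝ | ‖star e ⬝ᵥ (G X *ᵥ e)‖ < κ} with hb₁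
  set b₂ := {X : Fin W → Fin W → ℝ | ‖star v ⬝ᵥ (G X *ᵥ e)‖ < κ} with hb₂
  set b₃ := {X : Fin W → Fin W → ℝ | ‖star e ⬝ᵥ (G X *ᵥ v)‖ < κ} with hb₃
  have m₀ : gaussMat W (1 / 2) b₀ ≤ 8⁻¹ := hΛ _ hGm.norm (hUB Q hQ)
  have m₁ : gaussMat W (1 / 2) b₁ ≤ 8⁻¹ := hDle e e (nsq_single k) (nsq_single k)
  have m₂ : gaussMat W (1 / 2) b₂ ≤ 8⁻¹ := hDle v e hv (nsq_single k)
  have m₃ : gaussMat W (1 / 2) b₃ ≤ 8⁻¹ := hDle e v (nsq_single k) hv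
  set bad := b₀ ∪ b₁ ∪ b₂ ∪ b₃ with hbad
  have hmb : MeasurableSet bad :=
    (((measurableSet_lt measurable_const hGm.norm).union
      (measurableSet_lt (measurable_form hGm e e).norm measurable_const)).union
      (measurableSet_lt (measurable_form hGm v e).norm measurable_const)).union
      (measurableSet_lt (measurable_form hGm e v).norm measurable_const)
  have hbad2 : gaussMat W (1 / 2) bad ≤ 2⁻¹ := by
    calc gaussMat W (1 / 2) bad ≤ 8⁻¹ + 8⁻¹ + 8⁻¹ + 8⁻¹ :=
          (measure_union_le _ _).trans (add_le_add ((measure_union_le _ _).trans (add_le_add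
            ((measure_union_le _ _).trans (add_le_add m₀ m₁)) m₂)) m₃)
      _ = ENNReal.ofReal (1 / 8) * 4 := by
          rw [show (8⁻¹ : ℝ≥0∞) = ENNReal.ofReal (1 / 8) by
            rw [one_div, ENNReal.ofReal_inv_of_pos (by norm_num)]; norm_num]
          ring
      _ = 2⁻¹ := by
          rw [show (4 : ℝ≥0∞) = ENNReal.ofReal 4 by norm_num, ← ENNReal.ofReal_mul (by norm_num),
            show (1 / 8 * 4 : ℝ) = 2⁻¹ by norm_num, ENNReal.ofReal_inv_of_pos (by norm_num)]
          norm_num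
  have hgood : 2⁻¹ ≤ gaussMat W (1 / 2) badᶜ := by
    rw [prob_compl_eq_one_sub hmb, ← ENNReal.one_sub_inv_two]
    exact tsub_le_tsub_left hbad2 1
  have hint : ∀ X ∈ badᶜ, ENNReal.ofReal (ρ / τ) ≤
      volume {s ∈ Set.Icc (-T) T | shiftMat (Pi.single k (Pi.single k 1)) s X ∈ A} := by
    intro X hX
    simp only [hbad, hb₀, hb₁, hb₂, hb₃, Set.mem_compl_iff, Set.mem_union, Set.mem_ofPred_eq, not_or,
      not_lt] at hX
    obtain ⟨⟨⟨h0, h1⟩, h2⟩, h3⟩ := hX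
    have hNd : IsDissipative ((lam : ℂ) • symMat X + Q) :=
      hQ.add_hermitian (isHermitian_smul_symMat lam X)
    have hNN : ((lam : ℂ) • symMat X + Q) - ((lam : ℂ) • symMat X + Q)ᴴ = Q - Qᴴ := by
      rw [conjTranspose_add, (isHermitian_smul_symMat lam X).eq]
      abel
    rw [he, form_single] at h1
    obtain ⟨s₀, hs₀, hs⟩ := exists_resonance hNd k hv hlam hκ0 h0 hτ h1 h2 h3 hρ (by rwa [hNN])
    have hsub : Set.Icc (s₀ - ρ / (2 * τ)) (s₀ + ρ / (2 * τ)) ⊆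
        {s ∈ Set.Icc (-T) T | shiftMat (Pi.single k (Pi.single k 1)) s X ∈ A} := by
      intro s hs'
      have hρτ : ρ / (2 * τ) ≤ ρ := div_le_self hρ0.le (by linarith)
      have hs0' := abs_le.1 hs₀
      refine ⟨⟨?_, ?_⟩, ?_⟩
      · linarith [hs'.1]
      · linarith [hs'.2]
      · change τ ≤ _
        rw [smul_symMat_shiftMat_single]
        exact hs s (abs_le.2 ⟨by linarith [hs'.1], by linarith [hs'.2]⟩)
    refine le_trans (le_of_eq ?_) (measure_mono hsub)
    rw [Real.volume_Icc]
    congr 1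
    field_simp
    ring
  have h1 := hav (Pi.single k (Pi.single k 1)) (abs_single_le k) A hAm
  have h2 : ENNReal.ofReal (ρ / τ) * 2⁻¹ ≤ C * ENNReal.ofReal (T - -T) * gaussMat W 1 A := by
    refine le_trans ?_ h1
    calc ENNReal.ofReal (ρ / τ) * 2⁻¹ ≤ ENNReal.ofReal (ρ / τ) * gaussMat W (1 / 2) badᶜ := by gcongr
      _ = ∫⁻ _X in badᶜ, ENNReal.ofReal (ρ / τ) ∂(gaussMat W (1 / 2)) := by simp
      _ ≤ ∫⁻ X in badᶜ, volume {s ∈ Set.Icc (-T) T |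
            shiftMat (Pi.single k (Pi.single k 1)) s X ∈ A} ∂(gaussMat W (1 / 2)) :=
          setLIntegral_mono' hmb.compl hint
      _ ≤ _ := setLIntegral_le_lintegral _ _
  have hCC : C * ENNReal.ofReal (T - -T) = ENNReal.ofReal (C.toReal * (T - -T)) := by
    rw [ENNReal.ofReal_mul hCr.le, ENNReal.ofReal_toReal hCt]
  rw [hCC, ← ENNReal.ofReal_toReal (measure_ne_top (gaussMat W 1) A),
    ← ENNReal.ofReal_mul (by positivity),
    show (2⁻¹ : ℝ≥0∞) = ENNReal.ofReal 2⁻¹ by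
      rw [ENNReal.ofReal_inv_of_pos (by norm_num)]; norm_num,
    ← ENNReal.ofReal_mul (by positivity)] at h2
  rw [← ENNReal.ofReal_toReal (measure_ne_top (gaussMat W 1) A)]
  refine ENNReal.ofReal_le_ofReal ?_
  have h3 := (ENNReal.ofReal_le_ofReal_iff (by positivity)).1 h2
  rw [hc, div_div, div_le_iff₀ (by positivity)]
  calc 2⁻¹ * ρ = (ρ / τ * 2⁻¹) * τ := by field_simp
    _ ≤ (C.toReal * (T - -T) * (gaussMat W 1 A).toReal) * τ := by gcongr
    _ = _ := by ring

end ResonanceProbability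


/-! ### Vectors at which the norm is attained. -/

section TopSpace

open scoped Matrix.Norms.L2Operator NNReal ENNReal

/-- A unit vector at which the matrix attains its norm. -/
def IsTopVector (T : Matrix (Fin W) (Fin W) ℂ) (v : Fin W → ℂ) : Prop :=
  nsq v = 1 ∧ nsq (T *ᵥ v) = ‖T‖ ^ 2

theorem nsq_mulVec_le (T : Matrix (Fin W) (Fin W) ℂ) (v : Fin W → ℂ) :
    nsq (T *ᵥ v) ≤ ‖T‖ ^ 2 * nsq v := by
  have h := sqrt_nsq_mulVec_le T v
  have h1 := pow_le_pow_left₀ (Real.sqrt_nonneg _) h 2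
  rwa [mul_pow, Real.sq_sqrt (nsq_nonneg _), Real.sq_sqrt (nsq_nonneg _)] at h1

theorem star_mulVec_dotProduct (T : Matrix (Fin W) (Fin W) ℂ) (a b : Fin W → ℂ) :
    star (T *ᵥ a) ⬝ᵥ b = star a ⬝ᵥ (Tᴴ *ᵥ b) := by
  rw [star_mulVec, dotProduct_mulVec]

theorem star_dotProduct_gram (T : Matrix (Fin W) (Fin W) ℂ) (v : Fin W → ℂ) :
    star v ⬝ᵥ ((Tᴴ * T) *ᵥ v) = (nsq (T *ᵥ v) : ℂ) := by
  rw [← mulVec_mulVec, ← star_mulVec_dotProduct, star_dotProduct_self]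

theorem nsq_sub (a b : Fin W → ℂ) : nsq (a - b) = nsq a - 2 * (star a ⬝ᵥ b).re + nsq b := by
  have h : ((nsq (a - b) : ℝ) : ℂ) = nsq a - star a ⬝ᵥ b - star b ⬝ᵥ a + nsq b := by
    rw [← star_dotProduct_self, ← star_dotProduct_self, ← star_dotProduct_self, star_sub,
      sub_dotProduct, dotProduct_sub, dotProduct_sub]
    ring
  have h2 : star b ⬝ᵥ a = star (star a ⬝ᵥ b) := by
    rw [star_dotProduct]
  have h3 := congrArg Complex.re h
  rw [h2] at h3
  simp at h3
  linarith

theorem nsq_smul (c : ℂ) (v : Fin W → ℂ) : nsq (c • v) = ‖c‖ ^ 2 * nsq v := by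
  simp [nsq, mul_pow, Finset.mul_sum]

/-- Expanding the square, `‖T* T v - ‖T‖ ^ 2 v‖ ^ 2 ≤ ‖T‖ ^ 4 ‖v‖ ^ 2 (1 - 2 + 1) = 0`. -/
theorem gram_mulVec_of_norm_attained {T : Matrix (Fin W) (Fin W) ℂ} {v : Fin W → ℂ}
    (h : nsq (T *ᵥ v) = ‖T‖ ^ 2 * nsq v) : (Tᴴ * T) *ᵥ v = ((‖T‖ ^ 2 : ℝ) : ℂ) • v := by
  rw [← sub_eq_zero]
  refine nsq_eq_zero (le_antisymm ?_ (nsq_nonneg _))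
  rw [nsq_sub, dotProduct_smul, nsq_smul]
  have h1 : star ((Tᴴ * T) *ᵥ v) ⬝ᵥ v = (nsq (T *ᵥ v) : ℂ) := by
    rw [star_mulVec_dotProduct, conjTranspose_mul, conjTranspose_conjTranspose,
      star_dotProduct_gram]
  rw [h1, h]
  have h2 : nsq ((Tᴴ * T) *ᵥ v) ≤ ‖T‖ ^ 2 * (‖T‖ ^ 2 * nsq v) := by
    rw [← mulVec_mulVec, ← h]
    refine (nsq_mulVec_le _ _).trans_eq ?_
    rw [l2_opNorm_conjTranspose]
  have h3 : ((((‖T‖ ^ 2 : ℝ) : ℂ) • ((‖T‖ ^ 2 * nsq v : ℝ) : ℂ)).re) =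
      ‖T‖ ^ 2 * (‖T‖ ^ 2 * nsq v) := by
    rw [smul_eq_mul, ← Complex.ofReal_mul, Complex.ofReal_re]
  have h4 : ‖((‖T‖ ^ 2 : ℝ) : ℂ)‖ = ‖T‖ ^ 2 := by
    rw [Complex.norm_real, Real.norm_of_nonneg (sq_nonneg _)]
  rw [h3, h4]
  nlinarith

theorem norm_attained_of_gram_mulVec {T : Matrix (Fin W) (Fin W) ℂ} {v : Fin W → ℂ}
    (h : (Tᴴ * T) *ᵥ v = ((‖T‖ ^ 2 : ℝ) : ℂ) • v) : nsq (T *ᵥ v) = ‖T‖ ^ 2 * nsq v := by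
  have h1 := star_dotProduct_gram T v
  rw [h, dotProduct_smul, star_dotProduct_self, smul_eq_mul, ← Complex.ofReal_mul] at h1
  exact (Complex.ofReal_injective h1).symm

theorem nsq_eq_one_iff {v : Fin W → ℂ} : star v ⬝ᵥ v = 1 ↔ nsq v = 1 := by
  rw [star_dotProduct_self]
  exact_mod_cast Iff.rfl

theorem isUnitMaxEigenvector_iff (hW : 0 < W) (T : Matrix (Fin W) (Fin W) ℂ) (v : Fin W → ℂ) :
    IsUnitMaxEigenvector (Tᴴ * T) v ↔ IsTopVector T v := by
  have hval : ∀ (ν : ℝ) (u : Fin W → ℂ), (Tᴴ * T) *ᵥ u = (ν : ℂ) • u →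
      nsq (T *ᵥ u) = ν * nsq u := by
    intro ν u h
    have h1 := star_dotProduct_gram T u
    rw [h, dotProduct_smul, star_dotProduct_self, smul_eq_mul, ← Complex.ofReal_mul] at h1
    exact (Complex.ofReal_injective h1).symm
  constructor
  · rintro ⟨hv, μ, hμ, hmax⟩
    rw [nsq_eq_one_iff] at hv
    refine ⟨hv, ?_⟩
    have h1 := hval μ v hμ
    rw [hv, mul_one] at h1
    obtain ⟨w, hw, hTw⟩ := exists_norm_attained hW T
    have h2 : nsq (T *ᵥ w) = ‖T‖ ^ 2 * nsq w := by
      rw [← hTw, Real.sq_sqrt (nsq_nonneg _), hw, mul_one]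
    have h3 := hmax (‖T‖ ^ 2) w (by rintro rfl; simp [nsq] at hw) (gram_mulVec_of_norm_attained h2)
    have h4 := nsq_mulVec_le T v
    rw [hv] at h4
    linarith
  · rintro ⟨hv, hTv⟩
    refine ⟨nsq_eq_one_iff.2 hv, ‖T‖ ^ 2, gram_mulVec_of_norm_attained (by rw [hTv, hv, mul_one]),
      fun ν u hu hν => ?_⟩
    have h1 := hval ν u hν
    have h2 := nsq_mulVec_le T u
    rw [h1] at h2
    exact le_of_mul_le_mul_right h2 ((nsq_nonneg u).lt_of_ne fun h => hu (nsq_eq_zero h.symm))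

/-- The norm of the matrix is attained on a single line. -/
def IsTopSimple (T : Matrix (Fin W) (Fin W) ℂ) : Prop :=
  ∀ v w, IsTopVector T v → IsTopVector T w → star v ⬝ᵥ w ≠ 0

/-- The part of `w` orthogonal to `v` stays in the top eigenspace of `T* T`; normalized, it would be
a top vector orthogonal to `v`. So it is zero, and `w` is `v` times a phase. -/
theorem norm_form_eq_of_isTopSimple {T : Matrix (Fin W) (Fin W) ℂ} (hT : IsTopSimple T)
    {v w : Fin W → ℂ} (hv : IsTopVector T v) (hw : IsTopVector T w)
    (G : Matrix (Fin W) (Fin W) ℂ) : ‖star v ⬝ᵥ (G *ᵥ v)‖ = ‖star w ⬝ᵥ (G *ᵥ w)‖ := by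
  set c := star v ⬝ᵥ w with hc
  have gv := gram_mulVec_of_norm_attained (T := T) (v := v) (by rw [hv.2, hv.1, mul_one])
  have gw := gram_mulVec_of_norm_attained (T := T) (v := w) (by rw [hw.2, hw.1, mul_one])
  have h0 : w - c • v = 0 := by
    by_contra h
    have hpos : 0 < nsq (w - c • v) := (nsq_nonneg _).lt_of_ne fun h' => h (nsq_eq_zero h'.symm)
    have hg : (Tᴴ * T) *ᵥ (w - c • v) = ((‖T‖ ^ 2 : ℝ) : ℂ) • (w - c • v) := by
      rw [mulVec_sub, mulVec_smul, gv, gw, smul_sub, smul_comm]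
    have hatt := norm_attained_of_gram_mulVec hg
    set r : ℂ := (((Real.sqrt (nsq (w - c • v)))⁻¹ : ℝ) : ℂ) with hr
    have hrn : ‖r‖ ^ 2 * nsq (w - c • v) = 1 := by
      rw [hr, Complex.norm_real, norm_inv, Real.norm_of_nonneg (Real.sqrt_nonneg _), inv_pow,
        Real.sq_sqrt hpos.le, inv_mul_cancel₀ hpos.ne']
    refine hT v (r • (w - c • v)) hv ⟨by rw [nsq_smul, hrn], ?_⟩ ?_
    · rw [mulVec_smul, nsq_smul, hatt]
      linear_combination (‖T‖ ^ 2) * hrn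
    · rw [dotProduct_smul, dotProduct_sub, dotProduct_smul, ← hc, nsq_eq_one_iff.2 hv.1]
      simp
  have hwc : w = c • v := sub_eq_zero.1 h0
  have hcn : ‖c‖ ^ 2 = 1 := by
    have h1 := hw.1
    rw [hwc, nsq_smul, hv.1, mul_one] at h1
    exact h1
  rw [hwc, mulVec_smul, star_smul, smul_dotProduct, dotProduct_smul, smul_smul, norm_smul,
    norm_mul, norm_star, ← sq, hcn, one_mul]

theorem hasDerivAt_nsq {f : ℝ → Fin W → ℂ} {f' : Fin W → ℂ} {t : ℝ} (h : HasDerivAt f f' t) :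
    HasDerivAt (fun s => nsq (f s)) (2 * (star (f t) ⬝ᵥ f').re) t := by
  have h1 : ∀ i, HasDerivAt (fun s => ‖f s i‖ ^ 2) (2 * (star (f t i) * f' i).re) t := by
    intro i
    have := ((hasDerivAt_pi.1 h) i).norm_sq
    rw [Complex.inner, mul_comm (f' i)] at this
    exact this
  have h2 := HasDerivAt.fun_sum (u := Finset.univ) fun i _ => h1 i
  have h3 : 2 * (star (f t) ⬝ᵥ f').re = ∑ i, 2 * (star (f t i) * f' i).re := by
    rw [dotProduct, Complex.re_sum, Finset.mul_sum]
    rfl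
  rw [h3]
  exact h2

theorem hasDerivAt_inv_line {N : Matrix (Fin W) (Fin W) ℂ} (hN : IsUnit N.det)
    (B : Matrix (Fin W) (Fin W) ℂ) :
    HasDerivAt (fun s : ℝ => (N + (s : ℂ) • B)⁻¹) (-(N⁻¹ * B * N⁻¹)) 0 := by
  have hu : IsUnit N := (isUnit_iff_isUnit_det _).2 hN
  obtain ⟨u, rfl⟩ := hu
  have h1 := hasFDerivAt_ringInverse (𝕜 := ℝ) u
  have h2 : HasDerivAt (fun s : ℝ => (u : Matrix (Fin W) (Fin W) ℂ) + s • B) B 0 := by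
    simpa using ((hasDerivAt_id (0 : ℝ)).smul_const B).const_add (u : Matrix (Fin W) (Fin W) ℂ)
  have h3 : HasFDerivAt Ring.inverse (-ContinuousLinearMap.mulLeftRight ℝ
      (Matrix (Fin W) (Fin W) ℂ) ↑u⁻¹ ↑u⁻¹) ((u : Matrix (Fin W) (Fin W) ℂ) + (0 : ℝ) • B) := by
    rw [zero_smul, add_zero]; exact h1
  have h4 := h3.comp_hasDerivAt (0 : ℝ) h2
  have e1 : (fun s : ℝ => ((u : Matrix (Fin W) (Fin W) ℂ) + (s : ℂ) • B)⁻¹) =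
      Ring.inverse ∘ fun s : ℝ => (u : Matrix (Fin W) (Fin W) ℂ) + s • B := by
    ext1 s
    rw [Function.comp_apply, nonsing_inv_eq_ringInverse, Complex.coe_smul]
  rw [e1]
  convert! h4 using 1
  simp [ContinuousLinearMap.mulLeftRight_apply, coe_units_inv]

end TopSpace


/-! ### First variation of the norm, and consequences of a multiple top singular value. -/

section SimpleTop

open scoped Matrix.Norms.L2Operator NNReal ENNReal

theorem continuous_inv_of_isUnit {Y : Type*} [TopologicalSpace Y]
    {N : Y → Matrix (Fin W) (Fin W) ℂ} (hN : Continuous N) (h : ∀ y, IsUnit (N y).det) :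
    Continuous fun y => (N y)⁻¹ := by
  simp only [inv_def, Ring.inverse_eq_inv']
  exact (hN.matrix_det.inv₀ fun y => (h y).ne_zero).smul hN.matrix_adjugate

/-- The first variation of the norm at a top vector. -/
theorem deriv_norm_sq_eq {N P B : Matrix (Fin W) (Fin W) ℂ} (hN : IsUnit N.det) {v : Fin W → ℂ}
    (hv : IsTopVector (P * N⁻¹) v)
    (hd : DifferentiableAt ℝ (fun s : ℝ => ‖P * (N + (s : ℂ) • B)⁻¹‖) 0) :
    deriv (fun s : ℝ => ‖P * (N + (s : ℂ) • B)⁻¹‖ ^ 2) 0 =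
      -(2 * ‖P * N⁻¹‖ ^ 2 * (star v ⬝ᵥ (B *ᵥ (N⁻¹ *ᵥ v))).re) := by
  set T := P * N⁻¹ with hT
  have h1 : HasDerivAt (fun s : ℝ => (P * (N + (s : ℂ) • B)⁻¹) *ᵥ v)
      (-(T *ᵥ (B *ᵥ (N⁻¹ *ᵥ v)))) 0 := by
    set L : Matrix (Fin W) (Fin W) ℂ →ₗ[ℝ] (Fin W → ℂ) :=
      { toFun := fun M => (P * M) *ᵥ v
        map_add' := fun M M' => by rw [mul_add, add_mulVec]
        map_smul' := fun c M => by simp [smul_mulVec] } with hL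
    have h2 := (LinearMap.toContinuousLinearMap L).hasFDerivAt.comp_hasDerivAt (0 : ℝ)
      (hasDerivAt_inv_line hN B)
    convert! h2 using 1
    simp [hL, hT, mulVec_mulVec, Matrix.mul_assoc, neg_mulVec]
  have hψ := hasDerivAt_nsq h1
  have hφ : DifferentiableAt ℝ (fun s : ℝ => ‖P * (N + (s : ℂ) • B)⁻¹‖ ^ 2) 0 := hd.pow 2
  have hsub := hφ.hasDerivAt.sub hψ
  -- The squared norm dominates its value at the fixed vector `v`, with equality at `s = 0`, so the
  -- two derivatives agree there.
  have hmin : IsLocalMin (fun s : ℝ => ‖P * (N + (s : ℂ) • B)⁻¹‖ ^ 2 -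
      nsq ((P * (N + (s : ℂ) • B)⁻¹) *ᵥ v)) 0 := by
    refine Eventually.of_forall fun s => ?_
    have e0 : N + ((0 : ℝ) : ℂ) • B = N := by simp
    beta_reduce
    rw [e0, ← hT, hv.2, sub_self, sub_nonneg]
    simpa [hv.1] using nsq_mulVec_le (P * (N + (s : ℂ) • B)⁻¹) v
  have h0 := hmin.hasDerivAt_eq_zero hsub
  have e0 : N + ((0 : ℝ) : ℂ) • B = N := by simp
  rw [e0, ← hT] at h0
  have hg := gram_mulVec_of_norm_attained (T := T) (v := v) (by rw [hv.2, hv.1, mul_one])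
  have h3 : (star (T *ᵥ v) ⬝ᵥ -(T *ᵥ (B *ᵥ (N⁻¹ *ᵥ v)))).re =
      -(‖T‖ ^ 2 * (star v ⬝ᵥ (B *ᵥ (N⁻¹ *ᵥ v))).re) := by
    rw [dotProduct_neg, Complex.neg_re]
    congr 1
    have h4 : star (T *ᵥ v) ⬝ᵥ (T *ᵥ (B *ᵥ (N⁻¹ *ᵥ v))) =
        star ((Tᴴ * T) *ᵥ v) ⬝ᵥ (B *ᵥ (N⁻¹ *ᵥ v)) := by
      rw [star_mulVec_dotProduct (Tᴴ * T), conjTranspose_mul, conjTranspose_conjTranspose,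
        star_mulVec_dotProduct, mulVec_mulVec]
    rw [h4, hg, star_smul, smul_dotProduct]
    have h5 : star (((‖T‖ ^ 2 : ℝ) : ℂ)) = ((‖T‖ ^ 2 : ℝ) : ℂ) := Complex.conj_ofReal _
    rw [h5, smul_eq_mul, Complex.re_ofReal_mul]
  rw [h3] at h0
  linarith

/-- If the norm is attained at two orthogonal vectors and the first variation of the norm exists
in sufficiently many directions, then the perturbed matrix has a purely imaginary eigenvalue. -/
theorem exists_imaginary_eigenvalue {N P : Matrix (Fin W) (Fin W) ℂ} (hN : IsUnit N.det)
    (hP : P ≠ 0) (hns : ¬ IsTopSimple (P * N⁻¹))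
    (hd : ∀ e : Fin W → ℝ, (∃ i j, e = Pi.single i 1 ∨ (i ≠ j ∧ e = Pi.single i 1 + Pi.single j 1)) →
      DifferentiableAt ℝ (fun s : ℝ => ‖P * (N + (s : ℂ) • complexify fun i j => e i * e j)⁻¹‖) 0) :
    ∃ t : ℝ, (N + ((t : ℂ) * Complex.I) • (1 : Matrix (Fin W) (Fin W) ℂ)).det = 0 := by
  set T := P * N⁻¹ with hT
  set g := N⁻¹ with hg
  have hT0 : ‖T‖ ^ 2 ≠ 0 := by
    intro h
    have h1 : T = 0 := by simpa using h
    apply hP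
    have h2 : T * N = P := by rw [hT, Matrix.mul_assoc, nonsing_inv_mul _ hN, mul_one]
    rw [← h2, h1, Matrix.zero_mul]
  unfold IsTopSimple at hns
  push Not at hns
  obtain ⟨v, w, hv, hw, hvw⟩ := hns
  set top : (Fin W → ℂ) → Prop := fun u => (Tᴴ * T) *ᵥ u = ((‖T‖ ^ 2 : ℝ) : ℂ) • u with htop
  have tv : top v := gram_mulVec_of_norm_attained (by rw [hv.2, hv.1, mul_one])
  have tw : top w := gram_mulVec_of_norm_attained (by rw [hw.2, hw.1, mul_one])
  have tadd : ∀ a b, top a → top b → top (a + b) := by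
    intro a b ha hb
    simp only [htop, mulVec_add, smul_add] at *
    rw [ha, hb]
  have tsmul : ∀ (c : ℂ) a, top a → top (c • a) := by
    intro c a ha
    simp only [htop, mulVec_smul] at *
    rw [ha, smul_comm]
  have hcomb : ∀ α β : ℂ, α • v + β • w = 0 → α = 0 ∧ β = 0 := by
    intro α β h
    have hwv : star w ⬝ᵥ v = 0 := by rw [star_dotProduct, hvw, star_zero]
    have h1 := congrArg (fun x => star v ⬝ᵥ x) h
    have h2 := congrArg (fun x => star w ⬝ᵥ x) h
    simp only [dotProduct_add, dotProduct_smul, nsq_eq_one_iff.2 hv.1, nsq_eq_one_iff.2 hw.1, hvw,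
      hwv, dotProduct_zero, smul_eq_mul, mul_one, mul_zero, add_zero, zero_add] at h1 h2
    exact ⟨h1, h2⟩
  set ev : (Fin W → ℝ) → (Fin W → ℂ) → ℂ := fun e u => (fun i => (e i : ℂ)) ⬝ᵥ u with hev
  have evadd : ∀ e a b, ev e (a + b) = ev e a + ev e b := fun e a b => dotProduct_add _ _ _
  have evsmul : ∀ e (c : ℂ) a, ev e (c • a) = c * ev e a := fun e c a => dotProduct_smul _ _ _
  have hform : ∀ (e : Fin W → ℝ) (a b : Fin W → ℂ),
      star a ⬝ᵥ ((complexify fun i j => e i * e j) *ᵥ b) = star (ev e a) * ev e b := by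
    intro e a b
    have h1 : (complexify fun i j => e i * e j) =
        vecMulVec (fun i => (e i : ℂ)) fun i => (e i : ℂ) := by
      ext i j; simp [complexify, vecMulVec_apply]
    have h2 : star a ⬝ᵥ (fun i => (e i : ℂ)) = star (ev e a) := by
      rw [star_dotProduct, hev]
      simp only
      rw [dotProduct_comm]
      simp only [dotProduct, star_sum, star_mul', Pi.star_apply, star_star]
      refine Finset.sum_congr rfl fun i _ => ?_
      rw [Complex.star_def, Complex.conj_ofReal, mul_comm]
    rw [h1, vecMulVec_mulVec, dotProduct_smul, h2]
    simp [hev, mul_comm]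
  set good : (Fin W → ℝ) → Prop := fun e =>
    ∃ i j, e = Pi.single i 1 ∨ (i ≠ j ∧ e = Pi.single i 1 + Pi.single j 1) with hgood
  -- The derivative belongs to the norm, hence is the same for all unit top vectors. The top space
  -- has dimension at least two, so it contains `u₀ ≠ 0` with `ev e u₀ = 0`, and the common value is
  -- zero.
  have hzero : ∀ e, good e → ∀ u, top u → (star (ev e u) * ev e (g *ᵥ u)).re = 0 := by
    intro e he
    have heq : ∀ a b, IsTopVector T a → IsTopVector T b →
        (star (ev e a) * ev e (g *ᵥ a)).re = (star (ev e b) * ev e (g *ᵥ b)).re := by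
      intro a b ha hb
      have h1 := deriv_norm_sq_eq hN ha (hd e he)
      have h2 := deriv_norm_sq_eq hN hb (hd e he)
      rw [h1, hform, hform] at h2
      have h3 : ‖T‖ ^ 2 * ((star (ev e a) * ev e (g *ᵥ a)).re -
        (star (ev e b) * ev e (g *ᵥ b)).re) = 0 := by linarith
      rcases mul_eq_zero.1 h3 with h | h
      · exact absurd h hT0
      · linarith
    have hnormalize : ∀ u, top u → u ≠ 0 → ∃ r : ℝ, 0 < r ∧ IsTopVector T ((r : ℂ) • u) := by
      intro u hu hu0
      have hpos : 0 < nsq u := (nsq_nonneg _).lt_of_ne fun h' => hu0 (nsq_eq_zero h'.symm)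
      refine ⟨(Real.sqrt (nsq u))⁻¹, by positivity, ?_⟩
      have hrn : ‖(((Real.sqrt (nsq u))⁻¹ : ℝ) : ℂ)‖ ^ 2 * nsq u = 1 := by
        rw [Complex.norm_real, norm_inv, Real.norm_of_nonneg (Real.sqrt_nonneg _), inv_pow,
          Real.sq_sqrt hpos.le, inv_mul_cancel₀ hpos.ne']
      refine ⟨by rw [nsq_smul, hrn], ?_⟩
      rw [mulVec_smul, nsq_smul, norm_attained_of_gram_mulVec hu]
      linear_combination (‖T‖ ^ 2) * hrn
    obtain ⟨u₀, hu₀, hu₀0, hu₀e⟩ : ∃ u₀, top u₀ ∧ u₀ ≠ 0 ∧ ev e u₀ = 0 := by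
      by_cases h : ev e v = 0
      · refine ⟨v, tv, ?_, h⟩
        rintro rfl
        have := hv.1
        simp [nsq] at this
      · refine ⟨ev e w • v + (-ev e v) • w, tadd _ _ (tsmul _ _ tv) (tsmul _ _ tw), ?_, ?_⟩
        · intro h0
          exact h (neg_eq_zero.1 (hcomb _ _ h0).2)
        · rw [evadd, evsmul, evsmul]; ring
    obtain ⟨r₀, -, ht₀⟩ := hnormalize u₀ hu₀ hu₀0
    intro u hu
    by_cases hu0 : u = 0
    · subst hu0; simp [hev]
    obtain ⟨r, hr, ht⟩ := hnormalize u hu hu0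
    have h1 := heq _ _ ht ht₀
    rw [evsmul, evsmul, hu₀e, mul_zero, star_zero, zero_mul, Complex.zero_re, mulVec_smul,
      evsmul] at h1
    have h2 : star ((r : ℂ) * ev e u) * ((r : ℂ) * ev e (g *ᵥ u)) =
        ((r ^ 2 : ℝ) : ℂ) * (star (ev e u) * ev e (g *ᵥ u)) := by
      rw [star_mul', Complex.star_def, Complex.conj_ofReal]
      push_cast; ring
    rw [h2, Complex.re_ofReal_mul] at h1
    rcases mul_eq_zero.1 h1 with h | h
    · exact absurd h (by positivity)
    · exact h
  -- Polarization of the quadratic form in `hzero`, using `a + b` and `a + i b`.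
  have hpol : ∀ e, good e → ∀ a b, top a → top b →
      star (ev e a) * ev e (g *ᵥ b) + star (ev e (g *ᵥ a)) * ev e b = 0 := by
    intro e he a b ha hb
    have h0a := hzero e he a ha
    have h0b := hzero e he b hb
    have h1 := hzero e he (a + b) (tadd _ _ ha hb)
    have h2 := hzero e he (a + Complex.I • b) (tadd _ _ ha (tsmul _ _ hb))
    rw [mulVec_add, evadd, evadd] at h1
    rw [mulVec_add, mulVec_smul, evadd, evadd, evsmul, evsmul] at h2
    apply Complex.ext
    · simp at h0a h0b h1 h2 ⊢
      linarith
    · simp at h0a h0b h1 h2 ⊢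
      linarith
  have hev1 : ∀ i u, ev (Pi.single i 1) u = u i := by
    intro i u
    rw [hev]
    simp only [dotProduct]
    rw [Finset.sum_eq_single i]
    · simp
    · intro j _ hj; simp [hj]
    · simp
  have hev2 : ∀ i j u, ev (Pi.single i 1 + Pi.single j 1) u = u i + u j := by
    intro i j u
    rw [← hev1 i u, ← hev1 j u, hev]
    simp only [dotProduct, ← Finset.sum_add_distrib]
    refine Finset.sum_congr rfl fun k _ => ?_
    rw [Pi.add_apply]; push_cast; ring
  have hdiag : ∀ i a b, top a → top b →
      star (a i) * (g *ᵥ b) i + star ((g *ᵥ a) i) * b i = 0 := by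
    intro i a b ha hb
    have := hpol (Pi.single i 1) ⟨i, i, Or.inl rfl⟩ a b ha hb
    rwa [hev1, hev1, hev1, hev1] at this
  have hoff : ∀ i k a b, top a → top b → star (a i) * (g *ᵥ b) k + star (a k) * (g *ᵥ b) i +
      (star ((g *ᵥ a) i) * b k + star ((g *ᵥ a) k) * b i) = 0 := by
    intro i k a b ha hb
    have hi := hdiag i a b ha hb
    have hk := hdiag k a b ha hb
    by_cases hik : i = k
    · subst hik
      linear_combination 2 * hi
    · have := hpol (Pi.single i 1 + Pi.single k 1) ⟨i, k, Or.inr ⟨hik, rfl⟩⟩ a b ha hb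
      rw [hev2, hev2, hev2, hev2, star_add, star_add] at this
      linear_combination this - hi - hk
  obtain ⟨i, hi⟩ : ∃ i, v i ≠ 0 := by
    by_contra h
    push Not at h
    have := hv.1
    simp [nsq, h] at this
  -- A nonzero top vector whose `i`-th coordinate vanishes. The relation `hdiag` with `v` gives `(g
  -- y) i = 0`, then `hoff` gives `g y = c y`, and `hdiag` with `y` itself forces `Re c = 0`.
  set y := (-w i) • v + v i • w with hy
  have ty : top y := tadd _ _ (tsmul _ _ tv) (tsmul _ _ tw)
  have hy0 : y ≠ 0 := fun h => hi (hcomb _ _ h).2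
  have hyi : y i = 0 := by simp [hy]; ring
  have hgyi : (g *ᵥ y) i = 0 := by
    have := hdiag i y v ty tv
    rw [hyi, star_zero, zero_mul, zero_add] at this
    rcases mul_eq_zero.1 this with h | h
    · exact star_eq_zero.1 h
    · exact absurd h hi
  set c := -(star ((g *ᵥ v) i) / star (v i)) with hc
  have hvi : star (v i) ≠ 0 := fun h => hi (star_eq_zero.1 h)
  have hgy : g *ᵥ y = c • y := by
    ext k
    have := hoff i k v y tv ty
    rw [hgyi, hyi, mul_zero, mul_zero, add_zero, add_zero] at this
    rw [Pi.smul_apply, smul_eq_mul, hc]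
    field_simp
    linear_combination this
  have hNy : y = c • (N *ᵥ y) := by
    rw [← mulVec_smul, ← hgy, mulVec_mulVec, hg, mul_nonsing_inv _ hN, one_mulVec]
  have hc0 : c ≠ 0 := by
    intro h; rw [h, zero_smul] at hNy; exact hy0 hNy
  obtain ⟨k, hk⟩ : ∃ k, y k ≠ 0 := by
    by_contra h
    push Not at h
    exact hy0 (funext h)
  have hcre : c.re = 0 := by
    have h1 := hdiag k y y ty ty
    rw [hgy, Pi.smul_apply, smul_eq_mul, star_mul'] at h1
    have h2 : (c + star c) * (star (y k) * y k) = 0 := by linear_combination h1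
    rcases mul_eq_zero.1 h2 with h | h
    · have := congrArg Complex.re h
      simp at this
      linarith
    · rcases mul_eq_zero.1 h with h | h
      · exact absurd (star_eq_zero.1 h) hk
      · exact absurd h hk
  refine ⟨-(c⁻¹).im, ?_⟩
  have hcinv : ((-(c⁻¹).im : ℝ) : ℂ) * Complex.I = -c⁻¹ := by
    apply Complex.ext
    · simp [hcre]
    · simp
  rw [hcinv]
  refine Matrix.exists_mulVec_eq_zero_iff.1 ⟨y, hy0, ?_⟩
  rw [add_mulVec, smul_mulVec, one_mulVec]
  have h1 : c⁻¹ • y = N *ᵥ y := by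
    conv_lhs => rw [hNy]
    rw [smul_smul, inv_mul_cancel₀ hc0, one_smul]
  rw [neg_smul, h1, add_neg_cancel]

/-- A set is null for the law of a Gaussian matrix if it is null along all lines in a direction. -/
theorem gaussMat_null_of_lines {v : ℝ≥0} (hv : v ≠ 0) {S : Fin W → Fin W → ℝ}
    (hS : ∀ i j, |S i j| ≤ 1) {A : Set (Fin W → Fin W → ℝ)} (hA : MeasurableSet A)
    (h : ∀ X, ∀ᵐ s ∂(volume.restrict (Set.Icc (0 : ℝ) 1)), shiftMat S s X ∉ A) :
    gaussMat W v A = 0 := by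
  obtain ⟨C, -, hle⟩ := lintegral_le_average (W := W) hv
  have h1 := hle S hS (A.indicator 1) (measurable_one.indicator hA)
  rw [lintegral_indicator_one hA] at h1
  have h2 : ∀ X, (∫⁻ s in Set.Icc (0 : ℝ) 1,
      (A.indicator 1 (shiftMat S s X) : ℝ≥0∞)) = 0 := by
    intro X
    rw [lintegral_congr_ae (g := fun _ => 0), lintegral_zero]
    filter_upwards [h X] with s hs
    rw [Set.indicator_of_notMem hs]
  simp only [h2, lintegral_zero, mul_zero] at h1
  exact le_antisymm h1 bot_le

/-- The inverse is bounded on the compact segment, so by the resolvent identity the norm is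
Lipschitz there and Rademacher's theorem applies. The endpoints are discarded, since only interior
points give two-sided derivatives. -/
theorem ae_differentiableAt_norm_line {N P B : Matrix (Fin W) (Fin W) ℂ} (hN : IsDissipative N)
    (hB : B.IsHermitian) {lam : ℝ} (hlam : 0 < lam) :
    ∀ᵐ s₀ ∂(volume.restrict (Set.Icc (0 : ℝ) 1)),
      DifferentiableAt ℝ (fun s : ℝ => ‖P * (N + ((lam * s₀ + s : ℝ) : ℂ) • B)⁻¹‖) 0 := by
  set M : ℝ → Matrix (Fin W) (Fin W) ℂ := fun s => N + ((lam * s : ℝ) : ℂ) • B with hM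
  have hu : ∀ s, IsUnit (M s).det := by
    intro s
    have : (((lam * s : ℝ) : ℂ) • B).IsHermitian := by
      unfold Matrix.IsHermitian at *
      rw [conjTranspose_smul, hB]; simp
    rw [hM]
    simp only
    rw [add_comm]
    exact (hN.add_hermitian this).isUnit_det
  have hMc : Continuous M := by
    have : Continuous fun s : ℝ => ((lam * s : ℝ) : ℂ) := by fun_prop
    exact continuous_const.add (this.smul continuous_const)
  obtain ⟨Λ, hΛ⟩ := isCompact_Icc.exists_bound_of_continuousOn (s := Set.Icc (0 : ℝ) 1)
    (continuous_inv_of_isUnit hMc hu).continuousOn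
  have hΛ0 : 0 ≤ Λ := (norm_nonneg _).trans (hΛ 0 (by simp))
  have hlip : LipschitzOnWith (Real.toNNReal (‖P‖ * (Λ * (lam * ‖B‖) * Λ)))
      (fun s => ‖P * (M s)⁻¹‖) (Set.Icc (0 : ℝ) 1) := by
    refine LipschitzOnWith.of_dist_le' fun s hs t ht => ?_
    rw [Real.dist_eq]
    refine (abs_norm_sub_norm_le _ _).trans ?_
    have e : P * (M s)⁻¹ - P * (M t)⁻¹ = P * ((M s)⁻¹ * (M t - M s) * (M t)⁻¹) := by
      rw [← mul_sub]
      congr 1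
      rw [mul_sub, sub_mul, nonsing_inv_mul _ (hu s), one_mul, Matrix.mul_assoc,
        mul_nonsing_inv _ (hu t), mul_one]
    have e2 : M t - M s = ((lam * (t - s) : ℝ) : ℂ) • B := by
      rw [hM]
      simp only
      rw [add_sub_add_left_eq_sub, ← sub_smul]
      congr 1
      push_cast; ring
    have e3 : ‖M t - M s‖ = lam * ‖B‖ * dist s t := by
      rw [e2, norm_smul, Complex.norm_real, norm_mul, Real.norm_of_nonneg hlam.le, Real.dist_eq,
        abs_sub_comm, Real.norm_eq_abs]
      ring
    rw [e]
    calc ‖P * ((M s)⁻¹ * (M t - M s) * (M t)⁻¹)‖ ≤ ‖P‖ * (‖(M s)⁻¹‖ * ‖M t - M s‖ * ‖(M t)⁻¹‖) := by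
          refine (norm_mul_le _ _).trans ?_
          gcongr
          refine (norm_mul_le _ _).trans ?_
          gcongr
          exact norm_mul_le _ _
      _ ≤ ‖P‖ * (Λ * (lam * ‖B‖ * dist s t) * Λ) := by
          rw [e3]
          gcongr
          · exact hΛ s hs
          · exact hΛ t ht
      _ = _ := by ring
  have h1 := hlip.ae_differentiableWithinAt_real measurableSet_Icc
  have hne : ∀ᵐ s₀ ∂(volume.restrict (Set.Icc (0 : ℝ) 1)), s₀ ≠ 0 ∧ s₀ ≠ 1 := by
    refine ae_restrict_of_ae ?_
    have h0 : ∀ᵐ s : ℝ, s ≠ 0 := by simp [ae_iff, measure_singleton]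
    have h1 : ∀ᵐ s : ℝ, s ≠ 1 := by simp [ae_iff, measure_singleton]
    filter_upwards [h0, h1] with s a b using ⟨a, b⟩
  filter_upwards [h1, hne, ae_restrict_mem measurableSet_Icc] with s₀ hs₀ hne hmem
  have hd : DifferentiableAt ℝ (fun s => ‖P * (M s)⁻¹‖) s₀ :=
    hs₀.differentiableAt (Icc_mem_nhds (lt_of_le_of_ne hmem.1 hne.1.symm)
      (lt_of_le_of_ne hmem.2 hne.2))
  have e : (fun s : ℝ => ‖P * (N + ((lam * s₀ + s : ℝ) : ℂ) • B)⁻¹‖) =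
      (fun s => ‖P * (M s)⁻¹‖) ∘ fun s => s₀ + s / lam := by
    ext s
    simp only [Function.comp_apply, hM]
    congr 6
    field_simp
  rw [e]
  refine DifferentiableAt.comp (0 : ℝ) ?_ (by fun_prop)
  simpa using hd

end SimpleTop


/-! ### Almost sure simplicity of the top singular value; measurability of the events. -/

section AlmostSureSimple

open scoped Matrix.Norms.L2Operator NNReal ENNReal

/-- Projection along a compact factor is a closed map. This gives measurability of events that
quantify over unit vectors or over bounded parameters. -/
theorem isClosed_exists_mem_compact {X Y : Type*} [TopologicalSpace X] [TopologicalSpace Y]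
    {C : Set (X × Y)} (hC : IsClosed C) {K : Set Y} (hK : IsCompact K) :
    IsClosed {x | ∃ y ∈ K, (x, y) ∈ C} := by
  have := isCompact_iff_compactSpace.1 hK
  have h1 : {x | ∃ y ∈ K, (x, y) ∈ C} =
      Prod.fst '' ((fun p : X × K => (p.1, (p.2 : Y))) ⁻¹' C) := by
    ext x
    constructor
    · rintro ⟨y, hy, h⟩
      exact ⟨(x, ⟨y, hy⟩), h, rfl⟩
    · rintro ⟨⟨x', y⟩, h, rfl⟩
      exact ⟨y, y.2, h⟩
  rw [h1]
  exact isClosedMap_fst_of_compactSpace _ (hC.preimage (by fun_prop))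

theorem continuous_symMat : Continuous (symMat (W := W)) := by
  refine continuous_pi fun i => continuous_pi fun j => ?_
  simp only [symMat, of_apply, symmetrize]
  fun_prop

theorem smul_symMat_shiftMat {S : Fin W → Fin W → ℝ} (hS : ∀ i j, S i j = S j i) (lam s : ℝ)
    (Q : Matrix (Fin W) (Fin W) ℂ) (X : Fin W → Fin W → ℝ) :
    (lam : ℂ) • symMat (shiftMat S s X) + Q =
      ((lam : ℂ) • symMat X + Q) + ((lam * s : ℝ) : ℂ) • complexify S := by
  rw [symMat_shiftMat hS, smul_add, smul_smul, Complex.ofReal_mul, add_right_comm]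
  rfl

/-- Shift by multiples of the identity: a bad shift `s` makes `lam s + i t` a root of a fixed
characteristic polynomial, so only finitely many `s` on each line are bad. -/
theorem ae_no_imaginary_eigenvalue {lam : ℝ} (hlam : 0 < lam) {v : ℝ≥0} (hv : v ≠ 0)
    (Q : Matrix (Fin W) (Fin W) ℂ) :
    ∀ᵐ X ∂(gaussMat W v), ∀ t : ℝ, (((lam : ℂ) • symMat X + Q) +
      ((t : ℂ) * Complex.I) • (1 : Matrix (Fin W) (Fin W) ℂ)).det ≠ 0 := by
  have hcont : Continuous fun p : (Fin W → Fin W → ℝ) × ℝ => (((lam : ℂ) • symMat p.1 + Q) +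
      ((p.2 : ℂ) * Complex.I) • (1 : Matrix (Fin W) (Fin W) ℂ)).det := by
    refine Continuous.matrix_det ?_
    have h1 : Continuous fun p : (Fin W → Fin W → ℝ) × ℝ => symMat p.1 :=
      continuous_symMat.comp continuous_fst
    have h2 : Continuous fun p : (Fin W → Fin W → ℝ) × ℝ => ((p.2 : ℂ) * Complex.I) := by fun_prop
    exact ((h1.const_smul (lam : ℂ)).add continuous_const).add (h2.smul continuous_const)
  set A := {X : Fin W → Fin W → ℝ | ∃ t : ℝ, (((lam : ℂ) • symMat X + Q) +
      ((t : ℂ) * Complex.I) • (1 : Matrix (Fin W) (Fin W) ℂ)).det = 0} with hA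
  have hAm : MeasurableSet A := by
    have h1 : A = ⋃ n : ℕ, {X | ∃ t ∈ Set.Icc (-(n : ℝ)) n, (X, t) ∈
        {p : (Fin W → Fin W → ℝ) × ℝ | (((lam : ℂ) • symMat p.1 + Q) +
          ((p.2 : ℂ) * Complex.I) • (1 : Matrix (Fin W) (Fin W) ℂ)).det = 0}} := by
      ext X
      simp only [hA, Set.mem_ofPred_eq, Set.mem_iUnion]
      constructor
      · rintro ⟨t, ht⟩
        obtain ⟨n, hn⟩ := exists_nat_ge |t|
        exact ⟨n, t, abs_le.1 hn, ht⟩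
      · rintro ⟨n, t, -, ht⟩
        exact ⟨t, ht⟩
    rw [h1]
    exact MeasurableSet.iUnion fun n =>
      (isClosed_exists_mem_compact (isClosed_eq hcont continuous_const) isCompact_Icc).measurableSet
  have hnull : gaussMat W v A = 0 := by
    refine gaussMat_null_of_lines hv (S := fun i j => if i = j then 1 else 0)
      (fun i j => by split_ifs <;> simp) hAm fun X => ae_restrict_of_ae ?_
    set N := (lam : ℂ) • symMat X + Q with hN
    have hfin : (↑((-N).charpoly.roots.toFinset.image fun r : ℂ => r.re / lam) : Set ℝ).Finite :=
      Finset.finite_toSet _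
    have hae : ∀ᵐ s : ℝ, s ∉ (↑((-N).charpoly.roots.toFinset.image fun r : ℂ => r.re / lam) : Set ℝ) :=
      measure_eq_zero_iff_ae_notMem.1 (hfin.measure_zero _)
    filter_upwards [hae] with s hs hsA
    obtain ⟨t, ht⟩ := hsA
    apply hs
    have hone : complexify (fun i j : Fin W => if i = j then (1 : ℝ) else 0) = 1 := by
      ext i j
      simp only [complexify, of_apply, Matrix.one_apply]
      split_ifs <;> simp
    rw [smul_symMat_shiftMat (fun i j => by simp only [eq_comm]), hone,
      add_assoc, ← add_smul, ← hN] at ht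
    simp only [Finset.coe_image, Set.mem_image, Finset.mem_coe, Multiset.mem_toFinset]
    refine ⟨((lam * s : ℝ) : ℂ) + (t : ℂ) * Complex.I, ?_, ?_⟩
    · rw [Polynomial.mem_roots (charpoly_monic _).ne_zero, Polynomial.IsRoot, Matrix.eval_charpoly,
        ← ht]
      congr 1
      ext i j
      simp [Matrix.one_apply, Matrix.diagonal_apply, Matrix.scalar_apply]
      ring_nf
    · simp
      field_simp
  filter_upwards [measure_eq_zero_iff_ae_notMem.1 hnull] with X hX t ht
  exact hX ⟨t, ht⟩

theorem ae_differentiableAt_norm_direction {lam : ℝ} (hlam : 0 < lam) {v : ℝ≥0} (hv : v ≠ 0)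
    {Q : Matrix (Fin W) (Fin W) ℂ} (hQ : IsDissipative Q) (P : Matrix (Fin W) (Fin W) ℂ)
    {S : Fin W → Fin W → ℝ} (hS : ∀ i j, S i j = S j i) (hS1 : ∀ i j, |S i j| ≤ 1) :
    ∀ᵐ X ∂(gaussMat W v), DifferentiableAt ℝ
      (fun s : ℝ => ‖P * (((lam : ℂ) • symMat X + Q) + (s : ℂ) • complexify S)⁻¹‖) 0 := by
  have hSh := complexify_isHermitian hS
  have hc : Continuous (Function.uncurry fun (X : Fin W → Fin W → ℝ) (s : ℝ) =>
      ‖P * (((lam : ℂ) • symMat X + Q) + (s : ℂ) • complexify S)⁻¹‖) := by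
    refine Continuous.norm (continuous_const.mul ?_)
    refine continuous_inv_of_isUnit ?_ ?_
    · have h1 : Continuous fun p : (Fin W → Fin W → ℝ) × ℝ => symMat p.1 :=
        continuous_symMat.comp continuous_fst
      have h2 : Continuous fun p : (Fin W → Fin W → ℝ) × ℝ => (p.2 : ℂ) := by fun_prop
      exact ((h1.const_smul (lam : ℂ)).add continuous_const).add (h2.smul continuous_const)
    · rintro ⟨X, s⟩
      have hH : ((s : ℂ) • complexify S).IsHermitian := by
        unfold Matrix.IsHermitian at *
        rw [conjTranspose_smul, hSh]; simp
      rw [add_comm]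
      exact ((hQ.add_hermitian (isHermitian_smul_symMat lam X)).add_hermitian hH).isUnit_det
  set A := {X : Fin W → Fin W → ℝ | ¬ DifferentiableAt ℝ
      (fun s : ℝ => ‖P * (((lam : ℂ) • symMat X + Q) + (s : ℂ) • complexify S)⁻¹‖) 0} with hA
  have hAm : MeasurableSet A := by
    have h1 := measurableSet_of_differentiableAt_with_param (𝕜 := ℝ) hc
    have h2 : Measurable fun X : Fin W → Fin W → ℝ => (X, (0 : ℝ)) := by fun_prop
    exact (h2 h1).compl
  have hnull : gaussMat W v A = 0 := by
    refine gaussMat_null_of_lines hv hS1 hAm fun X => ?_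
    filter_upwards [ae_differentiableAt_norm_line (P := P)
      (hQ.add_hermitian (isHermitian_smul_symMat lam X)) hSh hlam] with s₀ hs₀ hmem
    apply hmem
    have e : (fun s : ℝ => ‖P * (((lam : ℂ) • symMat (shiftMat S s₀ X) + Q) +
        (s : ℂ) • complexify S)⁻¹‖) =
        fun s : ℝ => ‖P * (((lam : ℂ) • symMat X + Q) +
          ((lam * s₀ + s : ℝ) : ℂ) • complexify S)⁻¹‖ := by
      ext s
      rw [smul_symMat_shiftMat hS, add_assoc _ (((lam * s₀ : ℝ) : ℂ) • complexify S), ← add_smul,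
        ← Complex.ofReal_add]
    rw [e]
    exact hs₀
  filter_upwards [measure_eq_zero_iff_ae_notMem.1 hnull] with X hX
  by_contra h
  exact hX h

/-- The norm of a product of a fixed matrix with the inverse of a perturbed Gaussian matrix is
almost surely attained on a single line. -/
theorem ae_isTopSimple {lam : ℝ} (hlam : 0 < lam) {v : ℝ≥0} (hv : v ≠ 0)
    {Q : Matrix (Fin W) (Fin W) ℂ} (hQ : IsDissipative Q) {P : Matrix (Fin W) (Fin W) ℂ}
    (hP : P ≠ 0) :
    ∀ᵐ X ∂(gaussMat W v), IsTopSimple (P * ((lam : ℂ) • symMat X + Q)⁻¹) := by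
  have h1 : ∀ i j : Fin W, ∀ᵐ X ∂(gaussMat W v), DifferentiableAt ℝ
      (fun s : ℝ => ‖P * (((lam : ℂ) • symMat X + Q) + (s : ℂ) • complexify fun k l =>
        (Pi.single i 1 : Fin W → ℝ) k * (Pi.single i 1 : Fin W → ℝ) l)⁻¹‖) 0 := fun i j =>
    ae_differentiableAt_norm_direction hlam hv hQ P (fun k l => mul_comm _ _) fun k l => by
      by_cases hk : k = i <;> by_cases hl : l = i <;> simp [hk, hl]
  have h2 : ∀ i j : Fin W, ∀ᵐ X ∂(gaussMat W v), i ≠ j → DifferentiableAt ℝ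
      (fun s : ℝ => ‖P * (((lam : ℂ) • symMat X + Q) + (s : ℂ) • complexify fun k l =>
        (Pi.single i 1 + Pi.single j 1 : Fin W → ℝ) k *
          (Pi.single i 1 + Pi.single j 1 : Fin W → ℝ) l)⁻¹‖) 0 := by
    intro i j
    by_cases hij : i = j
    · exact ae_of_all _ fun X h => absurd hij h
    · have he : ∀ k, |(Pi.single i 1 + Pi.single j 1 : Fin W → ℝ) k| ≤ 1 := by
        intro k
        by_cases hk : k = i
        · subst hk; simp [hij]
        · by_cases hk' : k = j
          · subst hk'; simp [hk]
          · simp [hk, hk']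
      filter_upwards [ae_differentiableAt_norm_direction hlam hv hQ P
        (S := fun k l => (Pi.single i 1 + Pi.single j 1 : Fin W → ℝ) k *
          (Pi.single i 1 + Pi.single j 1 : Fin W → ℝ) l) (fun k l => mul_comm _ _) fun k l => by
          rw [abs_mul]; exact mul_le_one₀ (he k) (abs_nonneg _) (he l)] with X hX _ using hX
  filter_upwards [ae_all_iff.2 fun i => ae_all_iff.2 (h1 i),
    ae_all_iff.2 fun i => ae_all_iff.2 (h2 i), ae_no_imaginary_eigenvalue hlam hv Q]
    with X hX1 hX2 hX3
  by_contra hns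
  obtain ⟨t, ht⟩ := exists_imaginary_eigenvalue
    (hQ.add_hermitian (isHermitian_smul_symMat lam X)).isUnit_det hP hns (by
      rintro e ⟨i, j, rfl | ⟨hij, rfl⟩⟩
      · exact hX1 i i
      · exact hX2 i j hij)
  exact hX3 t ht

theorem isCompact_unit : IsCompact {v : Fin W → ℂ | nsq v = 1} := by
  refine Metric.isCompact_of_isClosed_isBounded ?_ ?_
  · refine isClosed_eq ?_ continuous_const
    unfold nsq
    fun_prop
  · refine (Metric.isBounded_closedBall (x := (0 : Fin W → ℂ)) (r := 1)).subset fun v hv => ?_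
    rw [mem_closedBall_zero_iff, pi_norm_le_iff_of_nonneg zero_le_one]
    exact fun i => norm_coordinate_le hv i

theorem continuous_nsq : Continuous (nsq (W := W)) := by
  unfold nsq
  fun_prop

theorem measurableSet_of_isClosed_matrix {Ω : Type*} [MeasurableSpace Ω]
    {M : Ω → Matrix (Fin W) (Fin W) ℂ} (hM : MeasurableEntries M)
    {C : Set (Matrix (Fin W) (Fin W) ℂ)} (hC : IsClosed C) : MeasurableSet {ω | M ω ∈ C} := by
  have h1 : IsClosed {A : Fin W → Fin W → ℂ | Matrix.of A ∈ C} := hC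
  have h2 : Measurable fun ω => (fun i j => M ω i j : Fin W → Fin W → ℂ) :=
    measurable_pi_lambda _ fun i => measurable_pi_lambda _ fun j => hM i j
  exact h2 h1.measurableSet

theorem measurableSet_of_isClosed_matrix_pair {Ω : Type*} [MeasurableSpace Ω]
    {M N : Ω → Matrix (Fin W) (Fin W) ℂ} (hM : MeasurableEntries M) (hN : MeasurableEntries N)
    {C : Set (Matrix (Fin W) (Fin W) ℂ × Matrix (Fin W) (Fin W) ℂ)} (hC : IsClosed C) :
    MeasurableSet {ω | (M ω, N ω) ∈ C} := by
  have h1 : IsClosed {A : (Fin W → Fin W → ℂ) × (Fin W → Fin W → ℂ) |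
      (Matrix.of A.1, Matrix.of A.2) ∈ C} := hC
  have h2 : Measurable fun ω => ((fun i j => M ω i j : Fin W → Fin W → ℂ),
      (fun i j => N ω i j : Fin W → Fin W → ℂ)) :=
    (measurable_pi_lambda _ fun i => measurable_pi_lambda _ fun j => hM i j).prodMk
      (measurable_pi_lambda _ fun i => measurable_pi_lambda _ fun j => hN i j)
  exact h2 h1.measurableSet

theorem measurableSet_isTopSimple {Ω : Type*} [MeasurableSpace Ω]
    {T : Ω → Matrix (Fin W) (Fin W) ℂ} (hT : MeasurableEntries T) :
    MeasurableSet {ω | IsTopSimple (T ω)} := by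
  set C : Set (Matrix (Fin W) (Fin W) ℂ) := {M | ∃ p ∈ {v : Fin W → ℂ | nsq v = 1} ×ˢ
    {v : Fin W → ℂ | nsq v = 1}, (M, p) ∈ {q : Matrix (Fin W) (Fin W) ℂ ×
      ((Fin W → ℂ) × (Fin W → ℂ)) | nsq (q.1 *ᵥ q.2.1) = ‖q.1‖ ^ 2 ∧
        nsq (q.1 *ᵥ q.2.2) = ‖q.1‖ ^ 2 ∧ star q.2.1 ⬝ᵥ q.2.2 = 0}} with hC
  have hCc : IsClosed C := by
    refine isClosed_exists_mem_compact ?_ (isCompact_unit.prod isCompact_unit)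
    have e1 : Continuous fun q : Matrix (Fin W) (Fin W) ℂ × ((Fin W → ℂ) × (Fin W → ℂ)) =>
        q.1 *ᵥ q.2.1 := by fun_prop
    have e2 : Continuous fun q : Matrix (Fin W) (Fin W) ℂ × ((Fin W → ℂ) × (Fin W → ℂ)) =>
        q.1 *ᵥ q.2.2 := by fun_prop
    have e3 : Continuous fun q : Matrix (Fin W) (Fin W) ℂ × ((Fin W → ℂ) × (Fin W → ℂ)) =>
        ‖q.1‖ ^ 2 := by fun_prop
    have e4 : Continuous fun q : Matrix (Fin W) (Fin W) ℂ × ((Fin W → ℂ) × (Fin W → ℂ)) =>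
        star q.2.1 ⬝ᵥ q.2.2 := by fun_prop
    exact (isClosed_eq (continuous_nsq.comp e1) e3).inter
      ((isClosed_eq (continuous_nsq.comp e2) e3).inter (isClosed_eq e4 continuous_const))
  have h1 : {ω | IsTopSimple (T ω)} = {ω | T ω ∈ C}ᶜ := by
    ext ω
    simp only [IsTopSimple, IsTopVector, hC, Set.mem_ofPred_eq, Set.mem_compl_iff, Set.mem_prod,
      not_exists, not_and, Prod.forall]
    constructor
    · rintro h v w ⟨hv, hw⟩ h1 h2
      exact h v w ⟨hv, h1⟩ ⟨hw, h2⟩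
    · rintro h v w ⟨hv, h1⟩ ⟨hw, h2⟩
      exact h v w ⟨hv, hw⟩ h1 h2
  rw [h1]
  exact (measurableSet_of_isClosed_matrix hT hCc).compl

/-- The complement is a countable union over margins `1 / (k + 1)`: failure by a given margin at
some unit vector is a closed condition. -/
theorem measurableSet_forall_isTopVector {Ω : Type*} [MeasurableSpace Ω]
    {T G : Ω → Matrix (Fin W) (Fin W) ℂ} (hT : MeasurableEntries T) (hG : MeasurableEntries G)
    (τ : ℝ) :
    MeasurableSet {ω | ∀ v, IsTopVector (T ω) v → τ ≤ ‖star v ⬝ᵥ (G ω *ᵥ v)‖} := by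
  set C : ℕ → Set (Matrix (Fin W) (Fin W) ℂ × Matrix (Fin W) (Fin W) ℂ) := fun k =>
    {M | ∃ v ∈ {v : Fin W → ℂ | nsq v = 1},
      (M, v) ∈ {q : (Matrix (Fin W) (Fin W) ℂ × Matrix (Fin W) (Fin W) ℂ) × (Fin W → ℂ) |
        nsq (q.1.1 *ᵥ q.2) = ‖q.1.1‖ ^ 2 ∧
          ‖star q.2 ⬝ᵥ (q.1.2 *ᵥ q.2)‖ ≤ τ - 1 / ((k : ℝ) + 1)}} with hC
  have hCc : ∀ k, IsClosed (C k) := by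
    intro k
    refine isClosed_exists_mem_compact ?_ isCompact_unit
    have e1 : Continuous fun q : (Matrix (Fin W) (Fin W) ℂ × Matrix (Fin W) (Fin W) ℂ) ×
        (Fin W → ℂ) => q.1.1 *ᵥ q.2 := by fun_prop
    have e2 : Continuous fun q : (Matrix (Fin W) (Fin W) ℂ × Matrix (Fin W) (Fin W) ℂ) ×
        (Fin W → ℂ) => ‖star q.2 ⬝ᵥ (q.1.2 *ᵥ q.2)‖ := by fun_prop
    exact (isClosed_eq (continuous_nsq.comp e1) (by fun_prop)).inter
      (isClosed_le e2 continuous_const)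
  have h1 : {ω | ∀ v, IsTopVector (T ω) v → τ ≤ ‖star v ⬝ᵥ (G ω *ᵥ v)‖} =
      (⋃ k, {ω | (T ω, G ω) ∈ C k})ᶜ := by
    ext ω
    simp only [Set.mem_ofPred_eq, Set.mem_compl_iff, Set.mem_iUnion, not_exists, hC, not_and]
    constructor
    · rintro h k v hv h1 h2
      have := h v ⟨hv, h1⟩
      have hk : 0 < 1 / ((k : ℝ) + 1) := by positivity
      linarith
    · intro h v hv
      by_contra hlt
      push Not at hlt
      obtain ⟨k, hk⟩ := exists_nat_one_div_lt (sub_pos.2 hlt)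
      exact h k v hv.1 hv.2 (by linarith)
  rw [h1]
  exact (MeasurableSet.iUnion fun k =>
    measurableSet_of_isClosed_matrix_pair hT hG (hCc k)).compl

end AlmostSureSimple


/-! ### The single-site structure of the model and its logarithmic moments. -/

section Model

open scoped Matrix.Norms.L2Operator NNReal ENNReal
open Real (posLog)

/-- The potential built from the symmetric part of the configuration.  It is always Hermitian, and
almost surely equal to the potential itself. -/
noncomputable def symPotential (A : Matrix (Fin W) (Fin W) ℂ) (lam : ℝ) (V : Config K W)
    (x : Site K) : Matrix (Fin W) (Fin W) ℂ :=
  A + (lam : ℂ) • complexify fun i j => (V x i j + V x j i) / 2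

theorem symPotential_isHermitian {A : Matrix (Fin W) (Fin W) ℂ} (hA : A.IsHermitian) (lam : ℝ)
    (V : Config K W) (x : Site K) : (symPotential A lam V x).IsHermitian := by
  refine hA.add ?_
  have := complexify_isHermitian (S := fun i j => (V x i j + V x j i) / 2)
    fun i j => by simp only [add_comm]
  unfold Matrix.IsHermitian at *
  rw [conjTranspose_smul, this]
  simp

theorem symPotential_congr (A : Matrix (Fin W) (Fin W) ℂ) (lam : ℝ) {V V' : Config K W}
    {x : Site K} (h : V x = V' x) : symPotential A lam V x = symPotential A lam V' x := by
  simp only [symPotential, h]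

theorem measurable_symPotential (A : Matrix (Fin W) (Fin W) ℂ) (lam : ℝ) (x : Site K)
    (i j : Fin W) : Measurable fun V : Config K W => symPotential A lam V x i j := by
  simp only [symPotential, complexify, Matrix.add_apply, Matrix.smul_apply, of_apply]
  fun_prop

theorem ae_potential_eq (K : ℕ) (A : Matrix (Fin W) (Fin W) ℂ) (lam : ℝ) :
    ∀ᵐ V ∂(law K W), potential A lam V = symPotential A lam V := by
  filter_upwards [ae_symm_law K W] with V hV
  ext x i j
  simp only [potential, symPotential, complexify, Matrix.add_apply, Matrix.smul_apply, of_apply,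
    hV x j i]
  congr 3
  ring

/-- The configuration with the matrix at a site replaced by the symmetrization of a given one. -/
noncomputable def siteUpdate (V : Config K W) (u : Site K) (X : Fin W → Fin W → ℝ) : Config K W :=
  Function.update V u (symmetrize X)

theorem siteUpdate_self (V : Config K W) (u : Site K) (X : Fin W → Fin W → ℝ) :
    siteUpdate V u X u = symmetrize X := Function.update_self _ _ _

theorem siteUpdate_of_ne (V : Config K W) {u x : Site K} (h : x ≠ u) (X : Fin W → Fin W → ℝ) :
    siteUpdate V u X x = V x := Function.update_of_ne h _ _

theorem measurable_siteUpdate (V : Config K W) (u : Site K) :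
    Measurable fun X : Fin W → Fin W → ℝ => siteUpdate V u X :=
  (measurable_update V).comp (measurable_symmetrize W)

theorem lintegral_siteUpdate (u : Site K) {F : Config K W → ℝ≥0∞} (hF : Measurable F) :
    ∫⁻ V, F V ∂(law K W) = ∫⁻ V, ∫⁻ X, F (siteUpdate V u X) ∂(gaussMat W 1) ∂(law K W) := by
  rw [lintegral_resample_site u hF]
  refine lintegral_congr fun V => ?_
  rw [goe_eq_map]
  exact lintegral_map (hF.comp (measurable_update V)) (measurable_symmetrize W)

theorem symPotential_siteUpdate (A : Matrix (Fin W) (Fin W) ℂ) (lam : ℝ) (V : Config K W)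
    (u : Site K) (X : Fin W → Fin W → ℝ) :
    symPotential A lam (siteUpdate V u X) u = A + (lam : ℂ) • symMat X := by
  simp only [symPotential, siteUpdate_self]
  congr 2
  ext i j
  simp only [complexify, symMat, of_apply, symmetrize, add_comm (X j i)]
  congr 1
  ring

/-- The inverse of the diagonal Green function without the random potential at the site. -/
noncomputable def environment (A : Matrix (Fin W) (Fin W) ℂ) (lam : ℝ) (S : Set (Site K)) (z : ℂ)
    (u : Site K) (V : Config K W) : Matrix (Fin W) (Fin W) ℂ :=
  A - z • (1 : Matrix (Fin W) (Fin W) ℂ) - selfEnergy S (symPotential A lam V) z u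

theorem green_congr_config (A : Matrix (Fin W) (Fin W) ℂ) (lam : ℝ) {S : Set (Site K)}
    {V V' : Config K W} (h : ∀ x ∈ S, V x = V' x) (z : ℂ) :
    green S (symPotential A lam V) z = green S (symPotential A lam V') z :=
  green_congr_potential (fun x hx => symPotential_congr A lam (h x hx)) z

theorem environment_congr (A : Matrix (Fin W) (Fin W) ℂ) (lam : ℝ) {S : Set (Site K)} (z : ℂ)
    {u : Site K} {V V' : Config K W} (h : ∀ x ∈ S, x ≠ u → V x = V' x) :
    environment A lam S z u V = environment A lam S z u V' := by
  have := green_congr_config A lam (S := S \ {u}) (V := V) (V' := V') (fun x hx => h x hx.1 hx.2) z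
  simp only [environment, selfEnergy, this]

theorem environment_siteUpdate (A : Matrix (Fin W) (Fin W) ℂ) (lam : ℝ) (S : Set (Site K)) (z : ℂ)
    (u : Site K) (V : Config K W) (X : Fin W → Fin W → ℝ) :
    environment A lam S z u (siteUpdate V u X) = environment A lam S z u V :=
  environment_congr A lam z fun _ _ hx => siteUpdate_of_ne V hx X

/-- The term `-z` contributes a strictly negative imaginary part; the Green functions of the
neighbours have nonnegative ones and enter with a minus sign. -/
theorem environment_isDissipative {A : Matrix (Fin W) (Fin W) ℂ} (hA : A.IsHermitian) (lam : ℝ)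
    (S : Set (Site K)) {z : ℂ} (hz : 0 < z.im) (u : Site K) (V : Config K W) :
    IsDissipative (environment A lam S z u V) := by
  intro w hw
  have h1 : 0 < nsq w := (nsq_nonneg _).lt_of_ne fun h' => hw (nsq_eq_zero h'.symm)
  have h2 : 0 ≤ ∑ y ∈ neighbors u,
      (star w ⬝ᵥ (green (S \ {u}) (symPotential A lam V) z y y *ᵥ w)).im :=
    Finset.sum_nonneg fun y _ =>
      im_green_nonneg _ (symPotential_isHermitian hA lam V) hz y w
  have h3 : (star w ⬝ᵥ (selfEnergy S (symPotential A lam V) z u *ᵥ w)).im =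
      ∑ y ∈ neighbors u, (star w ⬝ᵥ (green (S \ {u}) (symPotential A lam V) z y y *ᵥ w)).im := by
    rw [selfEnergy, sum_mulVec, dotProduct_sum, Complex.im_sum]
  rw [environment, sub_mulVec, sub_mulVec, dotProduct_sub, dotProduct_sub, Complex.sub_im,
    Complex.sub_im, im_dotProduct_hermitian hA, h3, smul_mulVec, one_mulVec, dotProduct_smul,
    star_dotProduct_self, smul_eq_mul, Complex.mul_im]
  simp only [Complex.ofReal_im, mul_zero, Complex.ofReal_re, zero_add]
  nlinarith [mul_pos hz h1]

theorem green_self_eq_environment {A : Matrix (Fin W) (Fin W) ℂ} (hA : A.IsHermitian) (lam : ℝ)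
    {S : Set (Site K)} {z : ℂ} (hz : 0 < z.im) {u : Site K} (hu : u ∈ S) (V : Config K W) :
    green S (symPotential A lam V) z u u =
      ((symPotential A lam V u - A) + environment A lam S z u V)⁻¹ := by
  rw [green_self_eq_inv (symPotential_isHermitian hA lam V) hz hu, environment]
  congr 1
  abel

/-- This exhibits the diagonal Green function, with the potential frozen off `u`, in the form to
which all the Gaussian matrix estimates apply. -/
theorem green_siteUpdate {A : Matrix (Fin W) (Fin W) ℂ} (hA : A.IsHermitian) (lam : ℝ)
    {S : Set (Site K)} {z : ℂ} (hz : 0 < z.im) {u : Site K} (hu : u ∈ S) (V : Config K W)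
    (X : Fin W → Fin W → ℝ) :
    green S (symPotential A lam (siteUpdate V u X)) z u u =
      ((lam : ℂ) • symMat X + environment A lam S z u V)⁻¹ := by
  rw [green_self_eq_environment hA lam hz hu, environment_siteUpdate, symPotential_siteUpdate,
    add_sub_cancel_left]

theorem measurableEntries_green {A : Matrix (Fin W) (Fin W) ℂ} (hA : A.IsHermitian) (lam : ℝ)
    (S : Set (Site K)) {z : ℂ} (hz : 0 < z.im) (x y : Site K) :
    MeasurableEntries fun V : Config K W => green S (symPotential A lam V) z x y := fun i j =>
  measurable_green S (fun x i j => measurable_symPotential A lam x i j)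
    (fun V => symPotential_isHermitian hA lam V) hz x y i j

theorem measurableEntries_environment {A : Matrix (Fin W) (Fin W) ℂ} (hA : A.IsHermitian)
    (lam : ℝ) (S : Set (Site K)) {z : ℂ} (hz : 0 < z.im) (u : Site K) :
    MeasurableEntries fun V : Config K W => environment A lam S z u V :=
  (measurableEntries_const _).sub
    (MeasurableEntries.sum _ fun w _ => measurableEntries_green hA lam _ hz w w)

theorem measurable_ofReal_posLog_sq {Ω : Type*} [MeasurableSpace Ω] {f : Ω → ℝ}
    (hf : Measurable f) : Measurable fun ω => ENNReal.ofReal (posLog (f ω) ^ 2) :=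
  ((Real.continuous_posLog.measurable.comp hf).pow_const 2).ennreal_ofReal

/-- The logarithmic moments of the diagonal Green function are uniformly bounded. -/
theorem lintegral_posLog_green_le (K : ℕ) {A : Matrix (Fin W) (Fin W) ℂ} (hA : A.IsHermitian)
    {lam : ℝ} (hlam : 0 < lam) : ∃ C : ℝ≥0∞, C ≠ ∞ ∧ ∀ (S : Set (Site K)) (z : ℂ), 0 < z.im →
      ∀ u, ∫⁻ V, ENNReal.ofReal (posLog ‖green S (symPotential A lam V) z u u‖ ^ 2) ∂(law K W) ≤
        C := by
  obtain ⟨C, hC, h⟩ := lintegral_posLog_inv_le W hlam one_ne_zero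
  refine ⟨C, hC, fun S z hz u => ?_⟩
  by_cases hu : u ∈ S
  · rw [lintegral_siteUpdate u (measurable_ofReal_posLog_sq
      (measurableEntries_green hA lam S hz u u).norm)]
    calc _ ≤ ∫⁻ _V, C ∂(law K W) := by
          refine lintegral_mono fun V => ?_
          simp only [green_siteUpdate hA lam hz hu]
          exact h _ (environment_isDissipative hA lam S hz u V)
      _ = C := by simp
  · have : ∀ V, green S (symPotential A lam V) z u u = 0 := fun V =>
      green_off (symPotential_isHermitian hA lam V) hz hu u
    simp [this]

theorem card_neighbors_le (u : Site K) : (neighbors u).card ≤ K + 1 := by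
  cases u with
  | nil =>
    refine Finset.card_image_le.trans ?_
    simp
  | cons a t =>
    refine (Finset.card_insert_le _ _).trans ?_
    gcongr
    exact Finset.card_image_le.trans (by simp)

theorem norm_environment_le (A : Matrix (Fin W) (Fin W) ℂ) (lam : ℝ) (S : Set (Site K)) (z : ℂ)
    (u : Site K) (V : Config K W) : ‖environment A lam S z u V‖ ≤ ‖A‖ + ‖z‖ +
      ∑ w ∈ neighbors u, ‖green (S \ {u}) (symPotential A lam V) z w w‖ := by
  have h1 : ‖(1 : Matrix (Fin W) (Fin W) ℂ)‖ ≤ 1 := by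
    refine norm_le_of_form zero_le_one fun v => ?_
    rw [one_mulVec, one_mul]
  refine (norm_sub_le _ _).trans (add_le_add ((norm_sub_le _ _).trans ?_) (norm_sum_le _ _))
  rw [norm_smul]
  gcongr
  exact mul_le_of_le_one_right (norm_nonneg _) h1

theorem lintegral_posLog_environment_le (K : ℕ) {A : Matrix (Fin W) (Fin W) ℂ}
    (hA : A.IsHermitian) {lam : ℝ} (hlam : 0 < lam) (R : ℝ) :
    ∃ C : ℝ≥0∞, C ≠ ∞ ∧ ∀ (S : Set (Site K)) (z : ℂ), 0 < z.im → ‖z‖ ≤ R → ∀ u,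
      ∫⁻ V, ENNReal.ofReal (posLog ‖environment A lam S z u V‖ ^ 2) ∂(law K W) ≤ C := by
  obtain ⟨C, hC, h⟩ := lintegral_posLog_green_le K hA hlam
  set c := Real.log 2 + posLog (‖A‖ + R) + Real.log (K + 1 : ℕ) with hc
  refine ⟨((K + 1 + 1 : ℕ) : ℝ≥0∞) * (ENNReal.ofReal (c ^ 2) + (K + 1 : ℕ) * C),
    ENNReal.mul_ne_top (by simp) (ENNReal.add_ne_top.2 ⟨ENNReal.ofReal_ne_top,
      ENNReal.mul_ne_top (by simp) hC⟩), fun S z hz hR u => ?_⟩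
  have key : ∀ V : Config K W, ENNReal.ofReal (posLog ‖environment A lam S z u V‖ ^ 2) ≤
      ((K + 1 + 1 : ℕ) : ℝ≥0∞) * (ENNReal.ofReal (c ^ 2) + ∑ w ∈ neighbors u,
        ENNReal.ofReal (posLog ‖green (S \ {u}) (symPotential A lam V) z w w‖ ^ 2)) := by
    intro V
    have h1 : posLog ‖environment A lam S z u V‖ ≤ c + ∑ w ∈ neighbors u,
        posLog ‖green (S \ {u}) (symPotential A lam V) z w w‖ := by
      refine (Real.posLog_le_posLog (norm_nonneg _) (norm_environment_le A lam S z u V)).trans ?_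
      refine Real.posLog_add.trans ?_
      have h2 := Real.posLog_sum (neighbors u)
        fun w => ‖green (S \ {u}) (symPotential A lam V) z w w‖
      have h3 : posLog (‖A‖ + ‖z‖) ≤ posLog (‖A‖ + R) :=
        Real.posLog_le_posLog (by positivity) (by gcongr)
      have h4 : Real.log (neighbors u).card ≤ Real.log (K + 1 : ℕ) := by
        rw [Real.log_of_nat_eq_posLog.symm, Real.log_of_nat_eq_posLog.symm]
        exact Real.posLog_le_posLog (by positivity) (by exact_mod_cast card_neighbors_le u)
      rw [hc]
      linarith
    refine (ofReal_sq_le_sum _ Real.posLog_nonneg h1).trans ?_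
    gcongr
    exact card_neighbors_le u
  refine (lintegral_mono key).trans ?_
  rw [lintegral_const_mul' _ _ (ENNReal.natCast_ne_top _), lintegral_add_left measurable_const,
    lintegral_finsetSum _ fun w _ => measurable_ofReal_posLog_sq
      (measurableEntries_green hA lam _ hz w w).norm]
  refine mul_le_mul' le_rfl (add_le_add (by simp) ?_)
  refine (Finset.sum_le_sum fun w _ => h _ z hz w).trans ?_
  rw [Finset.sum_const, nsmul_eq_mul]
  gcongr
  exact card_neighbors_le u

theorem nsq_smul_inv_norm {P : Matrix (Fin W) (Fin W) ℂ} (hP : P ≠ 0) {a : Fin W → ℂ}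
    (h : nsq (P *ᵥ a) = ‖P‖ ^ 2) : nsq (((‖P‖⁻¹ : ℝ) : ℂ) • (P *ᵥ a)) = 1 := by
  rw [nsq_smul, h, Complex.norm_real, norm_inv, norm_norm, inv_pow]
  exact inv_mul_cancel₀ (pow_ne_zero 2 (norm_ne_zero_iff.2 hP))

/-- The norm of a product is compared with a matrix element of the middle factor. -/
theorem exists_norm_mul_mul_ge (hW : 0 < W) {P R : Matrix (Fin W) (Fin W) ℂ} (hP : P ≠ 0)
    (hR : R ≠ 0) : ∃ a b : Fin W → ℂ, nsq a = 1 ∧ nsq b = 1 ∧ ∀ g : Matrix (Fin W) (Fin W) ℂ,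
      ‖star a ⬝ᵥ (g *ᵥ b)‖ * (‖P‖ * ‖R‖) ≤ ‖P * g * R‖ := by
  obtain ⟨a, ha, ha'⟩ := exists_norm_attained hW Pᴴ
  obtain ⟨b, hb, hb'⟩ := exists_norm_attained hW R
  have hPH : Pᴴ ≠ 0 := fun h => hP (by simpa using h)
  have hPn : ‖P‖ ≠ 0 := norm_ne_zero_iff.2 hP
  have hRn : ‖R‖ ≠ 0 := norm_ne_zero_iff.2 hR
  have ea : nsq (Pᴴ *ᵥ a) = ‖Pᴴ‖ ^ 2 := by rw [← ha', Real.sq_sqrt (nsq_nonneg _)]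
  have eb : nsq (R *ᵥ b) = ‖R‖ ^ 2 := by rw [← hb', Real.sq_sqrt (nsq_nonneg _)]
  refine ⟨((‖Pᴴ‖⁻¹ : ℝ) : ℂ) • (Pᴴ *ᵥ a), ((‖R‖⁻¹ : ℝ) : ℂ) • (R *ᵥ b),
    nsq_smul_inv_norm hPH ea, nsq_smul_inv_norm hR eb, fun g => ?_⟩
  have h1 : star (Pᴴ *ᵥ a) ⬝ᵥ (g *ᵥ (R *ᵥ b)) = star a ⬝ᵥ ((P * g * R) *ᵥ b) := by
    rw [star_mulVec_dotProduct, conjTranspose_conjTranspose, mulVec_mulVec, mulVec_mulVec,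
      Matrix.mul_assoc]
  rw [l2_opNorm_conjTranspose, star_smul, smul_dotProduct, mulVec_smul, dotProduct_smul, h1,
    norm_smul, norm_smul, norm_star, Complex.norm_real, Complex.norm_real, norm_inv, norm_inv,
    norm_norm, norm_norm]
  calc _ = ‖star a ⬝ᵥ ((P * g * R) *ᵥ b)‖ := by field_simp
    _ ≤ _ := norm_form_le _ ha hb

/-- The upper bound `n` controls the logarithm when `ρ ≥ 1`, the lower bound `f` when `ρ ≤ 1`. -/
theorem ofReal_log_sq_le {ρ f n : ℝ} (hf : 0 ≤ f) (hfρ : f ≤ ρ) (hρn : ρ ≤ n) :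
    ENNReal.ofReal (Real.log ρ ^ 2) ≤ ENNReal.ofReal (posLog n ^ 2) + logSqTop f := by
  rcases hf.eq_or_lt with h0 | h0
  · simp [logSqTop, ← h0]
  have hρ : 0 < ρ := h0.trans_le hfρ
  rw [logSqTop_of_ne_zero h0.ne']
  rcases le_total 1 ρ with h | h
  · refine le_add_right (ENNReal.ofReal_le_ofReal ?_)
    have h1 := Real.log_nonneg h
    gcongr
    refine (Real.log_le_log hρ hρn).trans ?_
    rw [Real.posLog_apply]
    exact le_max_right _ _
  · refine le_add_left (ENNReal.ofReal_le_ofReal ?_)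
    have h1 := Real.log_nonpos hρ.le h
    have h2 : -Real.log ρ ≤ posLog f⁻¹ := by
      rw [Real.posLog_apply, Real.log_inv]
      have := Real.log_le_log h0 hfρ
      exact le_max_of_le_right (by linarith)
    rw [logSq, ← neg_sq]
    gcongr
    linarith

/-- Multiplicative insertion of a diagonal Green function changes the logarithm of the norm by a
quantity with uniformly bounded second moment. -/
theorem lintegral_log_ratio_le (K : ℕ) (hW : 0 < W) {A : Matrix (Fin W) (Fin W) ℂ}
    (hA : A.IsHermitian) {lam : ℝ} (hlam : 0 < lam) (R : ℝ) :
    ∃ C : ℝ≥0∞, C ≠ ∞ ∧ ∀ (S : Set (Site K)) (z : ℂ), 0 < z.im → ‖z‖ ≤ R → ∀ u ∈ S,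
      ∀ P Q : Config K W → Matrix (Fin W) (Fin W) ℂ, MeasurableEntries P → MeasurableEntries Q →
      (∀ V, P V ≠ 0) → (∀ V, Q V ≠ 0) → (∀ V X, P (siteUpdate V u X) = P V) →
      (∀ V X, Q (siteUpdate V u X) = Q V) →
      ∫⁻ V, ENNReal.ofReal (Real.log (‖P V * green S (symPotential A lam V) z u u * Q V‖ /
        (‖P V‖ * ‖Q V‖)) ^ 2) ∂(law K W) ≤ C := by
  obtain ⟨C₁, hC₁, h₁⟩ := lintegral_posLog_inv_le W hlam one_ne_zero
  obtain ⟨C₂, hC₂, h₂⟩ := lintegral_logSqTop_form_le hW hlam one_ne_zero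
  obtain ⟨C₃, hC₃, h₃⟩ := lintegral_posLog_environment_le K hA hlam R
  refine ⟨C₁ + C₂ * (1 + C₃), ENNReal.add_ne_top.2 ⟨hC₁, ENNReal.mul_ne_top hC₂
    (ENNReal.add_ne_top.2 ⟨by simp, hC₃⟩)⟩, ?_⟩
  intro S z hz hR u hu P Q hPm hQm hP hQ hPu hQu
  have hgm := measurableEntries_green hA lam S hz u u
  have hm : Measurable fun V : Config K W => ENNReal.ofReal (Real.log
      (‖P V * green S (symPotential A lam V) z u u * Q V‖ / (‖P V‖ * ‖Q V‖)) ^ 2) :=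
    ((((hPm.mul hgm).mul hQm).norm.div (hPm.norm.mul hQm.norm)).log.pow_const 2).ennreal_ofReal
  rw [lintegral_siteUpdate u hm]
  have key : ∀ V : Config K W, ∫⁻ X, ENNReal.ofReal (Real.log (‖P (siteUpdate V u X) *
      green S (symPotential A lam (siteUpdate V u X)) z u u * Q (siteUpdate V u X)‖ /
        (‖P (siteUpdate V u X)‖ * ‖Q (siteUpdate V u X)‖)) ^ 2) ∂(gaussMat W 1) ≤
      C₁ + C₂ * (1 + ENNReal.ofReal (posLog ‖environment A lam S z u V‖ ^ 2)) := by
    -- With everything but the matrix at `u` frozen, the outer factors are constant and the ratio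
    -- lies between a matrix element and the norm of the middle factor.
    intro V
    simp only [hPu, hQu, green_siteUpdate hA lam hz hu]
    obtain ⟨a, b, ha, hb, hab⟩ := exists_norm_mul_mul_ge hW (hP V) (hQ V)
    have hpos : 0 < ‖P V‖ * ‖Q V‖ :=
      mul_pos (norm_pos_iff.2 (hP V)) (norm_pos_iff.2 (hQ V))
    have hd := environment_isDissipative hA lam S hz u V
    set E := environment A lam S z u V with hE
    calc _ ≤ ∫⁻ X, (ENNReal.ofReal (posLog ‖((lam : ℂ) • symMat X + E)⁻¹‖ ^ 2) +
          logSqTop ‖star a ⬝ᵥ (((lam : ℂ) • symMat X + E)⁻¹ *ᵥ b)‖) ∂(gaussMat W 1) := by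
          refine lintegral_mono fun X => ofReal_log_sq_le (norm_nonneg _) ?_ ?_
          · rw [le_div_iff₀ hpos]
            exact hab _
          · rw [div_le_iff₀ hpos]
            calc _ ≤ ‖P V‖ * ‖((lam : ℂ) • symMat X + E)⁻¹‖ * ‖Q V‖ := by
                  refine (norm_mul_le _ _).trans ?_
                  gcongr
                  exact norm_mul_le _ _
              _ = _ := by ring
      _ ≤ _ := by
          rw [lintegral_add_left (measurable_ofReal_posLog_sq
            (measurableEntries_inv_gauss lam E).norm)]
          exact add_le_add (h₁ E hd) (h₂ E hd a b ha hb)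
  refine (lintegral_mono key).trans ?_
  rw [lintegral_add_left measurable_const, lintegral_const_mul' _ _ hC₂,
    lintegral_add_left measurable_const]
  refine add_le_add (by simp) (mul_le_mul' le_rfl (add_le_add (by simp) (h₃ S z hz hR u)))

end Model


/-! ### Increments of the logarithm of the Green function along a path. -/

section Increments

open scoped Matrix.Norms.L2Operator NNReal ENNReal
open Real (posLog)

/-- The Green function from the root to the predecessor of `x` on the tree without `x`. -/
noncomputable def cutMat (A : Matrix (Fin W) (Fin W) ℂ) (lam : ℝ) (z : ℂ) (x : Site K)
    (V : Config K W) : Matrix (Fin W) (Fin W) ℂ :=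
  green {x}ᶜ (symPotential A lam V) z [] x.tail

theorem measurableEntries_cutMat {A : Matrix (Fin W) (Fin W) ℂ} (hA : A.IsHermitian) (lam : ℝ)
    {z : ℂ} (hz : 0 < z.im) (x : Site K) :
    MeasurableEntries fun V : Config K W => cutMat A lam z x V :=
  measurableEntries_green hA lam _ hz _ _

theorem cutMat_congr {A : Matrix (Fin W) (Fin W) ℂ} (hA : A.IsHermitian) (lam : ℝ)
    {z : ℂ} (hz : 0 < z.im) {x : Site K} (hx : x ≠ []) {V V' : Config K W}
    (h : ∀ y ∉ desc x, V y = V' y) : cutMat A lam z x V = cutMat A lam z x V' :=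
  green_root_congr (symPotential_isHermitian hA lam V) (symPotential_isHermitian hA lam V') hz hx
    (by simp) (by simp) rfl (fun y hy => symPotential_congr A lam (h y hy)) _ (nil_not_mem_desc hx) _

theorem isUnit_green_self {A : Matrix (Fin W) (Fin W) ℂ} (hA : A.IsHermitian) (lam : ℝ)
    {S : Set (Site K)} {z : ℂ} (hz : 0 < z.im) {u : Site K} (hu : u ∈ S) (V : Config K W) :
    IsUnit (green S (symPotential A lam V) z u u) :=
  IsUnit.of_mul_eq_one _ (green_self_mul (symPotential_isHermitian hA lam V) hz hu)

theorem cutMat_cons {A : Matrix (Fin W) (Fin W) ℂ} (hA : A.IsHermitian) (lam : ℝ)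
    {z : ℂ} (hz : 0 < z.im) {u : Site K} (hu : u ≠ []) (i : Fin K) (V : Config K W) :
    cutMat A lam z (i :: u) V =
      -(cutMat A lam z u V * green {i :: u}ᶜ (symPotential A lam V) z u u) :=
  cutGreen_extend (symPotential_isHermitian hA lam V) hz hu i

theorem self_mem_compl_cons (i : Fin K) (u : Site K) : u ∈ ({i :: u}ᶜ : Set (Site K)) := by
  simp

/-- Up to sign it is a product of invertible diagonal Green functions along the path. Being nonzero,
it has a genuine logarithm of its norm. -/
theorem isUnit_cutMat {A : Matrix (Fin W) (Fin W) ℂ} (hA : A.IsHermitian) (lam : ℝ)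
    {z : ℂ} (hz : 0 < z.im) {x : Site K} (hx : x ≠ []) (V : Config K W) :
    IsUnit (cutMat A lam z x V) := by
  induction x with
  | nil => exact absurd rfl hx
  | cons i u ih =>
    by_cases hu : u = []
    · subst hu
      exact isUnit_green_self hA lam hz (self_mem_compl_cons i []) V
    · rw [cutMat_cons hA lam hz hu]
      exact ((ih hu).mul (isUnit_green_self hA lam hz (self_mem_compl_cons i u) V)).neg

theorem ne_zero_of_isUnit (hW : 0 < W) {M : Matrix (Fin W) (Fin W) ℂ} (hM : IsUnit M) : M ≠ 0 := by
  have : Nonempty (Fin W) := ⟨⟨0, hW⟩⟩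
  exact hM.ne_zero

theorem norm_one_matrix (hW : 0 < W) : ‖(1 : Matrix (Fin W) (Fin W) ℂ)‖ = 1 := by
  have : Nonempty (Fin W) := ⟨⟨0, hW⟩⟩
  exact CStarRing.norm_one

/-- The logarithm of the norm of `cutMat`. -/
noncomputable def logCut (A : Matrix (Fin W) (Fin W) ℂ) (lam : ℝ) (z : ℂ) (x : Site K)
    (V : Config K W) : ℝ := Real.log ‖cutMat A lam z x V‖

theorem measurable_logCut {A : Matrix (Fin W) (Fin W) ℂ} (hA : A.IsHermitian) (lam : ℝ)
    {z : ℂ} (hz : 0 < z.im) (x : Site K) :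
    Measurable fun V : Config K W => logCut A lam z x V :=
  (measurableEntries_cutMat hA lam hz x).norm.log

/-- Here the root itself is removed, the matrix is zero, and the convention `Real.log 0 = 0`
supplies the value proper to an empty product. -/
theorem logCut_nil {A : Matrix (Fin W) (Fin W) ℂ} (hA : A.IsHermitian) (lam : ℝ)
    {z : ℂ} (hz : 0 < z.im) (V : Config K W) : logCut A lam z [] V = 0 := by
  have : cutMat A lam z [] V = 0 :=
    green_off (symPotential_isHermitian hA lam V) hz (by simp) _
  rw [logCut, this]
  simp

theorem cutMat_siteUpdate {A : Matrix (Fin W) (Fin W) ℂ} (hA : A.IsHermitian) (lam : ℝ)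
    {z : ℂ} (hz : 0 < z.im) {x u : Site K} (hx : x ≠ []) (hu : u ∈ desc x) (V : Config K W)
    (X : Fin W → Fin W → ℝ) : cutMat A lam z x (siteUpdate V u X) = cutMat A lam z x V :=
  cutMat_congr hA lam hz hx fun y hy => siteUpdate_of_ne V (fun h => hy (by rwa [h])) X

/-- The configuration seen from a site. -/
def shiftConfig (p : Site K) (V : Config K W) : Config K W := fun w => V (w ++ p)

theorem measurePreserving_shiftConfig (p : Site K) :
    MeasurePreserving (shiftConfig (W := W) p) (law K W) (law K W) :=
  measurePreserving_comp (List.append_left_injective p)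

theorem cutMat_append {A : Matrix (Fin W) (Fin W) ℂ} (hA : A.IsHermitian) (lam : ℝ)
    {z : ℂ} (hz : 0 < z.im) {u w : Site K} (hu : u ≠ []) (hw : w ≠ []) (i : Fin K)
    (V : Config K W) :
    cutMat A lam z (w ++ i :: u) V =
      cutMat A lam z u V * green {w ++ i :: u}ᶜ (symPotential A lam V) z u u *
        cutMat A lam z w (shiftConfig (i :: u) V) :=
  cutGreen_split (symPotential_isHermitian hA lam V) hz hu hw i

theorem ne_append_cons (w u : Site K) (i : Fin K) : u ≠ w ++ i :: u := by
  intro h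
  have := congrArg List.length h
  simp at this
  omega

theorem append_not_desc (w u : Site K) (i : Fin K) : w ++ i :: u ≠ u := (ne_append_cons w u i).symm

/-- Uniform second moment bounds for the increments of `logCut`. -/
theorem exists_logCut_increment_bound (K : ℕ) (hW : 0 < W) {A : Matrix (Fin W) (Fin W) ℂ}
    (hA : A.IsHermitian) {lam : ℝ} (hlam : 0 < lam) (R : ℝ) :
    ∃ C : ℝ≥0∞, C ≠ ∞ ∧ ∀ z : ℂ, 0 < z.im → ‖z‖ ≤ R →
      (∀ (u : Site K) (i : Fin K), ∫⁻ V, ENNReal.ofReal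
        ((logCut A lam z (i :: u) V - logCut A lam z u V) ^ 2) ∂(law K W) ≤ C) ∧
      (∀ (u w : Site K) (i : Fin K), u ≠ [] → w ≠ [] → ∫⁻ V, ENNReal.ofReal
        ((logCut A lam z (w ++ i :: u) V - logCut A lam z u V -
          logCut A lam z w (shiftConfig (i :: u) V)) ^ 2) ∂(law K W) ≤ C) ∧
      (∀ x : Site K, x ≠ [] → ∫⁻ V, ENNReal.ofReal
        ((Real.log ‖green Set.univ (symPotential A lam V) z [] x‖ - logCut A lam z x V) ^ 2)
          ∂(law K W) ≤ C) := by
  obtain ⟨C, hC, h⟩ := lintegral_log_ratio_le K hW hA hlam R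
  have hone : (1 : Matrix (Fin W) (Fin W) ℂ) ≠ 0 := ne_zero_of_isUnit hW isUnit_one
  have hn1 := norm_one_matrix hW
  have hm1 : MeasurableEntries fun _ : Config K W => (1 : Matrix (Fin W) (Fin W) ℂ) :=
    measurableEntries_const _
  refine ⟨C, hC, fun z hz hR => ⟨fun u i => ?_, fun u w i hu hw => ?_, fun x hx => ?_⟩⟩
  · by_cases hu : u = []
    · subst hu
      have := h {[i]}ᶜ z hz hR [] (self_mem_compl_cons i []) (fun _ => 1) (fun _ => 1) hm1 hm1
        (fun _ => hone) (fun _ => hone) (fun _ _ => rfl) (fun _ _ => rfl)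
      simp only [logCut_nil hA lam hz, sub_zero]
      simpa [hn1, logCut, cutMat] using this
    · have := h {i :: u}ᶜ z hz hR u (self_mem_compl_cons i u) (fun V => cutMat A lam z u V)
        (fun _ => 1) (measurableEntries_cutMat hA lam hz u) hm1
        (fun V => ne_zero_of_isUnit hW (isUnit_cutMat hA lam hz hu V)) (fun _ => hone)
        (fun V X => cutMat_siteUpdate hA lam hz hu (self_mem_desc u) V X) (fun _ _ => rfl)
      refine le_trans (lintegral_mono fun V => le_of_eq ?_) this
      have h1 : ‖cutMat A lam z (i :: u) V‖ ≠ 0 :=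
        norm_ne_zero_iff.2 (ne_zero_of_isUnit hW (isUnit_cutMat hA lam hz (by simp) V))
      have h2 : ‖cutMat A lam z u V‖ ≠ 0 :=
        norm_ne_zero_iff.2 (ne_zero_of_isUnit hW (isUnit_cutMat hA lam hz hu V))
      rw [hn1, mul_one, mul_one, ← norm_neg (_ * _), ← cutMat_cons hA lam hz hu,
        Real.log_div h1 h2]
      rfl
  · have := h {w ++ i :: u}ᶜ z hz hR u (by simpa using ne_append_cons w u i)
      (fun V => cutMat A lam z u V) (fun V => cutMat A lam z w (shiftConfig (i :: u) V))
      (measurableEntries_cutMat hA lam hz u)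
      ((measurableEntries_cutMat hA lam hz w).comp (measurePreserving_shiftConfig _).measurable)
      (fun V => ne_zero_of_isUnit hW (isUnit_cutMat hA lam hz hu V))
      (fun V => ne_zero_of_isUnit hW (isUnit_cutMat hA lam hz hw _))
      (fun V X => cutMat_siteUpdate hA lam hz hu (self_mem_desc u) V X)
      (fun V X => by
        congr 1
        ext1 y
        exact siteUpdate_of_ne V (append_not_desc y u i) X)
    refine le_trans (lintegral_mono fun V => le_of_eq ?_) this
    have h1 : ‖cutMat A lam z (w ++ i :: u) V‖ ≠ 0 :=
      norm_ne_zero_iff.2 (ne_zero_of_isUnit hW (isUnit_cutMat hA lam hz (by simp) V))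
    have h2 : ‖cutMat A lam z u V‖ ≠ 0 :=
      norm_ne_zero_iff.2 (ne_zero_of_isUnit hW (isUnit_cutMat hA lam hz hu V))
    have h3 : ‖cutMat A lam z w (shiftConfig (i :: u) V)‖ ≠ 0 :=
      norm_ne_zero_iff.2 (ne_zero_of_isUnit hW (isUnit_cutMat hA lam hz hw _))
    rw [← cutMat_append hA lam hz hu hw, Real.log_div h1 (mul_ne_zero h2 h3), Real.log_mul h2 h3,
      ← sub_sub]
    rfl
  · have := h Set.univ z hz hR x (Set.mem_univ x) (fun V => cutMat A lam z x V)
      (fun _ => 1) (measurableEntries_cutMat hA lam hz x) hm1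
      (fun V => ne_zero_of_isUnit hW (isUnit_cutMat hA lam hz hx V)) (fun _ => hone)
      (fun V X => cutMat_siteUpdate hA lam hz hx (self_mem_desc x) V X) (fun _ _ => rfl)
    refine le_trans (lintegral_mono fun V => le_of_eq ?_) this
    have e : cutMat A lam z x V * green Set.univ (symPotential A lam V) z x x =
        -green Set.univ (symPotential A lam V) z [] x := by
      rw [fullGreen_factor (symPotential_isHermitian hA lam V) hz hx, neg_neg]
      rfl
    have h2 : ‖cutMat A lam z x V‖ ≠ 0 :=
      norm_ne_zero_iff.2 (ne_zero_of_isUnit hW (isUnit_cutMat hA lam hz hx V))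
    have h1 : ‖green Set.univ (symPotential A lam V) z [] x‖ ≠ 0 := by
      rw [← norm_neg, ← e]
      exact norm_ne_zero_iff.2 (ne_zero_of_isUnit hW ((isUnit_cutMat hA lam hz hx V).mul
        (isUnit_green_self hA lam hz (Set.mem_univ x) V)))
    rw [hn1, mul_one, mul_one, e, norm_neg, Real.log_div h1 h2]
    rfl

theorem levelMap_nil (π : ℕ → Equiv.Perm (Fin K)) : levelMap π [] = [] := rfl

/-- Level-preserving automorphisms act on the Green functions. -/
theorem cutMat_levelMap {A : Matrix (Fin W) (Fin W) ℂ} (hA : A.IsHermitian) (lam : ℝ)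
    {z : ℂ} (hz : 0 < z.im) (π : ℕ → Equiv.Perm (Fin K)) (x : Site K) (V : Config K W) :
    cutMat A lam z (levelMap π x) V = cutMat A lam z x fun w => V (levelMap π w) := by
  have h := green_levelMap {levelMap π x}ᶜ (symPotential_isHermitian hA lam V) hz π [] x.tail
  have e : levelMap π ⁻¹' {levelMap π x}ᶜ = {x}ᶜ := by
    ext w
    simp [(levelMap_injective π).eq_iff]
  rw [e, levelMap_nil, ← tail_levelMap] at h
  exact h

theorem fullGreen_levelMap {A : Matrix (Fin W) (Fin W) ℂ} (hA : A.IsHermitian) (lam : ℝ)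
    {z : ℂ} (hz : 0 < z.im) (π : ℕ → Equiv.Perm (Fin K)) (x : Site K) (V : Config K W) :
    green Set.univ (symPotential A lam V) z [] (levelMap π x) =
      green Set.univ (symPotential A lam fun w => V (levelMap π w)) z [] x := by
  have h := green_levelMap Set.univ (symPotential_isHermitian hA lam V) hz π [] x
  rw [Set.preimage_univ, levelMap_nil] at h
  exact h

end Increments

/-! ### Second moments and standard deviations. -/

section SecondMoments

open scoped ENNReal

variable {Ω : Type*} [MeasurableSpace Ω] {μ : Measure Ω}

theorem memLp_two_of_lintegral_le {f : Ω → ℝ} (hf : Measurable f) {C : ℝ≥0∞} (hC : C ≠ ∞)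
    (h : ∫⁻ ω, ENNReal.ofReal (f ω ^ 2) ∂μ ≤ C) :
    MemLp f 2 μ ∧ ∫ ω, f ω ^ 2 ∂μ ≤ C.toReal := by
  have hi : Integrable (fun ω => f ω ^ 2) μ := by
    refine ⟨(hf.pow_const 2).aestronglyMeasurable, ?_⟩
    rw [hasFiniteIntegral_iff_ofReal (ae_of_all _ fun ω => sq_nonneg _)]
    exact h.trans_lt hC.lt_top
  refine ⟨(memLp_two_iff_integrable_sq hf.aestronglyMeasurable).2 hi, ?_⟩
  rw [integral_eq_lintegral_of_nonneg_ae (ae_of_all _ fun ω => sq_nonneg _)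
    (hf.pow_const 2).aestronglyMeasurable]
  exact ENNReal.toReal_mono hC h

/-- The triangle inequality for standard deviations, obtained from a weighted Young inequality with
weights `κ / s` and `s / κ`. -/
theorem variance_add_le_sq [IsProbabilityMeasure μ] {X Z : Ω → ℝ} (hX : MemLp X 2 μ)
    (hZ : MemLp Z 2 μ) {s κ : ℝ} (hs : 0 < s) (hκ : 0 < κ) (hXs : variance X μ ≤ s ^ 2)
    (hZκ : ∫ ω, Z ω ^ 2 ∂μ ≤ κ ^ 2) : variance (X + Z) μ ≤ (s + κ) ^ 2 := by
  have h1 : variance (X + Z) μ ≤ ∫ ω, ((X ω - μ[X]) + Z ω) ^ 2 ∂μ := by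
    have h2 : variance (X + Z) μ = variance (fun ω => (X ω - μ[X]) + Z ω) μ := by
      have : (fun ω => (X ω - μ[X]) + Z ω) = fun ω => (X + Z) ω + (-μ[X]) := by
        ext ω; simp; ring
      rw [this, variance_add_const (hX.add hZ).aestronglyMeasurable]
    rw [h2]
    exact variance_le_expectation_sq (((hX.sub (memLp_const _)).add hZ).aestronglyMeasurable)
  refine h1.trans ?_
  have hXi : Integrable (fun ω => (X ω - μ[X]) ^ 2) μ := (hX.sub (memLp_const _)).integrable_sq
  have hZi : Integrable (fun ω => Z ω ^ 2) μ := hZ.integrable_sq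
  have hv : ∫ ω, (X ω - μ[X]) ^ 2 ∂μ = variance X μ :=
    (variance_eq_integral hX.aestronglyMeasurable.aemeasurable).symm
  calc ∫ ω, ((X ω - μ[X]) + Z ω) ^ 2 ∂μ
      ≤ ∫ ω, ((1 + κ / s) * (X ω - μ[X]) ^ 2 + (1 + s / κ) * Z ω ^ 2) ∂μ := by
        refine integral_mono_of_nonneg (ae_of_all _ fun ω => sq_nonneg _)
          ((hXi.const_mul _).add (hZi.const_mul _)) (ae_of_all _ fun ω => ?_)
        have h3 : (1 + κ / s) * (X ω - μ[X]) ^ 2 + (1 + s / κ) * Z ω ^ 2 -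
            ((X ω - μ[X]) + Z ω) ^ 2 = (κ * (X ω - μ[X]) - s * Z ω) ^ 2 / (s * κ) := by
          field_simp
          ring
        have h4 : 0 ≤ (κ * (X ω - μ[X]) - s * Z ω) ^ 2 / (s * κ) := by positivity
        simp only
        linarith
    _ = (1 + κ / s) * variance X μ + (1 + s / κ) * ∫ ω, Z ω ^ 2 ∂μ := by
        rw [integral_add (hXi.const_mul _) (hZi.const_mul _), integral_const_mul,
          integral_const_mul, hv]
    _ ≤ (1 + κ / s) * s ^ 2 + (1 + s / κ) * κ ^ 2 := by gcongr
    _ = (s + κ) ^ 2 := by field_simp; ring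

theorem abs_integral_le_of_sq [IsProbabilityMeasure μ] {Z : Ω → ℝ} (hZ : MemLp Z 2 μ) {κ : ℝ}
    (hκ : 0 < κ) (h : ∫ ω, Z ω ^ 2 ∂μ ≤ κ ^ 2) : |∫ ω, Z ω ∂μ| ≤ κ := by
  have h1 := variance_nonneg Z μ
  have h2 := variance_eq_sub hZ
  have h3 : μ[Z ^ 2] = ∫ ω, Z ω ^ 2 ∂μ := rfl
  rw [h3] at h2
  exact abs_le_of_sq_le_sq (by linarith) hκ.le

end SecondMoments


/-! ### Almost additive sequences: linear variance, rate of the mean, strong law. -/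

section AlmostAdditive

open scoped ENNReal

variable {Ω : Type*} [MeasurableSpace Ω] {μ : Measure Ω}

/-- A sequence of random variables which is additive with independent parts, up to errors which are
bounded in mean square. -/
structure AlmostAdditive (μ : Measure Ω) (a : ℕ → Ω → ℝ) (κ : ℝ) : Prop where
  pos : 0 < κ
  memLp : ∀ n, MemLp (a n) 2 μ
  zero : a 0 = 0
  incr : ∀ n, ∫ ω, (a (n + 1) ω - a n ω) ^ 2 ∂μ ≤ κ ^ 2
  split : ∀ k l, 0 < k → 0 < l → ∃ b : Ω → ℝ, IdentDistrib b (a l) μ μ ∧ IndepFun (a k) b μ ∧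
    ∫ ω, (a (k + l + 1) ω - a k ω - b ω) ^ 2 ∂μ ≤ κ ^ 2

namespace AlmostAdditive

variable {a : ℕ → Ω → ℝ} {κ : ℝ}

theorem le_sqrt_bound (k : ℕ) (hk : 0 < k) :
    1 ≤ 6 * Real.sqrt k - 5 := by
  have : 1 ≤ Real.sqrt k := Real.one_le_sqrt.2 (by exact_mod_cast hk)
  linarith

/-- Induction by halving on the standard deviation. Two independent halves multiply it by `√2` and
the error adds `κ`; an even index costs one more increment `κ`. The offset `-5` absorbs both: `√2 (6
√k - 5) + 1 ≤ 6 √(2 k) - 6` because `5 √2 ≥ 7`. -/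
theorem variance_le [IsProbabilityMeasure μ] (h : AlmostAdditive μ a κ) (n : ℕ) (hn : 0 < n) :
    variance (a n) μ ≤ (κ * (6 * Real.sqrt n - 5)) ^ 2 := by
  have hκ := h.pos
  have incr : ∀ (n : ℕ) (s : ℝ), 0 < s → variance (a n) μ ≤ s ^ 2 →
      variance (a (n + 1)) μ ≤ (s + κ) ^ 2 := by
    intro n s hs hv
    have := variance_add_le_sq (h.memLp n) ((h.memLp (n + 1)).sub (h.memLp n)) hs hκ hv (h.incr n)
    rwa [add_sub_cancel] at this
  have mono : ∀ (n : ℕ) (s t : ℝ), 0 ≤ s → s ≤ t → variance (a n) μ ≤ s ^ 2 →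
      variance (a n) μ ≤ t ^ 2 := fun n s t hs hst hv => hv.trans (by gcongr)
  have one : variance (a 1) μ ≤ κ ^ 2 := by
    refine (variance_le_expectation_sq (h.memLp 1).1).trans ?_
    have := h.incr 0
    simpa [h.zero] using this
  induction n using Nat.strong_induction_on with
  | _ n ih =>
  by_cases hn1 : n = 1
  · subst hn1
    norm_num
    exact one
  by_cases hn2 : n = 2
  · subst hn2
    refine mono 2 (κ + κ) _ (by positivity) ?_ (incr 1 κ hκ one)
    have : (7 : ℝ) / 6 ≤ Real.sqrt 2 := by
      rw [show (7 : ℝ) / 6 = Real.sqrt ((7 / 6) ^ 2) from (Real.sqrt_sq (by norm_num)).symm]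
      exact Real.sqrt_le_sqrt (by norm_num)
    push_cast
    nlinarith
  have h2 : (7 : ℝ) / 5 ≤ Real.sqrt 2 := by
    rw [show (7 : ℝ) / 5 = Real.sqrt ((7 / 5) ^ 2) from (Real.sqrt_sq (by norm_num)).symm]
    exact Real.sqrt_le_sqrt (by norm_num)
  have odd : ∀ k, 0 < k → k < n →
      variance (a (k + k + 1)) μ ≤ (κ * (6 * Real.sqrt (k + k : ℕ) - 6)) ^ 2 ∧
      0 < κ * (6 * Real.sqrt (k + k : ℕ) - 6) := by
    intro k hk hkn
    obtain ⟨b, hb, hi, hZ⟩ := h.split k k hk hk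
    have hbL : MemLp b 2 μ := hb.memLp_iff.2 (h.memLp k)
    have hik := ih k hkn hk
    have h1 := le_sqrt_bound k hk
    have hs : 0 < Real.sqrt 2 * (κ * (6 * Real.sqrt k - 5)) := by positivity
    have hvar : variance (a k + b) μ ≤ (Real.sqrt 2 * (κ * (6 * Real.sqrt k - 5))) ^ 2 := by
      rw [hi.variance_add (h.memLp k) hbL, hb.variance_eq, mul_pow, Real.sq_sqrt (by norm_num)]
      linarith
    have hZ' : ∫ ω, (a (k + k + 1) - (a k + b)) ω ^ 2 ∂μ ≤ κ ^ 2 := by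
      simpa [sub_sub] using hZ
    have := variance_add_le_sq ((h.memLp k).add hbL)
      ((h.memLp (k + k + 1)).sub ((h.memLp k).add hbL)) hs hκ hvar hZ'
    rw [add_sub_cancel] at this
    have e : Real.sqrt (k + k : ℕ) = Real.sqrt 2 * Real.sqrt k := by
      rw [← Real.sqrt_mul (by norm_num)]
      congr 1
      push_cast
      ring
    have hle : Real.sqrt 2 * (κ * (6 * Real.sqrt k - 5)) + κ ≤
        κ * (6 * Real.sqrt (k + k : ℕ) - 6) := by
      rw [e]
      nlinarith
    exact ⟨mono _ _ _ (by positivity) hle this, lt_of_lt_of_le (by positivity) hle⟩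
  rcases Nat.even_or_odd' n with ⟨m, rfl | rfl⟩
  · obtain ⟨k, rfl⟩ : ∃ k, m = k + 1 := ⟨m - 1, by omega⟩
    obtain ⟨hv, hp⟩ := odd k (by omega) (by omega)
    have e : 2 * (k + 1) = k + k + 1 + 1 := by ring
    rw [e]
    refine mono _ _ _ (by positivity) ?_ (incr _ _ hp hv)
    have : Real.sqrt (k + k : ℕ) ≤ Real.sqrt (k + k + 1 + 1 : ℕ) :=
      Real.sqrt_le_sqrt (by push_cast; linarith)
    nlinarith
  · obtain ⟨hv, hp⟩ := odd m (by omega) (by omega)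
    have e : 2 * m + 1 = m + m + 1 := by ring
    rw [e]
    refine mono _ _ _ hp.le ?_ hv
    have : Real.sqrt (m + m : ℕ) ≤ Real.sqrt (m + m + 1 : ℕ) :=
      Real.sqrt_le_sqrt (by push_cast; linarith)
    nlinarith

theorem variance_le' [IsProbabilityMeasure μ] (h : AlmostAdditive μ a κ) (n : ℕ) :
    variance (a n) μ ≤ 36 * κ ^ 2 * n := by
  rcases Nat.eq_zero_or_pos n with rfl | hn
  · simp [h.zero]
  · refine (h.variance_le n hn).trans ?_
    have h1 := le_sqrt_bound n hn
    have h2 : 0 ≤ κ * (6 * Real.sqrt n - 5) := mul_nonneg h.pos.le (by linarith)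
    calc (κ * (6 * Real.sqrt n - 5)) ^ 2 ≤ (κ * (6 * Real.sqrt n)) ^ 2 := by
          have := h.pos
          gcongr
          linarith
      _ = 36 * κ ^ 2 * n := by
          rw [mul_pow, mul_pow, Real.sq_sqrt (by positivity)]
          ring

theorem integrable [IsProbabilityMeasure μ] (h : AlmostAdditive μ a κ) (n : ℕ) :
    Integrable (a n) μ := (h.memLp n).integrable (by norm_num)

theorem abs_mean_incr_le [IsProbabilityMeasure μ] (h : AlmostAdditive μ a κ) (n : ℕ) :
    |∫ ω, a (n + 1) ω ∂μ - ∫ ω, a n ω ∂μ| ≤ κ := by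
  rw [← integral_sub (h.integrable _) (h.integrable _)]
  exact abs_integral_le_of_sq ((h.memLp _).sub (h.memLp _)) h.pos (h.incr n)

theorem abs_mean_split_le [IsProbabilityMeasure μ] (h : AlmostAdditive μ a κ) (k l : ℕ) :
    |∫ ω, a (k + l + 1) ω ∂μ - ∫ ω, a k ω ∂μ - ∫ ω, a l ω ∂μ| ≤ κ := by
  rcases Nat.eq_zero_or_pos k with rfl | hk
  · have := h.abs_mean_incr_le l
    simpa [h.zero] using this
  rcases Nat.eq_zero_or_pos l with rfl | hl
  · have := h.abs_mean_incr_le k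
    simpa [h.zero] using this
  obtain ⟨b, hb, -, hZ⟩ := h.split k l hk hl
  have hbL : MemLp b 2 μ := hb.memLp_iff.2 (h.memLp l)
  have h1 := abs_integral_le_of_sq (((h.memLp (k + l + 1)).sub (h.memLp k)).sub hbL) h.pos hZ
  simp only [Pi.sub_apply] at h1
  rw [integral_sub (f := fun ω => a (k + l + 1) ω - a k ω) ((h.integrable _).sub (h.integrable _)) (hbL.integrable (by norm_num)),
    integral_sub (h.integrable _) (h.integrable _), hb.integral_eq] at h1
  exact h1

theorem mean_ge [IsProbabilityMeasure μ] (h : AlmostAdditive μ a κ) (n : ℕ) :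
    -(κ * n) ≤ ∫ ω, a n ω ∂μ := by
  induction n with
  | zero => simp [h.zero]
  | succ n ih =>
    have := (abs_le.1 (h.abs_mean_incr_le n)).1
    push_cast
    linarith

/-- The means grow linearly, with a one-sided quantitative bound. -/
theorem exists_rate [IsProbabilityMeasure μ] (h : AlmostAdditive μ a κ) :
    ∃ l : ℝ, Tendsto (fun n : ℕ => (∫ ω, a n ω ∂μ) / (n + 1)) atTop (𝓝 (-l)) ∧
      ∀ n : ℕ, -(l * (n + 1)) - κ ≤ ∫ ω, a n ω ∂μ := by
  -- The index shift turns `k + l + 1` into a sum of indices, and adding `κ` absorbs the error, so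
  -- that Fekete's lemma applies. That the limit is a lower bound for `g n / n` is the one-sided
  -- estimate.
  set g : ℕ → ℝ := fun N => match N with
    | 0 => 0
    | n + 1 => ∫ ω, a n ω ∂μ + κ with hg
  have hsub : Subadditive g := by
    intro N M
    rcases N with - | k
    · simp [hg]
    rcases M with - | l
    · simp [hg]
    have e : k + 1 + (l + 1) = (k + l + 1) + 1 := by ring
    rw [e]
    have := (abs_le.1 (h.abs_mean_split_le k l)).2
    simp only [hg]
    linarith
  have hbdd : BddBelow (Set.range fun n : ℕ => g n / n) := by
    refine ⟨-κ, ?_⟩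
    rintro _ ⟨N, rfl⟩
    have hκ := h.pos
    rcases N with - | n
    · simp [hg, hκ.le]
    · have := h.mean_ge n
      simp only [hg]
      rw [le_div_iff₀ (by positivity)]
      push_cast
      nlinarith
  refine ⟨-hsub.lim, ?_, fun n => ?_⟩
  · have h1 := (hsub.tendsto_lim hbdd).comp (tendsto_add_atTop_nat 1)
    have h2 : Tendsto (fun n : ℕ => κ * (1 / ((n : ℝ) + 1))) atTop (𝓝 (κ * 0)) :=
      tendsto_one_div_add_atTop_nhds_zero_nat.const_mul κ
    have h3 := h1.sub h2
    rw [mul_zero, sub_zero] at h3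
    rw [neg_neg]
    refine h3.congr fun n => ?_
    simp only [hg, Function.comp_apply]
    push_cast
    field_simp
    ring
  · have h1 := hsub.lim_le_div hbdd (n := n + 1) (by omega)
    simp only [hg] at h1
    rw [le_div_iff₀ (by positivity)] at h1
    push_cast at h1
    linarith

end AlmostAdditive

/-- Random variables with summable second moments converge to zero almost surely. -/
theorem ae_tendsto_zero_of_summable {f : ℕ → Ω → ℝ} (hf : ∀ k, MemLp (f k) 2 μ) {c : ℕ → ℝ}
    (hc : Summable c) (h : ∀ k, ∫ ω, f k ω ^ 2 ∂μ ≤ c k) :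
    ∀ᵐ ω ∂μ, Tendsto (fun k => f k ω) atTop (𝓝 0) := by
  have h0 : ∀ k, 0 ≤ c k := fun k => (integral_nonneg fun ω => sq_nonneg _).trans (h k)
  have hm : ∀ k, AEMeasurable (fun ω => ENNReal.ofReal (f k ω ^ 2)) μ := fun k =>
    ((hf k).1.aemeasurable.pow_const 2).ennreal_ofReal
  have h1 : ∫⁻ ω, ∑' k, ENNReal.ofReal (f k ω ^ 2) ∂μ ≠ ∞ := by
    rw [lintegral_tsum hm]
    refine ne_top_of_le_ne_top hc.tsum_ofReal_ne_top (ENNReal.tsum_le_tsum fun k => ?_)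
    rw [← ofReal_integral_eq_lintegral_ofReal (hf k).integrable_sq (ae_of_all _ fun _ => sq_nonneg _)]
    exact ENNReal.ofReal_le_ofReal (h k)
  filter_upwards [ae_lt_top' (AEMeasurable.tsum hm) h1] with ω hω
  have h2 : Tendsto (fun k => ENNReal.ofReal (f k ω ^ 2)) atTop (𝓝 0) :=
    ENNReal.tendsto_atTop_zero_of_tsum_ne_top hω.ne
  have h3 := (ENNReal.tendsto_toReal ENNReal.zero_ne_top).comp h2
  have h4 : Tendsto (fun k => f k ω ^ 2) atTop (𝓝 0) := by
    refine h3.congr fun k => ?_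
    simp [ENNReal.toReal_ofReal (sq_nonneg _)]
  have h5 := h4.sqrt
  simp only [Real.sqrt_sq_eq_abs, Real.sqrt_zero] at h5
  exact (tendsto_zero_iff_abs_tendsto_zero _).2 h5

theorem integral_sq_add_le {f g : Ω → ℝ} (hf : MemLp f 2 μ) (hg : MemLp g 2 μ) :
    ∫ ω, (f ω + g ω) ^ 2 ∂μ ≤ 2 * ∫ ω, f ω ^ 2 ∂μ + 2 * ∫ ω, g ω ^ 2 ∂μ := by
  rw [← integral_const_mul, ← integral_const_mul,
    ← integral_add (hf.integrable_sq.const_mul 2) (hg.integrable_sq.const_mul 2)]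
  refine integral_mono (hf.add hg).integrable_sq
    ((hf.integrable_sq.const_mul 2).add (hg.integrable_sq.const_mul 2)) fun ω => ?_
  simp only
  nlinarith [sq_nonneg (f ω - g ω)]

theorem integral_sq_sum_le {ι : Type*} (s : Finset ι) {f : ι → Ω → ℝ}
    (hf : ∀ i, MemLp (f i) 2 μ) {B : ℝ} (h : ∀ i, ∫ ω, f i ω ^ 2 ∂μ ≤ B) :
    ∫ ω, (∑ i ∈ s, |f i ω|) ^ 2 ∂μ ≤ s.card ^ 2 * B := by
  have hi : ∀ i ∈ s, Integrable (fun ω => f i ω ^ 2) μ := fun i _ => (hf i).integrable_sq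
  calc ∫ ω, (∑ i ∈ s, |f i ω|) ^ 2 ∂μ ≤ ∫ ω, s.card * ∑ i ∈ s, f i ω ^ 2 ∂μ := by
        refine integral_mono_of_nonneg (ae_of_all _ fun _ => sq_nonneg _)
          ((integrable_finsetSum _ hi).const_mul _) (ae_of_all _ fun ω => ?_)
        have := sq_sum_le_card_mul_sum_sq (s := s) (f := fun i => |f i ω|)
        simpa using this
    _ = s.card * ∑ i ∈ s, ∫ ω, f i ω ^ 2 ∂μ := by
        rw [integral_const_mul, integral_finsetSum _ hi]
    _ ≤ s.card * (s.card * B) := by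
        gcongr
        refine (Finset.sum_le_card_nsmul _ _ _ fun i _ => h i).trans (le_of_eq (nsmul_eq_mul _ _))
    _ = s.card ^ 2 * B := by ring

/-- A process with linearly bounded second moments and bounded increments grows sublinearly. -/
theorem ae_tendsto_div_zero {Y : ℕ → Ω → ℝ} {B : ℝ} (hY : ∀ n, MemLp (Y n) 2 μ)
    (h1 : ∀ n, ∫ ω, Y n ω ^ 2 ∂μ ≤ B * n) (h2 : ∀ n, ∫ ω, (Y (n + 1) ω - Y n ω) ^ 2 ∂μ ≤ B) :
    ∀ᵐ ω ∂μ, Tendsto (fun n : ℕ => Y n ω / (n + 1)) atTop (𝓝 0) := by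
  have hB : 0 ≤ B := (integral_nonneg fun ω => sq_nonneg _).trans (h2 0)
  -- Convergence is proved along the squares; `D k` dominates the fluctuation between `k ^ 2` and
  -- the next square. The second moments of `F k` are then `O(k⁻²)`, hence summable.
  set D : ℕ → Ω → ℝ := fun k ω =>
    ∑ j ∈ Finset.range (2 * k + 1), |Y (k ^ 2 + j + 1) ω - Y (k ^ 2 + j) ω| with hD
  have hΔ : ∀ n, MemLp (fun ω => Y (n + 1) ω - Y n ω) 2 μ := fun n => (hY _).sub (hY _)
  have hDL : ∀ k, MemLp (D k) 2 μ := fun k => memLp_finsetSum _ fun j _ => (hΔ (k ^ 2 + j)).abs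
  have hDs : ∀ k, ∫ ω, D k ω ^ 2 ∂μ ≤ (2 * k + 1) ^ 2 * B := by
    intro k
    have := integral_sq_sum_le (Finset.range (2 * k + 1)) (f := fun j ω =>
      Y (k ^ 2 + j + 1) ω - Y (k ^ 2 + j) ω) (fun j => hΔ (k ^ 2 + j)) fun j => h2 (k ^ 2 + j)
    simpa using this
  set F : ℕ → Ω → ℝ := fun k ω => (|Y (k ^ 2) ω| + D k ω) / (k ^ 2 + 1) with hF
  have hFL : ∀ k, MemLp (F k) 2 μ := fun k => by
    simp only [hF, div_eq_mul_inv]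
    exact ((hY _).abs.add (hDL k)).mul_const _
  -- As `1 / 0 ^ 2 = 0`, the index `0` needs a separate bound.
  have hs : Summable fun k : ℕ => 20 * B * (1 / ((k : ℝ) ^ 2)) + if k = 0 then 2 * B else 0 := by
    refine ((Real.summable_one_div_nat_pow.2 (by norm_num)).mul_left _).add ?_
    exact summable_of_ne_finset_zero (s := {0}) fun k hk => if_neg (by simpa using hk)
  have hFs : ∀ k : ℕ, ∫ ω, F k ω ^ 2 ∂μ ≤
      20 * B * (1 / ((k : ℝ) ^ 2)) + if k = 0 then 2 * B else 0 := by
    intro k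
    have e : ∀ ω, F k ω ^ 2 = ((k : ℝ) ^ 2 + 1)⁻¹ ^ 2 * (|Y (k ^ 2) ω| + D k ω) ^ 2 := fun ω => by
      simp only [hF]
      rw [div_eq_inv_mul, mul_pow]
    simp only [e]
    rw [integral_const_mul]
    have h3 := integral_sq_add_le (hY (k ^ 2)).abs (hDL k)
    have h4 := h1 (k ^ 2)
    have h5 := hDs k
    simp only [Pi.abs_apply, sq_abs] at h3
    push_cast at h4
    have h6 : ∫ ω, (|Y (k ^ 2) ω| + D k ω) ^ 2 ∂μ ≤ B * (2 * k ^ 2 + 2 * (2 * k + 1) ^ 2) := by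
      linarith
    refine (mul_le_mul_of_nonneg_left h6 (by positivity)).trans ?_
    by_cases hk : k = 0
    · subst hk
      norm_num
      linarith
    · rw [if_neg hk, add_zero]
      have hk1 : (1 : ℝ) ≤ k := by exact_mod_cast Nat.one_le_iff_ne_zero.2 hk
      rw [inv_pow, inv_mul_le_iff₀ (by positivity), mul_one_div, mul_div_assoc', le_div_iff₀ (by positivity)]
      have h7 : 2 * (k : ℝ) ^ 2 + 2 * (2 * k + 1) ^ 2 ≤ 20 * (k : ℝ) ^ 2 := by nlinarith
      have h8 : (k : ℝ) ^ 2 * k ^ 2 ≤ ((k : ℝ) ^ 2 + 1) ^ 2 := by nlinarith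
      calc B * (2 * (k : ℝ) ^ 2 + 2 * (2 * k + 1) ^ 2) * k ^ 2 ≤ B * (20 * k ^ 2) * k ^ 2 := by gcongr
        _ = 20 * B * (k ^ 2 * k ^ 2) := by ring
        _ ≤ 20 * B * ((k ^ 2 + 1) ^ 2) := by gcongr
        _ = _ := by ring
  filter_upwards [ae_tendsto_zero_of_summable hFL hs hFs] with ω hω
  have hsq : Tendsto (fun n : ℕ => F (Nat.sqrt n) ω) atTop (𝓝 0) := by
    refine hω.comp (tendsto_atTop.2 fun b => ?_)
    filter_upwards [eventually_ge_atTop (b ^ 2)] with n hn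
    exact Nat.le_sqrt'.2 hn
  refine squeeze_zero_norm (fun n => ?_) hsq
  obtain ⟨j, hj⟩ := Nat.exists_eq_add_of_le (Nat.sqrt_le' n)
  have hjlt : j < 2 * Nat.sqrt n + 1 := by
    have := Nat.lt_succ_sqrt' n
    rw [Nat.succ_eq_add_one] at this
    nlinarith
  set k := Nat.sqrt n with hk
  have htel : |Y n ω - Y (k ^ 2) ω| ≤ D k ω := by
    have h3 : Y n ω - Y (k ^ 2) ω =
        ∑ i ∈ Finset.range j, (Y (k ^ 2 + i + 1) ω - Y (k ^ 2 + i) ω) := by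
      have := Finset.sum_range_sub (fun i => Y (k ^ 2 + i) ω) j
      rw [add_zero, ← hj] at this
      exact this.symm
    rw [h3]
    refine (Finset.abs_sum_le_sum_abs _ _).trans ?_
    exact Finset.sum_le_sum_of_subset_of_nonneg (Finset.range_mono hjlt.le) fun _ _ _ => abs_nonneg _
  have h4 : |Y n ω| ≤ |Y (k ^ 2) ω| + D k ω := by
    have := abs_add_le (Y (k ^ 2) ω) (Y n ω - Y (k ^ 2) ω)
    rw [add_sub_cancel] at this
    linarith
  have h5 : (k : ℝ) ^ 2 ≤ n := by exact_mod_cast Nat.sqrt_le' n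
  rw [Real.norm_eq_abs, abs_div, abs_of_pos (by positivity : (0 : ℝ) < n + 1)]
  simp only [hF]
  gcongr

/-- The strong law for almost additive sequences. -/
theorem AlmostAdditive.ae_tendsto [IsProbabilityMeasure μ] {a : ℕ → Ω → ℝ} {κ : ℝ}
    (h : AlmostAdditive μ a κ) {l : ℝ}
    (hl : Tendsto (fun n : ℕ => (∫ ω, a n ω ∂μ) / (n + 1)) atTop (𝓝 (-l))) :
    ∀ᵐ ω ∂μ, Tendsto (fun n : ℕ => a n ω / (n + 1)) atTop (𝓝 (-l)) := by
  have hY : ∀ n, MemLp (fun ω => a n ω - μ[a n]) 2 μ := fun n => (h.memLp n).sub (memLp_const _)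
  have h1 : ∀ n : ℕ, ∫ ω, (a n ω - μ[a n]) ^ 2 ∂μ ≤ 36 * κ ^ 2 * n := fun n => by
    rw [← variance_eq_integral (h.memLp n).1.aemeasurable]
    exact h.variance_le' n
  have h2 : ∀ n : ℕ, ∫ ω, ((a (n + 1) ω - μ[a (n + 1)]) - (a n ω - μ[a n])) ^ 2 ∂μ ≤
      36 * κ ^ 2 := fun n => by
    have hd : MemLp (a (n + 1) - a n) 2 μ := (h.memLp _).sub (h.memLp _)
    have h3 : ∫ ω, ((a (n + 1) ω - μ[a (n + 1)]) - (a n ω - μ[a n])) ^ 2 ∂μ =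
        variance (a (n + 1) - a n) μ := by
      rw [variance_eq_integral hd.1.aemeasurable]
      refine integral_congr_ae (ae_of_all _ fun ω => ?_)
      simp only [Pi.sub_apply]
      rw [integral_sub (h.integrable _) (h.integrable _)]
      ring
    rw [h3]
    refine (variance_le_expectation_sq hd.1).trans ((h.incr n).trans ?_)
    nlinarith [sq_nonneg κ]
  filter_upwards [ae_tendsto_div_zero hY h1 h2] with ω hω
  have := hω.add hl
  rw [zero_add] at this
  refine this.congr fun n => ?_
  rw [← add_div, sub_add_cancel]

end AlmostAdditive


/-! ### Existence of the Lyapunov exponent and the bound on the mean. -/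

section Lyapunov

open scoped Matrix.Norms.L2Operator NNReal ENNReal
open Real (posLog)

theorem replicate_split (o : Fin K) (k l : ℕ) : List.replicate (k + l + 1) o =
    List.replicate l o ++ o :: List.replicate k o := by
  rw [← List.replicate_succ, List.replicate_append_replicate]
  congr 1
  ring

theorem replicate_ne_nil (o : Fin K) {k : ℕ} (hk : 0 < k) : List.replicate k o ≠ [] := by
  simpa using hk.ne'

theorem measurable_logFull {A : Matrix (Fin W) (Fin W) ℂ} (hA : A.IsHermitian) (lam : ℝ)
    {z : ℂ} (hz : 0 < z.im) (x : Site K) : Measurable fun V : Config K W =>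
      Real.log ‖green Set.univ (symPotential A lam V) z [] x‖ :=
  (measurableEntries_green hA lam _ hz _ _).norm.log

/-- The first variable depends only on sites outside `desc u`, the second only on sites of `desc (i
:: u)`. -/
theorem indepFun_logCut_shift {A : Matrix (Fin W) (Fin W) ℂ} (hA : A.IsHermitian) (lam : ℝ)
    {z : ℂ} (hz : 0 < z.im) {u : Site K} (hu : u ≠ []) (i : Fin K) (w : Site K) :
    IndepFun (fun V : Config K W => logCut A lam z u V)
      (fun V => logCut A lam z w (shiftConfig (i :: u) V)) (law K W) := by
  refine indepFun_of_disjoint (desc (i :: u)) (measurable_logCut hA lam hz u)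
    ((measurable_logCut hA lam hz w).comp (measurePreserving_shiftConfig _).measurable)
    (fun V V' h => ?_) (fun V V' h => ?_)
  · rw [logCut, logCut, cutMat_congr hA lam hz hu fun y hy => h y fun h' =>
      hy ((List.suffix_cons i u).trans h')]
  · have : shiftConfig (i :: u) V = shiftConfig (i :: u) V' := by
      ext1 y
      exact h _ (List.suffix_append y (i :: u))
    rw [this]

/-- The logarithms of the Green functions along a ray are almost additive, uniformly in bounded
sets of the upper half plane. -/
theorem exists_almostAdditive (K : ℕ) (hW : 0 < W) {A : Matrix (Fin W) (Fin W) ℂ}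
    (hA : A.IsHermitian) {lam : ℝ} (hlam : 0 < lam) (R : ℝ) : ∃ κ : ℝ, 0 < κ ∧
      ∀ z : ℂ, 0 < z.im → ‖z‖ ≤ R → ∀ o : Fin K,
        AlmostAdditive (law K W) (fun n V => logCut A lam z (List.replicate n o) V) κ ∧
        ∀ x : Site K, x ≠ [] → MemLp (fun V : Config K W =>
            Real.log ‖green Set.univ (symPotential A lam V) z [] x‖ - logCut A lam z x V) 2
              (law K W) ∧
          ∫ V, (Real.log ‖green Set.univ (symPotential A lam V) z [] x‖ - logCut A lam z x V) ^ 2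
            ∂(law K W) ≤ κ ^ 2 := by
  obtain ⟨C, hC, h⟩ := exists_logCut_increment_bound K hW hA hlam R
  have hκ : C.toReal ≤ (Real.sqrt C.toReal + 1) ^ 2 := by
    have h1 := Real.sq_sqrt (ENNReal.toReal_nonneg (a := C))
    nlinarith [Real.sqrt_nonneg C.toReal]
  refine ⟨Real.sqrt C.toReal + 1, by positivity, fun z hz hR o => ⟨?_, fun x hx => ?_⟩⟩
  · obtain ⟨hi, hs, -⟩ := h z hz hR
    have incr : ∀ n, _ := fun n => memLp_two_of_lintegral_le
      ((measurable_logCut hA lam hz (o :: List.replicate n o)).sub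
        (measurable_logCut hA lam hz (List.replicate n o))) hC (hi (List.replicate n o) o)
    refine ⟨by positivity, fun n => ?_, ?_, fun n => (incr n).2.trans hκ, fun k l hk hl => ?_⟩
    · induction n with
      | zero => simp only [List.replicate_zero, logCut_nil hA lam hz]; exact memLp_const 0
      | succ n ih =>
        have := ih.add (incr n).1
        refine this.ae_eq (ae_of_all _ fun V => ?_)
        simp [List.replicate_succ]
    · ext V
      simp [logCut_nil hA lam hz]
    · have hp := measurePreserving_shiftConfig (W := W) (o :: List.replicate k o)
      have hm := measurable_logCut hA lam hz (List.replicate l o)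
      refine ⟨fun V => logCut A lam z (List.replicate l o)
        (shiftConfig (o :: List.replicate k o) V), ⟨(hm.comp hp.measurable).aemeasurable,
          hm.aemeasurable, ?_⟩, indepFun_logCut_shift hA lam hz (replicate_ne_nil o hk) o _, ?_⟩
      · conv_rhs => rw [← hp.map_eq]
        rw [Measure.map_map hm hp.measurable]
        rfl
      · rw [replicate_split]
        exact (memLp_two_of_lintegral_le (((measurable_logCut hA lam hz _).sub
          (measurable_logCut hA lam hz _)).sub (hm.comp hp.measurable)) hC
            (hs _ _ o (replicate_ne_nil o hk) (replicate_ne_nil o hl))).2.trans hκ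
  · obtain ⟨-, -, hf⟩ := h z hz hR
    have := memLp_two_of_lintegral_le ((measurable_logFull hA lam hz x).sub
      (measurable_logCut hA lam hz x)) hC (hf x hx)
    exact ⟨this.1, this.2.trans hκ⟩

theorem IsLyapunovExponent.unique (o : Fin K) {A : Matrix (Fin W) (Fin W) ℂ} {lam : ℝ} {z : ℂ}
    {l l' : ℝ} (h : IsLyapunovExponent K A lam z l) (h' : IsLyapunovExponent K A lam z l') :
    l = l' := by
  have hb : ∀ n, ∃ i, List.replicate (n + 1) o = i :: List.replicate n o := fun n => ⟨o, rfl⟩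
  obtain ⟨V, h1, h2⟩ := ((h (fun n => List.replicate n o) rfl hb).and
    (h' (fun n => List.replicate n o) rfl hb)).exists
  exact tendsto_nhds_unique h1 h2

theorem IsLyapunovExponent.lyapunov_eq (o : Fin K) {A : Matrix (Fin W) (Fin W) ℂ} {lam : ℝ} {z : ℂ}
    {l : ℝ} (h : IsLyapunovExponent K A lam z l) : lyapunov K A lam z = l := by
  have hex : ∃ l, IsLyapunovExponent K A lam z l := ⟨l, h⟩
  rw [lyapunov, dif_pos hex]
  exact IsLyapunovExponent.unique o hex.choose_spec h

/-- A level-preserving automorphism carries the constant ray to any branch and preserves the law. -/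
theorem isLyapunovExponent_of_ray {A : Matrix (Fin W) (Fin W) ℂ} (hA : A.IsHermitian) (lam : ℝ)
    {z : ℂ} (hz : 0 < z.im) (o : Fin K) {l : ℝ} (h : ∀ᵐ V ∂(law K W), Tendsto (fun n : ℕ =>
      Real.log ‖green Set.univ (symPotential A lam V) z [] (List.replicate n o)‖ / (n + 1))
        atTop (𝓝 (-l))) : IsLyapunovExponent K A lam z l := by
  intro b h0 hb
  obtain ⟨π, hπ⟩ := exists_levelMap_branch b o h0 hb
  have hp := measurePreserving_comp (W := W) (levelMap_injective π)
  filter_upwards [hp.quasiMeasurePreserving.ae h, ae_potential_eq K A lam] with V hV hpot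
  have h2 := hV.neg
  rw [neg_neg] at h2
  refine h2.congr fun n => ?_
  rw [fullGreen, hpot, ← hπ n, opNorm_eq_norm, fullGreen_levelMap hA lam hz]
  ring

/-- The entries of the Green function are at most `1 / Im z`, uniformly in the distance.
Nonnegativity is needed later for `τ ≥ 1`. -/
theorem lyapunov_nonneg_of_isLyapunovExponent (o : Fin K) {A : Matrix (Fin W) (Fin W) ℂ}
    (hA : A.IsHermitian) {lam : ℝ}
    {z : ℂ} (hz : 0 < z.im) {l : ℝ} (h : IsLyapunovExponent K A lam z l) : 0 ≤ l := by
  have hb : ∀ n, ∃ i, List.replicate (n + 1) o = i :: List.replicate n o := fun n => ⟨o, rfl⟩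
  obtain ⟨V, h1, h2⟩ := ((h (fun n => List.replicate n o) rfl hb).and
    (ae_potential_eq K A lam)).exists
  set c : ℝ := ∑ _i : Fin W, ∑ _j : Fin W, 1 / z.im
  have h3 : Tendsto (fun n : ℕ => -(1 / ((n : ℝ) + 1) * posLog c)) atTop (𝓝 (-(0 * posLog c))) :=
    (tendsto_one_div_add_atTop_nhds_zero_nat.mul_const _).neg
  rw [zero_mul, neg_zero] at h3
  refine le_of_tendsto_of_tendsto' h3 h1 fun n => ?_
  have h4 : opNorm (fullGreen A lam V z [] (List.replicate n o)) ≤ c := by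
    rw [opNorm_eq_norm, fullGreen, h2]
    refine (norm_le_sum_entries _).trans ?_
    exact Finset.sum_le_sum fun i _ => Finset.sum_le_sum fun j _ =>
      norm_green_apply_le _ (symPotential_isHermitian hA lam V) hz _ _ _ _
  have h5 : Real.log (opNorm (fullGreen A lam V z [] (List.replicate n o))) ≤ posLog c :=
    (le_max_right _ _).trans (Real.posLog_le_posLog (norm_nonneg _) h4)
  gcongr

/-- Existence and nonnegativity of the Lyapunov exponent, with a quantitative lower bound on the
mean of the logarithm of the Green function at finite distance. -/
theorem exists_lyapunov_bound (K : ℕ) (hW : 0 < W) {A : Matrix (Fin W) (Fin W) ℂ}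
    (hA : A.IsHermitian) {lam : ℝ} (hlam : 0 < lam) (R : ℝ) : ∃ κ : ℝ, 0 < κ ∧
      ∀ z : ℂ, 0 < z.im → ‖z‖ ≤ R → ∀ o : Fin K, 0 ≤ lyapunov K A lam z ∧
        AlmostAdditive (law K W) (fun n V => logCut A lam z (List.replicate n o) V) κ ∧
        ∀ n : ℕ, -(lyapunov K A lam z * (n + 1)) - κ ≤
          ∫ V, logCut A lam z (List.replicate n o) V ∂(law K W) := by
  obtain ⟨κ, hκ, h⟩ := exists_almostAdditive K hW hA hlam R
  refine ⟨κ, hκ, fun z hz hR o => ?_⟩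
  obtain ⟨ha, hf⟩ := h z hz hR o
  obtain ⟨l, hl, hlb⟩ := ha.exists_rate
  -- The difference between the full and the cut logarithm is bounded in mean square, so `Z n / n`
  -- tends to zero almost surely and both have the same rate.
  set Z : ℕ → Config K W → ℝ := fun n V =>
    Real.log ‖green Set.univ (symPotential A lam V) z [] (List.replicate n o)‖ -
      logCut A lam z (List.replicate n o) V with hZ
  have hs : Summable fun k : ℕ => κ ^ 2 * (1 / ((k : ℝ) + 1) ^ 2) := by
    have := (summable_nat_add_iff 1).2 (Real.summable_one_div_nat_pow.2 (by norm_num : 1 < 2))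
    push_cast at this
    exact this.mul_left _
  have hZL : ∀ k, MemLp (fun V => Z (k + 1) V * ((k : ℝ) + 1)⁻¹) 2 (law K W) := fun k =>
    (hf _ (replicate_ne_nil o k.succ_pos)).1.mul_const _
  have hZs : ∀ k : ℕ, ∫ V, (Z (k + 1) V * ((k : ℝ) + 1)⁻¹) ^ 2 ∂(law K W) ≤
      κ ^ 2 * (1 / ((k : ℝ) + 1) ^ 2) := by
    intro k
    simp only [mul_pow]
    rw [integral_mul_const, inv_pow, one_div]
    gcongr
    exact (hf _ (replicate_ne_nil o k.succ_pos)).2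
  have hlyap : IsLyapunovExponent K A lam z l := by
    refine isLyapunovExponent_of_ray hA lam hz o ?_
    filter_upwards [ha.ae_tendsto hl, ae_tendsto_zero_of_summable hZL hs hZs] with V h1 h2
    have h3 : Tendsto (fun n : ℕ => Z n V / (n + 1)) atTop (𝓝 0) := by
      refine (tendsto_add_atTop_iff_nat 1).1 ?_
      refine squeeze_zero_norm (fun k => ?_) (tendsto_zero_iff_abs_tendsto_zero _ |>.1 h2)
      rw [Real.norm_eq_abs, Function.comp_apply, abs_mul, abs_div, div_eq_mul_inv]
      push_cast
      rw [abs_of_pos (by positivity : (0 : ℝ) < k + 1 + 1),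
        abs_of_pos (by positivity : (0 : ℝ) < ((k : ℝ) + 1)⁻¹)]
      gcongr
      linarith
    have h4 := h1.add h3
    rw [add_zero] at h4
    refine h4.congr fun n => ?_
    rw [← add_div]
    simp [hZ]
  rw [hlyap.lyapunov_eq o]
  exact ⟨lyapunov_nonneg_of_isLyapunovExponent o hA hz hlyap, ha, hlb⟩

end Lyapunov


/-! ### Convergence to zero in probability as `η ↓ 0`. -/

section VanishInProb

open scoped ENNReal

variable {Ω : Type*} [MeasurableSpace Ω] {μ : Measure Ω}

/-- Convergence to zero in probability of nonnegative random variables, as `η ↓ 0`. -/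
def VanishInProb (μ : Measure Ω) (f : ℝ → Ω → ℝ) : Prop :=
  ∀ ε : ℝ, 0 < ε → Tendsto (fun η => μ {ω | ε ≤ f η ω}) (𝓝[>] 0) (𝓝 0)

namespace VanishInProb

theorem of_ae_tendsto [IsFiniteMeasure μ] {f : ℝ → Ω → ℝ} (hf : ∀ η, 0 < η → Measurable (f η))
    (h : ∀ᵐ ω ∂μ, Tendsto (fun η => f η ω) (𝓝[>] 0) (𝓝 0)) : VanishInProb μ f := by
  intro ε hε
  have hms : ∀ η, 0 < η → MeasurableSet {ω | ε ≤ f η ω} := fun η hη =>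
    measurableSet_le measurable_const (hf η hη)
  have key : Tendsto (fun η => ∫⁻ ω, {ω | ε ≤ f η ω}.indicator 1 ω ∂μ) (𝓝[>] 0)
      (𝓝 (∫⁻ _ω, 0 ∂μ)) := by
    refine tendsto_lintegral_filter_of_dominated_convergence (fun _ => 1) ?_ ?_ ?_ ?_
    · filter_upwards [self_mem_nhdsWithin] with η hη
      exact measurable_one.indicator (hms η hη)
    · exact Eventually.of_forall fun η => ae_of_all _ fun ω =>
        Set.indicator_le_self' (fun _ _ => zero_le_one) ω |>.trans le_rfl
    · simp
    · filter_upwards [h] with ω hω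
      refine tendsto_const_nhds.congr' ?_
      filter_upwards [hω.eventually_lt_const hε] with η hη
      rw [Set.indicator_of_notMem]
      exact not_le.2 hη
  rw [lintegral_zero] at key
  refine key.congr' ?_
  filter_upwards [self_mem_nhdsWithin] with η hη
  exact lintegral_indicator_one (hms η hη)

theorem mono {f g : ℝ → Ω → ℝ} (hg : VanishInProb μ g)
    (h : ∀ᶠ η in 𝓝[>] 0, ∀ ω, f η ω ≤ g η ω) : VanishInProb μ f := by
  intro ε hε
  refine tendsto_of_tendsto_of_tendsto_of_le_of_le' tendsto_const_nhds (hg ε hε)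
    (Eventually.of_forall fun _ => bot_le) ?_
  filter_upwards [h] with η hη
  exact measure_mono fun ω (hω : ε ≤ f η ω) => hω.trans (hη ω)

theorem add {f g : ℝ → Ω → ℝ} (hf : VanishInProb μ f) (hg : VanishInProb μ g) :
    VanishInProb μ fun η ω => f η ω + g η ω := by
  intro ε hε
  have h1 := (hf (ε / 2) (by positivity)).add (hg (ε / 2) (by positivity))
  rw [add_zero] at h1
  refine tendsto_of_tendsto_of_tendsto_of_le_of_le tendsto_const_nhds h1 (fun _ => bot_le)
    fun η => (measure_mono fun ω hω => ?_).trans (measure_union_le _ _)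
  simp only [Set.mem_union, Set.mem_ofPred_eq] at hω ⊢
  by_contra! hcon
  linarith

theorem of_const {c : ℝ → ℝ} (hc : Tendsto c (𝓝[>] 0) (𝓝 0)) : VanishInProb μ fun η _ => c η := by
  intro ε hε
  refine tendsto_const_nhds.congr' ?_
  filter_upwards [hc.eventually_lt_const hε] with η hη
  simp [not_le.2 hη]

theorem sum {ι : Type*} (s : Finset ι) {f : ι → ℝ → Ω → ℝ} (h : ∀ i ∈ s, VanishInProb μ (f i)) :
    VanishInProb μ fun η ω => ∑ i ∈ s, f i η ω := by
  classical
  induction s using Finset.induction_on with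
  | empty => simpa using of_const (μ := μ) (c := fun _ => 0) tendsto_const_nhds
  | insert i s hi ih =>
    simp only [Finset.sum_insert hi]
    exact (h i (Finset.mem_insert_self i s)).add
      (ih fun j hj => h j (Finset.mem_insert_of_mem hj))

theorem comp {T : Ω → Ω} (hT : MeasurePreserving T μ μ) {f : ℝ → Ω → ℝ}
    (hf : ∀ η, 0 < η → Measurable (f η)) (h : VanishInProb μ f) :
    VanishInProb μ fun η ω => f η (T ω) := by
  intro ε hε
  refine (h ε hε).congr' ?_
  filter_upwards [self_mem_nhdsWithin] with η hη
  exact (hT.measure_preimage (measurableSet_le measurable_const (hf η hη)).nullMeasurableSet).symm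

/-- Multiplication by the square of a tight family. -/
theorem sq_mul {f t : ℝ → Ω → ℝ} (hf : VanishInProb μ f) (hf0 : ∀ η ω, 0 ≤ f η ω)
    (ht0 : ∀ η ω, 0 ≤ t η ω) (ht : ∀ p : ℝ≥0∞, p ≠ 0 → p ≠ ∞ → ∃ Λ : ℝ, 1 ≤ Λ ∧
      ∀ᶠ η in 𝓝[>] 0, μ {ω | Λ < t η ω} ≤ p) :
    VanishInProb μ fun η ω => t η ω ^ 2 * f η ω := by
  intro ε hε
  refine ENNReal.tendsto_nhds_zero.2 fun q hq => ?_
  obtain ⟨p, hp, hpq⟩ : ∃ p : ℝ≥0∞, (p ≠ 0 ∧ p ≠ ∞) ∧ p + p ≤ q := by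
    by_cases hqt : q = ∞
    · exact ⟨1, by simp, by simp [hqt]⟩
    · exact ⟨q / 2, ⟨(ENNReal.half_pos hq.ne').ne', ne_top_of_le_ne_top hqt ENNReal.half_le_self⟩,
        (ENNReal.add_halves q).le⟩
  obtain ⟨Λ, hΛ, hev⟩ := ht p hp.1 hp.2
  have h2 := ENNReal.tendsto_nhds_zero.1 (hf (ε / Λ ^ 2) (by positivity)) p (pos_iff_ne_zero.2 hp.1)
  filter_upwards [hev, h2] with η h3 h4
  refine (measure_mono fun ω hω => ?_).trans
    ((measure_union_le {ω | Λ < t η ω} {ω | ε / Λ ^ 2 ≤ f η ω}).trans ((add_le_add h3 h4).trans hpq))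
  simp only [Set.mem_union, Set.mem_ofPred_eq] at hω ⊢
  by_contra! hcon
  have h5 : t η ω ^ 2 * f η ω ≤ Λ ^ 2 * f η ω := by
    have := ht0 η ω
    have := hf0 η ω
    gcongr
    exact hcon.1
  have h6 : f η ω * Λ ^ 2 < ε := (lt_div_iff₀ (by positivity)).1 hcon.2
  linarith

end VanishInProb

end VanishInProb

/-! ### Propagation of the no-a.c. hypothesis from the root to all environments. -/

section ImaginaryPart

open scoped Matrix.Norms.L2Operator NNReal ENNReal
open Real (posLog)

theorem MeasurableEntries.conjTranspose {Ω : Type*} [MeasurableSpace Ω]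
    {M : Ω → Matrix (Fin W) (Fin W) ℂ} (hM : MeasurableEntries M) :
    MeasurableEntries fun ω => (M ω)ᴴ := fun i j => continuous_star.measurable.comp (hM j i)

/-- The spectral parameter `E + iη`. -/
noncomputable def specParam (E η : ℝ) : ℂ := E + η * Complex.I

theorem specParam_im (E η : ℝ) : (specParam E η).im = η := by simp [specParam]

theorem norm_specParam_le {E η : ℝ} (hη : 0 < η) (h1 : η < 1) : ‖specParam E η‖ ≤ |E| + 1 := by
  refine (norm_add_le _ _).trans ?_
  simp only [norm_mul, Complex.norm_I, Complex.norm_real, Real.norm_eq_abs, abs_of_pos hη]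
  linarith

/-- The skew-Hermitian part of the diagonal Green function. -/
noncomputable def skewGreen (A : Matrix (Fin W) (Fin W) ℂ) (lam E : ℝ) (S : Set (Site K))
    (u : Site K) (η : ℝ) (V : Config K W) : ℝ :=
  ‖green S (symPotential A lam V) (specParam E η) u u -
    (green S (symPotential A lam V) (specParam E η) u u)ᴴ‖

theorem measurable_skewGreen {A : Matrix (Fin W) (Fin W) ℂ} (hA : A.IsHermitian) (lam E : ℝ)
    (S : Set (Site K)) (u : Site K) {η : ℝ} (hη : 0 < η) :
    Measurable (skewGreen A lam E S u η) := by
  have h := measurableEntries_green hA lam S (z := specParam E η) (by rwa [specParam_im]) u u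
  have h2 : MeasurableEntries fun V : Config K W =>
      green S (symPotential A lam V) (specParam E η) u u -
        (green S (symPotential A lam V) (specParam E η) u u)ᴴ := h.sub (MeasurableEntries.conjTranspose h)
  exact h2.norm

theorem star_single_mulVec_single (M : Matrix (Fin W) (Fin W) ℂ) (j : Fin W) :
    star (Pi.single j (1 : ℂ) : Fin W → ℂ) ⬝ᵥ (M *ᵥ Pi.single j 1) = M j j := by
  rw [mulVec_single_one, ← Pi.single_star, star_one, single_one_dotProduct]
  rfl

theorem norm_sub_conjTranspose_le {G : Matrix (Fin W) (Fin W) ℂ}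
    (hG : ∀ w, 0 ≤ (star w ⬝ᵥ (G *ᵥ w)).im) :
    ‖G - Gᴴ‖ ≤ ∑ j, ∑ k, ((G j j).im + (G k k).im) :=
  (norm_le_sum_entries _).trans <| Finset.sum_le_sum fun j _ => Finset.sum_le_sum fun k _ =>
    norm_sub_conj_le hG j k

/-- The hypothesis is used on basis vectors only: since the imaginary part is nonnegative, its
diagonal entries control the whole skew part. -/
theorem vanishInProb_root {A : Matrix (Fin W) (Fin W) ℂ} (hA : A.IsHermitian) (lam E : ℝ)
    (hE : NoAC K A lam E) : VanishInProb (law K W) (skewGreen A lam E Set.univ []) := by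
  refine VanishInProb.of_ae_tendsto (fun η hη => measurable_skewGreen hA lam E _ _ hη) ?_
  have h1 : ∀ᵐ V ∂(law K W), ∀ j : Fin W, Tendsto (fun η : ℝ =>
      (star (Pi.single j (1 : ℂ) : Fin W → ℂ) ⬝ᵥ
        (fullGreen A lam V (E + η * Complex.I) [] [] *ᵥ Pi.single j 1)).im) (𝓝[>] 0) (𝓝 0) :=
    ae_all_iff.2 fun j => hE (Pi.single j 1)
  filter_upwards [h1, ae_potential_eq K A lam] with V hV hpot
  simp only [star_single_mulVec_single, fullGreen, hpot] at hV
  have h2 : Tendsto (fun η : ℝ => ∑ j : Fin W, ∑ k : Fin W,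
      ((green Set.univ (symPotential A lam V) (specParam E η) [] [] j j).im +
        (green Set.univ (symPotential A lam V) (specParam E η) [] [] k k).im)) (𝓝[>] 0)
        (𝓝 (∑ j : Fin W, ∑ k : Fin W, (0 + 0))) :=
    tendsto_finsetSum _ fun j _ => tendsto_finsetSum _ fun k _ => (hV j).add (hV k)
  simp only [add_zero, Finset.sum_const_zero] at h2
  refine tendsto_of_tendsto_of_tendsto_of_le_of_le' tendsto_const_nhds h2
    (Eventually.of_forall fun η => norm_nonneg _) ?_
  filter_upwards [self_mem_nhdsWithin] with η hη
  have hη' : 0 < (specParam E η).im := by rw [specParam_im]; exact hη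
  exact norm_sub_conjTranspose_le
    (im_green_nonneg _ (symPotential_isHermitian hA lam V) hη' [])

/-- The subtree beyond a removed site is a copy of the whole tree, with the same law. -/
theorem vanishInProb_child {A : Matrix (Fin W) (Fin W) ℂ} (hA : A.IsHermitian) (lam E : ℝ)
    (hE : NoAC K A lam E) {S : Set (Site K)} {u : Site K} (hu : u ∉ S) (i : Fin K)
    (hS : desc (i :: u) ⊆ S) : VanishInProb (law K W) (skewGreen A lam E S (i :: u)) := by
  refine ((vanishInProb_root hA lam E hE).comp (measurePreserving_shiftConfig (i :: u))
    fun η hη => measurable_skewGreen hA lam E _ _ hη).mono ?_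
  filter_upwards [self_mem_nhdsWithin] with η hη V
  have hη' : 0 < (specParam E η).im := by rw [specParam_im]; exact hη
  simp only [skewGreen]
  rw [green_child (symPotential_isHermitian hA lam V) hη' hu i hS]
  rfl

/-- The skew-Hermitian part of the environment is controlled by the neighbours. -/
theorem norm_environment_skew_le {A : Matrix (Fin W) (Fin W) ℂ} (hA : A.IsHermitian) (lam E : ℝ)
    (S : Set (Site K)) (u : Site K) {η : ℝ} (hη : 0 < η) (V : Config K W) :
    ‖environment A lam S (specParam E η) u V - (environment A lam S (specParam E η) u V)ᴴ‖ ≤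
      2 * η + ∑ w ∈ neighbors u, skewGreen A lam E (S \ {u}) w η V := by
  have h1 : environment A lam S (specParam E η) u V -
      (environment A lam S (specParam E η) u V)ᴴ =
      -((2 * η * Complex.I : ℂ) • (1 : Matrix (Fin W) (Fin W) ℂ)) -
        ∑ w ∈ neighbors u, (green (S \ {u}) (symPotential A lam V) (specParam E η) w w -
          (green (S \ {u}) (symPotential A lam V) (specParam E η) w w)ᴴ) := by
    rw [environment, selfEnergy, Finset.sum_sub_distrib, conjTranspose_sub, conjTranspose_sub, hA.eq,
      conjTranspose_smul, conjTranspose_one, conjTranspose_sum]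
    have h2 : star (specParam E η) = specParam E η - 2 * η * Complex.I := by
      simp only [specParam, star_add, star_mul', Complex.star_def, Complex.conj_ofReal,
        Complex.conj_I]
      ring
    rw [h2, sub_smul]
    abel
  have h3 : ‖(1 : Matrix (Fin W) (Fin W) ℂ)‖ ≤ 1 := by
    refine norm_le_of_form zero_le_one fun v => ?_
    rw [one_mulVec, one_mul]
  rw [h1]
  refine (norm_sub_le _ _).trans (add_le_add ?_ (norm_sum_le _ _))
  rw [norm_neg, norm_smul]
  simp only [norm_mul, Complex.norm_I, Complex.norm_real, Real.norm_eq_abs, abs_of_pos hη,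
    Complex.norm_ofNat, mul_one]
  exact mul_le_of_le_one_right (by positivity) h3

theorem vanishInProb_environment {A : Matrix (Fin W) (Fin W) ℂ} (hA : A.IsHermitian) (lam E : ℝ)
    {S : Set (Site K)} {u : Site K}
    (h : ∀ w ∈ neighbors u, VanishInProb (law K W) (skewGreen A lam E (S \ {u}) w)) :
    VanishInProb (law K W) fun η V => ‖environment A lam S (specParam E η) u V -
      (environment A lam S (specParam E η) u V)ᴴ‖ := by
  have hc : Tendsto (fun η : ℝ => 2 * η) (𝓝[>] 0) (𝓝 0) := by
    have : Tendsto (fun η : ℝ => 2 * η) (𝓝 0) (𝓝 (2 * 0)) := tendsto_id.const_mul 2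
    rw [mul_zero] at this
    exact this.mono_left nhdsWithin_le_nhds
  refine ((VanishInProb.of_const hc).add (VanishInProb.sum _ h)).mono ?_
  filter_upwards [self_mem_nhdsWithin] with η hη V
  exact norm_environment_skew_le hA lam E S u hη V

theorem skewGreen_le {A : Matrix (Fin W) (Fin W) ℂ} (hA : A.IsHermitian) (lam E : ℝ)
    {S : Set (Site K)} {u : Site K} (hu : u ∈ S) {η : ℝ} (hη : 0 < η) (V : Config K W) :
    skewGreen A lam E S u η V ≤
      ‖green S (symPotential A lam V) (specParam E η) u u‖ ^ 2 *
        ‖environment A lam S (specParam E η) u V -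
          (environment A lam S (specParam E η) u V)ᴴ‖ := by
  have hη' : 0 < (specParam E η).im := by rw [specParam_im]; exact hη
  have h1 := isUnit_green_self hA lam hη' hu V
  rw [green_self_eq_environment hA lam hη' hu V] at h1
  set N := (symPotential A lam V u - A) + environment A lam S (specParam E η) u V with hN
  have h2 : IsUnit N.det := by
    rw [Matrix.isUnit_iff_isUnit_det, Matrix.det_nonsing_inv] at h1
    exact isUnit_ringInverse.1 h1
  have h3 : N - Nᴴ = environment A lam S (specParam E η) u V -
      (environment A lam S (specParam E η) u V)ᴴ := by
    rw [hN, conjTranspose_add, conjTranspose_sub, hA.eq,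
      (symPotential_isHermitian hA lam V u).eq]
    abel
  have h4 := norm_inv_sub_conjTranspose_le h2
  rw [h3] at h4
  simp only [skewGreen, green_self_eq_environment hA lam hη' hu V]
  exact h4

/-- By `skewGreen_le` the skew part is that of the environment times the squared norm of the Green
function, and the latter is tight uniformly in `η` by its logarithmic moment. -/
theorem vanishInProb_green {A : Matrix (Fin W) (Fin W) ℂ} (hA : A.IsHermitian) {lam : ℝ}
    (hlam : 0 < lam) (E : ℝ) {S : Set (Site K)} {u : Site K} (hu : u ∈ S)
    (h : ∀ w ∈ neighbors u, VanishInProb (law K W) (skewGreen A lam E (S \ {u}) w)) :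
    VanishInProb (law K W) (skewGreen A lam E S u) := by
  obtain ⟨C, hC, hg⟩ := lintegral_posLog_green_le K hA hlam
  refine ((vanishInProb_environment hA lam E h).sq_mul
    (t := fun η V => ‖green S (symPotential A lam V) (specParam E η) u u‖)
    (fun _ _ => norm_nonneg _) (fun _ _ => norm_nonneg _) fun p hp hp' => ?_).mono ?_
  · obtain ⟨Λ, hΛ, h1⟩ := exists_upper_threshold hC hp hp'
    refine ⟨Λ, hΛ, ?_⟩
    filter_upwards [self_mem_nhdsWithin] with η hη
    have hη' : 0 < (specParam E η).im := by rw [specParam_im]; exact hη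
    exact h1 (law K W) (measurableEntries_green hA lam S hη' u u).norm (hg S _ hη' u)
  · filter_upwards [self_mem_nhdsWithin] with η hη V
    exact skewGreen_le hA lam E hu hη V

theorem desc_subset_compl_singleton (i : Fin K) (u : Site K) :
    desc (i :: u) ⊆ ({u}ᶜ : Set (Site K)) := by
  rintro w hw rfl
  exact not_mem_desc_of_length_lt (by simp) hw

theorem green_tail_congr {S : Set (Site K)} {U : Site K → Matrix (Fin W) (Fin W) ℂ}
    (hU : ∀ x, (U x).IsHermitian) {z : ℂ} (hz : 0 < z.im) {u : Site K} (hu : u ≠ [])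
    (hS : (desc u)ᶜ ⊆ S) : green (S \ {u}) U z u.tail u.tail = green {u}ᶜ U z u.tail u.tail := by
  refine green_root_congr hU hU hz hu (by simp) (by simp) ?_ (fun _ _ => rfl) _
    (not_mem_desc_of_length_lt ?_) _
  · ext w
    simp only [Set.mem_inter_iff, Set.mem_sdiff, Set.mem_compl_iff, Set.mem_singleton_iff]
    exact ⟨fun h => ⟨h.1.2, h.2⟩, fun h => ⟨⟨hS h.2, h.1⟩, h.2⟩⟩
  · have := List.length_pos_iff.2 hu
    simp only [List.length_tail]
    omega

theorem vanishInProb_neighbors {A : Matrix (Fin W) (Fin W) ℂ} (hA : A.IsHermitian) {lam : ℝ}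
    (E : ℝ) (hE : NoAC K A lam E) {S : Set (Site K)} {u : Site K}
    (hS : (desc u)ᶜ ⊆ S) (hS' : ∀ i, i :: u ∉ S ∨ desc (i :: u) ⊆ S)
    (hu : u ≠ [] → VanishInProb (law K W) (skewGreen A lam E {u}ᶜ u.tail)) :
    ∀ w ∈ neighbors u, VanishInProb (law K W) (skewGreen A lam E (S \ {u}) w) := by
  intro w hw
  rcases mem_neighbors_cases hw with ⟨i, rfl⟩ | ⟨hne, rfl⟩
  · rcases hS' i with h | h
    · refine (VanishInProb.of_const (c := fun _ => 0) tendsto_const_nhds).mono ?_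
      filter_upwards [self_mem_nhdsWithin] with η hη V
      have hη' : 0 < (specParam E η).im := by rw [specParam_im]; exact hη
      have h0 : green (S \ {u}) (symPotential A lam V) (specParam E η) (i :: u) (i :: u) = 0 :=
        green_off (symPotential_isHermitian hA lam V) hη' (fun h' => h h'.1) _
      simp [skewGreen, h0]
    · exact vanishInProb_child hA lam E hE (by simp) i fun w hw =>
        ⟨h hw, desc_subset_compl_singleton i u hw⟩
  · refine (hu hne).mono ?_
    filter_upwards [self_mem_nhdsWithin] with η hη V
    have hη' : 0 < (specParam E η).im := by rw [specParam_im]; exact hη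
    simp only [skewGreen]
    rw [green_tail_congr (symPotential_isHermitian hA lam V) hη' hne hS]

/-- Induction along the path from the root. In the tree without `i :: u`, the remaining forward
neighbours of `u` carry complete subtrees, and the backward neighbour is covered by the induction
hypothesis. -/
theorem vanishInProb_backward {A : Matrix (Fin W) (Fin W) ℂ} (hA : A.IsHermitian) {lam : ℝ}
    (hlam : 0 < lam) (E : ℝ) (hE : NoAC K A lam E) (u : Site K) (i : Fin K) :
    VanishInProb (law K W) (skewGreen A lam E {i :: u}ᶜ u) := by
  induction u generalizing i with
  | nil =>
    refine vanishInProb_green hA hlam E (self_mem_compl_cons i []) (vanishInProb_neighbors hA E hE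
      (fun w hw => absurd List.nil_suffix hw) (fun j => ?_) fun h => absurd rfl h)
    by_cases hj : j = i
    · exact Or.inl (by simp [hj])
    · refine Or.inr fun w hw h => ?_
      rw [Set.mem_singleton_iff] at h
      subst h
      exact not_mem_desc_of_mem_neighbors (child_mem_neighbors i []) (by simpa using Ne.symm hj) hw
  | cons k t ih =>
    refine vanishInProb_green hA hlam E (self_mem_compl_cons i _) (vanishInProb_neighbors hA E hE
      (fun w hw h => hw ?_) (fun j => ?_) fun _ => ih k)
    · rw [Set.mem_singleton_iff] at h
      subst h
      exact List.suffix_cons i _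
    by_cases hj : j = i
    · exact Or.inl (by simp [hj])
    · refine Or.inr fun w hw h => ?_
      rw [Set.mem_singleton_iff] at h
      subst h
      exact not_mem_desc_of_mem_neighbors (child_mem_neighbors i _) (by simpa using Ne.symm hj) hw

/-- Absence of absolutely continuous spectrum at the root makes the environment of every site
asymptotically Hermitian, in probability. -/
theorem vanishInProb_environment_univ {A : Matrix (Fin W) (Fin W) ℂ} (hA : A.IsHermitian) {lam : ℝ}
    (hlam : 0 < lam) (E : ℝ) (hE : NoAC K A lam E) (x : Site K) :
    VanishInProb (law K W) fun η V => ‖environment A lam Set.univ (specParam E η) x V -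
      (environment A lam Set.univ (specParam E η) x V)ᴴ‖ := by
  refine vanishInProb_environment hA lam E (vanishInProb_neighbors hA E hE (Set.subset_univ _)
    (fun i => Or.inr (Set.subset_univ _)) fun hx => ?_)
  obtain ⟨i, t, rfl⟩ := List.exists_cons_of_ne_nil hx
  exact vanishInProb_backward hA hlam E hE t i

end ImaginaryPart


/-! ### Good events and the first moment. -/

section FirstMoment

open scoped Matrix.Norms.L2Operator NNReal ENNReal
open Real (posLog)

theorem measure_siteUpdate (u : Site K) {s : Set (Config K W)} (hs : MeasurableSet s) :
    law K W s = ∫⁻ V, gaussMat W 1 {X | siteUpdate V u X ∈ s} ∂(law K W) := by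
  rw [← lintegral_indicator_one hs, lintegral_siteUpdate u (measurable_one.indicator hs)]
  refine lintegral_congr fun V => ?_
  exact lintegral_indicator_one (measurable_siteUpdate V u hs)

theorem ae_of_ae_siteUpdate (u : Site K) {s : Set (Config K W)} (hs : MeasurableSet s)
    (h : ∀ V, ∀ᵐ X ∂(gaussMat W 1), siteUpdate V u X ∈ s) : ∀ᵐ V ∂(law K W), V ∈ s := by
  change law K W sᶜ = 0
  rw [measure_siteUpdate u hs.compl]
  refine (lintegral_congr fun V => ?_).trans lintegral_zero
  exact h V

/-- The largest singular value of the Green function between the root and the predecessor of a site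
at distance at least two is almost surely simple. -/
theorem ae_isTopSimple_cutMat (hW : 0 < W) {A : Matrix (Fin W) (Fin W) ℂ} (hA : A.IsHermitian)
    {lam : ℝ} (hlam : 0 < lam) {z : ℂ} (hz : 0 < z.im) {u : Site K} (hu : u ≠ []) (i : Fin K) :
    ∀ᵐ V ∂(law K W), IsTopSimple (cutMat A lam z (i :: u) V) := by
  refine ae_of_ae_siteUpdate u (s := {V | IsTopSimple (cutMat A lam z (i :: u) V)})
    (measurableSet_isTopSimple (measurableEntries_cutMat hA lam hz (i :: u))) fun V => ?_
  have h := ae_isTopSimple hlam one_ne_zero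
    (environment_isDissipative hA lam ({i :: u}ᶜ : Set (Site K)) hz u V)
    (neg_ne_zero.2 (ne_zero_of_isUnit hW (isUnit_cutMat hA lam hz hu V)))
  filter_upwards [h] with X hX
  rw [cutMat_cons hA lam hz hu, cutMat_siteUpdate hA lam hz hu (self_mem_desc u),
    green_siteUpdate hA lam hz (self_mem_compl_cons i u), ← neg_mul]
  exact hX

/-- All sites of a sphere are equivalent in law. -/
theorem measure_norm_cutMat_lt {A : Matrix (Fin W) (Fin W) ℂ} (hA : A.IsHermitian) (lam : ℝ)
    {z : ℂ} (hz : 0 < z.im) (o : Fin K) (x : Site K) (r : ℝ) :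
    law K W {V | ‖cutMat A lam z x V‖ < r} =
      law K W {V | ‖cutMat A lam z (List.replicate x.length o) V‖ < r} := by
  obtain ⟨π, hπ⟩ := exists_levelMap_site x o
  have hp := measurePreserving_comp (W := W) (levelMap_injective π)
  have hm : MeasurableSet {V : Config K W | ‖cutMat A lam z (List.replicate x.length o) V‖ < r} :=
    measurableSet_lt (measurableEntries_cutMat hA lam hz _).norm measurable_const
  rw [← hp.measure_preimage hm.nullMeasurableSet]
  congr 1
  ext V
  simp only [Set.mem_preimage, Set.mem_ofPred_eq]
  rw [← cutMat_levelMap hA lam hz, hπ]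

/-- The Green function at distance `n` is typically not smaller than the Lyapunov exponent
predicts. -/
theorem measure_small_le (hW : 0 < W) {A : Matrix (Fin W) (Fin W) ℂ} (hA : A.IsHermitian) {lam : ℝ}
    {z : ℂ} (hz : 0 < z.im) (o : Fin K) {κ l L δ : ℝ}
    (ha : AlmostAdditive (law K W) (fun n V => logCut A lam z (List.replicate n o) V) κ)
    (hmean : ∀ n : ℕ, -(l * (n + 1)) - κ ≤
      ∫ V, logCut A lam z (List.replicate n o) V ∂(law K W))
    (hδ : 0 < δ) (hl : l ≤ L + δ / 4) {n : ℕ} (hn0 : 0 < n) (hn1 : 4 * (L + δ / 4 + κ) / δ ≤ n)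
    (hn2 : 864 * κ ^ 2 / δ ^ 2 ≤ n) {x : Site K} (hx : x.length = n) :
    law K W {V | ‖cutMat A lam z x V‖ < Real.exp (-(L + δ) * n)} ≤ ENNReal.ofReal (1 / 6) := by
  rw [measure_norm_cutMat_lt hA lam hz o x, hx]
  have hn : (0 : ℝ) < n := by exact_mod_cast hn0
  -- By `hn1` the mean is at least `-(L + δ / 2) n`, so the event is a deviation of at least `δ n /
  -- 2`. Chebyshev with variance `36 κ ^ 2 n` gives `144 κ ^ 2 / (δ ^ 2 n)`, which is at most `1 /
  -- 6` by `hn2`.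
  have hc : 0 < δ / 2 * n := by positivity
  refine le_trans (measure_mono fun V hV => ?_)
    ((meas_ge_le_variance_div_sq (ha.memLp n) hc).trans (ENNReal.ofReal_le_ofReal ?_))
  · simp only [Set.mem_ofPred_eq] at hV ⊢
    have h0 : 0 < ‖cutMat A lam z (List.replicate n o) V‖ := norm_pos_iff.2
      (ne_zero_of_isUnit hW (isUnit_cutMat hA lam hz (replicate_ne_nil o hn0) V))
    have h1 : logCut A lam z (List.replicate n o) V < -(L + δ) * n := by
      rw [← Real.log_exp (-(L + δ) * n)]
      exact Real.log_lt_log h0 hV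
    have h2 := hmean n
    rw [div_le_iff₀ hδ] at hn1
    have h3 : l * (n + 1) ≤ (L + δ / 4) * (n + 1) := by gcongr
    rw [abs_sub_comm]
    refine le_trans ?_ (le_abs_self _)
    nlinarith
  · rw [div_le_iff₀ (by positivity)]
    rw [div_le_iff₀ (by positivity)] at hn2
    refine (ha.variance_le' n).trans ?_
    nlinarith

/-- The event that the Green function to a site is large and there is a resonance at the site. -/
def resonantEvent (A : Matrix (Fin W) (Fin W) ℂ) (lam : ℝ) (z : ℂ) (r τ : ℝ) (x : Site K) :
    Set (Config K W) :=
  {V | r ≤ ‖cutMat A lam z x V‖} ∩ {V | ∀ v, IsTopVector (cutMat A lam z x V) v →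
    τ ≤ ‖star v ⬝ᵥ (green Set.univ (symPotential A lam V) z x x *ᵥ v)‖}

theorem measurableSet_resonantEvent {A : Matrix (Fin W) (Fin W) ℂ} (hA : A.IsHermitian) (lam : ℝ)
    {z : ℂ} (hz : 0 < z.im) (r τ : ℝ) (x : Site K) :
    MeasurableSet (resonantEvent A lam z r τ x) :=
  (measurableSet_le measurable_const (measurableEntries_cutMat hA lam hz x).norm).inter
    (measurableSet_forall_isTopVector (measurableEntries_cutMat hA lam hz x)
      (measurableEntries_green hA lam Set.univ hz x x) τ)

theorem mem_event_iff (hW : 0 < W) {A : Matrix (Fin W) (Fin W) ℂ} {lam : ℝ} {z : ℂ} {L δ : ℝ}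
    {n : ℕ} {V : Config K W} (hV : potential A lam V = symPotential A lam V) (x : Site K) :
    V ∈ eventR A lam z L δ n x ∩ eventE A lam z L δ n x ↔
      V ∈ resonantEvent A lam z (Real.exp (-(L + δ) * n)) (tau L δ n) x := by
  simp only [eventR, eventE, resonantEvent, cutGreen, fullGreen, hV, Set.mem_inter_iff,
    Set.mem_ofPred_eq, isUnitMaxEigenvector_iff hW, opNorm_eq_norm]
  rfl

/-- The configurations outside of a site for which a resonance at the site is not too unlikely. -/
def goodEvent (A : Matrix (Fin W) (Fin W) ℂ) (lam : ℝ) (z : ℂ) (r B ρ : ℝ) (x : Site K) :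
    Set (Config K W) :=
  ({V | ‖cutMat A lam z x V‖ < r} ∪ {V | ¬IsTopSimple (cutMat A lam z x V)} ∪
    {V | B < ‖environment A lam Set.univ z x V‖} ∪
      {V | ρ ≤ ‖environment A lam Set.univ z x V - (environment A lam Set.univ z x V)ᴴ‖})ᶜ

theorem measurableSet_goodEvent {A : Matrix (Fin W) (Fin W) ℂ} (hA : A.IsHermitian) (lam : ℝ)
    {z : ℂ} (hz : 0 < z.im) (r B ρ : ℝ) (x : Site K) :
    MeasurableSet (goodEvent A lam z r B ρ x) := by
  have h1 := measurableEntries_cutMat (W := W) hA lam hz x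
  have h2 := measurableEntries_environment (W := W) hA lam (Set.univ : Set (Site K)) hz x
  have h3 : MeasurableEntries fun V : Config K W => environment A lam Set.univ z x V -
      (environment A lam Set.univ z x V)ᴴ := h2.sub (MeasurableEntries.conjTranspose h2)
  exact ((((measurableSet_lt h1.norm measurable_const).union (measurableSet_isTopSimple h1).compl).union
    (measurableSet_lt measurable_const h2.norm)).union
      (measurableSet_le measurable_const h3.norm)).compl

/-- Three bad events of probability at most `1 / 6` each and one null event. -/
theorem measure_goodEvent_ge {A : Matrix (Fin W) (Fin W) ℂ} (hA : A.IsHermitian) (lam : ℝ)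
    {z : ℂ} (hz : 0 < z.im) {r B ρ : ℝ} {x : Site K}
    (h1 : law K W {V | ‖cutMat A lam z x V‖ < r} ≤ ENNReal.ofReal (1 / 6))
    (h2 : ∀ᵐ V ∂(law K W), IsTopSimple (cutMat A lam z x V))
    (h3 : law K W {V | B < ‖environment A lam Set.univ z x V‖} ≤ ENNReal.ofReal (1 / 6))
    (h4 : law K W {V | ρ ≤ ‖environment A lam Set.univ z x V -
      (environment A lam Set.univ z x V)ᴴ‖} ≤ ENNReal.ofReal (1 / 6)) :
    ENNReal.ofReal (1 / 2) ≤ law K W (goodEvent A lam z r B ρ x) := by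
  have hm := (measurableSet_goodEvent (W := W) hA lam hz r B ρ x).compl
  rw [goodEvent, compl_compl] at hm
  rw [goodEvent, prob_compl_eq_one_sub hm]
  refine ENNReal.le_sub_of_add_le_right (measure_ne_top _ _) ?_
  have h2' : law K W {V | ¬IsTopSimple (cutMat A lam z x V)} = 0 := h2
  have h5 := ((measure_union_le _ _).trans (add_le_add ((measure_union_le _ _).trans (add_le_add
    ((measure_union_le _ _).trans (add_le_add h1 h2'.le)) h3)) h4))
  refine (add_le_add le_rfl h5).trans ?_
  rw [add_zero, ← ENNReal.ofReal_add (by norm_num) (by norm_num),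
    ← ENNReal.ofReal_add (by norm_num) (by norm_num),
    ← ENNReal.ofReal_add (by norm_num) (by norm_num), ENNReal.ofReal_le_one]
  norm_num

/-- On the good event the conditional probability of a resonance is bounded below. -/
theorem resonance_of_mem_goodEvent (hW : 0 < W) {A : Matrix (Fin W) (Fin W) ℂ}
    (hA : A.IsHermitian) {lam : ℝ} {z : ℂ} (hz : 0 < z.im) {r B ε c τ : ℝ}
    (hτ : 1 ≤ τ) {x : Site K} (hx : x ≠ [])
    (hres : ∀ Q : Matrix (Fin W) (Fin W) ℂ, IsDissipative Q → ‖Q‖ ≤ B →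
      ∀ τ : ℝ, 1 ≤ τ → ‖Q - Qᴴ‖ ≤ ε / τ → ∀ v : Fin W → ℂ, nsq v = 1 → ENNReal.ofReal (c / τ) ≤
        gaussMat W 1 {X | τ ≤ ‖star v ⬝ᵥ (((lam : ℂ) • symMat X + Q)⁻¹ *ᵥ v)‖})
    {V : Config K W} (hV : V ∈ goodEvent A lam z r B (ε / τ) x) :
    ENNReal.ofReal (c / τ) ≤
      gaussMat W 1 {X | siteUpdate V x X ∈ resonantEvent A lam z r τ x} := by
  simp only [goodEvent, Set.mem_compl_iff, Set.mem_union, Set.mem_ofPred_eq, not_or, not_lt,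
    not_not, not_le] at hV
  obtain ⟨⟨⟨h1, h2⟩, h3⟩, h4⟩ := hV
  obtain ⟨v, hv, hv'⟩ := exists_norm_attained hW (cutMat A lam z x V)
  have hv2 : IsTopVector (cutMat A lam z x V) v :=
    ⟨hv, by rw [← hv', Real.sq_sqrt (nsq_nonneg _)]⟩
  refine (hres _ (environment_isDissipative hA lam Set.univ hz x V) h3 τ hτ h4.le v hv).trans
    (measure_mono fun X hX => ?_)
  have hX' : τ ≤ ‖star v ⬝ᵥ (((lam : ℂ) • symMat X + environment A lam Set.univ z x V)⁻¹ *ᵥ v)‖ :=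
    hX
  simp only [resonantEvent, Set.mem_ofPred_eq, Set.mem_inter_iff,
    cutMat_siteUpdate hA lam hz hx (self_mem_desc x), green_siteUpdate hA lam hz (Set.mem_univ x)]
  -- Resampling the matrix at `x` leaves the cut matrix and its top vectors unchanged, and
  -- simplicity carries the bound from `v` to every other choice.
  refine ⟨h1, fun w hw => ?_⟩
  rwa [norm_form_eq_of_isTopSimple h2 hw hv2]

theorem measure_resonantEvent_ge {A : Matrix (Fin W) (Fin W) ℂ} (hA : A.IsHermitian) (lam : ℝ)
    {z : ℂ} (hz : 0 < z.im) {r B ρ c τ : ℝ} (hc : 0 ≤ c / τ) {x : Site K}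
    (hgood : ENNReal.ofReal (1 / 2) ≤ law K W (goodEvent A lam z r B ρ x))
    (h : ∀ V ∈ goodEvent A lam z r B ρ x, ENNReal.ofReal (c / τ) ≤
      gaussMat W 1 {X | siteUpdate V x X ∈ resonantEvent A lam z r τ x}) :
    c / τ / 2 ≤ (law K W).real (resonantEvent A lam z r τ x) := by
  have hm := measurableSet_goodEvent (W := W) hA lam hz r B ρ x
  have h1 : ENNReal.ofReal (c / τ) * ENNReal.ofReal (1 / 2) ≤
      law K W (resonantEvent A lam z r τ x) := by
    rw [measure_siteUpdate x (measurableSet_resonantEvent hA lam hz r τ x)]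
    calc _ ≤ ENNReal.ofReal (c / τ) * law K W (goodEvent A lam z r B ρ x) := by gcongr
      _ = ∫⁻ V, (goodEvent A lam z r B ρ x).indicator (fun _ => ENNReal.ofReal (c / τ)) V
            ∂(law K W) := (lintegral_indicator_const hm _).symm
      _ ≤ _ := lintegral_mono fun V => ?_
    by_cases hV : V ∈ goodEvent A lam z r B ρ x
    · rw [Set.indicator_of_mem hV]
      exact h V hV
    · rw [Set.indicator_of_notMem hV]
      exact bot_le
  rw [← ENNReal.ofReal_mul hc] at h1
  have h2 := (ENNReal.ofReal_le_iff_le_toReal (measure_ne_top _ _)).1 h1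
  rw [measureReal_def]
  linarith

/-- The sphere as a finite set. -/
noncomputable def sphereFinset (K n : ℕ) : Finset (Site K) :=
  (List.finite_length_eq (Fin K) n).toFinset

theorem mem_sphereFinset {n : ℕ} {x : Site K} : x ∈ sphereFinset K n ↔ x.length = n := by
  simp [sphereFinset]

theorem card_sphereFinset (K n : ℕ) : (sphereFinset K n).card = K ^ n := by
  have h1 : Fintype.card (List.Vector (Fin K) n) = K ^ n := by simp
  rw [← h1, ← Nat.card_eq_fintype_card, sphereFinset, ← Nat.card_eq_card_finite_toFinset]
  rfl

/-- The count agrees almost everywhere, namely where the potential is Hermitian, with a sum of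
indicators of measurable events. -/
theorem integral_count {A : Matrix (Fin W) (Fin W) ℂ} (hW : 0 < W) (hA : A.IsHermitian) (lam : ℝ)
    {z : ℂ} (hz : 0 < z.im) (L δ : ℝ) (n : ℕ) :
    ∫ V, (count A lam z L δ n V : ℝ) ∂(law K W) = ∑ x ∈ sphereFinset K n,
      (law K W).real (resonantEvent A lam z (Real.exp (-(L + δ) * n)) (tau L δ n) x) := by
  classical
  set F : Site K → Set (Config K W) :=
    resonantEvent A lam z (Real.exp (-(L + δ) * n)) (tau L δ n) with hF
  have hm : ∀ x, MeasurableSet (F x) := fun x => measurableSet_resonantEvent hA lam hz _ _ x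
  have h1 : ∀ᵐ V ∂(law K W), (count A lam z L δ n V : ℝ) =
      ∑ x ∈ sphereFinset K n, (F x).indicator (fun _ => (1 : ℝ)) V := by
    filter_upwards [ae_potential_eq K A lam] with V hV
    have h2 : {x ∈ sphere K n | V ∈ eventR A lam z L δ n x ∩ eventE A lam z L δ n x} =
        ((sphereFinset K n).filter fun x => V ∈ F x : Finset (Site K)) := by
      ext x
      simp only [Set.mem_ofPred_eq, Finset.coe_filter, mem_sphereFinset, mem_event_iff hW hV]
      rfl
    rw [count, h2, Set.ncard_coe_finset, Finset.card_filter]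
    push_cast
    exact Finset.sum_congr rfl fun x _ => by simp [Set.indicator_apply]
  rw [integral_congr_ae h1, integral_finsetSum _ fun x _ =>
    (integrable_const (1 : ℝ)).indicator (hm x)]
  exact Finset.sum_congr rfl fun x _ => by
    rw [integral_indicator_const _ (hm x), smul_eq_mul, mul_one]

theorem le_integral_count {A : Matrix (Fin W) (Fin W) ℂ} (hW : 0 < W) (hA : A.IsHermitian) (lam : ℝ)
    {z : ℂ} (hz : 0 < z.im) {L δ : ℝ} {n : ℕ} {p : ℝ}
    (h : ∀ x : Site K, x.length = n →
      p ≤ (law K W).real (resonantEvent A lam z (Real.exp (-(L + δ) * n)) (tau L δ n) x)) :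
    (K : ℝ) ^ n * p ≤ ∫ V, (count A lam z L δ n V : ℝ) ∂(law K W) := by
  rw [integral_count hW hA lam hz]
  have := Finset.card_nsmul_le_sum (sphereFinset K n) _ p fun x hx => h x (mem_sphereFinset.1 hx)
  rwa [card_sphereFinset, nsmul_eq_mul, Nat.cast_pow] at this

/-- For `η < 1` the spectral parameter has norm at most `|E| + 1`, so `B`, `c`, `ε` and `κ` can be
fixed before `δ`, `n` and `η`. Only `η₀` depends on `n`: through `τ` and through the finitely many
sites of the sphere. -/
theorem first_moment_bound (K W : ℕ) (hK : 1 < K) (hW : 0 < W)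
    (A : Matrix (Fin W) (Fin W) ℂ) (hA : A.IsHermitian) (lam : ℝ) (hlam : 0 < lam)
    (E L : ℝ)
    (hL : Tendsto (fun η : ℝ => lyapunov K A lam (E + η * Complex.I))
      (𝓝[>] 0) (𝓝 L))
    (hE : NoAC K A lam E) :
    ∃ C : ℝ, 0 < C ∧ ∀ δ : ℝ, 0 < δ → ∃ n₀ : ℕ, ∀ n : ℕ, n₀ ≤ n →
      ∃ η₀ : ℝ, 0 < η₀ ∧ ∀ η : ℝ, 0 < η → η < η₀ →
        (K : ℝ) ^ n / (C * tau L δ n) ≤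
          ∫ V, (count A lam (E + η * Complex.I) L δ n V : ℝ)
            ∂(law K W) := by
  have o : Fin K := ⟨0, by omega⟩
  have h6 : ENNReal.ofReal (1 / 6) ≠ 0 := by simp
  obtain ⟨D, hD, henv⟩ := lintegral_posLog_environment_le K hA hlam (|E| + 1)
  obtain ⟨B, -, hB⟩ := exists_upper_threshold hD h6 ENNReal.ofReal_ne_top
  obtain ⟨c, hc, ε, hε, hres⟩ := resonance_probability hW hlam B
  obtain ⟨κ, hκ, hlyap⟩ := exists_lyapunov_bound K hW hA hlam (|E| + 1)
  have hIoo : ∀ᶠ η : ℝ in 𝓝[>] 0, 0 < η ∧ η < 1 :=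
    (eventually_mem_nhdsWithin).and (eventually_nhdsWithin_of_eventually_nhds
      (eventually_lt_nhds zero_lt_one))
  have hz : ∀ η : ℝ, 0 < η → 0 < (specParam E η).im := fun η hη => by
    rwa [specParam_im]
  have hL0 : 0 ≤ L := by
    refine ge_of_tendsto hL ?_
    filter_upwards [hIoo] with η hη
    exact (hlyap _ (hz η hη.1) (norm_specParam_le hη.1 hη.2) o).1
  refine ⟨2 / c, by positivity, fun δ hδ => ?_⟩
  obtain ⟨n₁, hn₁⟩ := exists_nat_ge (4 * (L + δ / 4 + κ) / δ)
  obtain ⟨n₂, hn₂⟩ := exists_nat_ge (864 * κ ^ 2 / δ ^ 2)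
  -- The summand `2` ensures that the predecessor of `x` is not the root, as the simplicity
  -- statement requires; the others are for `measure_small_le`.
  refine ⟨2 + n₁ + n₂, fun n hn => ?_⟩
  have hnn₁ : (n₁ : ℝ) ≤ n := by exact_mod_cast (by omega : n₁ ≤ n)
  have hnn₂ : (n₂ : ℝ) ≤ n := by exact_mod_cast (by omega : n₂ ≤ n)
  set τ := tau L δ n with hτ
  have hτ1 : 1 ≤ τ := Real.one_le_exp (by positivity)
  have hτ0 : 0 < τ := by linarith
  have hskew : ∀ᶠ η : ℝ in 𝓝[>] 0, ∀ x ∈ sphereFinset K n,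
      law K W {V | ε / τ ≤
        ‖environment A lam Set.univ (specParam E η) x V -
          (environment A lam Set.univ (specParam E η) x V)ᴴ‖} ≤
        ENNReal.ofReal (1 / 6) :=
    (Finset.eventually_all _).2 fun x _ => ENNReal.tendsto_nhds_zero.1
      (vanishInProb_environment_univ hA hlam E hE x (ε / τ) (by positivity)) _
        (pos_iff_ne_zero.2 h6)
  have hlyapL : ∀ᶠ η : ℝ in 𝓝[>] 0, lyapunov K A lam (E + η * Complex.I) ≤ L + δ / 4 :=
    (hL.eventually_lt_const (by linarith : L < L + δ / 4)).mono fun _ h => h.le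
  obtain ⟨η₀, hη₀, hsub⟩ := mem_nhdsGT_iff_exists_Ioo_subset.1
    (hIoo.and (hskew.and hlyapL))
  refine ⟨η₀, hη₀, fun η h0 h1 => ?_⟩
  obtain ⟨⟨-, hη1⟩, hsk, hly⟩ := hsub ⟨h0, h1⟩
  obtain ⟨-, hadd, hmean⟩ :=
    hlyap _ (hz η h0) (norm_specParam_le h0 hη1) o
  -- With `C = 2 / c`, each site must contribute the conditional probability `c / τ` times the
  -- probability `1 / 2` of the good event.
  have hK' : (K : ℝ) ^ n / (2 / c * τ) = (K : ℝ) ^ n * (c / τ / 2) := by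
    field_simp
  rw [hK']
  refine le_integral_count hW hA lam (hz η h0) fun x hx => ?_
  obtain ⟨i, u, rfl⟩ := List.exists_cons_of_ne_nil (l := x) (by rintro rfl; simp at hx; omega)
  have hu : u ≠ [] := by rintro rfl; simp at hx; omega
  refine measure_resonantEvent_ge hA lam (hz η h0) (by positivity)
    (measure_goodEvent_ge (B := B) (ρ := ε / τ) hA lam (hz η h0)
      (measure_small_le hW hA (hz η h0) o hadd hmean hδ hly (by omega)
        (hn₁.trans hnn₁) (hn₂.trans hnn₂) hx)
      (ae_isTopSimple_cutMat hW hA hlam (hz η h0) hu i)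
      (hB _ (measurableEntries_environment hA lam _ (hz η h0) _).norm
        (henv _ _ (hz η h0) (norm_specParam_le h0 hη1) _))
      (hsk _ (mem_sphereFinset.2 hx)))
    fun V hV => resonance_of_mem_goodEvent hW hA (hz η h0) hτ1 (by simp) hres hV

end FirstMoment

end BetheStrip

theorem proposition3p2 (K W : ℕ) (hK : 1 < K) (hW : 0 < W)
    (A : Matrix (Fin W) (Fin W) ℂ) (hA : A.IsHermitian) (lam : ℝ) (hlam : 0 < lam)
    (E L : ℝ)
    (hL : Filter.Tendsto (fun η : ℝ => BetheStrip.lyapunov K A lam (E + η * Complex.I))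
      (nhdsWithin 0 (Set.Ioi 0)) (nhds L))
    (hE : BetheStrip.NoAC K A lam E) :
    ∃ C : ℝ, 0 < C ∧ ∀ δ : ℝ, 0 < δ → ∃ n₀ : ℕ, ∀ n : ℕ, n₀ ≤ n →
      ∃ η₀ : ℝ, 0 < η₀ ∧ ∀ η : ℝ, 0 < η → η < η₀ →
        (K : ℝ) ^ n / (C * BetheStrip.tau L δ n) ≤
          ∫ V, (BetheStrip.count A lam (E + η * Complex.I) L δ n V : ℝ)
            ∂(BetheStrip.law K W) := by
  exact BetheStrip.first_moment_bound K W hK hW A hA lam hlam E L hL hE
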